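/- **Setting.** Write $H_0=-\Delta$ on $L^2(\mathbb R^3)$, $\hat V(\xi)=(2\pi)^{-3/2}\int e^{-ix\cdot\xi}V(x)\,dx$, and let $\{e_1,e_2,e_3\}$ be an orthonormal basis of $\mathbb R^3$. Let $V\in L^1(\mathbb R^3)$ be a real, time-independent potential such that the distributional derivatives $\partial_{\xi\cdot e_r}^j\partial_{\xi\cdot e_m}^l\hat V$ ($0\le j,l\le 2$, $1\le r,m\le 3$) are functions, $$\hat V_a(\xi):=\sum_{j,l=0}^{2}\sum_{r,m=1}^{3}\bigl|\partial_{\xi\cdot e_r}^j\partial_{\xi\cdot e_m}^l\hat V(\xi)\bigr|\in L^1(\mathbb R^3),$$ and $$K_m(V):=\sup_{\eta\in\mathbb R^3}\ \max_{l=1,2,3,\ j=0,1,2}\int_{S^2}d\sigma(\omega)\int_{-\infty}^{\infty}dk\ \sup_{\varepsilon\ge 0}|L_{\eta,l,j}(k,\omega,\varepsilon)|<\infty ,$$ where $$L_{\eta,l,j}(k,\omega,\varepsilon)=\frac1{\sqrt{2\pi}}\int_0^\infty e^{-ikr}\,r\,e^{-\varepsilon/r}\,(\partial_{\xi\cdot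 e_l}^j\hat V)(r\omega-\eta)\,dr .$$ Let $U(t,s)$ be the propagator of $i\partial_t\psi=(H_0+V)\psi$ (so $U(t,s)\psi_0$ is the value at time $t$ of the solution equal to $\psi_0$ at time $s$), $\Omega(t)=U(0,t)e^{-itH_0}$, and for $\varepsilon>0$ $$\Omega_\varepsilon=1+i\int_0^\infty e^{-\varepsilon t}\,\Omega(t)\,e^{itH_0}Ve^{-itH_0}\,dt\quad\text{on }L^2 .$$ For $\beta\in C^\infty(\mathbb R;\mathbb R)$ with $\beta(\lambda)=0$ for $\lambda<1/2$ and $\beta(\lambda)=1$ for $\lambda\ge1$ put $\beta(H_0>M^2)=\beta(H_0/M^2)$. A bounded operator $S$ on $L^p$ is called the *extension to $L^p$* of an operator $T$ on $L^2$ if $S=T$ on $L^2\cap L^p$ and, when $p=\infty$, $S$ is also weak-* continuous on $L^\infty=(L^1)^*$; it is unique if it exists. **Theorem.** The wave operator $\Omega=\operatorname{s-lim}_{T\to\infty}U(0,T)e^{-iTH_0}$ exists on $L^2$ and is bounded there, and there is $M_0=M_0(V)>0$ such that for all such $\beta$, all $M\ge M_0$ and all $1\le p\le\infty$: 1. $\Omega_\varepsilon\,\beta(H_0>M^2)$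 (for every $\varepsilon>0$), $\Omega\,\beta(H_0>M^2)$ and $\beta(H_0>M^2)\,\Omega^*$ have bounded extensions to $L^p$. 2. As $\varepsilon\downarrow0$, $\Omega_\varepsilon\,\beta(H_0>M^2)g\to\Omega\,\beta(H_0>M^2)g$ in the norm of $L^p$, for every $g\in L^p$ if $p<\infty$, and for every $g\in L^2\cap L^\infty$ if $p=\infty$. 3. If $p=\infty$, then for every $g\in L^\infty$ the convergence in 2 holds in $L^\infty(B)$ for every ball $B\subset\mathbb R^3$. -/

import Mathlib

open MeasureTheory Filter Topology Set
open scoped ENNReal FourierTransform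

noncomputable section

/-- The configuration space `ℝ³` with its Euclidean norm. -/
abbrev E3 : Type := EuclideanSpace ℝ (Fin 3)

/-- The Hilbert space `L²(ℝ³; ℂ)`. -/
abbrev L2 : Type := Lp ℂ 2 (volume : Measure E3)

/-! ### Weak derivatives and the conditions on the potential -/

/-- The iterated directional derivative `∂_{v₁} ⋯ ∂_{vₙ} φ` along a list of directions. -/
def iterDirDeriv : List E3 → (E3 → ℝ) → (E3 → ℝ)
  | [], φ => φ
  | v :: vs, φ => fun ξ => fderiv ℝ (iterDirDeriv vs φ) ξ v

/-- `D` is the distributional derivative of `f` along the directions `vs`. -/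
def IsWeakDeriv (vs : List E3) (f D : E3 → ℂ) : Prop :=
  LocallyIntegrable D ∧
    ∀ φ : E3 → ℝ, ContDiff ℝ (⊤ : ℕ∞) φ → HasCompactSupport φ →
      ∫ ξ, (iterDirDeriv vs φ ξ : ℂ) * f ξ = (-1) ^ vs.length * ∫ ξ, (φ ξ : ℂ) * D ξ

open Classical in
/-- The distributional derivative of `f` along `vs`, a function determined almost everywhere
(`0` if the distributional derivative is not a locally integrable function). -/
def weakDeriv (vs : List E3) (f : E3 → ℂ) : E3 → ℂ :=
  if h : ∃ D, IsWeakDeriv vs f D then h.choose else 0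

/-- The Fourier transform `V̂(ξ) = (2π)^{-3/2} ∫ e^{-i x·ξ} V(x) dx`. -/
def fourierHat (V : E3 → ℝ) (ξ : E3) : ℂ :=
  ((2 * Real.pi) ^ (-(3 / 2) : ℝ) : ℝ) *
    ∫ x : E3, Complex.exp (-Complex.I * (inner ℝ x ξ : ℝ)) * (V x : ℂ)

/-- The directions of `∂_{ξ·e_r}^j ∂_{ξ·e_m}^l`. -/
def dirs (b : OrthonormalBasis (Fin 3) ℝ E3) (r j m l : Fin 3) : List E3 :=
  List.replicate j (b r) ++ List.replicate l (b m)

/-- `V̂_a(ξ) = ∑_{j,l=0}^{2} ∑_{r,m=1}^{3} |∂_{ξ·e_r}^j ∂_{ξ·e_m}^l V̂(ξ)|`. -/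
def hatVa (b : OrthonormalBasis (Fin 3) ℝ E3) (V : E3 → ℝ) (ξ : E3) : ℝ :=
  ∑ j : Fin 3, ∑ l : Fin 3, ∑ r : Fin 3, ∑ m : Fin 3,
    ‖weakDeriv (dirs b r j m l) (fourierHat V) ξ‖

/-- `V̂_a ∈ L¹`: all the distributional derivatives in `V̂_a` are functions, and `V̂_a` is
integrable. -/
def HatVaInL1 (b : OrthonormalBasis (Fin 3) ℝ E3) (V : E3 → ℝ) : Prop :=
  (∀ r j m l : Fin 3, ∃ D, IsWeakDeriv (dirs b r j m l) (fourierHat V) D) ∧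
    Integrable (hatVa b V)

/-- `L_{η,l,j}(k, ω, ε)`: the one-dimensional Fourier transform, at frequency `k`, of
`r ↦ χ(r ≥ 0) r (∂_{e_l}^j V̂)(r ω - η) e^{-ε/r}`. -/
def radialFourier (b : OrthonormalBasis (Fin 3) ℝ E3) (V : E3 → ℝ) (η : E3) (l j : Fin 3)
    (k : ℝ) (ω : E3) (ε : ℝ) : ℂ :=
  ((2 * Real.pi) ^ (-(1 / 2) : ℝ) : ℝ) *
    ∫ r in Ioi (0 : ℝ), Complex.exp (-Complex.I * (k * r : ℝ)) *
      ((r * Real.exp (-ε / r) : ℝ) *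
        weakDeriv (List.replicate j (b l)) (fourierHat V) (r • ω - η))

/-- `K₁(V, η) = max_{l,j} ∫_{S²} dσ(ω) ∫ dk sup_{ε ≥ 0} |L_{η,l,j}(k, ω, ε)|`. -/
def K1 (b : OrthonormalBasis (Fin 3) ℝ E3) (V : E3 → ℝ) (η : E3) : ℝ≥0∞ :=
  ⨆ (l : Fin 3) (j : Fin 3),
    ∫⁻ ω : Metric.sphere (0 : E3) 1, ∫⁻ k : ℝ, ⨆ (ε : ℝ) (_ : 0 ≤ ε),
      ‖radialFourier b V η l j k ω ε‖ₑ ∂volume ∂(volume : Measure E3).toSphere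

/-- `K_m(V) = sup_η K₁(V, η)`. -/
def Km (b : OrthonormalBasis (Fin 3) ℝ E3) (V : E3 → ℝ) : ℝ≥0∞ :=
  ⨆ η : E3, K1 b V η

/-! ### Operators on `L²` -/

open Classical in
/-- Multiplication by `m` on `L²` (with value `0` where the product is not in `L²`). -/
def mulOp (m : E3 → ℂ) (f : L2) : L2 :=
  if h : MemLp (fun x => m x * f x) 2 (volume : Measure E3) then h.toLp else 0

/-- `g(H₀)` for `H₀ = -Δ`: the Fourier multiplier `g(|k|²)`. The Fourier transform `𝓕` has the
kernel `e^{-2πi x·ξ}`, so that `k = 2πξ`. -/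
def funH0 (g : ℝ → ℂ) (f : L2) : L2 :=
  𝓕⁻ (mulOp (fun ξ => g ((2 * Real.pi * ‖ξ‖) ^ 2)) (𝓕 f))

/-- `e^{-itH₀}`. -/
def freeEvolution (t : ℝ) (f : L2) : L2 :=
  funH0 (fun lam => Complex.exp (-Complex.I * (t * lam : ℝ))) f

/-- Multiplication by the potential `V`. -/
def potOp (V : E3 → ℝ) (f : L2) : L2 := mulOp (fun x => (V x : ℂ)) f

/-- `ψ ∈ C(ℝ; L²)` solves `i ∂ₜψ = (H₀ + V)ψ`, `ψ(s) = ψ₀`, in the integral (Duhamel) form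
`ψ(t) = e^{-i(t-s)H₀} ψ₀ - i ∫_s^t e^{-i(t-τ)H₀} V ψ(τ) dτ`. -/
def IsSchrodingerSolution (V : E3 → ℝ) (s : ℝ) (ψ₀ : L2) (ψ : ℝ → L2) : Prop :=
  Continuous ψ ∧ ∀ t : ℝ, ψ t = freeEvolution (t - s) ψ₀ -
    Complex.I • ∫ τ in s..t, freeEvolution (t - τ) (potOp V (ψ τ))

open Classical in
/-- The propagator `U(t, s)`: the value at time `t` of the solution that equals `ψ₀` at time
`s`. -/
def propagator (V : E3 → ℝ) (t s : ℝ) (ψ₀ : L2) : L2 :=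
  if h : ∃ ψ, IsSchrodingerSolution V s ψ₀ ψ then h.choose t else 0

/-- `Ω(t) = U(0, t) e^{-itH₀}`. -/
def waveAt (V : E3 → ℝ) (t : ℝ) (f : L2) : L2 :=
  propagator V 0 t (freeEvolution t f)

/-- `Ω` is the wave operator: the strong limit of `U(0, T) e^{-iTH₀}` on `L²` as `T → ∞`. -/
def IsWaveOperator (V : E3 → ℝ) (Ω : L2 →L[ℂ] L2) : Prop :=
  ∀ f : L2, Tendsto (fun T : ℝ => waveAt V T f) atTop (𝓝 (Ω f))

/-- `Ω_ε = 1 + i ∫₀^∞ e^{-εt} Ω(t) e^{itH₀} V e^{-itH₀} dt`. -/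
def abelWave (V : E3 → ℝ) (ε : ℝ) (f : L2) : L2 :=
  f + Complex.I • ∫ t in Ioi (0 : ℝ), (Real.exp (-ε * t) : ℂ) •
    waveAt V t (freeEvolution (-t) (potOp V (freeEvolution t f)))

/-- The smooth cut-off profiles: `β(λ) = 0` for `λ < 1/2` and `β(λ) = 1` for `λ ≥ 1`. -/
def IsCutoff (β : ℝ → ℝ) : Prop :=
  ContDiff ℝ (⊤ : ℕ∞) β ∧ (∀ lam < 1 / 2, β lam = 0) ∧ ∀ lam ≥ 1, β lam = 1

/-- `β(H₀ > M²) = β(H₀ / M²)`. -/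
def highFreq (β : ℝ → ℝ) (M : ℝ) (f : L2) : L2 :=
  funH0 (fun lam => (β (lam / M ^ 2) : ℂ)) f

/-! ### Extension to `L^p` -/

/-- `S` is the bounded operator on `L^p` defined by the operator `T` on `L²`: it agrees with `T` on
`L² ∩ L^p`, and if `p = ∞` it is also weak-* continuous, that is, it is the transpose of an
operator on `L¹`. There is at most one such `S`, as `L² ∩ L^p` is dense in `L^p`
(weak-* dense if `p = ∞`). -/
def IsLpExtension (p : ℝ≥0∞) [Fact (1 ≤ p)] (T : L2 → L2)
    (S : Lp ℂ p (volume : Measure E3) →L[ℂ] Lp ℂ p (volume : Measure E3)) : Prop :=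
  (∀ (f : L2) (g : Lp ℂ p (volume : Measure E3)),
      (f : E3 → ℂ) =ᵐ[volume] g → (T f : E3 → ℂ) =ᵐ[volume] S g) ∧
    (p = ∞ → ∀ h : Lp ℂ 1 (volume : Measure E3), ∃ k : Lp ℂ 1 (volume : Measure E3),
      ∀ g : Lp ℂ p (volume : Measure E3), ∫ x, h x * S g x = ∫ x, k x * g x)

end

/-! The Abel mean ε∫₀^∞ e^{-εt} Ω(t) dt (`abelOp`) is the operator Ω_ε (`abelOp_eq`), and it solves
X = 1 + i D X, where D X = ∫₀^∞ e^{-ετ} e^{iτH₀} V X e^{-iτH₀} dτ (`abelOp_fix`). Multiplied on the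
right by B = β(H₀ > M²) this reads X = B + i D X. The task is to bound X on L¹ and L^∞ uniformly in
ε; everything else follows by interpolation, duality and limits.

One application of D. Write V as a superposition of plane waves. Up to the phase e^{iτ|ξ|²},
conjugation of e^{iξ·x} by e^{iτH₀} only adds a translation by 2τξ (`conjEv_Weyl`). In polar
coordinates ξ = rω, with s = rτ, the matrix element of D e^{iη·x} between g and f is an integral
over ω, s and x of conj g(x) f(x + 2sω) against an r-integral, and that r-integral is L_η at
frequency -(s + ω·x) with regularisation εs. This explains the supremum over ε in K_m. Integrating
the modulus of L_η over its frequency bounds D e^{iη·x} on L¹ and on L^∞ by K_m, uniformly in η and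
ε (`inner_avg_le_lineForm`, `lineForm_le_left`, `lineForm_le_right`). The same holds with x_l^j V in
place of V.

Superpositions. The Weyl operators, modulation times translation, are closed under products and
under the free flow up to phases. `Dom X μ` says that the time-averaged matrix elements of X are at
most the μ-integral of those of the Weyl operators. The modulus stands outside the time integral, so
the oscillation in the last time variable, which K_m measures, is not lost. Domination is stable
under sums, products, free conjugation, time averages and norm-convergent series, with the obvious
rules for the total mass. Hence it suffices to write V X = ∑ x_l^j V F_{lj} with F_{lj} dominated by
finite measures that do not depend on ε (`exists_factorisation`).

The Neumann series. Free conjugation preserves mass, so D has no mass bound uniform in ε as it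
stands; time decay must be gained. The kernel of u e^{iτH₀} v has τ-derivative (-3/(2τ) +
i|x-y|²/(4τ²)) times itself, and |x-y|² expands into the weights x_l^j, which u and v absorb because
two derivatives of the Fourier transform are controlled. Two integrations by parts leave weights
τ^{-2} and τ^{-3}, and each costs a resolvent, of mass O(M^{-2}) at frequencies above M
(`exists_cutSym_mass`, `exists_isNeumann`). With the time axis cut at 1/M the outcome is O(1/M)
(`ibpCoeff_eq`, `Gauge.ibpCoeff`). For large M the series ∑ (iD)^n B, sandwiched with x_l^j V, has
geometrically decaying masses. That it sums to X is seen in operator norm: ‖X‖ is bounded because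
Ω(t) is unitary, so the remainder vanishes. The same estimate is needed for masses and for norms,
hence the abstract `Gauge`; `IBPBound.neumann` concludes.

Limits. Cook's method and the dispersive estimate give Ω, and Abel means converge strongly to it.
For bounded f, the difference between Ω_ε β(H₀ > M²) f and its limit tends to 0 in L^∞: short times
are small by phase-space mass, long times by the decay τ^{-3/2} (`uniform_of_dispersive`). Mass far
from the support is controlled through tails of L_η (`KerBdd.tight`). Together these give
convergence in every L^p on bounded compactly supported functions, then everywhere by density. For p
= ∞ the operator is the transpose of one on L¹, and a general g is split into a near part, which is
in L², and a far part, which tightness makes small on a ball. -/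

noncomputable section

/-! ### Multiplication operators and Fourier multipliers -/

/-- Bounded operators on `L²`. -/
abbrev Op : Type := L2 →L[ℂ] L2

/-- A measurable function bounded everywhere. -/
def BddM (m : E3 → ℂ) : Prop :=
  AEStronglyMeasurable m (volume : Measure E3) ∧ ∃ C : ℝ, ∀ x, ‖m x‖ ≤ C

lemma BddM.memLp {m : E3 → ℂ} (hm : BddM m) {p : ℝ≥0∞} {f : E3 → ℂ} (hf : MemLp f p volume) :
    MemLp (fun x => m x * f x) p (volume : Measure E3) := by
  obtain ⟨h1, C, hC⟩ := hm
  refine MemLp.of_le_mul (c := C) hf (h1.mul hf.1) (Eventually.of_forall fun x => ?_)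
  rw [norm_mul]
  gcongr
  exact hC x

lemma mulOp_coeFn {m : E3 → ℂ} (hm : BddM m) (f : L2) :
    (mulOp m f : E3 → ℂ) =ᵐ[volume] fun x => m x * f x := by
  have h := hm.memLp (Lp.memLp f)
  rw [mulOp, dif_pos h]
  exact h.coeFn_toLp

lemma norm_le_of_ae_le {f g : L2} {C : ℝ} (h : ∀ᵐ x, ‖f x‖ ≤ C * ‖g x‖) :
    ‖f‖ ≤ C * ‖g‖ := by
  have := Lp.norm_le_mul_norm_of_ae_le_mul (f := f) (g := g) (c := C) h
  exact this

open Classical in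
/-- Multiplication by a bounded function as a bounded operator (`0` if `m` is not bounded). -/
def mulL (m : E3 → ℂ) : Op :=
  if hm : BddM m then
    LinearMap.mkContinuous
      { toFun := mulOp m
        map_add' := fun f g => by
          apply Lp.ext
          filter_upwards [mulOp_coeFn hm (f + g), mulOp_coeFn hm f, mulOp_coeFn hm g,
            Lp.coeFn_add f g, Lp.coeFn_add (mulOp m f) (mulOp m g)] with x h1 h2 h3 h4 h5
          rw [h1, h5, h4, Pi.add_apply, Pi.add_apply, h2, h3, mul_add]
        map_smul' := fun c f => by
          apply Lp.ext
          filter_upwards [mulOp_coeFn hm (c • f), mulOp_coeFn hm f,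
            Lp.coeFn_smul c f, Lp.coeFn_smul c (mulOp m f)] with x h1 h2 h4 h5
          simp only [RingHom.id_apply]
          rw [h1, h5, h4, Pi.smul_apply, Pi.smul_apply, h2, smul_eq_mul, smul_eq_mul]
          ring }
      (max hm.2.choose 0) (fun f => by
        refine norm_le_of_ae_le ?_
        filter_upwards [mulOp_coeFn hm f] with x h1
        change ‖(mulOp m f : E3 → ℂ) x‖ ≤ _
        rw [h1, norm_mul]
        gcongr
        exact (hm.2.choose_spec x).trans (le_max_left _ _))
  else 0

lemma mulL_apply {m : E3 → ℂ} (hm : BddM m) (f : L2) : mulL m f = mulOp m f := by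
  rw [mulL, dif_pos hm]; rfl

lemma mulL_coeFn {m : E3 → ℂ} (hm : BddM m) (f : L2) :
    (mulL m f : E3 → ℂ) =ᵐ[volume] fun x => m x * f x := by
  rw [mulL_apply hm]; exact mulOp_coeFn hm f

lemma mulOp_congr {m m' : E3 → ℂ} (h : m =ᵐ[volume] m') (f : L2) : mulOp m f = mulOp m' f := by
  have e : (fun x => m x * f x) =ᵐ[volume] fun x => m' x * f x := by
    filter_upwards [h] with x hx; rw [hx]
  unfold mulOp
  by_cases h1 : MemLp (fun x => m x * f x) 2 (volume : Measure E3)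
  · have h2 := (memLp_congr_ae e).1 h1
    rw [dif_pos h1, dif_pos h2]
    exact MemLp.toLp_congr _ _ e
  · have h2 := fun h => h1 ((memLp_congr_ae e).2 h)
    rw [dif_neg h1, dif_neg h2]

lemma mulL_norm_apply_le {m : E3 → ℂ} {C : ℝ} (hC : ∀ x, ‖m x‖ ≤ C) (f : L2) :
    ‖mulL m f‖ ≤ C * ‖f‖ := by
  have h0 : 0 ≤ C := (norm_nonneg _).trans (hC 0)
  by_cases hm : BddM m
  · refine norm_le_of_ae_le ?_
    filter_upwards [mulL_coeFn hm f] with x h1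
    rw [h1, norm_mul]
    gcongr
    exact hC x
  · rw [mulL, dif_neg hm]
    simpa using by positivity

lemma mulL_norm_le {m : E3 → ℂ} {C : ℝ} (hC : ∀ x, ‖m x‖ ≤ C) : ‖mulL m‖ ≤ C :=
  ContinuousLinearMap.opNorm_le_bound _ ((norm_nonneg _).trans (hC 0))
    (mulL_norm_apply_le hC)

lemma BddM.mul {m m' : E3 → ℂ} (h : BddM m) (h' : BddM m') : BddM (fun x => m x * m' x) := by
  obtain ⟨h1, C, hC⟩ := h
  obtain ⟨h1', C', hC'⟩ := h'
  refine ⟨h1.mul h1', C * C', fun x => ?_⟩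
  rw [norm_mul]
  exact mul_le_mul (hC x) (hC' x) (norm_nonneg _) ((norm_nonneg _).trans (hC x))

lemma BddM.add {m m' : E3 → ℂ} (h : BddM m) (h' : BddM m') : BddM (fun x => m x + m' x) := by
  obtain ⟨h1, C, hC⟩ := h
  obtain ⟨h1', C', hC'⟩ := h'
  exact ⟨h1.add h1', C + C', fun x => (norm_add_le _ _).trans (add_le_add (hC x) (hC' x))⟩

lemma BddM.const (c : ℂ) : BddM (fun _ => c) :=
  ⟨aestronglyMeasurable_const, ‖c‖, fun _ => le_rfl⟩

lemma BddM.smul {m : E3 → ℂ} (c : ℂ) (h : BddM m) : BddM (fun x => c * m x) :=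
  (BddM.const c).mul h

lemma BddM.conj {m : E3 → ℂ} (h : BddM m) : BddM (fun x => (starRingEnd ℂ) (m x)) := by
  obtain ⟨h1, C, hC⟩ := h
  refine ⟨(Complex.continuous_conj.comp_aestronglyMeasurable h1), C, fun x => ?_⟩
  simpa using hC x

lemma BddM.of_continuous {m : E3 → ℂ} (h : Continuous m) {C : ℝ} (hC : ∀ x, ‖m x‖ ≤ C) : BddM m :=
  ⟨h.aestronglyMeasurable, C, hC⟩

lemma mulL_mul {m m' : E3 → ℂ} (h : BddM m) (h' : BddM m') :
    mulL m * mulL m' = mulL (fun x => m x * m' x) := by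
  ext1 f
  apply Lp.ext
  change (mulL m (mulL m' f) : E3 → ℂ) =ᵐ[volume] _
  filter_upwards [mulL_coeFn h (mulL m' f), mulL_coeFn h' f, mulL_coeFn (h.mul h') f] with x h1 h2 h3
  rw [h1, h2, h3, mul_assoc]

lemma mulL_add {m m' : E3 → ℂ} (h : BddM m) (h' : BddM m') :
    mulL (fun x => m x + m' x) = mulL m + mulL m' := by
  ext1 f
  apply Lp.ext
  rw [add_apply]
  filter_upwards [mulL_coeFn h f, mulL_coeFn h' f, mulL_coeFn (h.add h') f,
    Lp.coeFn_add (mulL m f) (mulL m' f)] with x h1 h2 h3 h4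
  rw [h3, h4, Pi.add_apply, h1, h2, add_mul]

lemma mulL_const (c : ℂ) : mulL (fun _ => c) = c • (1 : Op) := by
  ext1 f
  apply Lp.ext
  filter_upwards [mulL_coeFn (BddM.const c) f, Lp.coeFn_smul c f] with x h1 h2
  rw [h1]
  change _ = (c • f : L2) x
  rw [h2]; rfl

lemma L2_inner_eq (f g : L2) : inner ℂ f g = ∫ x, (starRingEnd ℂ) (f x) * g x := by
  rw [MeasureTheory.L2.inner_def]
  refine integral_congr_ae (Eventually.of_forall fun x => ?_)
  simp [RCLike.inner_apply, mul_comm]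

lemma inner_mulL {m : E3 → ℂ} (h : BddM m) (f g : L2) :
    inner ℂ f (mulL m g) = ∫ x, (starRingEnd ℂ) (f x) * (m x * g x) := by
  rw [L2_inner_eq]
  refine integral_congr_ae ?_
  filter_upwards [mulL_coeFn h g] with x h1
  rw [h1]

lemma mulL_inner_left {m : E3 → ℂ} (h : BddM m) (f g : L2) :
    inner ℂ (mulL (fun x => (starRingEnd ℂ) (m x)) f) g = inner ℂ f (mulL m g) := by
  rw [inner_mulL h, L2_inner_eq]
  refine integral_congr_ae ?_
  filter_upwards [mulL_coeFn h.conj f] with x h1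
  rw [h1]
  simp only [map_mul, Complex.conj_conj]
  ring

lemma tendsto_lintegral_filter_of_dominated_convergence_ae {α ι : Type*} [MeasurableSpace α]
    {μ : Measure α} {l : Filter ι} [l.IsCountablyGenerated] {F : ι → α → ℝ≥0∞} {f : α → ℝ≥0∞}
    (bound : α → ℝ≥0∞) (hF : ∀ i, AEMeasurable (F i) μ) (hb : ∀ i, ∀ᵐ a ∂μ, F i a ≤ bound a)
    (hfin : ∫⁻ a, bound a ∂μ ≠ ∞) (hlim : ∀ᵐ a ∂μ, Tendsto (fun i => F i a) l (𝓝 (f a))) :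
    Tendsto (fun i => ∫⁻ a, F i a ∂μ) l (𝓝 (∫⁻ a, f a ∂μ)) := by
  refine tendsto_of_seq_tendsto fun u hu => ?_
  refine tendsto_lintegral_of_dominated_convergence' bound (fun n => hF _) (fun n => hb _) hfin ?_
  filter_upwards [hlim] with a ha
  exact ha.comp hu

/-- Dominated convergence for multiplication operators. -/
lemma mulL_tendsto {ι : Type*} {l : Filter ι} [l.IsCountablyGenerated] {m : ι → E3 → ℂ}
    {m₀ : E3 → ℂ} {C : ℝ} (hm : ∀ i, AEStronglyMeasurable (m i) (volume : Measure E3))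
    (hm₀ : AEStronglyMeasurable m₀ (volume : Measure E3))
    (hC : ∀ i x, ‖m i x‖ ≤ C) (hC₀ : ∀ x, ‖m₀ x‖ ≤ C)
    (hlim : ∀ x, Tendsto (fun i => m i x) l (𝓝 (m₀ x))) (f : L2) :
    Tendsto (fun i => mulL (m i) f) l (𝓝 (mulL m₀ f)) := by
  have hb : ∀ i, BddM (m i) := fun i => ⟨hm i, C, hC i⟩
  have hb₀ : BddM m₀ := ⟨hm₀, C, hC₀⟩
  rw [Lp.tendsto_Lp_iff_tendsto_eLpNorm']
  have key : ∀ i, eLpNorm ((mulL (m i) f : E3 → ℂ) - (mulL m₀ f : E3 → ℂ)) 2 volume =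
      (∫⁻ x, ‖(m i x - m₀ x) * f x‖ₑ ^ (2 : ℝ)) ^ (1 / (2 : ℝ)) := by
    intro i
    rw [eLpNorm_eq_lintegral_rpow_enorm_toReal (by norm_num) (by norm_num)]
    simp only [ENNReal.toReal_ofNat]
    congr 1
    refine lintegral_congr_ae ?_
    filter_upwards [mulL_coeFn (hb i) f, mulL_coeFn hb₀ f] with x h1 h2
    simp only [Pi.sub_apply]
    rw [h1, h2, sub_mul]
  simp_rw [key]
  have h2 : Tendsto (fun i => ∫⁻ x, ‖(m i x - m₀ x) * f x‖ₑ ^ (2 : ℝ)) l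
      (𝓝 (∫⁻ _ : E3, 0)) := by
    refine tendsto_lintegral_filter_of_dominated_convergence_ae
      (fun x => (ENNReal.ofReal (2 * C) * ‖f x‖ₑ) ^ (2 : ℝ)) ?_ ?_ ?_ ?_
    · intro i
      exact ((((hm i).sub hm₀).mul (Lp.aestronglyMeasurable f)).enorm).pow_const _
    · refine fun i => Eventually.of_forall fun x => ?_
      rw [enorm_mul]
      gcongr
      rw [← ofReal_norm]
      apply ENNReal.ofReal_le_ofReal
      have := norm_sub_le (m i x) (m₀ x)
      linarith [hC i x, hC₀ x]
    · simp_rw [ENNReal.mul_rpow_of_nonneg _ _ (by norm_num : (0 : ℝ) ≤ 2)]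
      have hfin : ENNReal.ofReal (2 * C) ^ (2 : ℝ) ≠ ∞ :=
        ENNReal.rpow_ne_top_of_nonneg (by norm_num) ENNReal.ofReal_ne_top
      rw [lintegral_const_mul' _ _ hfin]
      refine ENNReal.mul_ne_top hfin ?_
      have := Lp.eLpNorm_lt_top f
      rw [eLpNorm_lt_top_iff_lintegral_rpow_enorm_lt_top (by norm_num) (by norm_num)] at this
      simpa using this.ne
    · refine Eventually.of_forall fun x => ?_
      have h3 : Tendsto (fun i => ‖(m i x - m₀ x) * f x‖ₑ) l (𝓝 ‖(m₀ x - m₀ x) * f x‖ₑ) :=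
        (((hlim x).sub_const _).mul_const _).enorm
      have h4 := h3.ennrpow_const (2 : ℝ)
      simpa using h4
  simp only [lintegral_zero] at h2
  have h5 := h2.ennrpow_const (1 / 2 : ℝ)
  simpa using h5

lemma mulL_continuous {X : Type*} [TopologicalSpace X] [FirstCountableTopology X]
    {m : X → E3 → ℂ} {C : ℝ} (hm : ∀ a, AEStronglyMeasurable (m a) (volume : Measure E3))
    (hC : ∀ a x, ‖m a x‖ ≤ C) (hcont : ∀ x, Continuous fun a => m a x) (f : L2) :
    Continuous fun a => mulL (m a) f := by
  rw [continuous_iff_continuousAt]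
  intro a
  exact mulL_tendsto hm (hm a) hC (hC a) (fun x => (hcont x).tendsto a) f

/-- Strongly continuous, uniformly bounded families act jointly continuously. -/
lemma strong_joint {X Y : Type*} [TopologicalSpace X] [TopologicalSpace Y] {A : X → Op} {C : ℝ}
    (hC : ∀ a, ‖A a‖ ≤ C) (hA : ∀ f, Continuous fun a => A a f) {u : Y → X} {f : Y → L2}
    (hu : Continuous u) (hf : Continuous f) : Continuous fun y => A (u y) (f y) := by
  rw [continuous_iff_continuousAt]
  intro y₀
  have h1 : Tendsto (fun y => A (u y) (f y₀)) (𝓝 y₀) (𝓝 (A (u y₀) (f y₀))) :=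
    ((hA (f y₀)).comp hu).tendsto y₀
  have h2 : Tendsto (fun y => A (u y) (f y) - A (u y) (f y₀)) (𝓝 y₀) (𝓝 0) := by
    refine squeeze_zero_norm (a := fun y => C * ‖f y - f y₀‖) (fun y => ?_) ?_
    · rw [← map_sub]
      exact ((A (u y)).le_opNorm _).trans (by gcongr; exact hC _)
    · have : Continuous fun y => C * ‖f y - f y₀‖ := by fun_prop
      simpa using this.tendsto y₀
  have := h2.add h1
  simpa [ContinuousAt] using this

/-! ### The Fourier transform on `L²` -/

/-- The Fourier transform on `L²` as a bounded operator. -/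
def FL : L2 ≃ₗᵢ[ℂ] L2 := Lp.fourierTransformₗᵢ E3 ℂ

lemma FL_apply (f : L2) : FL f = 𝓕 f := rfl
-- The L² transform is the distributional one, so tested against a smooth compactly supported φ both
-- sides give ∫ φ̂ f; locally integrable functions with equal tests agree almost everywhere.
lemma L2_fourier_ae {f : L2} (hf : Integrable (f : E3 → ℂ)) :
    ((𝓕 f : L2) : E3 → ℂ) =ᵐ[volume] 𝓕 (f : E3 → ℂ) := by
  have hcont : Continuous (𝓕 (f : E3 → ℂ)) :=
    VectorFourier.fourierIntegral_continuous Real.continuous_fourierChar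
      (by exact continuous_inner) hf
  refine ae_eq_of_integral_contDiff_smul_eq ((Lp.memLp _).locallyIntegrable one_le_two)
    hcont.locallyIntegrable ?_
  intro g hg hgc
  have hg₁ : HasCompactSupport (Complex.ofRealCLM ∘ g) := hgc.comp_left rfl
  have hg₂ : ContDiff ℝ (⊤ : ℕ∞) (Complex.ofRealCLM ∘ g) := by fun_prop
  set φ : SchwartzMap E3 ℂ := hg₁.toSchwartzMap hg₂ with hφ
  have hφx : ∀ x, φ x = (g x : ℂ) := fun x => rfl
  have e1 : ∫ x, g x • (𝓕 f : L2) x = ∫ x, (𝓕 φ) x * f x := by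
    have h := Lp.fourier_toTemperedDistribution_eq f
    have h' := congrArg (fun T => T φ) h
    simp only [TemperedDistribution.fourier_apply, Lp.toTemperedDistribution_apply] at h'
    simpa [hφx] using h'.symm
  have e2 : ∫ x, g x • 𝓕 (f : E3 → ℂ) x = ∫ x, (𝓕 φ) x * f x := by
    have h := VectorFourier.integral_fourierIntegral_smul_eq_flip (𝕜 := ℝ) (μ := volume) (ν := volume)
      (f := φ) (g := (f : E3 → ℂ)) (L := innerₗ E3) Real.continuous_fourierChar
      (by exact continuous_inner) φ.integrable hf
    rw [flip_innerₗ] at h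
    simp only [smul_eq_mul] at h
    calc _ = ∫ x, φ x * 𝓕 (f : E3 → ℂ) x := by simp [hφx]
      _ = _ := h.symm
      _ = _ := by rfl
  rw [e1, e2]

/-- The Fourier multiplier with symbol `m`, in the frequency variable of `𝓕`. -/
def fmul (m : E3 → ℂ) : Op :=
  (FL.symm.toContinuousLinearEquiv : Op) ∘L mulL m ∘L (FL.toContinuousLinearEquiv : Op)

lemma fmul_apply (m : E3 → ℂ) (f : L2) : fmul m f = FL.symm (mulL m (FL f)) := rfl

lemma FL_fmul (m : E3 → ℂ) (f : L2) : FL (fmul m f) = mulL m (FL f) := by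
  rw [fmul_apply, LinearIsometryEquiv.apply_symm_apply]

lemma fmul_norm_apply_le {m : E3 → ℂ} {C : ℝ} (hC : ∀ x, ‖m x‖ ≤ C) (f : L2) :
    ‖fmul m f‖ ≤ C * ‖f‖ := by
  rw [fmul_apply, LinearIsometryEquiv.norm_map]
  have := mulL_norm_apply_le hC (FL f)
  rwa [LinearIsometryEquiv.norm_map] at this

lemma fmul_norm_le {m : E3 → ℂ} {C : ℝ} (hC : ∀ x, ‖m x‖ ≤ C) : ‖fmul m‖ ≤ C :=
  ContinuousLinearMap.opNorm_le_bound _ ((norm_nonneg _).trans (hC 0)) (fmul_norm_apply_le hC)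

lemma fmul_mul {m m' : E3 → ℂ} (h : BddM m) (h' : BddM m') :
    fmul m * fmul m' = fmul (fun x => m x * m' x) := by
  ext1 f
  change fmul m (fmul m' f) = _
  rw [fmul_apply m, FL_fmul, fmul_apply, ← mulL_mul h h']
  rfl

lemma fmul_add {m m' : E3 → ℂ} (h : BddM m) (h' : BddM m') :
    fmul (fun x => m x + m' x) = fmul m + fmul m' := by
  ext1 f
  rw [add_apply, fmul_apply, fmul_apply, fmul_apply, mulL_add h h',
    add_apply, map_add]

lemma fmul_const (c : ℂ) : fmul (fun _ => c) = c • (1 : Op) := by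
  ext1 f
  rw [fmul_apply, mulL_const]
  simp

lemma fmul_smul {m : E3 → ℂ} (c : ℂ) (h : BddM m) : fmul (fun x => c * m x) = c • fmul m := by
  rw [← fmul_mul (BddM.const c) h, fmul_const, smul_mul_assoc, one_mul]

lemma fmul_comm {m m' : E3 → ℂ} (h : BddM m) (h' : BddM m') :
    fmul m * fmul m' = fmul m' * fmul m := by
  rw [fmul_mul h h', fmul_mul h' h]
  congr 1; ext x; ring

lemma inner_fmul (m : E3 → ℂ) (f g : L2) :
    inner ℂ f (fmul m g) = inner ℂ (FL f) (mulL m (FL g)) := by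
  rw [← FL_fmul, LinearIsometryEquiv.inner_map_map]

lemma fmul_inner_left {m : E3 → ℂ} (h : BddM m) (f g : L2) :
    inner ℂ (fmul (fun x => (starRingEnd ℂ) (m x)) f) g = inner ℂ f (fmul m g) := by
  rw [inner_fmul, ← mulL_inner_left h, ← FL_fmul, LinearIsometryEquiv.inner_map_map]

lemma fmul_adjoint {m : E3 → ℂ} (h : BddM m) :
    ContinuousLinearMap.adjoint (fmul m) = fmul (fun x => (starRingEnd ℂ) (m x)) := by
  symm
  rw [ContinuousLinearMap.eq_adjoint_iff]
  intro x y
  exact fmul_inner_left h x y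

lemma fmul_tendsto {ι : Type*} {l : Filter ι} [l.IsCountablyGenerated] {m : ι → E3 → ℂ}
    {m₀ : E3 → ℂ} {C : ℝ} (hm : ∀ i, AEStronglyMeasurable (m i) (volume : Measure E3))
    (hm₀ : AEStronglyMeasurable m₀ (volume : Measure E3))
    (hC : ∀ i x, ‖m i x‖ ≤ C) (hC₀ : ∀ x, ‖m₀ x‖ ≤ C)
    (hlim : ∀ x, Tendsto (fun i => m i x) l (𝓝 (m₀ x))) (f : L2) :
    Tendsto (fun i => fmul (m i) f) l (𝓝 (fmul m₀ f)) := by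
  simp_rw [fmul_apply]
  exact (FL.symm.continuous.tendsto _).comp (mulL_tendsto hm hm₀ hC hC₀ hlim (FL f))

lemma fmul_continuous {X : Type*} [TopologicalSpace X] [FirstCountableTopology X]
    {m : X → E3 → ℂ} {C : ℝ} (hm : ∀ a, AEStronglyMeasurable (m a) (volume : Measure E3))
    (hC : ∀ a x, ‖m a x‖ ≤ C) (hcont : ∀ x, Continuous fun a => m a x) (f : L2) :
    Continuous fun a => fmul (m a) f := by
  simp_rw [fmul_apply]
  exact FL.symm.continuous.comp (mulL_continuous hm hC hcont (FL f))

lemma fmul_apply_eq {m : E3 → ℂ} (hm : BddM m) (f : L2) : fmul m f = 𝓕⁻ (mulOp m (𝓕 f)) := by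
  rw [fmul_apply, mulL_apply hm]; rfl

end

noncomputable section

/-! ### Free evolution, translations and modulations -/

/-- Schwartz functions are dense and integrable. This lets identities between bounded operators be
checked where the Fourier transform is an integral. -/
lemma Op_ext_of_integrable {A B : Op} (h : ∀ f : L2, Integrable (f : E3 → ℂ) → A f = B f) :
    A = B := by
  ext1 f
  refine DenseRange.induction_on (p := fun f => A f = B f)
    (SchwartzMap.denseRange_toLpCLM (E := E3) (F := ℂ) (μ := volume) (p := 2)
      ENNReal.ofNat_ne_top) f (isClosed_eq A.continuous B.continuous) ?_
  intro φ
  apply h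
  have : (SchwartzMap.toLpCLM ℂ ℂ 2 volume φ : E3 → ℂ) =ᵐ[volume] φ :=
    SchwartzMap.coeFn_toLp φ 2 volume
  exact (integrable_congr this).2 φ.integrable

lemma norm_exp_I_mul (a : ℝ) : ‖Complex.exp (Complex.I * (a : ℂ))‖ = 1 := by
  rw [mul_comm]; exact Complex.norm_exp_ofReal_mul_I a

lemma BddM.exp {q : E3 → ℝ} (hq : Continuous q) :
    BddM (fun x => Complex.exp (Complex.I * (q x : ℂ))) :=
  BddM.of_continuous (by fun_prop) (fun x => (norm_exp_I_mul (q x)).le)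

/-- The symbol of `e^{itH₀}`. -/
def symE (t : ℝ) (ξ : E3) : ℂ := Complex.exp (Complex.I * ((t * (2 * Real.pi * ‖ξ‖) ^ 2 : ℝ) : ℂ))

lemma symE_norm (t : ℝ) (ξ : E3) : ‖symE t ξ‖ = 1 := norm_exp_I_mul _

lemma symE_bdd (t : ℝ) : BddM (symE t) :=
  BddM.exp (q := fun ξ => t * (2 * Real.pi * ‖ξ‖) ^ 2) (by fun_prop)

/-- `e^{itH₀}`. -/
def Ev (t : ℝ) : Op := fmul (symE t)

lemma freeEvolution_eq (t : ℝ) (f : L2) : freeEvolution t f = Ev (-t) f := by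
  rw [Ev, fmul_apply_eq (symE_bdd _), freeEvolution, funH0]
  congr 2
  ext ξ
  simp only [symE]
  congr 1
  push_cast
  ring

lemma Ev_mul (s t : ℝ) : Ev s * Ev t = Ev (s + t) := by
  rw [Ev, Ev, fmul_mul (symE_bdd _) (symE_bdd _), Ev]
  congr 1
  ext ξ
  simp only [symE]
  rw [← Complex.exp_add]
  congr 1
  push_cast
  ring

lemma Ev_zero : Ev 0 = 1 := by
  have : symE 0 = fun _ => 1 := by ext ξ; simp [symE]
  rw [Ev, this, fmul_const, one_smul]

lemma Ev_apply_apply (s t : ℝ) (f : L2) : Ev s (Ev t f) = Ev (s + t) f := by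
  rw [← Ev_mul]; rfl

lemma Ev_adjoint (t : ℝ) : ContinuousLinearMap.adjoint (Ev t) = Ev (-t) := by
  rw [Ev, fmul_adjoint (symE_bdd _), Ev]
  congr 1
  ext ξ
  simp only [symE]
  rw [← Complex.exp_conj]
  congr 1
  rw [map_mul, Complex.conj_I, Complex.conj_ofReal]
  push_cast
  ring

lemma Ev_inner (t : ℝ) (f g : L2) : inner ℂ f (Ev t g) = inner ℂ (Ev (-t) f) g := by
  rw [← Ev_adjoint, ContinuousLinearMap.adjoint_inner_left]

lemma Ev_norm (t : ℝ) (f : L2) : ‖Ev t f‖ = ‖f‖ := by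
  have h1 : ∀ t f, ‖Ev t f‖ ≤ ‖f‖ := fun t f => by
    simpa [Ev] using fmul_norm_apply_le (fun x => (symE_norm t x).le) f
  refine le_antisymm (h1 t f) ?_
  have := h1 (-t) (Ev t f)
  rwa [Ev_apply_apply, neg_add_cancel, Ev_zero] at this

lemma Ev_opNorm_le (t : ℝ) : ‖Ev t‖ ≤ 1 :=
  ContinuousLinearMap.opNorm_le_bound _ zero_le_one fun f => by rw [Ev_norm, one_mul]

lemma Ev_continuous (f : L2) : Continuous fun t => Ev t f := by
  refine fmul_continuous (C := 1) (fun t => (symE_bdd t).1) (fun t x => (symE_norm t x).le) ?_ f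
  intro ξ
  unfold symE
  fun_prop

lemma Ev_joint {Y : Type*} [TopologicalSpace Y] {u : Y → ℝ} {f : Y → L2}
    (hu : Continuous u) (hf : Continuous f) : Continuous fun y => Ev (u y) (f y) :=
  strong_joint Ev_opNorm_le Ev_continuous hu hf

/-- Multiplication by `e^{iη·x}`. -/
def modul (η : E3) : Op := mulL (fun x => Complex.exp (Complex.I * (inner ℝ η x : ℝ)))

/-- Translation `f ↦ f(· + y)`. -/
def shiftL (y : E3) : Op :=
  fmul (fun ξ => Complex.exp (Complex.I * (2 * Real.pi * inner ℝ y ξ : ℝ)))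

lemma modul_bdd (η : E3) : BddM (fun x => Complex.exp (Complex.I * (inner ℝ η x : ℝ))) :=
  BddM.exp (q := fun x => inner ℝ η x) (by fun_prop)

lemma shiftL_bdd (y : E3) :
    BddM (fun ξ => Complex.exp (Complex.I * (2 * Real.pi * inner ℝ y ξ : ℝ))) :=
  BddM.exp (q := fun ξ => 2 * Real.pi * inner ℝ y ξ) (by fun_prop)

/-- Translation as composition with a measure preserving map. -/
def shiftMP (y : E3) : Op :=
  (Lp.compMeasurePreservingₗᵢ ℂ (fun x : E3 => x + y)
    (measurePreserving_add_right volume y)).toContinuousLinearMap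

lemma shiftMP_coeFn (y : E3) (f : L2) :
    (shiftMP y f : E3 → ℂ) =ᵐ[volume] fun x => f (x + y) :=
  Lp.coeFn_compMeasurePreserving f (measurePreserving_add_right volume y)

lemma shiftMP_integrable (y : E3) {f : L2} (hf : Integrable (f : E3 → ℂ)) :
    Integrable (shiftMP y f : E3 → ℂ) :=
  (integrable_congr (shiftMP_coeFn y f)).2 (hf.comp_add_right y)

/-- Translation is defined as a Fourier multiplier so that it visibly commutes with the free
evolution; here it is recovered as composition with x ↦ x + y, first on L¹ ∩ L². -/
lemma shiftL_eq (y : E3) : shiftL y = shiftMP y := by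
  apply Op_ext_of_integrable
  intro f hf
  apply FL.injective
  rw [shiftL, FL_fmul]
  apply Lp.ext
  have hc : 𝓕 (shiftMP y f : E3 → ℂ) = 𝓕 (fun x => f (x + y)) := by
    ext ξ; exact Real.fourier_congr_ae (shiftMP_coeFn y f) ξ
  filter_upwards [mulL_coeFn (shiftL_bdd y) (FL f), L2_fourier_ae hf,
    L2_fourier_ae (shiftMP_integrable y hf)] with ξ h1 h2 h3
  rw [h1, FL_apply, FL_apply, h2, h3, hc]
  have := congrFun (VectorFourier.fourierIntegral_comp_add_right Real.fourierChar volume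
    (innerₗ E3) (f : E3 → ℂ) y) ξ
  change _ = VectorFourier.fourierIntegral Real.fourierChar volume
    (innerₗ E3) ((f : E3 → ℂ) ∘ fun x => x + y) ξ
  rw [this]
  simp only [Circle.smul_def, smul_eq_mul, innerₗ_apply_apply, Real.fourierChar_apply]
  congr 2
  push_cast
  ring

lemma shiftL_coeFn (y : E3) (f : L2) :
    (shiftL y f : E3 → ℂ) =ᵐ[volume] fun x => f (x + y) := by
  rw [shiftL_eq]; exact shiftMP_coeFn y f

lemma modul_coeFn (η : E3) (f : L2) : (modul η f : E3 → ℂ) =ᵐ[volume]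
    fun x => Complex.exp (Complex.I * (inner ℝ η x : ℝ)) * f x :=
  mulL_coeFn (modul_bdd η) f

lemma FL_modul (η : E3) (f : L2) :
    FL (modul η f) = shiftMP (-((2 * Real.pi)⁻¹ • η)) (FL f) := by
  have : (FL.toContinuousLinearEquiv : Op) ∘L modul η =
      shiftMP (-((2 * Real.pi)⁻¹ • η)) ∘L (FL.toContinuousLinearEquiv : Op) := by
    apply Op_ext_of_integrable
    intro f hf
    change FL (modul η f) = shiftMP (-((2 * Real.pi)⁻¹ • η)) (FL f)
    have hi : Integrable (modul η f : E3 → ℂ) := by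
      refine (integrable_congr (modul_coeFn η f)).2 ?_
      have := (modul_bdd η).memLp (p := 1) (f := f) (memLp_one_iff_integrable.2 hf)
      exact memLp_one_iff_integrable.1 this
    apply Lp.ext
    have hc : 𝓕 (modul η f : E3 → ℂ) =
        𝓕 (fun x => Complex.exp (Complex.I * (inner ℝ η x : ℝ)) * f x) := by
      ext ξ; exact Real.fourier_congr_ae (modul_coeFn η f) ξ
    have hq := (measurePreserving_add_right (volume : Measure E3)
      (-((2 * Real.pi)⁻¹ • η))).quasiMeasurePreserving.ae (L2_fourier_ae hf)
    filter_upwards [shiftMP_coeFn (-((2 * Real.pi)⁻¹ • η)) (FL f), hq,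
      L2_fourier_ae hi] with ξ h1 h2 h3
    rw [h1, FL_apply, FL_apply, h2, h3, hc]
    rw [Real.fourier_eq', Real.fourier_eq']
    refine integral_congr_ae (Eventually.of_forall fun x => ?_)
    simp only [smul_eq_mul]
    rw [← mul_assoc, ← Complex.exp_add]
    congr 2
    rw [inner_add_right, inner_neg_right, inner_smul_right, real_inner_comm x η]
    have : (Real.pi : ℂ) ≠ 0 := by exact_mod_cast Real.pi_ne_zero
    push_cast
    field_simp
    ring
  exact congrArg (fun A : Op => A f) this

/-- Modulation by η translates the Fourier transform, hence translates symbols. The factor (2π)⁻¹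
comes from the normalisation of `𝓕`, whose frequency ξ corresponds to k = 2πξ. -/
lemma modul_fmul (η : E3) {m : E3 → ℂ} (hm : BddM m)
    (hm' : BddM (fun ξ => m (ξ - (2 * Real.pi)⁻¹ • η))) :
    modul η * fmul m = fmul (fun ξ => m (ξ - (2 * Real.pi)⁻¹ • η)) * modul η := by
  ext1 f
  change modul η (fmul m f) = fmul _ (modul η f)
  apply FL.injective
  rw [FL_fmul, FL_modul, FL_modul, FL_fmul]
  apply Lp.ext
  have hq := (measurePreserving_add_right (volume : Measure E3)
      (-((2 * Real.pi)⁻¹ • η))).quasiMeasurePreserving.ae (mulL_coeFn hm (FL f))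
  filter_upwards [shiftMP_coeFn (-((2 * Real.pi)⁻¹ • η)) (mulL m (FL f)),
    shiftMP_coeFn (-((2 * Real.pi)⁻¹ • η)) (FL f), hq,
    mulL_coeFn hm' (shiftMP (-((2 * Real.pi)⁻¹ • η)) (FL f))] with ξ h1 h2 h3 h4
  rw [h1, h4, h2, h3, sub_eq_add_neg]

lemma shiftL_mul (y y' : E3) : shiftL y * shiftL y' = shiftL (y + y') := by
  rw [shiftL, shiftL, fmul_mul (shiftL_bdd y) (shiftL_bdd y'), shiftL]
  congr 1; ext ξ
  rw [← Complex.exp_add, inner_add_left]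
  congr 1; push_cast; ring

lemma modul_mul (η η' : E3) : modul η * modul η' = modul (η + η') := by
  rw [modul, modul, mulL_mul (modul_bdd η) (modul_bdd η'), modul]
  congr 1; ext ξ
  rw [← Complex.exp_add, inner_add_left]
  congr 1; push_cast; ring

lemma shiftL_modul (y η : E3) :
    shiftL y * modul η = Complex.exp (Complex.I * (inner ℝ η y : ℝ)) • (modul η * shiftL y) := by
  have hb : BddM (fun ξ : E3 => (fun ξ => Complex.exp (Complex.I * (2 * Real.pi * inner ℝ y ξ : ℝ)))
      (ξ - (2 * Real.pi)⁻¹ • η)) :=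
    BddM.exp (q := fun ξ => 2 * Real.pi * inner ℝ y (ξ - (2 * Real.pi)⁻¹ • η)) (by fun_prop)
  rw [shiftL, modul_fmul η (shiftL_bdd y) hb, ← smul_mul_assoc, ← fmul_smul _ hb]
  congr 2; ext ξ
  simp only
  rw [← Complex.exp_add]
  congr 1
  rw [inner_sub_right, inner_smul_right, real_inner_comm η y]
  have : (Real.pi : ℂ) ≠ 0 := by exact_mod_cast Real.pi_ne_zero
  push_cast
  field_simp
  ring

lemma shiftL_Ev (y : E3) (t : ℝ) : shiftL y * Ev t = Ev t * shiftL y :=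
  fmul_comm (shiftL_bdd y) (symE_bdd t)

/-- The Weyl operators `f ↦ e^{iη·x} f(x + y)`, `θ = (η, y)`. -/
def Weyl (θ : E3 × E3) : Op := modul θ.1 * shiftL θ.2

lemma Weyl_coeFn (θ : E3 × E3) (f : L2) : (Weyl θ f : E3 → ℂ) =ᵐ[volume]
    fun x => Complex.exp (Complex.I * (inner ℝ θ.1 x : ℝ)) * f (x + θ.2) := by
  filter_upwards [modul_coeFn θ.1 (shiftL θ.2 f), shiftL_coeFn θ.2 f] with x h1 h2
  change (modul θ.1 (shiftL θ.2 f)) x = _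
  rw [h1, h2]

lemma modul_norm_le (η : E3) : ‖modul η‖ ≤ 1 := mulL_norm_le fun _ => (norm_exp_I_mul _).le
lemma shiftL_norm_le (y : E3) : ‖shiftL y‖ ≤ 1 := fmul_norm_le fun _ => (norm_exp_I_mul _).le

lemma Weyl_norm_le (θ : E3 × E3) : ‖Weyl θ‖ ≤ 1 :=
  (norm_mul_le _ _).trans (mul_le_one₀ (modul_norm_le _) (norm_nonneg _) (shiftL_norm_le _))

lemma modul_continuous (f : L2) : Continuous fun η => modul η f := by
  refine mulL_continuous (C := 1) (fun t => (modul_bdd t).1) (fun t x => (norm_exp_I_mul _).le) ?_ f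
  intro ξ
  fun_prop

lemma shiftL_continuous (f : L2) : Continuous fun y => shiftL y f := by
  refine fmul_continuous (C := 1) (fun t => (shiftL_bdd t).1) (fun t x => (norm_exp_I_mul _).le) ?_ f
  intro ξ
  fun_prop

lemma Weyl_continuous (f : L2) : Continuous fun θ => Weyl θ f :=
  strong_joint modul_norm_le modul_continuous continuous_fst
    ((shiftL_continuous f).comp continuous_snd)

lemma Weyl_zero : Weyl 0 = 1 := by
  have h1 : modul 0 = 1 := by
    have := mulL_const 1
    rw [one_smul] at this
    rw [← this, modul]; congr 1; ext x; simp
  have h2 : shiftL 0 = 1 := by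
    have := fmul_const 1
    rw [one_smul] at this
    rw [← this, shiftL]; congr 1; ext x; simp
  rw [Weyl, Prod.fst_zero, Prod.snd_zero, h1, h2, one_mul]

/-- The canonical commutation relation. Only the modulus 1 of the phase is used later: it makes
domination of a product a convolution of measures. -/
lemma Weyl_mul (θ θ' : E3 × E3) : Weyl θ * Weyl θ' =
    Complex.exp (Complex.I * (inner ℝ θ'.1 θ.2 : ℝ)) • Weyl (θ + θ') := by
  rw [Weyl, Weyl, Weyl, mul_assoc, ← mul_assoc (shiftL θ.2), shiftL_modul, smul_mul_assoc,
    mul_smul_comm, mul_assoc, shiftL_mul, ← mul_assoc, modul_mul]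
  rfl

/-- Conjugation by the free evolution. -/
def conjEv (τ : ℝ) (Z : Op) : Op := Ev τ * Z * Ev (-τ)

/-- The flow on phase space induced by the free evolution. -/
def flow (τ : ℝ) (θ : E3 × E3) : E3 × E3 := (θ.1, θ.2 + (2 * τ) • θ.1)

/-- Passing the modulation through e^{-iτH₀} translates the symbol, and |k|² - |k-η|² = 2k·η - |η|²
is affine in k. What is left of the two evolutions is therefore the translation by 2τη times
e^{-iτ|η|²}; commuting this translation back past the modulation contributes e^{2iτ|η|²}. -/
lemma conjEv_Weyl (τ : ℝ) (θ : E3 × E3) : conjEv τ (Weyl θ) =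
    Complex.exp (Complex.I * ((τ * ‖θ.1‖ ^ 2 : ℝ) : ℂ)) • Weyl (flow τ θ) := by
  have hb : BddM (fun ξ : E3 => symE (-τ) (ξ - (2 * Real.pi)⁻¹ • θ.1)) :=
    BddM.exp (q := fun ξ => -τ * (2 * Real.pi * ‖ξ - (2 * Real.pi)⁻¹ • θ.1‖) ^ 2) (by fun_prop)
  have h1 : Ev τ * fmul (fun ξ => symE (-τ) (ξ - (2 * Real.pi)⁻¹ • θ.1)) =
      Complex.exp (-Complex.I * ((τ * ‖θ.1‖ ^ 2 : ℝ) : ℂ)) • shiftL ((2 * τ) • θ.1) := by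
    rw [Ev, fmul_mul (symE_bdd τ) hb, shiftL, ← fmul_smul _ (shiftL_bdd _)]
    congr 1; ext ξ
    simp only [symE]
    rw [← Complex.exp_add, ← Complex.exp_add]
    congr 1
    have h2 : ‖ξ - (2 * Real.pi)⁻¹ • θ.1‖ ^ 2 =
        ‖ξ‖ ^ 2 - 2 * ((2 * Real.pi)⁻¹ * inner ℝ ξ θ.1) + ((2 * Real.pi)⁻¹) ^ 2 * ‖θ.1‖ ^ 2 := by
      rw [norm_sub_sq_real, inner_smul_right, norm_smul, mul_pow, Real.norm_eq_abs, sq_abs]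
    have h3 : (τ * (2 * Real.pi * ‖ξ‖) ^ 2 +
        -τ * (2 * Real.pi * ‖ξ - (2 * Real.pi)⁻¹ • θ.1‖) ^ 2 : ℝ) =
        -(τ * ‖θ.1‖ ^ 2) + 2 * Real.pi * inner ℝ ((2 * τ) • θ.1) ξ := by
      rw [mul_pow _ ‖ξ - (2 * Real.pi)⁻¹ • θ.1‖, h2, inner_smul_left, real_inner_comm]
      have := Real.pi_ne_zero
      simp only [conj_trivial]
      field_simp
      ring
    have h4 := congrArg (fun r : ℝ => (r : ℂ)) h3
    push_cast at h4 ⊢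
    linear_combination Complex.I * h4
  rw [conjEv, Weyl, mul_assoc, mul_assoc, shiftL_Ev, ← mul_assoc (modul θ.1), Ev, Ev,
    modul_fmul θ.1 (symE_bdd _) hb, ← mul_assoc, ← mul_assoc, ← Ev, h1, smul_mul_assoc,
    smul_mul_assoc, shiftL_modul, smul_mul_assoc, mul_assoc, shiftL_mul, smul_smul, ← Complex.exp_add,
    Weyl, flow, add_comm ((2 * τ) • θ.1)]
  congr 2
  rw [inner_smul_right, real_inner_self_eq_norm_sq]
  push_cast; ring

lemma conjEv_apply (τ : ℝ) (Z : Op) (f : L2) : conjEv τ Z f = Ev τ (Z (Ev (-τ) f)) := rfl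

lemma conjEv_norm_le (τ : ℝ) (Z : Op) : ‖conjEv τ Z‖ ≤ ‖Z‖ := by
  refine ContinuousLinearMap.opNorm_le_bound _ (norm_nonneg _) fun f => ?_
  rw [conjEv_apply, Ev_norm]
  refine (Z.le_opNorm _).trans ?_
  rw [Ev_norm]

lemma conjEv_continuous (Z : Op) (f : L2) : Continuous fun τ => conjEv τ Z f := by
  simp_rw [conjEv_apply]
  exact Ev_joint continuous_id (Z.continuous.comp (Ev_joint continuous_neg continuous_const))

lemma conjEv_inner (τ : ℝ) (Z : Op) (f g : L2) :
    inner ℂ g (conjEv τ Z f) = inner ℂ (Ev (-τ) g) (Z (Ev (-τ) f)) := by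
  rw [conjEv_apply, Ev_inner]

end

noncomputable section

/-! ### Operators dominated by a measure on phase space -/

/-- Bounded continuous curves in `L²`. -/
def BC (f : ℝ → L2) : Prop := Continuous f ∧ ∃ C : ℝ, ∀ t, ‖f t‖ ≤ C

lemma BC.clm {f : ℝ → L2} (hf : BC f) (X : Op) : BC (fun t => X (f t)) := by
  obtain ⟨h1, C, hC⟩ := hf
  exact ⟨X.continuous.comp h1, ‖X‖ * C, fun t => (X.le_opNorm _).trans (by gcongr; exact hC t)⟩

lemma BC.const (f : L2) : BC (fun _ => f) := ⟨continuous_const, ‖f‖, fun _ => le_rfl⟩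

lemma BC.Ev (f : L2) : BC (fun t => Ev (-t) f) :=
  ⟨(Ev_continuous f).comp continuous_neg, ‖f‖, fun _ => (Ev_norm _ _).le⟩

/-- `∫₀^∞ e^{-εt} ⟨g t, X (f t)⟩ dt`. -/
def pairing (ε : ℝ) (f g : ℝ → L2) (X : Op) : ℂ :=
  ∫ t in Ioi (0 : ℝ), (Real.exp (-ε * t) : ℂ) * inner ℂ (g t) (X (f t))

lemma integrable_exp_neg {ε : ℝ} (hε : 0 < ε) :
    Integrable (fun t : ℝ => Real.exp (-ε * t)) (volume.restrict (Ioi 0)) :=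
  (integrableOn_exp_mul_Ioi (by linarith : -ε < 0) 0)

lemma pairing_integrable {ε : ℝ} (hε : 0 < ε) {f g : ℝ → L2} (hf : BC f) (hg : BC g) (X : Op) :
    Integrable (fun t => (Real.exp (-ε * t) : ℂ) * inner ℂ (g t) (X (f t)))
      (volume.restrict (Ioi (0 : ℝ))) := by
  obtain ⟨h1, C, hC⟩ := hf.clm X
  obtain ⟨h2, C', hC'⟩ := hg
  refine (integrable_exp_neg hε).ofReal.mul_bdd (c := C' * C) ?_ ?_
  · exact (h2.inner h1).aestronglyMeasurable
  · refine Eventually.of_forall fun t => (norm_inner_le_norm _ _).trans ?_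
    exact mul_le_mul (hC' t) (hC t) (norm_nonneg _) ((norm_nonneg _).trans (hC' t))

lemma pairing_add {ε : ℝ} (hε : 0 < ε) {f g : ℝ → L2} (hf : BC f) (hg : BC g) (X Y : Op) :
    pairing ε f g (X + Y) = pairing ε f g X + pairing ε f g Y := by
  rw [pairing, pairing, pairing, ← integral_add (pairing_integrable hε hf hg X)
    (pairing_integrable hε hf hg Y)]
  congr 1; ext t
  rw [add_apply, inner_add_right, mul_add]

lemma pairing_smul (ε : ℝ) (f g : ℝ → L2) (c : ℂ) (X : Op) :
    pairing ε f g (c • X) = c * pairing ε f g X := by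
  rw [pairing, pairing, ← integral_const_mul]
  congr 1; ext t
  change _ * inner ℂ (g t) (c • X (f t)) = _
  rw [inner_smul_right]; ring

lemma pairing_mul_right (ε : ℝ) (f g : ℝ → L2) (X Y : Op) :
    pairing ε f g (X * Y) = pairing ε (fun t => Y (f t)) g X := rfl

lemma pairing_mul_left (ε : ℝ) (f g : ℝ → L2) (X Y : Op) :
    pairing ε f g (X * Y) = pairing ε f (fun t => ContinuousLinearMap.adjoint X (g t)) Y := by
  rw [pairing, pairing]
  congr 1; ext t
  rw [ContinuousLinearMap.adjoint_inner_left]; rfl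

lemma pairing_conjEv (ε τ : ℝ) (f g : ℝ → L2) (X : Op) :
    pairing ε f g (conjEv τ X) = pairing ε (fun t => Ev (-τ) (f t)) (fun t => Ev (-τ) (g t)) X := by
  rw [pairing, pairing]
  congr 1; ext t
  rw [conjEv_inner]

lemma pairing_norm_le {ε : ℝ} (hε : 0 < ε) {f g : ℝ → L2} {C C' : ℝ} (hf : ∀ t, ‖f t‖ ≤ C)
    (hg : ∀ t, ‖g t‖ ≤ C') (X : Op) : ‖pairing ε f g X‖ ≤ ε⁻¹ * (C' * (‖X‖ * C)) := by
  have h1 : ∀ t, ‖(Real.exp (-ε * t) : ℂ) * inner ℂ (g t) (X (f t))‖ ≤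
      Real.exp (-ε * t) * (C' * (‖X‖ * C)) := fun t => by
    rw [norm_mul, Complex.norm_real, Real.norm_of_nonneg (Real.exp_pos _).le]
    gcongr
    refine (norm_inner_le_norm _ _).trans ?_
    have h0 := (norm_nonneg _).trans (hg t)
    exact mul_le_mul (hg t) ((X.le_opNorm _).trans (by gcongr; exact hf t)) (norm_nonneg _) h0
  refine (norm_integral_le_of_norm_le ((integrable_exp_neg hε).mul_const _)
    (Eventually.of_forall h1)).trans (le_of_eq ?_)
  rw [integral_mul_const, integral_exp_mul_Ioi (by linarith : -ε < 0)]
  simp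

lemma pairing_continuous {Y : Type*} [TopologicalSpace Y] [FirstCountableTopology Y] {ε : ℝ}
    (hε : 0 < ε) {f g : ℝ → L2} (hf : BC f) (hg : BC g) {A : Y → Op} {K : ℝ}
    (hK : ∀ y, ‖A y‖ ≤ K) (hA : ∀ u, Continuous fun y => A y u) :
    Continuous fun y => pairing ε f g (A y) := by
  obtain ⟨h1, C, hC⟩ := hf
  obtain ⟨h2, C', hC'⟩ := hg
  refine continuous_of_dominated (bound := fun t => Real.exp (-ε * t) * (C' * (K * C))) ?_ ?_ ?_ ?_
  · intro y
    have : Continuous fun t => inner ℂ (g t) (A y (f t)) := h2.inner ((A y).continuous.comp h1)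
    exact (Continuous.mul (by fun_prop) this).aestronglyMeasurable
  · intro y
    refine Eventually.of_forall fun t => ?_
    rw [norm_mul, Complex.norm_real, Real.norm_of_nonneg (Real.exp_pos _).le]
    gcongr
    refine (norm_inner_le_norm _ _).trans ?_
    have h0 := (norm_nonneg _).trans (hC' t)
    refine mul_le_mul (hC' t) (((A y).le_opNorm _).trans ?_) (norm_nonneg _) h0
    exact mul_le_mul (hK y) (hC t) (norm_nonneg _) ((norm_nonneg _).trans (hK y))
  · exact (integrable_exp_neg hε).mul_const _
  · refine Eventually.of_forall fun t => ?_
    exact continuous_const.mul (continuous_const.inner (hA (f t)))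

lemma pairing_Weyl_continuous {ε : ℝ} (hε : 0 < ε) {f g : ℝ → L2} (hf : BC f) (hg : BC g) :
    Continuous fun θ => pairing ε f g (Weyl θ) :=
  pairing_continuous hε hf hg Weyl_norm_le Weyl_continuous

lemma pairing_Weyl_measurable {ε : ℝ} (hε : 0 < ε) {f g : ℝ → L2} (hf : BC f) (hg : BC g) :
    Measurable fun θ => ‖pairing ε f g (Weyl θ)‖ₑ :=
  (pairing_Weyl_continuous hε hf hg).measurable.enorm

/-- Exchange of `pairing` with an integral of operators. -/
lemma pairing_integral {α : Type*} [TopologicalSpace α] [SecondCountableTopology α]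
    [MeasurableSpace α] [BorelSpace α] {ν : Measure α} [SFinite ν] {c : α → ℂ}
    (hc : Integrable c ν) {A : α → Op} {K : ℝ} (hK : ∀ a, ‖A a‖ ≤ K)
    (hA : ∀ u, Continuous fun a => A a u) {X : Op}
    (hX : ∀ f g : L2, inner ℂ g (X f) = ∫ a, c a * inner ℂ g (A a f) ∂ν)
    {ε : ℝ} (hε : 0 < ε) {f g : ℝ → L2} (hf : BC f) (hg : BC g) :
    pairing ε f g X = ∫ a, c a * pairing ε f g (A a) ∂ν := by
  obtain ⟨h1, C, hC⟩ := hf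
  obtain ⟨h2, C', hC'⟩ := hg
  simp_rw [pairing, hX, ← integral_const_mul]
  rw [integral_integral_swap]
  · congr 1; ext a; congr 1; ext t; ring
  · have hcont : Continuous fun p : ℝ × α => inner ℂ (g p.1) (A p.2 (f p.1)) :=
      (h2.comp continuous_fst).inner
        (strong_joint hK hA continuous_snd (h1.comp continuous_fst))
    have hi : Integrable (fun p : ℝ × α => (Real.exp (-ε * p.1) : ℂ) * c p.2)
        ((volume.restrict (Ioi 0)).prod ν) :=
      (integrable_exp_neg hε).ofReal.mul_prod hc
    have h3 : Integrable (fun p : ℝ × α => ((Real.exp (-ε * p.1) : ℂ) * c p.2) *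
        inner ℂ (g p.1) (A p.2 (f p.1))) ((volume.restrict (Ioi 0)).prod ν) := by
      refine hi.mul_bdd (c := C' * (K * C)) hcont.aestronglyMeasurable ?_
      refine Eventually.of_forall fun p => (norm_inner_le_norm _ _).trans ?_
      have h0 := (norm_nonneg _).trans (hC' p.1)
      refine mul_le_mul (hC' p.1) (((A p.2).le_opNorm _).trans ?_) (norm_nonneg _) h0
      exact mul_le_mul (hK _) (hC _) (norm_nonneg _) ((norm_nonneg _).trans (hK p.2))
    refine h3.congr (Eventually.of_forall fun p => ?_)
    simp only [Function.uncurry]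
    ring

/-- `X` is dominated by the measure `μ` on phase space: every time-averaged matrix element of `X`
is bounded by the `μ`-integral of those of the Weyl operators. -/
def Dom (X : Op) (μ : Measure (E3 × E3)) : Prop :=
  ∀ ε > 0, ∀ f g : ℝ → L2, BC f → BC g →
    ‖pairing ε f g X‖ₑ ≤ ∫⁻ θ, ‖pairing ε f g (Weyl θ)‖ₑ ∂μ

lemma Dom.mono {X : Op} {μ μ' : Measure (E3 × E3)} (h : Dom X μ) (hμ : μ ≤ μ') : Dom X μ' :=
  fun ε hε f g hf hg => (h ε hε f g hf hg).trans (lintegral_mono' hμ le_rfl)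

lemma Dom.zero : Dom 0 0 := fun ε hε f g hf hg => by simp [pairing]

lemma Dom.add {X Y : Op} {μ ν : Measure (E3 × E3)} (h : Dom X μ) (h' : Dom Y ν) :
    Dom (X + Y) (μ + ν) := fun ε hε f g hf hg => by
  rw [pairing_add hε hf hg, lintegral_add_measure]
  exact (enorm_add_le _ _).trans (add_le_add (h ε hε f g hf hg) (h' ε hε f g hf hg))

lemma Dom.smul {X : Op} {μ : Measure (E3 × E3)} (h : Dom X μ) {c : ℂ} {k : ℝ≥0∞}
    (hc : ‖c‖ₑ ≤ k) : Dom (c • X) (k • μ) := fun ε hε f g hf hg => by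
  rw [pairing_smul, lintegral_smul_measure, enorm_mul]
  exact mul_le_mul' hc (h ε hε f g hf hg)

lemma Dom.Weyl (θ : E3 × E3) : Dom (Weyl θ) (Measure.dirac θ) := fun ε hε f g hf hg => by
  rw [lintegral_dirac]

lemma enorm_exp_I_mul (a : ℝ) : ‖Complex.exp (Complex.I * (a : ℂ))‖ₑ = 1 := by
  rw [← ofReal_norm, norm_exp_I_mul]; simp

/-- Use the bound for X on the curve Y f, then, for each θ, the bound for Y against the curve
obtained by applying the adjoint of the Weyl operator to g. Both steps need domination for all
bounded continuous curves and not just for fixed vectors. -/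
lemma Dom.mul {X Y : Op} {μ ν : Measure (E3 × E3)} [SFinite μ] [SFinite ν] (h : Dom X μ)
    (h' : Dom Y ν) : Dom (X * Y) ((μ.prod ν).map fun p => p.1 + p.2) := fun ε hε f g hf hg => by
  rw [lintegral_map (pairing_Weyl_measurable hε hf hg) (by fun_prop),
    lintegral_prod _ (by exact ((pairing_Weyl_measurable hε hf hg).comp
      (measurable_fst.add measurable_snd)).aemeasurable), pairing_mul_right]
  refine (h ε hε _ g (hf.clm Y) hg).trans (lintegral_mono fun θ => ?_)
  rw [← pairing_mul_right, pairing_mul_left]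
  refine (h' ε hε f _ hf (hg.clm _)).trans (le_of_eq ?_)
  refine lintegral_congr fun θ' => ?_
  rw [← pairing_mul_left, Weyl_mul, pairing_smul, enorm_mul, enorm_exp_I_mul, one_mul]

lemma flow_continuous : Continuous fun p : ℝ × (E3 × E3) => flow p.1 p.2 := by
  unfold flow; fun_prop

lemma flow_measurable (τ : ℝ) : Measurable (flow τ) := by
  have : Continuous (flow τ) := by unfold flow; fun_prop
  exact this.measurable

/-- The two free evolutions are absorbed into the test curves, which stay bounded and continuous;
undoing this on each Weyl operator transports θ along the flow, up to a phase. -/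
lemma Dom.conjEv {X : Op} {μ : Measure (E3 × E3)} (h : Dom X μ) (τ : ℝ) :
    Dom (conjEv τ X) (μ.map (flow τ)) := fun ε hε f g hf hg => by
  rw [lintegral_map (pairing_Weyl_measurable hε hf hg) (flow_measurable τ), pairing_conjEv]
  refine (h ε hε _ _ (hf.clm _) (hg.clm _)).trans (le_of_eq ?_)
  refine lintegral_congr fun θ' => ?_
  rw [← pairing_conjEv, conjEv_Weyl, pairing_smul, enorm_mul, enorm_exp_I_mul, one_mul]

/-- The pairing commutes with the operator integral, so a superposition of dominated operators is
dominated by the superposed measures. The map Φ allows the dominating measures to be images of one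
fixed μ, which avoids measurable choices. -/
lemma Dom.integral {α : Type*} [TopologicalSpace α] [SecondCountableTopology α]
    [MeasurableSpace α] [BorelSpace α] {ν : Measure α} [SFinite ν] {c : α → ℂ}
    (hc : Integrable c ν) {A : α → Op} {K : ℝ} (hK : ∀ a, ‖A a‖ ≤ K)
    (hA : ∀ u, Continuous fun a => A a u) {X : Op}
    (hX : ∀ f g : L2, inner ℂ g (X f) = ∫ a, c a * inner ℂ g (A a f) ∂ν)
    {w : α → ℝ≥0∞} (hw : AEMeasurable w ν) (hcw : ∀ a, ‖c a‖ₑ ≤ w a)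
    {μ : Measure (E3 × E3)} [SFinite μ] {Φ : α × (E3 × E3) → E3 × E3} (hΦ : Measurable Φ)
    (hd : ∀ a, Dom (A a) (μ.map fun θ => Φ (a, θ))) :
    Dom X (((ν.withDensity w).prod μ).map Φ) := fun ε hε f g hf hg => by
  have hm := pairing_Weyl_measurable hε hf hg
  rw [lintegral_map hm hΦ, lintegral_prod _ (by exact (hm.comp hΦ).aemeasurable),
    pairing_integral hc hK hA hX hε hf hg,
    lintegral_withDensity_eq_lintegral_mul₀ hw
      (by exact (hm.comp hΦ).lintegral_prod_right'.aemeasurable)]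
  refine (enorm_integral_le_lintegral_enorm _).trans (lintegral_mono fun a => ?_)
  rw [enorm_mul, Pi.mul_apply]
  refine mul_le_mul' (hcw a) ((hd a ε hε f g hf hg).trans (le_of_eq ?_))
  exact lintegral_map hm (hΦ.comp measurable_prodMk_left)

lemma pairing_const {ε : ℝ} (hε : 0 < ε) (f g : L2) (X : Op) :
    pairing ε (fun _ => f) (fun _ => g) X = (ε⁻¹ : ℝ) * inner ℂ g (X f) := by
  rw [pairing, integral_mul_const]
  congr 1
  rw [integral_complex_ofReal, integral_exp_mul_Ioi (by linarith : -ε < 0)]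
  simp

/-- Constant curves with ε = 1: the weight e^{-t} has total integral 1, so the pairing is the plain
matrix element. -/
lemma Dom.inner_le {X : Op} {μ : Measure (E3 × E3)} (h : Dom X μ) (f g : L2) :
    ‖inner ℂ g (X f)‖ₑ ≤ ∫⁻ θ, ‖inner ℂ g (_root_.Weyl θ f)‖ₑ ∂μ := by
  have := h 1 one_pos _ _ (BC.const f) (BC.const g)
  simpa [pairing_const one_pos] using this

lemma Dom.norm_le {X : Op} {μ : Measure (E3 × E3)} (h : Dom X μ) {c : NNReal}
    (hc : μ univ ≤ c) : ‖X‖ ≤ c := by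
  refine ContinuousLinearMap.opNorm_le_bound _ c.2 fun f => ?_
  have h1 : ∀ g : L2, ‖inner ℂ g (X f)‖ ≤ c * ‖f‖ * ‖g‖ := fun g => by
    have h2 : ‖inner ℂ g (X f)‖ₑ ≤ ENNReal.ofReal (c * ‖f‖ * ‖g‖) := by
      refine (h.inner_le f g).trans ?_
      calc ∫⁻ θ, ‖inner ℂ g (_root_.Weyl θ f)‖ₑ ∂μ ≤ ∫⁻ _, ENNReal.ofReal (‖f‖ * ‖g‖) ∂μ := by
            refine lintegral_mono fun θ => ?_
            rw [← ofReal_norm]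
            apply ENNReal.ofReal_le_ofReal
            refine (norm_inner_le_norm _ _).trans ?_
            rw [mul_comm]
            gcongr
            exact ((_root_.Weyl θ).le_of_opNorm_le (Weyl_norm_le θ) f).trans (one_mul _).le
        _ = ENNReal.ofReal (‖f‖ * ‖g‖) * μ univ := by rw [lintegral_const]
        _ ≤ ENNReal.ofReal (‖f‖ * ‖g‖) * c := by gcongr
        _ = _ := by
            rw [← ENNReal.ofReal_coe_nnreal, ← ENNReal.ofReal_mul (by positivity)]
            congr 1; ring
    rw [← ofReal_norm] at h2
    exact (ENNReal.ofReal_le_ofReal_iff (by positivity)).1 h2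
  have h3 := h1 (X f)
  rw [inner_self_eq_norm_sq_to_K] at h3
  simp only [norm_pow, RCLike.norm_ofReal, abs_norm] at h3
  rcases eq_or_lt_of_le (norm_nonneg (X f)) with h4 | h4
  · rw [← h4]; positivity
  · nlinarith

lemma integrable_smul_conjEv {w : ℝ → ℂ} (hw : Integrable w) (Z : Op) (f : L2) :
    Integrable fun τ => w τ • conjEv τ Z f :=
  hw.smul_bdd (‖Z‖ * ‖f‖) (conjEv_continuous Z f).aestronglyMeasurable
    (Eventually.of_forall fun τ => (conjEv τ Z).le_of_opNorm_le (conjEv_norm_le τ Z) f)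

open Classical in
/-- Averages of `τ ↦ e^{iτH₀} Z e^{-iτH₀}` (`0` if the weight is not integrable). -/
def avg (w : ℝ → ℂ) (Z : Op) : Op :=
  if hw : Integrable w then
    LinearMap.mkContinuous
      { toFun := fun f => ∫ τ, w τ • conjEv τ Z f
        map_add' := fun f g => by
          rw [← integral_add (integrable_smul_conjEv hw Z f) (integrable_smul_conjEv hw Z g)]
          simp_rw [map_add, smul_add]
        map_smul' := fun c f => by
          simp only [map_smul, RingHom.id_apply]
          rw [← integral_smul]
          simp_rw [smul_comm c] }
      ((∫ τ, ‖w τ‖) * ‖Z‖) (fun f => by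
        change ‖∫ τ, w τ • conjEv τ Z f‖ ≤ _
        rw [mul_assoc, ← integral_mul_const]
        refine norm_integral_le_of_norm_le (hw.norm.mul_const _) (Eventually.of_forall fun τ => ?_)
        rw [norm_smul]
        gcongr
        exact (conjEv τ Z).le_of_opNorm_le (conjEv_norm_le τ Z) f)
  else 0

lemma avg_apply {w : ℝ → ℂ} (hw : Integrable w) (Z : Op) (f : L2) :
    avg w Z f = ∫ τ, w τ • conjEv τ Z f := by
  rw [avg, dif_pos hw]; rfl

lemma inner_avg {w : ℝ → ℂ} (hw : Integrable w) (Z : Op) (f g : L2) :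
    inner ℂ g (avg w Z f) = ∫ τ, w τ * inner ℂ g (conjEv τ Z f) := by
  rw [avg_apply hw, ← integral_inner (integrable_smul_conjEv hw Z f)]
  simp_rw [inner_smul_right]

lemma avg_norm_le {w : ℝ → ℂ} (hw : Integrable w) (Z : Op) :
    ‖avg w Z‖ ≤ (∫ τ, ‖w τ‖) * ‖Z‖ := by
  rw [avg, dif_pos hw]
  exact LinearMap.mkContinuous_norm_le _
    (mul_nonneg (integral_nonneg fun _ => norm_nonneg _) (norm_nonneg _)) _

lemma Dom.avg {X : Op} {μ : Measure (E3 × E3)} [SFinite μ] (h : Dom X μ) {w : ℝ → ℂ}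
    (hw : Integrable w) {w' : ℝ → ℝ≥0∞} (hw' : Measurable w') (hww' : ∀ τ, ‖w τ‖ₑ ≤ w' τ) :
    Dom (avg w X) (((volume.withDensity w').prod μ).map fun p => flow p.1 p.2) :=
  Dom.integral hw (fun τ => conjEv_norm_le τ X) (conjEv_continuous X) (inner_avg hw X)
    hw'.aemeasurable hww' flow_continuous.measurable fun τ => h.conjEv τ

/-- Uniform domination of a family of operators by a measure of mass at most `c`. -/
def DomF {ι : Type*} (X : ι → Op) (c : NNReal) : Prop :=
  ∃ μ : Measure (E3 × E3), μ univ ≤ c ∧ ∀ i, Dom (X i) μ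

lemma isFiniteMeasure_of_le {α : Type*} [MeasurableSpace α] {μ : Measure α} {c : NNReal}
    (h : μ univ ≤ c) : IsFiniteMeasure μ := ⟨h.trans_lt ENNReal.coe_lt_top⟩

/-! ### Arithmetic of masses for uniformly dominated families -/

section DomF
variable {ι : Type*}

lemma DomF.mono {X : ι → Op} {c c' : NNReal} (h : DomF X c) (hc : c ≤ c') : DomF X c' := by
  obtain ⟨μ, h1, h2⟩ := h
  exact ⟨μ, h1.trans (by exact_mod_cast hc), h2⟩

lemma DomF.zero : DomF (fun _ : ι => 0) 0 := ⟨0, by simp, fun _ => Dom.zero⟩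

lemma DomF.add {X Y : ι → Op} {c c' : NNReal} (h : DomF X c) (h' : DomF Y c') :
    DomF (fun i => X i + Y i) (c + c') := by
  obtain ⟨μ, h1, h2⟩ := h
  obtain ⟨ν, h3, h4⟩ := h'
  refine ⟨μ + ν, ?_, fun i => (h2 i).add (h4 i)⟩
  rw [Measure.add_apply, ENNReal.coe_add]
  exact add_le_add h1 h3

lemma DomF.sum {κ : Type*} {s : Finset κ} {X : κ → ι → Op} {c : κ → NNReal}
    (h : ∀ k ∈ s, DomF (X k) (c k)) : DomF (fun i => ∑ k ∈ s, X k i) (∑ k ∈ s, c k) := by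
  classical
  induction s using Finset.induction_on with
  | empty => simpa using DomF.zero
  | insert a s ha ih =>
    simp only [Finset.sum_insert ha]
    exact (h a (Finset.mem_insert_self _ _)).add
      (ih fun k hk => h k (Finset.mem_insert_of_mem hk))

lemma DomF.smul {X : ι → Op} {c : NNReal} (h : DomF X c) {a : ι → ℂ} {k : NNReal}
    (ha : ∀ i, ‖a i‖ ≤ k) : DomF (fun i => a i • X i) (k * c) := by
  obtain ⟨μ, h1, h2⟩ := h
  refine ⟨(k : ℝ≥0∞) • μ, ?_, fun i => (h2 i).smul ?_⟩
  · rw [Measure.smul_apply, smul_eq_mul, ENNReal.coe_mul]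
    exact mul_le_mul' le_rfl h1
  · rw [← ofReal_norm, ← ENNReal.ofReal_coe_nnreal]
    exact ENNReal.ofReal_le_ofReal (ha i)

lemma DomF.mul {X Y : ι → Op} {c c' : NNReal} (h : DomF X c) (h' : DomF Y c') :
    DomF (fun i => X i * Y i) (c * c') := by
  obtain ⟨μ, h1, h2⟩ := h
  obtain ⟨ν, h3, h4⟩ := h'
  have := isFiniteMeasure_of_le h1
  have := isFiniteMeasure_of_le h3
  refine ⟨_, ?_, fun i => (h2 i).mul (h4 i)⟩
  rw [Measure.map_apply (by fun_prop) MeasurableSet.univ, preimage_univ, ← univ_prod_univ,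
    Measure.prod_prod, ENNReal.coe_mul]
  exact mul_le_mul' h1 h3

lemma DomF.conjEv {X : ι → Op} {c : NNReal} (h : DomF X c) (τ : ℝ) :
    DomF (fun i => conjEv τ (X i)) c := by
  obtain ⟨μ, h1, h2⟩ := h
  refine ⟨_, ?_, fun i => (h2 i).conjEv τ⟩
  rwa [Measure.map_apply (flow_measurable τ) MeasurableSet.univ, preimage_univ]

lemma DomF.avg {X : ι → Op} {c : NNReal} (h : DomF X c) {w : ι → ℝ → ℂ}
    (hw : ∀ i, Integrable (w i)) {w' : ℝ → ℝ≥0∞} (hw' : Measurable w')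
    (hww' : ∀ i τ, ‖w i τ‖ₑ ≤ w' τ) {k : NNReal} (hk : ∫⁻ τ, w' τ ≤ k) :
    DomF (fun i => avg (w i) (X i)) (k * c) := by
  obtain ⟨μ, h1, h2⟩ := h
  have := isFiniteMeasure_of_le h1
  refine ⟨_, ?_, fun i => (h2 i).avg (hw i) hw' (hww' i)⟩
  rw [Measure.map_apply flow_continuous.measurable MeasurableSet.univ, preimage_univ,
    ← univ_prod_univ, Measure.prod_prod, ENNReal.coe_mul, withDensity_apply _ MeasurableSet.univ,
    Measure.restrict_univ]
  exact mul_le_mul' hk h1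

lemma DomF.norm_le {X : ι → Op} {c : NNReal} (h : DomF X c) (i : ι) : ‖X i‖ ≤ c := by
  obtain ⟨μ, h1, h2⟩ := h
  exact (h2 i).norm_le h1

lemma DomF.one : DomF (fun _ : ι => (1 : Op)) 1 := by
  refine ⟨Measure.dirac 0, by simp, fun _ => ?_⟩
  rw [← Weyl_zero]
  exact Dom.Weyl 0

lemma DomF.comp {κ : Type*} {X : ι → Op} {c : NNReal} (h : DomF X c) (σ : κ → ι) :
    DomF (fun k => X (σ k)) c := by
  obtain ⟨μ, h1, h2⟩ := h
  exact ⟨μ, h1, fun k => h2 (σ k)⟩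

/-- For fixed ε the pairing is continuous in the operator norm, so the bound for partial sums passes
to the limit; norm convergence of the series is a hypothesis and does not follow from domination by
the individual measures. -/
lemma Dom.hasSum {X : ℕ → Op} {S : Op} {μ : ℕ → Measure (E3 × E3)} (h : ∀ n, Dom (X n) (μ n))
    (hS : HasSum X S) : Dom S (Measure.sum μ) := fun ε hε f g hf hg => by
  rw [lintegral_sum_measure]
  have hlim : Tendsto (fun N => pairing ε f g (∑ n ∈ Finset.range N, X n)) atTop
      (𝓝 (pairing ε f g S)) := by
    obtain ⟨-, C, hC⟩ := id hf
    obtain ⟨-, C', hC'⟩ := id hg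
    rw [tendsto_iff_norm_sub_tendsto_zero]
    refine squeeze_zero (fun _ => norm_nonneg _)
      (g := fun N => ε⁻¹ * (C' * (‖∑ n ∈ Finset.range N, X n - S‖ * C))) (fun N => ?_) ?_
    · have := pairing_add hε hf hg (∑ n ∈ Finset.range N, X n - S) S
      rw [sub_add_cancel] at this
      rw [this, add_sub_cancel_right]
      exact pairing_norm_le hε hC hC' _
    · have h0 := (tendsto_iff_norm_sub_tendsto_zero.1 hS.tendsto_sum_nat)
      simpa using ((h0.mul_const C).const_mul C').const_mul ε⁻¹
  refine le_of_tendsto hlim.enorm (Eventually.of_forall fun N => ?_)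
  have hN : Dom (∑ n ∈ Finset.range N, X n) (∑ n ∈ Finset.range N, μ n) := by
    induction N with
    | zero => simpa using Dom.zero
    | succ N ih =>
      rw [Finset.sum_range_succ, Finset.sum_range_succ]
      exact ih.add (h N)
  refine (hN ε hε f g hf hg).trans ?_
  rw [lintegral_finsetSum_measure]
  exact ENNReal.sum_le_tsum _

lemma DomF.hasSum {X : ℕ → ι → Op} {S : ι → Op} {c : ℕ → NNReal} (h : ∀ n, DomF (X n) (c n))
    (hc : Summable c) (hS : ∀ i, HasSum (fun n => X n i) (S i)) : DomF S (∑' n, c n) := by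
  choose μ h1 h2 using h
  refine ⟨Measure.sum μ, ?_, fun i => Dom.hasSum (fun n => h2 n i) (hS i)⟩
  rw [Measure.sum_apply _ MeasurableSet.univ, ENNReal.coe_tsum hc]
  exact ENNReal.tsum_le_tsum h1

end DomF

/-! ### Dominated multiplication operators and Fourier multipliers -/

lemma inner_mulL_integral {α : Type*} [TopologicalSpace α] [SecondCountableTopology α]
    [MeasurableSpace α] [BorelSpace α] {ν : Measure α} [SFinite ν] {c : α → ℂ}
    (hc : Integrable c ν) {e : α → E3 → ℂ} (he : Continuous fun p : α × E3 => e p.1 p.2)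
    (he1 : ∀ a x, ‖e a x‖ ≤ 1) {m : E3 → ℂ} (hmb : BddM m) (hm : ∀ x, m x = ∫ a, c a * e a x ∂ν)
    (f g : L2) : inner ℂ g (mulL m f) = ∫ a, c a * inner ℂ g (mulL (e a) f) ∂ν := by
  have hb : ∀ a, BddM (e a) := fun a =>
    BddM.of_continuous (he.comp (Continuous.prodMk_right a)) (he1 a)
  rw [inner_mulL hmb]
  simp_rw [inner_mulL (hb _), hm, ← integral_const_mul, ← integral_mul_const, ← integral_const_mul]
  rw [integral_integral_swap]
  · congr 1; ext a; congr 1; ext x; ring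
  · have hfg : Integrable fun x => (starRingEnd ℂ) (g x) * f x := by
      refine (MeasureTheory.L2.integrable_inner (𝕜 := ℂ) g f).congr (Eventually.of_forall fun x => ?_)
      simp [RCLike.inner_apply, mul_comm]
    have h1 : Integrable (fun p : E3 × α => ((starRingEnd ℂ) (g p.1) * f p.1) * c p.2)
        (volume.prod ν) := hfg.mul_prod hc
    have h2 := h1.mul_bdd (c := 1) (g := fun p : E3 × α => e p.2 p.1)
      (he.comp continuous_swap).aestronglyMeasurable (Eventually.of_forall fun p => he1 _ _)
    refine h2.congr (Eventually.of_forall fun p => ?_)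
    simp only [Function.uncurry]
    ring

lemma modul_eq_Weyl (η : E3) : modul η = Weyl (η, 0) := by
  have : shiftL 0 = 1 := by
    have := fmul_const 1
    rw [one_smul] at this
    rw [← this, shiftL]; congr 1; ext x; simp
  rw [Weyl, this, mul_one]

lemma shiftL_eq_Weyl (y : E3) : shiftL y = Weyl (0, y) := by
  have : modul 0 = 1 := by
    have := mulL_const 1
    rw [one_smul] at this
    rw [← this, modul]; congr 1; ext x; simp
  rw [Weyl, this, one_mul]

/-- Weyl operators have mass 1, so the mass of a superposition is the L¹ norm of its density. The
Dirac mass at 0 is only a dummy second factor, which Φ forgets. -/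
lemma DomF.of_Weyl_integral {D : E3 → ℂ} (hD : Integrable D) {θ : E3 → E3 × E3}
    (hθ : Continuous θ) {X : Op}
    (hX : ∀ f g : L2, inner ℂ g (X f) = ∫ ξ, D ξ * inner ℂ g (Weyl (θ ξ) f)) (ι : Type*) :
    DomF (fun _ : ι => X) (∫⁻ ξ, ‖D ξ‖ₑ).toNNReal := by
  have hfin : ∫⁻ ξ, ‖D ξ‖ₑ ≠ ∞ := hD.2.ne
  refine ⟨_, ?_, fun _ => Dom.integral hD (A := fun ξ => Weyl (θ ξ)) (fun ξ => Weyl_norm_le _)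
    (fun u => (Weyl_continuous u).comp hθ) hX hD.1.enorm (fun ξ => le_rfl)
    (μ := Measure.dirac (0 : E3 × E3))
    (Φ := fun p => θ p.1) (by fun_prop) (fun ξ => ?_)⟩
  · rw [Measure.map_apply (by fun_prop) MeasurableSet.univ, preimage_univ, ← univ_prod_univ,
      Measure.prod_prod, withDensity_apply _ MeasurableSet.univ, Measure.restrict_univ]
    simp [ENNReal.coe_toNNReal hfin]
  · have : (Measure.dirac (0 : E3 × E3)).map (fun _ => θ ξ) = Measure.dirac (θ ξ) := by
      rw [Measure.map_const]; simp
    exact this ▸ Dom.Weyl (θ ξ)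

lemma DomF.mulL {D : E3 → ℂ} (hD : Integrable D) {v : E3 → ℂ} (hvb : BddM v)
    (hv : ∀ x, v x = ∫ ξ, D ξ * Complex.exp (Complex.I * (inner ℝ ξ x : ℝ))) (ι : Type*) :
    DomF (fun _ : ι => mulL v) (∫⁻ ξ, ‖D ξ‖ₑ).toNNReal := by
  refine DomF.of_Weyl_integral hD (θ := fun ξ => (ξ, 0)) (by fun_prop) (fun f g => ?_) ι
  simp_rw [← modul_eq_Weyl]
  exact inner_mulL_integral hD (by fun_prop) (fun a x => (norm_exp_I_mul _).le) hvb hv f g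

end

noncomputable section

/-! ### The perturbed evolution -/

/-- `φ(t) = f - i ∫₀ᵗ e^{iτH₀} A e^{-iτH₀} φ(τ) dτ`, the evolution equation in the interaction
picture. -/
def IsInter (A : Op) (f : L2) (φ : ℝ → L2) : Prop :=
  Continuous φ ∧ ∀ t, φ t = f - Complex.I • ∫ τ in (0 : ℝ)..t, conjEv τ A (φ τ)

lemma conjEv_joint (A : Op) {Y : Type*} [TopologicalSpace Y] {u : Y → ℝ} {f : Y → L2}
    (hu : Continuous u) (hf : Continuous f) : Continuous fun y => conjEv (u y) A (f y) :=
  strong_joint (fun τ => conjEv_norm_le τ A) (conjEv_continuous A) hu hf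

lemma conjEv_symm {A : Op} (hA : ∀ f g : L2, inner ℂ f (A g) = inner ℂ (A f) g) (τ : ℝ) (f g : L2) :
    inner ℂ f (conjEv τ A g) = inner ℂ (conjEv τ A f) g := by
  rw [conjEv_inner, hA, conjEv_apply, ← neg_neg τ, ← Ev_inner, neg_neg]

lemma IsInter.hasDerivAt {A : Op} {f : L2} {φ : ℝ → L2} (h : IsInter A f φ) (t : ℝ) :
    HasDerivAt φ (-(Complex.I • conjEv t A (φ t))) t := by
  have hc : Continuous fun τ => conjEv τ A (φ τ) := conjEv_joint A continuous_id h.1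
  have h1 := ((hc.integral_hasStrictDerivAt 0 t).hasDerivAt.const_smul Complex.I).const_sub f
  refine h1.congr_of_eventuallyEq (Eventually.of_forall fun s => ?_)
  exact h.2 s

/-- Symmetry of A makes the derivative of ⟨φ, φ⟩ vanish. Applied to a difference of two solutions
this also gives uniqueness. -/
lemma IsInter.norm_eq {A : Op} (hA : ∀ f g : L2, inner ℂ f (A g) = inner ℂ (A f) g) {f : L2}
    {φ : ℝ → L2} (h : IsInter A f φ) (t : ℝ) : ‖φ t‖ = ‖f‖ := by
  have h0 : φ 0 = f := by simpa using h.2 0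
  have hd : ∀ t, HasDerivAt (fun t => (inner ℂ (φ t) (φ t) : ℂ)) 0 t := by
    intro t
    have h1 := (h.hasDerivAt t).inner ℂ (h.hasDerivAt t)
    have h2 : inner ℂ (φ t) (-(Complex.I • conjEv t A (φ t))) +
        inner ℂ (-(Complex.I • conjEv t A (φ t))) (φ t) = 0 := by
      rw [inner_neg_right, inner_neg_left, inner_smul_left, inner_smul_right, conjEv_symm hA]
      simp
    rwa [h2] at h1
  have h2 : (inner ℂ (φ t) (φ t) : ℂ) = inner ℂ (φ 0) (φ 0) :=
    is_const_of_deriv_eq_zero (fun t => (hd t).differentiableAt) (fun t => (hd t).deriv) t 0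
  rw [inner_self_eq_norm_sq_to_K, inner_self_eq_norm_sq_to_K, h0] at h2
  have h3 : ‖φ t‖ ^ 2 = ‖f‖ ^ 2 := by exact_mod_cast h2
  exact (sq_eq_sq₀ (norm_nonneg _) (norm_nonneg _)).1 h3

lemma IsInter.add {A : Op} {f g : L2} {φ ψ : ℝ → L2} (h : IsInter A f φ) (h' : IsInter A g ψ) :
    IsInter A (f + g) (fun t => φ t + ψ t) := by
  refine ⟨h.1.add h'.1, fun t => ?_⟩
  simp_rw [map_add]
  have h1 : Continuous fun τ => conjEv τ A (φ τ) := conjEv_joint A continuous_id h.1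
  have h2 : Continuous fun τ => conjEv τ A (ψ τ) := conjEv_joint A continuous_id h'.1
  rw [intervalIntegral.integral_add (h1.intervalIntegrable _ _) (h2.intervalIntegrable _ _)]
  rw [h.2 t, h'.2 t, smul_add]
  abel

lemma IsInter.smul {A : Op} {f : L2} {φ : ℝ → L2} (h : IsInter A f φ) (c : ℂ) :
    IsInter A (c • f) (fun t => c • φ t) := by
  refine ⟨h.1.const_smul c, fun t => ?_⟩
  simp_rw [map_smul]
  rw [intervalIntegral.integral_smul, smul_comm Complex.I, ← smul_sub, ← h.2 t]

lemma IsInter.unique {A : Op} (hA : ∀ f g : L2, inner ℂ f (A g) = inner ℂ (A f) g) {f : L2}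
    {φ ψ : ℝ → L2} (h : IsInter A f φ) (h' : IsInter A f ψ) : φ = ψ := by
  ext1 t
  have h1 := (h.add (h'.smul (-1))).norm_eq hA t
  have h2 : f + (-1 : ℂ) • f = 0 := by module
  rw [h2, norm_zero, norm_eq_zero] at h1
  have h3 : φ t - ψ t = 0 := by rw [← h1]; module
  exact sub_eq_zero.1 h3

-- Global existence in one step: divide the unknown by cosh(κt). The integral operator gains 1/κ
-- against this weight, so it contracts on bounded continuous functions on all of ℝ, and κ = 2‖A‖ +
-- 1 makes the constant at most 1/2.
open BoundedContinuousFunction in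
lemma IsInter.exists (A : Op) (f : L2) : ∃ φ, IsInter A f φ := by
  set κ : ℝ := 2 * ‖A‖ + 1 with hκ
  have hA0 : 0 ≤ ‖A‖ := norm_nonneg A
  have hκ0 : 0 < κ := by positivity
  have hcosh : ∀ t, 0 < Real.cosh (κ * t) := fun t => Real.cosh_pos _
  have hint : ∀ t, |∫ τ in (0 : ℝ)..t, Real.cosh (κ * τ)| ≤ κ⁻¹ * Real.cosh (κ * t) := by
    intro t
    have h1 : ∫ τ in (0 : ℝ)..t, Real.cosh (κ * τ) = κ⁻¹ * Real.sinh (κ * t) := by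
      have hd : ∀ x ∈ uIcc 0 t, HasDerivAt (fun τ => κ⁻¹ * Real.sinh (κ * τ)) (Real.cosh (κ * x)) x := by
        intro x _
        have h := ((Real.hasDerivAt_sinh (κ * x)).comp x
          ((hasDerivAt_id x).const_mul κ)).const_mul κ⁻¹
        have e : κ⁻¹ * (Real.cosh (κ * x) * (κ * 1)) = Real.cosh (κ * x) := by
          field_simp
        rwa [e] at h
      rw [intervalIntegral.integral_eq_sub_of_hasDerivAt hd
        ((by fun_prop : Continuous fun x => Real.cosh (κ * x)).intervalIntegrable _ _)]
      simp
    rw [h1, abs_mul, abs_of_pos (inv_pos.2 hκ0)]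
    gcongr
    rw [abs_le]
    constructor
    · have := Real.sinh_lt_cosh (-(κ * t))
      rw [Real.sinh_neg, Real.cosh_neg] at this
      linarith
    · exact (Real.sinh_lt_cosh _).le
  -- the weighted integral operator
  let J : (ℝ →ᵇ L2) → ℝ → L2 := fun u t =>
    ∫ τ in (0 : ℝ)..t, conjEv τ A (Real.cosh (κ * τ) • u τ)
  have hJint : ∀ u : ℝ →ᵇ L2, Continuous fun τ => conjEv τ A (Real.cosh (κ * τ) • u τ) := fun u =>
    conjEv_joint A continuous_id ((by fun_prop : Continuous fun τ => Real.cosh (κ * τ)).smul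
      u.continuous)
  have hJc : ∀ u, Continuous (J u) := fun u =>
    intervalIntegral.continuous_primitive (fun a b => (hJint u).intervalIntegrable a b) 0
  have hJb : ∀ u : ℝ → L2, ∀ K : ℝ, (∀ t, ‖u t‖ ≤ K) → 0 ≤ K → ∀ t,
      ‖∫ τ in (0 : ℝ)..t, conjEv τ A (Real.cosh (κ * τ) • u τ)‖ ≤
        ‖A‖ * K * κ⁻¹ * Real.cosh (κ * t) := by
    intro u K hK hK0 t
    have h1 : ‖∫ τ in (0 : ℝ)..t, conjEv τ A (Real.cosh (κ * τ) • u τ)‖ ≤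
        |∫ τ in (0 : ℝ)..t, ‖A‖ * K * Real.cosh (κ * τ)| := by
      refine intervalIntegral.norm_integral_le_abs_of_norm_le (Eventually.of_forall fun τ => ?_)
        ((by fun_prop : Continuous fun τ => ‖A‖ * K * Real.cosh (κ * τ)).intervalIntegrable _ _)
      refine ((conjEv τ A).le_of_opNorm_le (conjEv_norm_le τ A) _).trans ?_
      rw [norm_smul, Real.norm_of_nonneg (hcosh τ).le]
      nlinarith [mul_le_mul_of_nonneg_left (hK τ) (mul_nonneg hA0 (hcosh τ).le)]
    refine h1.trans ?_
    rw [intervalIntegral.integral_const_mul, abs_mul, abs_of_nonneg (by positivity), mul_assoc (‖A‖ * K)]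
    gcongr
    exact hint t
  let T : (ℝ →ᵇ L2) → (ℝ →ᵇ L2) := fun u =>
    BoundedContinuousFunction.ofNormedAddCommGroup
      (fun t => (Real.cosh (κ * t))⁻¹ • (f - Complex.I • J u t))
      (((by fun_prop : Continuous fun t => Real.cosh (κ * t)).inv₀ fun t => (hcosh t).ne').smul
        (continuous_const.sub ((hJc u).const_smul Complex.I : Continuous fun t => Complex.I • J u t)))
      (‖f‖ + ‖A‖ * ‖u‖ * κ⁻¹) (fun t => by
        rw [norm_smul, norm_inv, Real.norm_of_nonneg (hcosh t).le, inv_mul_le_iff₀ (hcosh t)]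
        refine (norm_sub_le _ _).trans ?_
        rw [norm_smul, Complex.norm_I, one_mul]
        have h1 := hJb u ‖u‖ (fun t => u.norm_coe_le_norm t) (norm_nonneg _) t
        have h2 := Real.one_le_cosh (κ * t)
        have h3 := norm_nonneg f
        have h4 : ‖f‖ * 1 ≤ ‖f‖ * Real.cosh (κ * t) := by gcongr
        have h5 : J u t = ∫ τ in (0 : ℝ)..t, conjEv τ A (Real.cosh (κ * τ) • u τ) := rfl
        rw [h5]
        linarith)
  have hT : ContractingWith (1 / 2) T := by
    refine ⟨by norm_num, LipschitzWith.of_dist_le_mul fun u v => ?_⟩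
    rw [BoundedContinuousFunction.dist_le (by positivity)]
    intro t
    rw [dist_eq_norm]
    change ‖(Real.cosh (κ * t))⁻¹ • (f - Complex.I • J u t) -
      (Real.cosh (κ * t))⁻¹ • (f - Complex.I • J v t)‖ ≤ _
    have h1 : (Real.cosh (κ * t))⁻¹ • (f - Complex.I • J u t) -
      (Real.cosh (κ * t))⁻¹ • (f - Complex.I • J v t) =
      -((Real.cosh (κ * t))⁻¹ • Complex.I • (J u t - J v t)) := by module
    have h2 : J u t - J v t = ∫ τ in (0 : ℝ)..t, conjEv τ A (Real.cosh (κ * τ) • (u τ - v τ)) := by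
      change (∫ τ in (0 : ℝ)..t, _) - (∫ τ in (0 : ℝ)..t, _) = _
      rw [← intervalIntegral.integral_sub ((hJint u).intervalIntegrable _ _)
        ((hJint v).intervalIntegrable _ _)]
      simp_rw [smul_sub, map_sub]
    rw [h1, norm_neg, norm_smul, norm_smul, Complex.norm_I, one_mul, norm_inv,
      Real.norm_of_nonneg (hcosh t).le, inv_mul_le_iff₀ (hcosh t), h2]
    refine (hJb (fun τ => u τ - v τ) (dist u v) (fun τ => ?_) dist_nonneg t).trans ?_
    · rw [← dist_eq_norm]; exact u.dist_coe_le_dist τ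
    · have h3 : ‖A‖ * κ⁻¹ ≤ 1 / 2 := by
        rw [← div_eq_mul_inv, div_le_iff₀ hκ0]; linarith
      have h4 := mul_le_mul_of_nonneg_right h3
        (mul_nonneg (dist_nonneg (x := u) (y := v)) (hcosh t).le)
      simp only [NNReal.coe_div, NNReal.coe_one, NNReal.coe_ofNat]
      nlinarith
  set u := hT.fixedPoint T with hu
  have hfix : T u = u := hT.fixedPoint_isFixedPt
  refine ⟨fun t => Real.cosh (κ * t) • u t,
    (by fun_prop : Continuous fun t => Real.cosh (κ * t)).smul u.continuous, fun t => ?_⟩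
  have h1 : u t = (Real.cosh (κ * t))⁻¹ • (f - Complex.I • J u t) := by
    conv_lhs => rw [← hfix]
    rfl
  simp only
  conv_lhs => rw [h1]
  rw [smul_smul, mul_inv_cancel₀ (hcosh t).ne', one_smul]

/-- A symmetric bounded operator. -/
def SymOp (A : Op) : Prop := ∀ f g : L2, inner ℂ f (A g) = inner ℂ (A f) g

/-- The propagator in the interaction picture. -/
def interFun (A : Op) (f : L2) : ℝ → L2 := (IsInter.exists A f).choose

lemma interFun_spec (A : Op) (f : L2) : IsInter A f (interFun A f) :=
  (IsInter.exists A f).choose_spec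

open Classical in
/-- `e^{-itH}`, `H = H₀ + A`. -/
def Gp (A : Op) (t : ℝ) : Op :=
  if hA : SymOp A then
    LinearMap.mkContinuous
      { toFun := fun f => Ev (-t) (interFun A f t)
        map_add' := fun f g => by
          rw [← map_add]
          congr 1
          exact congrFun ((interFun_spec A (f + g)).unique hA
            ((interFun_spec A f).add (interFun_spec A g))) t
        map_smul' := fun c f => by
          rw [RingHom.id_apply, ← map_smul]
          congr 1
          exact congrFun ((interFun_spec A (c • f)).unique hA ((interFun_spec A f).smul c)) t }
      1 (fun f => by
        change ‖Ev (-t) (interFun A f t)‖ ≤ _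
        rw [Ev_norm, (interFun_spec A f).norm_eq hA, one_mul])
  else 0

/-! ### The unitary group e^{-itH} and Ω(t) -/

section
variable {A : Op} (hA : SymOp A)
include hA

lemma Gp_apply (t : ℝ) (f : L2) : Gp A t f = Ev (-t) (interFun A f t) := by
  rw [Gp, dif_pos hA]; rfl

lemma Gp_norm (t : ℝ) (f : L2) : ‖Gp A t f‖ = ‖f‖ := by
  rw [Gp_apply hA, Ev_norm, (interFun_spec A f).norm_eq hA]

lemma Gp_opNorm_le (t : ℝ) : ‖Gp A t‖ ≤ 1 :=
  ContinuousLinearMap.opNorm_le_bound _ zero_le_one fun f => by rw [Gp_norm hA, one_mul]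

lemma Gp_continuous (f : L2) : Continuous fun t => Gp A t f := by
  simp_rw [Gp_apply hA]
  exact Ev_joint continuous_neg (interFun_spec A f).1

lemma Gp_joint {Y : Type*} [TopologicalSpace Y] {u : Y → ℝ} {f : Y → L2}
    (hu : Continuous u) (hf : Continuous f) : Continuous fun y => Gp A (u y) (f y) :=
  strong_joint (Gp_opNorm_le hA) (Gp_continuous hA) hu hf

omit hA in
/-- The Schrödinger equation for `H₀ + A` in Duhamel form, started at time `s`. -/
def IsSol (A : Op) (s : ℝ) (ψ₀ : L2) (ψ : ℝ → L2) : Prop :=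
  Continuous ψ ∧ ∀ t : ℝ, ψ t = Ev (-(t - s)) ψ₀ -
    Complex.I • ∫ τ in s..t, Ev (-(t - τ)) (A (ψ τ))

omit hA in
lemma isSol_iff (A : Op) (s : ℝ) (ψ₀ : L2) (ψ : ℝ → L2) : IsSol A s ψ₀ ψ ↔ Continuous ψ ∧
    ∀ t, Ev t (ψ t) = Ev s ψ₀ - Complex.I • ∫ τ in s..t, conjEv τ A (Ev τ (ψ τ)) := by
  refine and_congr_right fun hψ => forall_congr' fun t => ?_
  have h1 : ∀ τ, conjEv τ A (Ev τ (ψ τ)) = Ev τ (A (ψ τ)) := fun τ => by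
    rw [conjEv_apply, Ev_apply_apply, neg_add_cancel, Ev_zero]; rfl
  have h2 : ∫ τ in s..t, Ev (-(t - τ)) (A (ψ τ)) = Ev (-t) (∫ τ in s..t, Ev τ (A (ψ τ))) := by
    have hc : Continuous fun τ => Ev τ (A (ψ τ)) := Ev_joint continuous_id (A.continuous.comp hψ)
    rw [← ContinuousLinearMap.intervalIntegral_comp_comm _ (hc.intervalIntegrable _ _)]
    congr 1; ext1 τ
    rw [Ev_apply_apply]; congr 2; ring
  have h3 : ∀ a b : L2, a = Ev (-t) b ↔ Ev t a = b := fun a b => by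
    constructor
    · rintro rfl; rw [Ev_apply_apply, add_neg_cancel, Ev_zero]; rfl
    · rintro rfl; rw [Ev_apply_apply, neg_add_cancel, Ev_zero]; rfl
  have h4 : Ev (-(t - s)) ψ₀ = Ev (-t) (Ev s ψ₀) := by rw [Ev_apply_apply]; congr 2; ring
  rw [h2, h4, ← map_smul, ← map_sub, h3]
  simp_rw [h1]

lemma Gp_isSol_zero (f : L2) : IsSol A 0 f (fun t => Gp A t f) := by
  rw [isSol_iff]
  refine ⟨Gp_continuous hA f, fun t => ?_⟩
  simp_rw [Gp_apply hA, Ev_apply_apply, add_neg_cancel, Ev_zero]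
  exact (interFun_spec A f).2 t

omit hA in
lemma IsSol.shift {s : ℝ} {ψ₀ : L2} {ψ : ℝ → L2} (h : IsSol A s ψ₀ ψ) (r : ℝ) :
    IsSol A (s - r) ψ₀ (fun t => ψ (t + r)) := by
  refine ⟨h.1.comp (by fun_prop), fun t => ?_⟩
  change ψ (t + r) = _
  rw [h.2 (t + r)]
  have h1 := intervalIntegral.integral_comp_add_right (a := s - r) (b := t)
    (fun τ => Ev (-(t + r - τ)) (A (ψ τ))) r
  rw [sub_add_cancel] at h1
  rw [← h1]
  congr 2
  · congr 2; ring
  · congr 1; ext1 τ; congr 3; ring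

omit hA in
lemma IsSol.restart {s : ℝ} {ψ₀ : L2} {ψ : ℝ → L2} (h : IsSol A s ψ₀ ψ) (r : ℝ) :
    IsSol A r (ψ r) ψ := by
  rw [isSol_iff] at h ⊢
  refine ⟨h.1, fun t => ?_⟩
  have hc : Continuous fun τ => conjEv τ A (Ev τ (ψ τ)) :=
    conjEv_joint A continuous_id (Ev_joint continuous_id h.1)
  rw [h.2 t, h.2 r, ← intervalIntegral.integral_add_adjacent_intervals
    (hc.intervalIntegrable s r) (hc.intervalIntegrable r t), smul_add]
  abel

lemma IsSol.eq {s : ℝ} {ψ₀ : L2} {ψ : ℝ → L2} (h : IsSol A s ψ₀ ψ) (t : ℝ) :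
    ψ t = Gp A (t - s) ψ₀ := by
  have h1 := h.shift s
  rw [sub_self, isSol_iff] at h1
  have h2 : IsInter A ψ₀ fun t => Ev t (ψ (t + s)) := by
    refine ⟨Ev_joint continuous_id h1.1, fun t => ?_⟩
    have := h1.2 t
    rwa [Ev_zero] at this
  have h3 := congrFun (h2.unique hA (interFun_spec A ψ₀)) (t - s)
  simp only [sub_add_cancel] at h3
  rw [Gp_apply hA, ← h3, Ev_apply_apply, neg_add_cancel, Ev_zero]; rfl

lemma Gp_isSol (s : ℝ) (f : L2) : IsSol A s f (fun t => Gp A (t - s) f) := by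
  simpa [sub_eq_add_neg] using (Gp_isSol_zero hA f).shift (-s)

lemma Gp_zero : Gp A 0 = 1 := by
  ext1 f
  have := (Gp_isSol_zero hA f).2 0
  simpa [Ev_zero] using this

lemma Gp_add (t s : ℝ) (f : L2) : Gp A t (Gp A s f) = Gp A (t + s) f := by
  have := ((Gp_isSol_zero hA f).restart s).eq hA (t + s)
  rw [this]; congr 2; ring

lemma Gp_inner (t : ℝ) (f g : L2) : inner ℂ g (Gp A (-t) f) = inner ℂ (Gp A t g) f := by
  let U : L2 →ₗᵢ[ℂ] L2 := ⟨(Gp A t : L2 →ₗ[ℂ] L2), Gp_norm hA t⟩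
  have h1 := U.inner_map_map g (Gp A (-t) f)
  rw [← h1]
  change inner ℂ (Gp A t g) (Gp A t (Gp A (-t) f)) = _
  rw [Gp_add hA, add_neg_cancel, Gp_zero hA]; rfl

omit hA in
/-- `Ω(t) = e^{itH} e^{-itH₀}`. -/
def Om (A : Op) (t : ℝ) : Op := Gp A (-t) * Ev (-t)

omit hA in
lemma Om_apply (t : ℝ) (f : L2) : Om A t f = Gp A (-t) (Ev (-t) f) := rfl

lemma Om_opNorm_le (t : ℝ) : ‖Om A t‖ ≤ 1 :=
  (norm_mul_le _ _).trans (mul_le_one₀ (Gp_opNorm_le hA _) (norm_nonneg _) (Ev_opNorm_le _))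

lemma Om_continuous (f : L2) : Continuous fun t => Om A t f :=
  Gp_joint hA continuous_neg ((Ev_continuous f).comp continuous_neg)

lemma Om_joint {Y : Type*} [TopologicalSpace Y] {u : Y → ℝ} {f : Y → L2}
    (hu : Continuous u) (hf : Continuous f) : Continuous fun y => Om A (u y) (f y) :=
  strong_joint (Om_opNorm_le hA) (Om_continuous hA) hu hf

lemma Om_zero : Om A 0 = 1 := by
  rw [Om, neg_zero, Gp_zero hA, Ev_zero, one_mul]

omit hA in
lemma inner_intervalIntegral {u : ℝ → L2} (hu : Continuous u) (a b : ℝ) (g : L2) :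
    inner ℂ g (∫ τ in a..b, u τ) = ∫ τ in a..b, inner ℂ g (u τ) :=
  ((innerSL ℂ g).intervalIntegral_comp_comm (hu.intervalIntegrable a b)).symm

omit hA in
lemma intervalIntegral_inner {u : ℝ → L2} (hu : Continuous u) (a b : ℝ) (g : L2) :
    inner ℂ (∫ τ in a..b, u τ) g = ∫ τ in a..b, inner ℂ (u τ) g := by
  rw [← inner_conj_symm, inner_intervalIntegral hu, intervalIntegral, map_sub, ← integral_conj,
    ← integral_conj, ← intervalIntegral]
  simp_rw [inner_conj_symm]

/-- Duhamel's formula for e^{-itH} g, read through the adjoint, so that Ω(σ) stands to the left of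
the potential. This is the form needed for the derivative of Ω(t) and for Cook's method. -/
lemma Om_right (t : ℝ) (f : L2) :
    Om A t f = f + Complex.I • ∫ σ in (0 : ℝ)..t, Om A σ (conjEv σ A f) := by
  refine ext_inner_left ℂ fun g => ?_
  have hc : Continuous fun σ => Om A σ (conjEv σ A f) :=
    Om_joint hA continuous_id (conjEv_continuous A f)
  have hc2 : Continuous fun τ => Ev (-(t - τ)) (A (Gp A τ g)) :=
    Ev_joint (by fun_prop) (A.continuous.comp (Gp_continuous hA g))
  have h := (Gp_isSol_zero hA g).2 t
  simp only [sub_zero] at h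
  rw [inner_add_right, inner_smul_right, inner_intervalIntegral hc, Om_apply, Gp_inner hA, h,
    inner_sub_left, inner_smul_left, intervalIntegral_inner hc2, Ev_inner, Ev_apply_apply, neg_neg,
    add_neg_cancel, Ev_zero, Complex.conj_I, neg_mul, sub_neg_eq_add]
  congr 2
  congr 1; ext1 τ
  rw [Om_apply, conjEv_apply, Ev_apply_apply, neg_add_cancel, Ev_zero, Gp_inner hA, ← Ev_inner,
    Ev_apply_apply, ← hA]
  change _ = inner ℂ (Gp A τ g) (A _)
  congr 3; ring_nf

/-- Duhamel's formula for e^{itH} itself, after reversing time: now the potential stands to the left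
of Ω(t-s). This form produces the fixed-point equation of the Abel mean. -/
lemma Om_left (t : ℝ) (f : L2) :
    Om A t f = f + Complex.I • ∫ s in (0 : ℝ)..t, Ev s (A (Om A (t - s) (Ev (-s) f))) := by
  have h := (Gp_isSol_zero hA (Ev (-t) f)).2 (-t)
  simp only at h
  rw [Om_apply, h]
  have h1 : Ev (-(-t - 0)) (Ev (-t) f) = f := by
    rw [Ev_apply_apply]; simp [Ev_zero]
  rw [h1, sub_eq_add_neg, ← smul_neg]
  congr 2
  have h2 : ∫ τ in (0 : ℝ)..(-t), Ev (-(-t - τ)) (A (Gp A τ (Ev (-t) f))) =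
      ∫ τ in t..0, Ev (t - τ) (A (Gp A (-τ) (Ev (-t) f))) := by
    have := intervalIntegral.integral_comp_neg (a := t) (b := 0)
      (fun τ => Ev (-(-t - τ)) (A (Gp A τ (Ev (-t) f))))
    rw [neg_zero] at this
    rw [← this]
    congr 1; ext1 τ; congr 2; ring
  rw [h2, ← intervalIntegral.integral_symm]
  have h3 := intervalIntegral.integral_comp_sub_left (a := 0) (b := t)
    (fun τ => Ev (t - τ) (A (Gp A (-τ) (Ev (-t) f)))) t
  rw [sub_zero, sub_self] at h3
  rw [← h3]
  congr 1; ext1 s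
  rw [Om_apply, Ev_apply_apply]
  congr 2
  · ring
  · congr 3; ring

end
end

noncomputable section

/-! ### Wave operator and its Abel means -/

/-- The weight `χ(τ > 0) e^{-ετ}`. -/
def wexp (ε : ℝ) : ℝ → ℂ := indicator (Ioi 0) (fun τ => (Real.exp (-ε * τ) : ℂ))

lemma wexp_integrable {ε : ℝ} (hε : 0 < ε) : Integrable (wexp ε) :=
  (integrable_indicator_iff measurableSet_Ioi).2 (integrable_exp_neg hε).ofReal

lemma wexp_smul_indicator {E : Type*} [AddCommGroup E] [Module ℂ E] (ε : ℝ) (u : ℝ → E) :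
    (fun τ => wexp ε τ • u τ) = indicator (Ioi 0) fun τ => (Real.exp (-ε * τ) : ℂ) • u τ := by
  ext τ
  simp only [wexp, indicator]
  split_ifs <;> simp

lemma integral_wexp_smul (ε : ℝ) (u : ℝ → L2) :
    ∫ τ, wexp ε τ • u τ = ∫ τ in Ioi (0 : ℝ), (Real.exp (-ε * τ) : ℂ) • u τ := by
  rw [← integral_indicator measurableSet_Ioi, wexp_smul_indicator]

lemma integral_wexp_mul (ε : ℝ) (u : ℝ → ℂ) :
    ∫ τ, wexp ε τ * u τ = ∫ τ in Ioi (0 : ℝ), (Real.exp (-ε * τ) : ℂ) * u τ := by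
  rw [← integral_indicator measurableSet_Ioi]
  exact congrArg _ (wexp_smul_indicator ε u)

lemma integral_cexp_neg_Ioi {ε : ℝ} (hε : 0 < ε) :
    ∫ t in Ioi (0 : ℝ), (Real.exp (-ε * t) : ℂ) = (ε⁻¹ : ℝ) := by
  rw [integral_complex_ofReal, integral_exp_mul_Ioi (by linarith : -ε < 0)]
  simp

lemma integrable_exp_smul {ε : ℝ} (hε : 0 < ε) {u : ℝ → L2} (hu : BC u) :
    Integrable (fun t : ℝ => (Real.exp (-ε * t) : ℂ) • u t) (volume.restrict (Ioi 0)) := by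
  obtain ⟨h1, C, hC⟩ := hu
  have h2 : Integrable (fun t : ℝ => (Real.exp (-ε * t) : ℂ)) (volume.restrict (Ioi 0)) :=
    (integrable_exp_neg hε).ofReal
  exact h2.smul_bdd C h1.aestronglyMeasurable (Eventually.of_forall hC)

section
variable {A : Op} (hA : SymOp A)
include hA

lemma Om_BC (f : L2) : BC fun t => Om A t f :=
  ⟨Om_continuous hA f, ‖f‖, fun t => ((Om A t).le_of_opNorm_le (Om_opNorm_le hA t) f).trans
    (one_mul _).le⟩

lemma Om_conjEv_BC (f : L2) : BC fun t => Om A t (conjEv t A f) :=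
  ⟨Om_joint hA continuous_id (conjEv_continuous A f), ‖A‖ * ‖f‖, fun t =>
    ((Om A t).le_of_opNorm_le (Om_opNorm_le hA t) _).trans ((one_mul _).le.trans
      ((conjEv t A).le_of_opNorm_le (conjEv_norm_le t A) f))⟩

lemma Om_hasDerivAt (f : L2) (t : ℝ) :
    HasDerivAt (fun t => Om A t f) (Complex.I • Om A t (conjEv t A f)) t := by
  have h1 := (((Om_conjEv_BC hA f).1.integral_hasStrictDerivAt 0 t).hasDerivAt.const_smul
    Complex.I).const_add f
  exact h1.congr_of_eventuallyEq (Eventually.of_forall fun s => Om_right hA s f)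

omit hA in
open Classical in
/-- The Abel mean `ε ∫₀^∞ e^{-εt} Ω(t) dt`. -/
def abelOp (A : Op) (ε : ℝ) : Op :=
  if h : SymOp A ∧ 0 < ε then
    LinearMap.mkContinuous
      { toFun := fun f => ε • ∫ t in Ioi (0 : ℝ), (Real.exp (-ε * t) : ℂ) • Om A t f
        map_add' := fun f g => by
          rw [← smul_add, ← integral_add (integrable_exp_smul h.2 (Om_BC h.1 f))
            (integrable_exp_smul h.2 (Om_BC h.1 g))]
          simp_rw [map_add, smul_add]
        map_smul' := fun c f => by
          have e : ∀ t : ℝ, (Real.exp (-ε * t) : ℂ) • Om A t (c • f) =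
              c • (Real.exp (-ε * t) : ℂ) • Om A t f := fun t => by rw [map_smul, smul_comm]
          simp_rw [e]
          rw [integral_smul, smul_comm]
          rfl }
      1 (fun f => by
        change ‖ε • ∫ t in Ioi (0 : ℝ), (Real.exp (-ε * t) : ℂ) • Om A t f‖ ≤ _
        rw [norm_smul, Real.norm_of_nonneg h.2.le, one_mul]
        have h1 : ‖∫ t in Ioi (0 : ℝ), (Real.exp (-ε * t) : ℂ) • Om A t f‖ ≤
            ∫ t in Ioi (0 : ℝ), Real.exp (-ε * t) * ‖f‖ := by
          refine norm_integral_le_of_norm_le ((integrable_exp_neg h.2).mul_const _)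
            (Eventually.of_forall fun t => ?_)
          rw [norm_smul, Complex.norm_real, Real.norm_of_nonneg (Real.exp_pos _).le]
          gcongr
          exact ((Om A t).le_of_opNorm_le (Om_opNorm_le h.1 t) f).trans (one_mul _).le
        rw [integral_mul_const, integral_exp_mul_Ioi (by linarith [h.2] : -ε < 0)] at h1
        have h2 := mul_le_mul_of_nonneg_left h1 h.2.le
        have h3 := h.2.ne'
        refine h2.trans (le_of_eq ?_)
        simp only [mul_zero, Real.exp_zero]
        field_simp)
  else 0

lemma abelOp_apply {ε : ℝ} (hε : 0 < ε) (f : L2) :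
    abelOp A ε f = ε • ∫ t in Ioi (0 : ℝ), (Real.exp (-ε * t) : ℂ) • Om A t f := by
  rw [abelOp, dif_pos ⟨hA, hε⟩]; rfl

omit hA in
lemma abelOp_norm_le (ε : ℝ) : ‖abelOp A ε‖ ≤ 1 := by
  rw [abelOp]
  split_ifs
  · exact LinearMap.mkContinuous_norm_le _ zero_le_one _
  · simp

/-- Integrate the derivative of e^{-εt} Ω(t) f over (0, ∞): the boundary term is -f and the
derivative of the exponential produces the Abel mean. The right side is Ω_ε of the statement. -/
lemma abelOp_eq {ε : ℝ} (hε : 0 < ε) (f : L2) : abelOp A ε f = f + Complex.I •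
    ∫ t in Ioi (0 : ℝ), (Real.exp (-ε * t) : ℂ) • Om A t (conjEv t A f) := by
  have hd : ∀ t, HasDerivAt (fun t : ℝ => (Real.exp (-ε * t) : ℂ) • Om A t f)
      ((Real.exp (-ε * t) : ℂ) • (Complex.I • Om A t (conjEv t A f)) +
        ((-ε * Real.exp (-ε * t) : ℝ) : ℂ) • Om A t f) t := by
    intro t
    have h1 : HasDerivAt (fun t : ℝ => (Real.exp (-ε * t) : ℂ)) ((-ε * Real.exp (-ε * t) : ℝ) : ℂ) t := by
      have := ((Real.hasDerivAt_exp (-ε * t)).comp t ((hasDerivAt_id t).const_mul (-ε))).ofReal_comp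
      convert this using 2
      simp; ring
    exact h1.smul (Om_hasDerivAt hA f t)
  have hi1 : Integrable (fun t : ℝ => Complex.I • ((Real.exp (-ε * t) : ℂ) •
      Om A t (conjEv t A f))) (volume.restrict (Ioi 0)) :=
    (integrable_exp_smul hε (Om_conjEv_BC hA f)).smul Complex.I
  have hi2 : Integrable (fun t : ℝ => (-ε : ℂ) • ((Real.exp (-ε * t) : ℂ) • Om A t f))
      (volume.restrict (Ioi 0)) := (integrable_exp_smul hε (Om_BC hA f)).smul (-ε : ℂ)
  have e1 : (fun t : ℝ => (Real.exp (-ε * t) : ℂ) • (Complex.I • Om A t (conjEv t A f)) +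
        ((-ε * Real.exp (-ε * t) : ℝ) : ℂ) • Om A t f) =
      fun t => Complex.I • ((Real.exp (-ε * t) : ℂ) • Om A t (conjEv t A f)) +
        (-ε : ℂ) • ((Real.exp (-ε * t) : ℂ) • Om A t f) := by
    ext1 t
    rw [smul_comm Complex.I, smul_smul (-ε : ℂ)]
    push_cast; rfl
  have hlim : Tendsto (fun t : ℝ => (Real.exp (-ε * t) : ℂ) • Om A t f) atTop (𝓝 0) := by
    refine squeeze_zero_norm (a := fun t => Real.exp (-ε * t) * ‖f‖) (fun t => ?_) ?_
    · rw [norm_smul, Complex.norm_real, Real.norm_of_nonneg (Real.exp_pos _).le]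
      gcongr
      exact ((Om A t).le_of_opNorm_le (Om_opNorm_le hA t) f).trans (one_mul _).le
    · have h1 : Tendsto (fun t : ℝ => -ε * t) atTop atBot :=
        tendsto_id.const_mul_atTop_of_neg (by linarith)
      simpa using (Real.tendsto_exp_atBot.comp h1).mul_const ‖f‖
  have key := integral_Ioi_of_hasDerivAt_of_tendsto (a := (0 : ℝ))
    (hd 0).continuousAt.continuousWithinAt (fun t _ => hd t)
    (by rw [e1]; exact hi1.add hi2) hlim
  rw [e1] at key
  rw [integral_add hi1 hi2] at key
  simp only [integral_smul] at key
  rw [abelOp_apply hA hε, mul_zero, Real.exp_zero, Om_zero hA] at *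
  simp only [Complex.ofReal_one, one_smul, one_apply_eq_self, zero_sub] at key
  have h2 : ((-ε : ℂ)) • (∫ t in Ioi (0 : ℝ), (Real.exp (-ε * t) : ℂ) • Om A t f) =
      -(ε • ∫ t in Ioi (0 : ℝ), (Real.exp (-ε * t) : ℂ) • Om A t f) := by
    rw [neg_smul]; rfl
  rw [h2] at key
  rw [← sub_eq_add_neg, sub_eq_iff_eq_add, neg_add_eq_sub, eq_sub_iff_add_eq] at key
  rw [← key, add_comm]

/-- Insert `Om_left` into the Abel mean and substitute r = t - s. The double integral over 0 < s < t
factorises because e^{-εt} = e^{-εs} e^{-εr}, and the r-integral is again the Abel mean. -/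
lemma abelOp_fix {ε : ℝ} (hε : 0 < ε) :
    abelOp A ε = 1 + Complex.I • avg (wexp ε) (A * abelOp A ε) := by
  ext1 f
  refine ext_inner_left ℂ fun g => ?_
  -- the matrix elements
  let k : ℝ → ℝ → ℂ := fun s r => inner ℂ g (Ev s (A (Om A r (Ev (-s) f))))
  have hk : Continuous fun p : ℝ × ℝ => k p.1 p.2 :=
    continuous_const.inner (Ev_joint continuous_fst (A.continuous.comp
      (Om_joint hA continuous_snd ((Ev_continuous f).comp continuous_fst.neg))))
  have hkb : ∀ s r, ‖k s r‖ ≤ ‖g‖ * (‖A‖ * ‖f‖) := fun s r => by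
    refine (norm_inner_le_norm _ _).trans ?_
    gcongr
    rw [Ev_norm]
    refine (A.le_opNorm _).trans ?_
    gcongr
    refine ((Om A r).le_of_opNorm_le (Om_opNorm_le hA r) _).trans ?_
    rw [one_mul, Ev_norm]
  have hw := wexp_integrable hε
  have h1 : inner ℂ g (abelOp A ε f) = ε * ∫ t, wexp ε t * inner ℂ g (Om A t f) := by
    have h2 : ∫ t, wexp ε t * inner ℂ g (Om A t f) = ∫ t, inner ℂ g (wexp ε t • Om A t f) := by
      simp_rw [inner_smul_right]
    have h3 : Integrable fun t => wexp ε t • Om A t f :=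
      hw.smul_bdd ‖f‖ (Om_BC hA f).1.aestronglyMeasurable (Eventually.of_forall fun t =>
        ((Om A t).le_of_opNorm_le (Om_opNorm_le hA t) f).trans (one_mul _).le)
    rw [h2, integral_inner h3, integral_wexp_smul, abelOp_apply hA hε]
    change inner ℂ g ((ε : ℂ) • _) = _
    rw [inner_smul_right]
  have h4 : ∀ t, inner ℂ g (Om A t f) = inner ℂ g f + Complex.I * ∫ s in (0 : ℝ)..t, k s (t - s) := by
    intro t
    have hc : Continuous fun s => Ev s (A (Om A (t - s) (Ev (-s) f))) :=
      Ev_joint continuous_id (A.continuous.comp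
        (Om_joint hA (by fun_prop) ((Ev_continuous f).comp continuous_neg)))
    rw [Om_left hA, inner_add_right, inner_smul_right, inner_intervalIntegral hc]
  have hF0 : Integrable (fun p : ℝ × ℝ => wexp ε p.1 * wexp ε p.2 * k p.1 p.2) := by
    refine (hw.mul_prod hw).mul_bdd (c := ‖g‖ * (‖A‖ * ‖f‖)) hk.aestronglyMeasurable
      (Eventually.of_forall fun p => hkb _ _)
  have hF : Integrable (fun p : ℝ × ℝ => wexp ε p.2 * wexp ε (p.1 - p.2) * k p.2 (p.1 - p.2)) := by
    have := hw.convolution_integrand (ContinuousLinearMap.mul ℂ ℂ) hw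
    refine this.mul_bdd (c := ‖g‖ * (‖A‖ * ‖f‖)) (g := fun p : ℝ × ℝ => k p.2 (p.1 - p.2)) ?_
      (Eventually.of_forall fun p => hkb _ _)
    exact (hk.comp (by fun_prop : Continuous fun p : ℝ × ℝ =>
      (p.2, p.1 - p.2))).aestronglyMeasurable
  -- The weight including its cutoff is multiplicative on 0 < s < t and the product on the right
  -- vanishes for all other s; hence the inner integral may run over all of ℝ and the double
  -- integral becomes a convolution.
  have h5 : ∀ t, wexp ε t * ∫ s in (0 : ℝ)..t, k s (t - s) =
      ∫ s, wexp ε s * wexp ε (t - s) * k s (t - s) := by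
    intro t
    rcases le_or_gt t 0 with ht | ht
    · have e1 : wexp ε t = 0 := by simp [wexp, ht]
      have e2 : ∀ s, wexp ε s * wexp ε (t - s) * k s (t - s) = 0 := fun s => by
        rcases le_or_gt s 0 with hs | hs
        · simp [wexp, hs]
        · have : t - s ≤ 0 := by linarith
          have e3 : wexp ε (t - s) = 0 := by
            simp only [wexp, indicator, mem_Ioi, not_lt.2 this, if_false]
          rw [e3]; ring
      rw [e1, zero_mul]
      simp_rw [e2]
      simp
    · rw [intervalIntegral.integral_of_le ht.le, integral_Ioc_eq_integral_Ioo,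
        ← integral_const_mul, ← integral_indicator measurableSet_Ioo]
      congr 1; ext s
      by_cases hs : s ∈ Ioo 0 t
      · rw [indicator_of_mem hs]
        have e1 : wexp ε t = wexp ε s * wexp ε (t - s) := by
          have : 0 < t - s := by linarith [hs.2]
          simp only [wexp, indicator, mem_Ioi, ht, hs.1, this, if_true]
          rw [← Complex.ofReal_mul, ← Real.exp_add]
          congr 2; ring
        rw [e1]
      · rw [indicator_of_notMem hs]
        rcases le_or_gt s 0 with hs' | hs'
        · simp [wexp, hs']
        · have : t - s ≤ 0 := by
            by_contra h
            exact hs ⟨hs', by linarith⟩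
          have e3 : wexp ε (t - s) = 0 := by
            simp only [wexp, indicator, mem_Ioi, not_lt.2 this, if_false]
          rw [e3]; ring
  have h6 : ∫ t, wexp ε t * ∫ s in (0 : ℝ)..t, k s (t - s) =
      ∫ s, wexp ε s * ∫ r, wexp ε r * k s r := by
    simp_rw [h5]
    rw [integral_integral_swap hF]
    congr 1; ext s
    rw [integral_sub_right_eq_self (fun r => wexp ε s * wexp ε r * k s r) s, ← integral_const_mul]
    simp_rw [mul_assoc]
  have h7 : ∀ s, ε * ∫ r, wexp ε r * k s r = inner ℂ g (conjEv s (A * abelOp A ε) f) := by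
    intro s
    have h3 : Integrable fun t => wexp ε t • Om A t (Ev (-s) f) :=
      hw.smul_bdd ‖Ev (-s) f‖ (Om_BC hA _).1.aestronglyMeasurable (Eventually.of_forall fun t =>
        ((Om A t).le_of_opNorm_le (Om_opNorm_le hA t) _).trans (one_mul _).le)
    have h8 : conjEv s (A * abelOp A ε) f = (ε : ℂ) • Ev s (A (∫ t, wexp ε t • Om A t (Ev (-s) f))) := by
      change Ev s (A (abelOp A ε (Ev (-s) f))) = _
      rw [abelOp_apply hA hε, ← integral_wexp_smul, ← map_smul, ← map_smul]
      rfl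
    rw [h8, inner_smul_right]
    have h9 := ((innerSL ℂ g) ∘L Ev s ∘L A).integral_comp_comm h3
    change _ = (ε : ℂ) * ((innerSL ℂ g) ∘L Ev s ∘L A) (∫ t, wexp ε t • Om A t (Ev (-s) f))
    rw [← h9]
    congr 2; ext t
    simp [k]
  have hi1 : Integrable fun t => wexp ε t * inner ℂ g f := hw.mul_const _
  have hi2 : Integrable fun t => wexp ε t * (Complex.I * ∫ s in (0 : ℝ)..t, k s (t - s)) := by
    have := hF.integral_prod_left.const_mul Complex.I
    refine this.congr (Eventually.of_forall fun t => ?_)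
    simp only
    rw [← h5]; ring
  rw [h1, add_apply, inner_add_right, smul_apply, inner_smul_right,
    inner_avg hw]
  simp_rw [h4, mul_add]
  rw [integral_add hi1 hi2, mul_add]
  congr 1
  · have := integral_wexp_mul ε (fun _ => inner ℂ g f)
    rw [this, integral_mul_const, integral_cexp_neg_Ioi hε, ← mul_assoc]
    have : (ε : ℂ) ≠ 0 := by exact_mod_cast hε.ne'
    push_cast
    rw [mul_inv_cancel₀ this, one_mul]; rfl
  · simp_rw [mul_left_comm _ Complex.I]
    rw [integral_const_mul, h6, mul_left_comm, ← integral_const_mul]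
    congr 2; ext s
    rw [mul_left_comm, h7]

/-- Cook's method. -/
lemma exists_wave {S : Set L2} (hS : Dense S)
    (hcook : ∀ f ∈ S, IntegrableOn (fun t => A (Ev (-t) f)) (Ioi 0)) :
    ∃ Ω : Op, ∀ f, Tendsto (fun t => Om A t f) atTop (𝓝 (Ω f)) := by
  have h1 : ∀ f ∈ S, ∃ y, Tendsto (fun t => Om A t f) atTop (𝓝 y) := by
    intro f hf
    have hi : IntegrableOn (fun σ => Om A σ (conjEv σ A f)) (Ioi 0) := by
      refine (hcook f hf).norm.mono' (Om_conjEv_BC hA f).1.aestronglyMeasurable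
        (Eventually.of_forall fun t => ?_)
      refine ((Om A t).le_of_opNorm_le (Om_opNorm_le hA t) _).trans ?_
      rw [one_mul, conjEv_apply, Ev_norm]
    have h2 := intervalIntegral_tendsto_integral_Ioi (0 : ℝ) hi tendsto_id
    refine ⟨_, ((h2.const_smul Complex.I).const_add f).congr fun t => ?_⟩
    exact (Om_right hA t f).symm
  have h3 : ∀ f, ∃ y, Tendsto (fun t => Om A t f) atTop (𝓝 y) := by
    intro f
    have hc : CauchySeq fun t => Om A t f := by
      rw [Metric.cauchySeq_iff']
      intro δ hδ
      obtain ⟨f', hf', hff'⟩ := Metric.dense_iff.1 hS f (δ / 3) (by positivity)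
      obtain ⟨y, hy⟩ := h1 f' hff'
      obtain ⟨N, hN⟩ := Metric.cauchySeq_iff'.1 hy.cauchySeq (δ / 3) (by positivity)
      refine ⟨N, fun t ht => ?_⟩
      have hd : ∀ t, dist (Om A t f) (Om A t f') < δ / 3 := fun t => by
        rw [dist_eq_norm, ← map_sub]
        refine ((Om A t).le_of_opNorm_le (Om_opNorm_le hA t) _).trans_lt ?_
        rw [one_mul, ← dist_eq_norm, dist_comm]
        exact hf'
      have h4 := dist_triangle4 (Om A t f) (Om A t f') (Om A N f') (Om A N f)
      have h5 := hd N
      rw [dist_comm] at h5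
      linarith [hd t, hN t ht]
    exact cauchySeq_tendsto_of_complete hc
  choose y hy using h3
  refine ⟨LinearMap.mkContinuous
    { toFun := y
      map_add' := fun f g => tendsto_nhds_unique (hy (f + g))
        (((hy f).add (hy g)).congr fun t => (map_add _ _ _).symm)
      map_smul' := fun c f => tendsto_nhds_unique (hy (c • f))
        (((hy f).const_smul c).congr fun t => (map_smul _ _ _).symm) } 1 (fun f => ?_), hy⟩
  refine le_of_tendsto (hy f).norm (Eventually.of_forall fun t => ?_)
  exact (Om A t).le_of_opNorm_le (Om_opNorm_le hA t) f

/-- The Abel means converge to the wave operator. -/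
lemma abelOp_tendsto {Ω : Op} (hΩ : ∀ f, Tendsto (fun t => Om A t f) atTop (𝓝 (Ω f))) (f : L2) :
    Tendsto (fun ε => abelOp A ε f) (𝓝[>] 0) (𝓝 (Ω f)) := by
  -- Rescaled by s = εt, the weight no longer depends on ε and Ω(s/ε) f converges for each s > 0, so
  -- dominated convergence applies.
  have h1 : ∀ ε > 0, abelOp A ε f = ∫ s in Ioi (0 : ℝ), (Real.exp (-s) : ℂ) • Om A (ε⁻¹ * s) f := by
    intro ε hε
    rw [abelOp_apply hA hε]
    have := integral_comp_mul_left_Ioi (fun s : ℝ => (Real.exp (-s) : ℂ) • Om A (ε⁻¹ * s) f) 0 hε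
    rw [mul_zero] at this
    have h3 := congrArg (fun y => ε • y) this
    simp only [smul_smul, mul_inv_cancel₀ hε.ne', one_smul] at h3
    rw [← h3]
    congr 2; ext1 t
    rw [← mul_assoc, inv_mul_cancel₀ hε.ne', one_mul, neg_mul]
  have h2 : Ω f = ∫ s in Ioi (0 : ℝ), (Real.exp (-s) : ℂ) • Ω f := by
    have := integral_cexp_neg_Ioi one_pos
    simp only [neg_mul, one_mul, inv_one, Complex.ofReal_one] at this
    rw [integral_smul_const, this, one_smul]
  rw [h2]
  refine Tendsto.congr' (f₁ := fun ε : ℝ => ∫ s in Ioi (0 : ℝ), (Real.exp (-s) : ℂ) • Om A (ε⁻¹ * s) f)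
    ?_ ?_
  · filter_upwards [self_mem_nhdsWithin] with ε hε
    exact (h1 ε hε).symm
  refine tendsto_integral_filter_of_dominated_convergence (fun s => Real.exp (-s) * ‖f‖) ?_ ?_ ?_ ?_
  · refine Eventually.of_forall fun ε => ?_
    exact ((by fun_prop : Continuous fun s : ℝ => (Real.exp (-s) : ℂ)).smul
      (Om_joint hA (by fun_prop) continuous_const)).aestronglyMeasurable
  · refine Eventually.of_forall fun ε => Eventually.of_forall fun s => ?_
    rw [norm_smul, Complex.norm_real, Real.norm_of_nonneg (Real.exp_pos _).le]
    gcongr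
    exact ((Om A _).le_of_opNorm_le (Om_opNorm_le hA _) f).trans (one_mul _).le
  · have := integrable_exp_neg one_pos
    simp only [neg_mul, one_mul] at this
    exact this.mul_const _
  · rw [ae_restrict_iff' measurableSet_Ioi]
    refine Eventually.of_forall fun s hs => ?_
    refine Tendsto.const_smul ?_ _
    exact (hΩ f).comp (tendsto_inv_nhdsGT_zero.atTop_mul_const hs)

end
end

noncomputable section

/-! ### Fourier inversion and weak derivatives of the Fourier transform -/

lemma integral_fourier_mul_flip {f g : E3 → ℂ} (hf : Integrable f) (hg : Integrable g) :
    ∫ ξ, 𝓕 f ξ * g ξ = ∫ x, f x * 𝓕 g x := by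
  simpa using! VectorFourier.integral_fourierIntegral_smul_eq_flip (L := innerₗ E3)
    Real.continuous_fourierChar continuous_inner hf hg

lemma fourierInv_fourier_ae_eq {f : E3 → ℂ} (hf : Integrable f) (hf' : Integrable (𝓕 f)) :
    f =ᵐ[volume] 𝓕⁻ (𝓕 f) := by
  have hc : Continuous (𝓕⁻ (𝓕 f)) := by
    rw [Real.fourierInv_eq_fourier_comp_neg]
    exact VectorFourier.fourierIntegral_continuous Real.continuous_fourierChar
      (by exact continuous_inner) hf'.comp_neg
  refine ae_eq_of_integral_contDiff_smul_eq hf.locallyIntegrable hc.locallyIntegrable ?_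
  intro φ h1 h2
  let Φ : SchwartzMap E3 ℂ := (h2.comp_left (g := ((↑) : ℝ → ℂ)) Complex.ofReal_zero).toSchwartzMap
    (Complex.ofRealCLM.contDiff.comp h1)
  have hΦ : ∀ x, Φ x = (φ x : ℂ) := fun x => rfl
  have e1 : ∫ x, Φ x * f x = ∫ x, (𝓕⁻ Φ : SchwartzMap E3 ℂ) x * 𝓕 f x := by
    rw [← integral_fourier_mul_flip (SchwartzMap.integrable _) hf, ← SchwartzMap.fourier_coe,
      FourierTransform.fourier_fourierInv_eq]
  have e2 : ∫ x, Φ x * 𝓕⁻ (𝓕 f) x = ∫ x, (𝓕⁻ Φ : SchwartzMap E3 ℂ) x * 𝓕 f x := by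
    rw [Real.fourierInv_eq_fourier_comp_neg, ← integral_fourier_mul_flip (SchwartzMap.integrable _)
      hf'.comp_neg, SchwartzMap.fourierInv_coe, ← integral_neg_eq_self]
    congr 1; ext x
    rw [Real.fourierInv_eq_fourier_neg, neg_neg]
  simpa only [hΦ, Complex.real_smul] using e1.trans e2.symm

/-- `∫ D(ξ) e^{iξ·x} dξ`. -/
def invF (D : E3 → ℂ) (x : E3) : ℂ := ∫ ξ, D ξ * Complex.exp (Complex.I * (inner ℝ ξ x : ℝ))

lemma invF_norm_le (D : E3 → ℂ) (x : E3) : ‖invF D x‖ ≤ ∫ ξ, ‖D ξ‖ := by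
  refine (norm_integral_le_integral_norm _).trans (le_of_eq ?_)
  simp_rw [norm_mul, norm_exp_I_mul, mul_one]

lemma invF_continuous {D : E3 → ℂ} (hD : Integrable D) : Continuous (invF D) := by
  refine continuous_of_dominated (bound := fun ξ => ‖D ξ‖) (fun x => ?_) (fun x => ?_) hD.norm ?_
  · exact hD.1.mul (by fun_prop : Continuous _).aestronglyMeasurable
  · exact Eventually.of_forall fun ξ => by rw [norm_mul, norm_exp_I_mul, mul_one]
  · exact Eventually.of_forall fun ξ => by fun_prop

lemma invF_bdd {D : E3 → ℂ} (hD : Integrable D) : BddM (invF D) :=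
  BddM.of_continuous (invF_continuous hD) (invF_norm_le D)

lemma fourierHat_eq (V : E3 → ℝ) (ξ : E3) : fourierHat V ξ =
    ((2 * Real.pi) ^ (-(3 / 2) : ℝ) : ℝ) * 𝓕 (fun x => (V x : ℂ)) ((2 * Real.pi)⁻¹ • ξ) := by
  rw [fourierHat, Real.fourier_eq']
  congr 2; ext x
  rw [smul_eq_mul, inner_smul_right]
  congr 2
  have := Real.pi_ne_zero
  have e : -2 * Real.pi * ((2 * Real.pi)⁻¹ * inner ℝ x ξ) = -(inner ℝ x ξ : ℝ) := by field_simp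
  rw [e]; push_cast; ring

lemma fourierHat_continuous {V : E3 → ℝ} (hV : Integrable V) : Continuous (fourierHat V) := by
  have h1 : Continuous (𝓕 (fun x => (V x : ℂ))) :=
    VectorFourier.fourierIntegral_continuous Real.continuous_fourierChar
      (by exact continuous_inner) hV.ofReal
  have : fourierHat V = fun ξ => ((2 * Real.pi) ^ (-(3 / 2) : ℝ) : ℝ) *
      𝓕 (fun x => (V x : ℂ)) ((2 * Real.pi)⁻¹ • ξ) := funext (fourierHat_eq V)
  rw [this]
  exact continuous_const.mul (h1.comp (by fun_prop))

lemma two_pi_rpow : ((2 * Real.pi) ^ (-(3 / 2) : ℝ)) ^ 2 * (2 * Real.pi) ^ 3 = 1 := by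
  have h : (0 : ℝ) < 2 * Real.pi := by positivity
  rw [← Real.rpow_natCast, ← Real.rpow_mul h.le, ← Real.rpow_natCast (2 * Real.pi) 3,
    ← Real.rpow_add h]
  norm_num

lemma ae_eq_invF {V : E3 → ℝ} (hV : Integrable V) (hV' : Integrable (fourierHat V)) :
    (fun x => (V x : ℂ)) =ᵐ[volume]
      fun x => ((2 * Real.pi) ^ (-(3 / 2) : ℝ) : ℝ) * invF (fourierHat V) x := by
  set c : ℝ := (2 * Real.pi) ^ (-(3 / 2) : ℝ) with hc
  have hpi : (0 : ℝ) < 2 * Real.pi := by positivity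
  have hc0 : 0 < c := Real.rpow_pos_of_pos hpi _
  have hF : ∀ η, 𝓕 (fun x => (V x : ℂ)) η = (c⁻¹ : ℝ) * fourierHat V ((2 * Real.pi) • η) := fun η => by
    rw [fourierHat_eq, smul_smul, inv_mul_cancel₀ hpi.ne', one_smul, ← mul_assoc, ← Complex.ofReal_mul,
      ← hc, inv_mul_cancel₀ hc0.ne', Complex.ofReal_one, one_mul]
  have hi : Integrable (𝓕 (fun x => (V x : ℂ))) := by
    have := (hV'.comp_smul hpi.ne').const_mul ((c⁻¹ : ℝ) : ℂ)
    exact this.congr (Eventually.of_forall fun η => (hF η).symm)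
  refine (fourierInv_fourier_ae_eq hV.ofReal hi).trans (Eventually.of_forall fun x => ?_)
  rw [Real.fourierInv_eq']
  change _ = (c : ℂ) * ∫ ξ, fourierHat V ξ * Complex.exp (Complex.I * (inner ℝ ξ x : ℝ))
  have h2 := Measure.integral_comp_smul (μ := (volume : Measure E3))
    (fun ξ => fourierHat V ξ * Complex.exp (Complex.I * (inner ℝ ξ x : ℝ))) (2 * Real.pi)
  have h3 : ∀ η, Complex.exp (((2 * Real.pi * inner ℝ η x : ℝ) : ℂ) * Complex.I) •
      𝓕 (fun x => (V x : ℂ)) η = (c⁻¹ : ℝ) * (fourierHat V ((2 * Real.pi) • η) *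
        Complex.exp (Complex.I * (inner ℝ ((2 * Real.pi) • η) x : ℝ))) := fun η => by
    rw [hF, smul_eq_mul, inner_smul_left, mul_comm Complex.I]
    simp only [conj_trivial]
    ring
  refine (integral_congr_ae (Eventually.of_forall h3)).trans ?_
  rw [integral_const_mul, h2, finrank_euclideanSpace_fin, abs_of_pos (by positivity),
    Complex.real_smul, ← mul_assoc, ← Complex.ofReal_mul]
  congr 2
  have := two_pi_rpow
  rw [← hc] at this
  field_simp
  linarith

/-! ### Weak derivatives tested against plane waves -/

lemma iterDirDeriv_append (vs : List E3) (v : E3) (φ : E3 → ℝ) :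
    iterDirDeriv (vs ++ [v]) φ = iterDirDeriv vs (fun ξ => fderiv ℝ φ ξ v) := by
  induction vs with
  | nil => rfl
  | cons w vs ih =>
    ext ξ
    simp only [List.cons_append, iterDirDeriv, ih]

lemma contDiff_fderiv_apply {φ : E3 → ℝ} (h : ContDiff ℝ (⊤ : ℕ∞) φ) (v : E3) :
    ContDiff ℝ (⊤ : ℕ∞) (fun ξ => fderiv ℝ φ ξ v) :=
  (h.fderiv_right (by simp)).clm_apply contDiff_const

lemma contDiff_iterDirDeriv {φ : E3 → ℝ} (h : ContDiff ℝ (⊤ : ℕ∞) φ) (vs : List E3) :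
    ContDiff ℝ (⊤ : ℕ∞) (iterDirDeriv vs φ) := by
  induction vs with
  | nil => exact h
  | cons v vs ih => exact contDiff_fderiv_apply ih v

lemma iterDirDeriv_add {φ ψ : E3 → ℝ} (h : ContDiff ℝ (⊤ : ℕ∞) φ) (h' : ContDiff ℝ (⊤ : ℕ∞) ψ)
    (a c : ℝ) (vs : List E3) : iterDirDeriv vs (fun ξ => a * φ ξ + c * ψ ξ) =
      fun ξ => a * iterDirDeriv vs φ ξ + c * iterDirDeriv vs ψ ξ := by
  induction vs with
  | nil => rfl
  | cons v vs ih =>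
    ext ξ
    have h1 := ((contDiff_iterDirDeriv h vs).differentiable (by simp) ξ).hasFDerivAt
    have h2 := ((contDiff_iterDirDeriv h' vs).differentiable (by simp) ξ).hasFDerivAt
    have h3 := (h1.const_mul a).add (h2.const_mul c)
    change fderiv ℝ (iterDirDeriv vs fun ξ => a * φ ξ + c * ψ ξ) ξ v = _
    rw [ih]
    have h4 : HasFDerivAt (fun ξ => a * iterDirDeriv vs φ ξ + c * iterDirDeriv vs ψ ξ) _ ξ := h3
    rw [h4.fderiv]
    simp [iterDirDeriv]

/-- A truncated plane wave. -/
def truncWave (χ : E3 → ℝ) (x : E3) (θ ρ : ℝ) (ξ : E3) : ℝ :=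
  χ (ρ • ξ) * Real.cos (inner ℝ x ξ + θ)

lemma truncWave_contDiff {χ : E3 → ℝ} (hχ : ContDiff ℝ (⊤ : ℕ∞) χ) (x : E3) (θ ρ : ℝ) :
    ContDiff ℝ (⊤ : ℕ∞) (truncWave χ x θ ρ) := by
  unfold truncWave
  exact (hχ.comp (contDiff_id.const_smul ρ)).mul
    (Real.contDiff_cos.comp ((contDiff_const.inner ℝ contDiff_id).add contDiff_const))

lemma truncWave_fderiv {χ : E3 → ℝ} (hχ : ContDiff ℝ (⊤ : ℕ∞) χ) (x v : E3) (θ ρ : ℝ) (ξ : E3) :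
    fderiv ℝ (truncWave χ x θ ρ) ξ v = ρ * truncWave (fun ξ => fderiv ℝ χ ξ v) x θ ρ ξ +
      inner ℝ x v * truncWave χ x (θ + Real.pi / 2) ρ ξ := by
  have h1 : HasFDerivAt (fun ξ : E3 => ρ • ξ) (ρ • ContinuousLinearMap.id ℝ E3) ξ :=
    (hasFDerivAt_id ξ).const_smul ρ
  have h2 : HasFDerivAt (fun ξ => χ (ρ • ξ)) _ ξ :=
    (hχ.differentiable (by simp) (ρ • ξ)).hasFDerivAt.comp ξ h1
  have h3 : HasFDerivAt (fun ξ : E3 => inner ℝ x ξ + θ) (innerSL ℝ x) ξ :=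
    ((innerSL ℝ x).hasFDerivAt).add_const θ
  have h4 : HasFDerivAt (fun ξ => Real.cos (inner ℝ x ξ + θ)) _ ξ := h3.cos
  have h5 : HasFDerivAt (truncWave χ x θ ρ) _ ξ := h2.mul h4
  rw [h5.fderiv]
  have h6 : Real.cos (inner ℝ x ξ + (θ + Real.pi / 2)) = -Real.sin (inner ℝ x ξ + θ) := by
    rw [← add_assoc, Real.cos_add_pi_div_two]
  simp [truncWave, h6]
  ring

lemma exists_bound_of_hasCompactSupport {χ : E3 → ℝ} (h : Continuous χ) (h' : HasCompactSupport χ) :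
    ∃ C : ℝ, 0 ≤ C ∧ ∀ ξ, |χ ξ| ≤ C := by
  obtain ⟨C, hC⟩ := h.bounded_above_of_compact_support h'
  exact ⟨C, (norm_nonneg _).trans (hC 0), hC⟩

/-- A derivative that hits the cosine gives a factor x·v and advances the phase by π/2; one that
hits the cutoff χ(ρξ) costs a factor ρ. The induction strips the innermost direction and runs over
all χ at once, because the derivative of a cutoff is treated as a new cutoff. -/
lemma truncWave_iterDirDeriv (x : E3) (vs : List E3) : ∀ χ : E3 → ℝ, ContDiff ℝ (⊤ : ℕ∞) χ →
    HasCompactSupport χ → ∃ C : ℝ, ∀ ρ θ : ℝ, ∀ ξ, 0 < ρ → ρ ≤ 1 →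
      |iterDirDeriv vs (truncWave χ x θ ρ) ξ - (vs.map fun v => inner ℝ x v).prod *
        truncWave χ x (θ + vs.length * (Real.pi / 2)) ρ ξ| ≤ C * ρ := by
  induction vs using List.reverseRecOn with
  | nil => exact fun χ _ _ => ⟨0, fun ρ θ ξ _ _ => by simp [iterDirDeriv]⟩
  | append_singleton vs v ih =>
    intro χ h1 h2
    obtain ⟨C, hC⟩ := ih χ h1 h2
    obtain ⟨C', hC'⟩ := ih (fun ξ => fderiv ℝ χ ξ v) (contDiff_fderiv_apply h1 v)
      (h2.fderiv_apply ℝ v)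
    obtain ⟨B, hB0, hB⟩ := exists_bound_of_hasCompactSupport (contDiff_fderiv_apply h1 v).continuous
      (h2.fderiv_apply ℝ v)
    set P := (vs.map fun v => inner ℝ x v).prod with hP
    refine ⟨C' + |P| * B + |inner ℝ x v| * C, fun ρ θ ξ hρ hρ1 => ?_⟩
    rw [iterDirDeriv_append, funext (truncWave_fderiv h1 x v θ ρ), iterDirDeriv_add
      (truncWave_contDiff (contDiff_fderiv_apply h1 v) _ _ _) (truncWave_contDiff h1 _ _ _)]
    have e1 := hC ρ (θ + Real.pi / 2) ξ hρ hρ1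
    have e2 := hC' ρ θ ξ hρ hρ1
    set a := iterDirDeriv vs (truncWave (fun ξ => fderiv ℝ χ ξ v) x θ ρ) ξ
    set d := iterDirDeriv vs (truncWave χ x (θ + Real.pi / 2) ρ) ξ
    have e3 : |truncWave (fun ξ => fderiv ℝ χ ξ v) x (θ + vs.length * (Real.pi / 2)) ρ ξ| ≤ B := by
      rw [truncWave, abs_mul]
      exact (mul_le_mul (hB _) (Real.abs_cos_le_one _) (abs_nonneg _) hB0).trans (mul_one _).le
    set t := truncWave (fun ξ => fderiv ℝ χ ξ v) x (θ + vs.length * (Real.pi / 2)) ρ ξ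
    have e4 : truncWave χ x (θ + ((vs ++ [v]).length : ℝ) * (Real.pi / 2)) ρ ξ =
        truncWave χ x (θ + Real.pi / 2 + vs.length * (Real.pi / 2)) ρ ξ := by
      congr 1; simp; ring
    rw [e4]
    set u := truncWave χ x (θ + Real.pi / 2 + vs.length * (Real.pi / 2)) ρ ξ
    simp only [List.map_append, List.map_cons, List.map_nil, List.prod_append, List.prod_singleton]
    rw [← hP]
    have e5 : ρ * a + inner ℝ x v * d - P * inner ℝ x v * u =
      ρ * (a - P * t) + ρ * (P * t) + inner ℝ x v * (d - P * u) := by ring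
    rw [e5]
    refine (abs_add_three _ _ _).trans ?_
    rw [abs_mul, abs_mul, abs_mul, abs_mul, abs_of_pos hρ]
    have e6 : |a - P * t| ≤ C' := e2.trans (by
      have : 0 ≤ C' := by
        by_contra h
        push Not at h
        have := (abs_nonneg _).trans e2
        nlinarith
      nlinarith)
    have e7 : |P| * |t| ≤ |P| * B := by gcongr
    have e8 : |inner ℝ x v| * |d - P * u| ≤ |inner ℝ x v| * (C * ρ) := by gcongr
    nlinarith

lemma exists_cutoff : ∃ χ : E3 → ℝ, ContDiff ℝ (⊤ : ℕ∞) χ ∧ HasCompactSupport χ ∧ χ 0 = 1 := by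
  let f : ContDiffBump (0 : E3) := ⟨1, 2, one_pos, one_lt_two⟩
  exact ⟨f, f.contDiff, f.hasCompactSupport, f.one_of_mem_closedBall (by simp [f])⟩

/-- Removal of the cutoff, ρ ↓ 0, in the definition of the weak derivative; integrability of f and D
gives the dominating functions. Test functions are real, hence cosines with a free phase θ instead
of exponentials. -/
lemma weakDeriv_cos {f D : E3 → ℂ} {vs : List E3} (h : IsWeakDeriv vs f D) (hf : Integrable f)
    (hD : Integrable D) (x : E3) (θ : ℝ) :
    ((vs.map fun v => (inner ℝ x v : ℝ)).prod : ℂ) *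
      ∫ ξ, (Real.cos (inner ℝ x ξ + (θ + vs.length * (Real.pi / 2))) : ℂ) * f ξ =
      (-1) ^ vs.length * ∫ ξ, (Real.cos (inner ℝ x ξ + θ) : ℂ) * D ξ := by
  obtain ⟨χ, h1, h2, h3⟩ := exists_cutoff
  obtain ⟨C, hC⟩ := truncWave_iterDirDeriv x vs χ h1 h2
  obtain ⟨B, hB0, hB⟩ := exists_bound_of_hasCompactSupport h1.continuous h2
  set P := (vs.map fun v => (inner ℝ x v : ℝ)).prod with hP
  have hC0 : 0 ≤ C := by
    have := (abs_nonneg _).trans (hC 1 0 0 one_pos le_rfl)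
    linarith
  have htw : ∀ θ ρ ξ, |truncWave χ x θ ρ ξ| ≤ B := fun θ ρ ξ => by
    rw [truncWave, abs_mul]
    exact (mul_le_mul (hB _) (Real.abs_cos_le_one _) (abs_nonneg _) hB0).trans (mul_one _).le
  have htl : ∀ θ ξ, Tendsto (fun ρ => truncWave χ x θ ρ ξ) (𝓝[>] 0)
      (𝓝 (Real.cos (inner ℝ x ξ + θ))) := fun θ ξ => by
    have : Continuous fun ρ => truncWave χ x θ ρ ξ := by
      unfold truncWave
      exact (h1.continuous.comp (by fun_prop)).mul continuous_const
    have h4 := this.tendsto 0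
    rw [truncWave, zero_smul, h3, one_mul] at h4
    exact h4.mono_left nhdsWithin_le_nhds
  have hsmall : ∀ᶠ ρ : ℝ in 𝓝[>] 0, 0 < ρ ∧ ρ ≤ 1 := by
    filter_upwards [Ioc_mem_nhdsGT (zero_lt_one (α := ℝ))] with ρ hρ using hρ
  have hlim1 : Tendsto (fun ρ => ∫ ξ, (iterDirDeriv vs (truncWave χ x θ ρ) ξ : ℂ) * f ξ) (𝓝[>] 0)
      (𝓝 (∫ ξ, ((P * Real.cos (inner ℝ x ξ + (θ + vs.length * (Real.pi / 2))) : ℝ) : ℂ) * f ξ)) := by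
    refine tendsto_integral_filter_of_dominated_convergence (fun ξ => (C + |P| * B) * ‖f ξ‖) ?_ ?_
      (hf.norm.const_mul _) ?_
    · refine Eventually.of_forall fun ρ => ?_
      exact (Complex.continuous_ofReal.comp (contDiff_iterDirDeriv
        (truncWave_contDiff h1 _ _ _) vs).continuous).aestronglyMeasurable.mul hf.1
    · filter_upwards [hsmall] with ρ hρ
      refine Eventually.of_forall fun ξ => ?_
      rw [norm_mul, Complex.norm_real, Real.norm_eq_abs]
      gcongr
      have e1 := hC ρ θ ξ hρ.1 hρ.2
      have e2 := htw (θ + vs.length * (Real.pi / 2)) ρ ξ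
      have e3 := abs_sub_abs_le_abs_sub (iterDirDeriv vs (truncWave χ x θ ρ) ξ)
        (P * truncWave χ x (θ + vs.length * (Real.pi / 2)) ρ ξ)
      rw [abs_mul P] at e3
      have e4 : |P| * |truncWave χ x (θ + vs.length * (Real.pi / 2)) ρ ξ| ≤ |P| * B := by gcongr
      have e5 : C * ρ ≤ C := mul_le_of_le_one_right hC0 hρ.2
      linarith
    · refine Eventually.of_forall fun ξ => Tendsto.mul_const _ ?_
      refine (Complex.continuous_ofReal.tendsto _).comp ?_
      have e1 : Tendsto (fun ρ => P * truncWave χ x (θ + vs.length * (Real.pi / 2)) ρ ξ) (𝓝[>] 0)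
        (𝓝 (P * Real.cos (inner ℝ x ξ + (θ + vs.length * (Real.pi / 2))))) :=
        (htl _ ξ).const_mul P
      have e2 : Tendsto (fun ρ => iterDirDeriv vs (truncWave χ x θ ρ) ξ -
          P * truncWave χ x (θ + vs.length * (Real.pi / 2)) ρ ξ) (𝓝[>] 0) (𝓝 0) := by
        refine squeeze_zero_norm' (a := fun ρ => C * ρ) ?_ ?_
        · filter_upwards [hsmall] with ρ hρ using hC ρ θ ξ hρ.1 hρ.2
        · have : Tendsto (fun ρ : ℝ => C * ρ) (𝓝 0) (𝓝 (C * 0)) := tendsto_id.const_mul C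
          rw [mul_zero] at this
          exact this.mono_left nhdsWithin_le_nhds
      simpa using e2.add e1
  have hlim2 : Tendsto (fun ρ => ∫ ξ, (truncWave χ x θ ρ ξ : ℂ) * D ξ) (𝓝[>] 0)
      (𝓝 (∫ ξ, (Real.cos (inner ℝ x ξ + θ) : ℂ) * D ξ)) := by
    refine tendsto_integral_filter_of_dominated_convergence (fun ξ => B * ‖D ξ‖) ?_ ?_
      (hD.norm.const_mul _) ?_
    · exact Eventually.of_forall fun ρ => (Complex.continuous_ofReal.comp
        (truncWave_contDiff h1 _ _ _).continuous).aestronglyMeasurable.mul hD.1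
    · refine Eventually.of_forall fun ρ => Eventually.of_forall fun ξ => ?_
      rw [norm_mul, Complex.norm_real, Real.norm_eq_abs]
      gcongr
      exact htw _ _ _
    · exact Eventually.of_forall fun ξ =>
        ((Complex.continuous_ofReal.tendsto _).comp (htl θ ξ)).mul_const _
  have hlim3 := hlim2.const_mul ((-1 : ℂ) ^ vs.length)
  have heq : ∀ᶠ ρ : ℝ in 𝓝[>] 0, (-1 : ℂ) ^ vs.length * ∫ ξ, (truncWave χ x θ ρ ξ : ℂ) * D ξ =
      ∫ ξ, (iterDirDeriv vs (truncWave χ x θ ρ) ξ : ℂ) * f ξ := by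
    filter_upwards [hsmall] with ρ hρ
    refine (h.2 _ (truncWave_contDiff h1 _ _ _) ?_).symm
    exact HasCompactSupport.mul_right (h2.comp_smul hρ.1.ne')
  rw [tendsto_nhds_unique (hlim3.congr' heq) hlim1, ← integral_const_mul]
  congr 1; ext ξ
  push_cast; ring

/-- The phases 0 and -π/2 give the real and imaginary parts of the plane wave; the phase n·π/2
picked up by n derivatives is the factor iⁿ. -/
lemma weakDeriv_invF {f D : E3 → ℂ} {vs : List E3} (h : IsWeakDeriv vs f D) (hf : Integrable f)
    (hD : Integrable D) (x : E3) :
    ((vs.map fun v => (inner ℝ x v : ℝ)).prod : ℂ) * invF f x =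
      Complex.I ^ vs.length * invF D x := by
  have hcos : ∀ (g : E3 → ℂ) (_ : Integrable g) (θ : ℝ),
      Integrable fun ξ => (Real.cos (inner ℝ x ξ + θ) : ℂ) * g ξ := fun g hg θ => by
    refine hg.bdd_mul (c := 1) (by fun_prop : Continuous _).aestronglyMeasurable
      (Eventually.of_forall fun ξ => ?_)
    rw [Complex.norm_real]; exact Real.abs_cos_le_one _
  have key : ∀ (g : E3 → ℂ) (_ : Integrable g) (α : ℝ), invF g x * Complex.exp (Complex.I * α) =
      (∫ ξ, (Real.cos (inner ℝ x ξ + α) : ℂ) * g ξ) +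
        Complex.I * ∫ ξ, (Real.cos (inner ℝ x ξ + (-(Real.pi / 2) + α)) : ℂ) * g ξ := by
    intro g hg α
    rw [invF, ← integral_mul_const, ← integral_const_mul,
      ← integral_add (hcos g hg _) ((hcos g hg _).const_mul _)]
    congr 1; ext ξ
    have e1 : Real.cos (inner ℝ x ξ + (-(Real.pi / 2) + α)) = Real.sin (inner ℝ x ξ + α) := by
      rw [← Real.cos_sub_pi_div_two]; congr 1; ring
    rw [e1, mul_assoc, ← Complex.exp_add, ← mul_add, ← Complex.ofReal_add, mul_comm Complex.I,
      Complex.exp_mul_I, real_inner_comm]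
    push_cast; ring
  have k1 := weakDeriv_cos h hf hD x 0
  have k2 := weakDeriv_cos h hf hD x (-(Real.pi / 2))
  have k3 := key f hf (vs.length * (Real.pi / 2))
  have k4 := key D hD 0
  rw [zero_add] at k1
  rw [Complex.ofReal_zero, mul_zero, Complex.exp_zero, mul_one, add_zero] at k4
  have e : Complex.exp (Complex.I * ((vs.length * (Real.pi / 2) : ℝ) : ℂ)) = Complex.I ^ vs.length := by
    have : Complex.I * ((vs.length * (Real.pi / 2) : ℝ) : ℂ) =
        (vs.length : ℂ) * ((Real.pi / 2 : ℂ) * Complex.I) := by push_cast; ring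
    rw [this, Complex.exp_nat_mul, Complex.exp_pi_div_two_mul_I]
  rw [e] at k3
  have k5 : ((vs.map fun v => (inner ℝ x v : ℝ)).prod : ℂ) * (invF f x * Complex.I ^ vs.length) =
      (-1) ^ vs.length * invF D x := by
    rw [k3, k4, mul_add, k1, mul_left_comm, k2]; ring
  have hI : Complex.I ^ vs.length * Complex.I ^ vs.length = (-1) ^ vs.length := by
    rw [← mul_pow, Complex.I_mul_I]
  have hI' : Complex.I ^ vs.length ≠ 0 := pow_ne_zero _ Complex.I_ne_zero
  apply mul_right_cancel₀ hI'
  rw [mul_assoc, k5, ← hI]; ring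

/-- `v` is the Fourier transform of an integrable function. -/
def FT1 (v : E3 → ℂ) : Prop := ∃ D : E3 → ℂ, Integrable D ∧ ∀ x, v x = invF D x

lemma FT1.bdd {v : E3 → ℂ} (h : FT1 v) : BddM v := by
  obtain ⟨D, h1, h2⟩ := h
  rw [funext h2]; exact invF_bdd h1

/-- The weights `(x·e_l)^j V(x)`. -/
def qf (b : OrthonormalBasis (Fin 3) ℝ E3) (V₀ : E3 → ℂ) (l j : Fin 3) (x : E3) : ℂ :=
  ((inner ℝ x (b l) ^ (j : ℕ) : ℝ) : ℂ) * V₀ x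

section
variable {b : OrthonormalBasis (Fin 3) ℝ E3} {V : E3 → ℝ}

lemma HatVaInL1.isWeakDeriv (h : HatVaInL1 b V) (r j m l : Fin 3) :
    IsWeakDeriv (dirs b r j m l) (fourierHat V) (weakDeriv (dirs b r j m l) (fourierHat V)) := by
  rw [weakDeriv, dif_pos (h.1 r j m l)]
  exact (h.1 r j m l).choose_spec

lemma HatVaInL1.integrable (h : HatVaInL1 b V) (r j m l : Fin 3) :
    Integrable (weakDeriv (dirs b r j m l) (fourierHat V)) := by
  refine h.2.mono' (h.isWeakDeriv r j m l).1.aestronglyMeasurable (Eventually.of_forall fun ξ => ?_)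
  rw [hatVa]
  refine le_trans ?_ (Finset.single_le_sum (f := fun j => ∑ l : Fin 3, ∑ r : Fin 3, ∑ m : Fin 3,
    ‖weakDeriv (dirs b r j m l) (fourierHat V) ξ‖) (fun _ _ => by positivity) (Finset.mem_univ j))
  refine le_trans ?_ (Finset.single_le_sum (f := fun l => ∑ r : Fin 3, ∑ m : Fin 3,
    ‖weakDeriv (dirs b r j m l) (fourierHat V) ξ‖) (fun _ _ => by positivity) (Finset.mem_univ l))
  refine le_trans ?_ (Finset.single_le_sum (f := fun r => ∑ m : Fin 3,
    ‖weakDeriv (dirs b r j m l) (fourierHat V) ξ‖) (fun _ _ => by positivity) (Finset.mem_univ r))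
  exact Finset.single_le_sum (f := fun m => ‖weakDeriv (dirs b r j m l) (fourierHat V) ξ‖)
    (fun _ _ => by positivity) (Finset.mem_univ m)

/-- The weak derivative along the empty list is the function itself almost everywhere, so the terms
of order zero in `hatVa` already contain the Fourier transform. -/
lemma HatVaInL1.integrable_fourierHat (hV : Integrable V) (h : HatVaInL1 b V) :
    Integrable (fourierHat V) := by
  refine (h.integrable 0 0 0 0).congr ?_
  have h1 := h.isWeakDeriv 0 0 0 0
  refine ae_eq_of_integral_contDiff_smul_eq h1.1 (fourierHat_continuous hV).locallyIntegrable ?_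
  intro φ hφ hφ'
  have h2 := h1.2 φ hφ hφ'
  simp only [dirs, Fin.val_zero, List.replicate_zero, List.append_nil, List.length_nil, pow_zero,
    one_mul, iterDirDeriv] at h2
  simpa [Complex.real_smul, dirs] using h2.symm

/-- Fourier inversion supplies a continuous representative V₀. Multiplying it by monomials in the
coordinates corresponds to differentiating the transform, so these weighted potentials are inverse
transforms of integrable functions. The identities hold at every x; reality passes from almost every
point to every point by continuity. -/
lemma exists_regular_potential (hV : Integrable V) (h : HatVaInL1 b V) :
    ∃ V₀ : E3 → ℂ, (fun x => (V x : ℂ)) =ᵐ[volume] V₀ ∧ Integrable V₀ ∧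
      (∀ x, (starRingEnd ℂ) (V₀ x) = V₀ x) ∧
      (∀ l j : Fin 3, Integrable (weakDeriv (List.replicate j (b l)) (fourierHat V)) ∧
        ∀ x, qf b V₀ l j x = (((2 * Real.pi) ^ (-(3 / 2) : ℝ) : ℝ) * Complex.I ^ (j : ℕ)) *
          invF (weakDeriv (List.replicate j (b l)) (fourierHat V)) x) ∧
      ∀ r j m l : Fin 3, FT1 fun x => ((inner ℝ x (b r) ^ (j : ℕ) : ℝ) : ℂ) * qf b V₀ m l x := by
  have hi := h.integrable_fourierHat hV
  set c : ℂ := (((2 * Real.pi) ^ (-(3 / 2) : ℝ) : ℝ) : ℂ) with hc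
  have hae : (fun x => (V x : ℂ)) =ᵐ[volume] fun x => c * invF (fourierHat V) x := ae_eq_invF hV hi
  have hcont : Continuous fun x => c * invF (fourierHat V) x :=
    continuous_const.mul (invF_continuous hi)
  have hprod : ∀ r j m l : Fin 3, ∀ x,
      ((inner ℝ x (b r) ^ (j : ℕ) : ℝ) : ℂ) * (((inner ℝ x (b m) ^ (l : ℕ) : ℝ) : ℂ) *
        (c * invF (fourierHat V) x)) = (c * Complex.I ^ (dirs b r j m l).length) *
          invF (weakDeriv (dirs b r j m l) (fourierHat V)) x := fun r j m l x => by
    have := weakDeriv_invF (h.isWeakDeriv r j m l) hi (h.integrable r j m l) x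
    rw [mul_assoc c, ← this, dirs]
    simp
    ring
  refine ⟨_, hae, hV.ofReal.congr hae, ?_, fun l j => ?_, fun r j m l => ?_⟩
  · have : (fun x => (starRingEnd ℂ) (c * invF (fourierHat V) x)) =ᵐ[volume]
        fun x => c * invF (fourierHat V) x := by
      filter_upwards [hae] with x hx
      rw [← hx, Complex.conj_ofReal]
    exact congrFun ((Continuous.ae_eq_iff_eq _ (Complex.continuous_conj.comp hcont) hcont).1 this)
  · have e : dirs b l j 0 0 = List.replicate j (b l) := by simp [dirs]
    have h1 := h.integrable l j 0 0
    have h2 := hprod l j 0 0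
    rw [e] at h1 h2
    refine ⟨h1, fun x => ?_⟩
    rw [qf]
    simpa using h2 x
  · refine ⟨fun ξ => (c * Complex.I ^ (dirs b r j m l).length) *
      weakDeriv (dirs b r j m l) (fourierHat V) ξ, (h.integrable r j m l).const_mul _, fun x => ?_⟩
    simp only [qf]
    rw [hprod, invF, invF, ← integral_const_mul]
    simp_rw [mul_assoc]

end

end

noncomputable section

/-! ### The kernel of the free evolution -/

/-- The prefactor `(4πs)^{-3/2}` of the heat kernel at complex time. -/
def heatAmp (s : ℂ) : ℂ := ((4 * Real.pi * s) ^ (((3 / 2 : ℝ)) : ℂ))⁻¹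

/-- The heat kernel at complex time. -/
def heatKer (s : ℂ) (y : E3) : ℂ := heatAmp s * Complex.exp (-(1 / (4 * s)) * (‖y‖ : ℂ) ^ 2)

lemma heatAmp_norm (s : ℂ) : ‖heatAmp s‖ = ((4 * Real.pi * ‖s‖) ^ (3 / 2 : ℝ))⁻¹ := by
  rw [heatAmp, norm_inv, Complex.norm_cpow_real]
  simp [abs_of_pos Real.pi_pos]

lemma re_one_div {s : ℂ} (hs : 0 ≤ s.re) : 0 ≤ (1 / (4 * s)).re := by
  rw [one_div, Complex.inv_re]
  exact div_nonneg (by simpa using hs) (Complex.normSq_nonneg _)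

lemma re_heat_exponent (s : ℂ) (r : ℝ) :
    (-(4 * Real.pi ^ 2 * s) * (r : ℂ) ^ 2).re = -(4 * Real.pi ^ 2 * s.re * r ^ 2) := by
  have : -(4 * Real.pi ^ 2 * s) * (r : ℂ) ^ 2 = -(((4 * Real.pi ^ 2 * r ^ 2 : ℝ) : ℂ) * s) := by
    push_cast; ring
  rw [this, Complex.neg_re, Complex.re_ofReal_mul]; ring

lemma heatKer_norm_le {s : ℂ} (hs : 0 ≤ s.re) (y : E3) : ‖heatKer s y‖ ≤ ‖heatAmp s‖ := by
  rw [heatKer, norm_mul, Complex.norm_exp]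
  refine mul_le_of_le_one_right (norm_nonneg _) (Real.exp_le_one_iff.2 ?_)
  have : (-(1 / (4 * s)) * (‖y‖ : ℂ) ^ 2).re = -((1 / (4 * s)).re * ‖y‖ ^ 2) := by
    rw [← Complex.ofReal_pow, Complex.re_mul_ofReal, Complex.neg_re, neg_mul]
  rw [this]
  have := re_one_div hs
  have : 0 ≤ (1 / (4 * s)).re * ‖y‖ ^ 2 := by positivity
  linarith

lemma heatKer_continuous (s : ℂ) : Continuous (heatKer s) := by
  unfold heatKer; fun_prop

lemma re_one_div_pos {s : ℂ} (hs : 0 < s.re) : 0 < (1 / (4 * s)).re := by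
  have hs0 : s ≠ 0 := fun h => by simp [h] at hs
  rw [one_div, Complex.inv_re]
  refine div_pos (by simpa using hs) (Complex.normSq_pos.2 (by simpa using hs0))

lemma heatKer_integrable {s : ℂ} (hs : 0 < s.re) : Integrable (heatKer s) := by
  have := GaussianFourier.integrable_cexp_neg_mul_sq_norm_add (V := E3) (re_one_div_pos hs) 0 0
  simp only [zero_mul, add_zero] at this
  exact this.const_mul _

lemma heatKer_fourier {s : ℂ} (hs : 0 < s.re) (ξ : E3) :
    Complex.exp (-(4 * Real.pi ^ 2 * s) * (‖ξ‖ : ℂ) ^ 2) =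
      ∫ y, heatKer s y * Complex.exp (Complex.I * (2 * Real.pi * inner ℝ y ξ : ℝ)) := by
  have hs0 : s ≠ 0 := fun h => by simp [h] at hs
  have hpi : (Real.pi : ℂ) ≠ 0 := by exact_mod_cast Real.pi_ne_zero
  have h1 := fourier_gaussian_innerProductSpace (V := E3) (re_one_div_pos hs) (-ξ)
  rw [Real.fourier_eq', norm_neg, finrank_euclideanSpace_fin] at h1
  have e1 : (Real.pi : ℂ) / (1 / (4 * s)) = 4 * Real.pi * s := by field_simp
  have e2 : -(Real.pi : ℂ) ^ 2 * (‖ξ‖ : ℂ) ^ 2 / (1 / (4 * s)) =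
      -(4 * Real.pi ^ 2 * s) * (‖ξ‖ : ℂ) ^ 2 := by field_simp
  have e3 : (((3 : ℕ) : ℂ) / 2) = (((3 / 2 : ℝ)) : ℂ) := by push_cast; rfl
  rw [e1, e2, e3] at h1
  have h0 : (4 * Real.pi * s) ^ (((3 / 2 : ℝ)) : ℂ) ≠ 0 := by
    rw [Complex.cpow_ne_zero_iff_of_exponent_ne_zero (by norm_num)]
    exact mul_ne_zero (mul_ne_zero (by norm_num) hpi) hs0
  have h2 : Complex.exp (-(4 * Real.pi ^ 2 * s) * (‖ξ‖ : ℂ) ^ 2) = heatAmp s *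
      ((4 * Real.pi * s) ^ (((3 / 2 : ℝ)) : ℂ) *
        Complex.exp (-(4 * Real.pi ^ 2 * s) * (‖ξ‖ : ℂ) ^ 2)) := by
    rw [heatAmp, ← mul_assoc, inv_mul_cancel₀ h0, one_mul]
  rw [h2, ← h1, ← integral_const_mul]
  congr 1; ext y
  rw [heatKer, smul_eq_mul, inner_neg_right, mul_neg, neg_mul, neg_mul, neg_neg, mul_comm _ Complex.I]
  ring

lemma integrable_conj_mul {g h : E3 → ℂ} (hg : Integrable g) (hh : Integrable h) :
    Integrable fun p : E3 × E3 => (starRingEnd ℂ) (g p.1) * h p.2 := by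
  have hg' : Integrable fun x => (starRingEnd ℂ) (g x) :=
    hg.congr' (Complex.continuous_conj.comp_aestronglyMeasurable hg.1)
      (Eventually.of_forall fun x => (by simp))
  exact hg'.mul_prod hh

lemma integral_prod_shift {F : E3 × E3 → ℂ} (hF : Integrable F) :
    ∫ y, ∫ x, F (x, x + y) = ∫ p, F p := by
  have hmp := measurePreserving_prod_add (volume : Measure E3) (volume : Measure E3)
  have h1 : Integrable (fun p : E3 × E3 => F (p.1, p.1 + p.2)) :=
    hmp.integrable_comp_of_integrable hF
  rw [← integral_integral_swap (f := fun x y => F (x, x + y)) h1]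
  rw [Measure.volume_eq_prod, integral_prod F hF]
  congr 1; ext x
  exact integral_add_left_eq_self (fun y => F (x, y)) x

lemma inner_heat {s : ℂ} (hs : 0 < s.re) {g h : L2} (hg : Integrable g) (hh : Integrable h) :
    inner ℂ g (fmul (fun ξ => Complex.exp (-(4 * Real.pi ^ 2 * s) * (‖ξ‖ : ℂ) ^ 2)) h) =
      ∫ p : E3 × E3, (starRingEnd ℂ) (g p.1) * h p.2 * heatKer s (p.2 - p.1) := by
  have hb : BddM (fun ξ : E3 => Complex.exp (-(4 * Real.pi ^ 2 * s) * (‖ξ‖ : ℂ) ^ 2)) := by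
    refine BddM.of_continuous (by fun_prop) (C := 1) fun ξ => ?_
    rw [Complex.norm_exp]
    refine Real.exp_le_one_iff.2 ?_
    rw [re_heat_exponent]
    have : 0 ≤ 4 * Real.pi ^ 2 * s.re * ‖ξ‖ ^ 2 := by positivity
    linarith
  rw [inner_fmul, inner_mulL_integral (heatKer_integrable hs) (by fun_prop)
    (fun a x => (norm_exp_I_mul _).le) hb (heatKer_fourier hs)]
  have hF : Integrable fun p : E3 × E3 => (starRingEnd ℂ) (g p.1) * h p.2 * heatKer s (p.2 - p.1) :=
    (integrable_conj_mul hg hh).mul_bdd (c := ‖heatAmp s‖)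
      ((heatKer_continuous s).comp (by fun_prop)).aestronglyMeasurable
      (Eventually.of_forall fun p => heatKer_norm_le hs.le _)
  rw [← integral_prod_shift hF]
  congr 1; ext y
  rw [← inner_fmul]
  change _ * inner ℂ g (shiftL y h) = _
  rw [L2_inner_eq, ← integral_const_mul]
  refine integral_congr_ae ?_
  filter_upwards [shiftL_coeFn y h] with x hx
  rw [hx, add_sub_cancel_left]; ring

/-- The Schrödinger kernel is the limit δ ↓ 0 of heat kernels at time δ - iτ. Their modulus is at
most (4πτ)^{-3/2} throughout, which dominates the limit when g and h are integrable. -/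
lemma inner_Ev_kernel {τ : ℝ} (hτ : 0 < τ) {g h : L2} (hg : Integrable g) (hh : Integrable h) :
    inner ℂ g (Ev τ h) = ∫ p : E3 × E3, (starRingEnd ℂ) (g p.1) * h p.2 *
      heatKer (-Complex.I * τ) (p.2 - p.1) := by
  let s : ℝ → ℂ := fun δ => δ + -Complex.I * τ
  have hsc : Continuous s := by fun_prop
  have hs0 : s 0 = -Complex.I * τ := by simp [s]
  have hre : ∀ δ, (s δ).re = δ := fun δ => by simp [s]
  have him : ∀ δ, (s δ).im = -τ := fun δ => by simp [s]
  have hne : ∀ δ, s δ ≠ 0 := fun δ h => by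
    have := him δ
    rw [h] at this
    simp at this
    exact hτ.ne' this
  have hnorm : ∀ δ, τ ≤ ‖s δ‖ := fun δ => by
    have := Complex.abs_im_le_norm (s δ)
    rwa [him, abs_neg, abs_of_pos hτ] at this
  have hker : ∀ y, ContinuousAt (fun δ => heatKer (s δ) y) 0 := fun y => by
    have h1 : ContinuousAt (fun δ => heatAmp (s δ)) 0 := by
      refine ContinuousAt.inv₀ ?_ ?_
      · refine ContinuousAt.cpow ((continuous_const.mul hsc).continuousAt) continuousAt_const ?_
        rw [Complex.mem_slitPlane_iff]
        right
        have : (4 * (Real.pi : ℂ) * s 0) = ((4 * Real.pi : ℝ) : ℂ) * s 0 := by push_cast; ring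
        rw [this, Complex.im_ofReal_mul, him]
        have := Real.pi_pos
        have : 0 < 4 * Real.pi * τ := by positivity
        intro h; linarith
      · rw [Complex.cpow_ne_zero_iff_of_exponent_ne_zero (by norm_num)]
        have hpi : (Real.pi : ℂ) ≠ 0 := by exact_mod_cast Real.pi_ne_zero
        exact mul_ne_zero (mul_ne_zero (by norm_num) hpi) (hne 0)
    have h2 : ContinuousAt (fun δ => (1 / (4 * s δ))) 0 :=
      continuousAt_const.div (continuous_const.mul hsc).continuousAt (mul_ne_zero (by norm_num) (hne 0))
    exact h1.mul (Complex.continuous_exp.continuousAt.comp (h2.neg.mul continuousAt_const))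
  -- Using max δ 0 makes the multipliers bounded by 1 for every real δ, as the convergence lemma
  -- requires; on δ > 0 nothing changes.
  have hl1 : Tendsto (fun δ => inner ℂ g
      (fmul (fun ξ => Complex.exp (-(4 * Real.pi ^ 2 * s (max δ 0)) * (‖ξ‖ : ℂ) ^ 2)) h)) (𝓝[>] 0)
      (𝓝 (inner ℂ g (Ev τ h))) := by
    refine tendsto_const_nhds.inner (fmul_tendsto (C := 1) (fun δ => ?_) (symE_bdd τ).1 (fun δ ξ => ?_)
      (fun ξ => (symE_norm τ ξ).le) (fun ξ => ?_) h)
    · exact (by fun_prop : Continuous _).aestronglyMeasurable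
    · rw [Complex.norm_exp]
      refine Real.exp_le_one_iff.2 ?_
      rw [re_heat_exponent, hre]
      have : 0 ≤ 4 * Real.pi ^ 2 * max δ 0 * ‖ξ‖ ^ 2 := by positivity
      linarith
    · have hc : Continuous fun δ => Complex.exp (-(4 * Real.pi ^ 2 * s (max δ 0)) * (‖ξ‖ : ℂ) ^ 2) := by
        fun_prop
      have := (hc.tendsto 0).mono_left (nhdsWithin_le_nhds (s := Ioi 0))
      rw [max_self, hs0] at this
      convert this using 2
      rw [symE]
      congr 1; push_cast; ring
  have hl2 : Tendsto (fun δ => ∫ p : E3 × E3, (starRingEnd ℂ) (g p.1) * h p.2 *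
      heatKer (s δ) (p.2 - p.1)) (𝓝[>] 0) (𝓝 (∫ p : E3 × E3, (starRingEnd ℂ) (g p.1) * h p.2 *
      heatKer (-Complex.I * τ) (p.2 - p.1))) := by
    refine tendsto_integral_filter_of_dominated_convergence
      (fun p => ‖(starRingEnd ℂ) (g p.1) * h p.2‖ * ((4 * Real.pi * τ) ^ (3 / 2 : ℝ))⁻¹) ?_ ?_
      ((integrable_conj_mul hg hh).norm.mul_const _) ?_
    · exact Eventually.of_forall fun δ => (integrable_conj_mul hg hh).1.mul
        ((heatKer_continuous _).comp (by fun_prop)).aestronglyMeasurable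
    · filter_upwards [self_mem_nhdsWithin] with δ hδ
      refine Eventually.of_forall fun p => ?_
      rw [norm_mul]
      gcongr
      refine (heatKer_norm_le (by rw [hre]; exact (mem_Ioi.1 hδ).le) _).trans ?_
      rw [heatAmp_norm]
      have := hnorm δ
      have := Real.pi_pos
      gcongr
    · refine Eventually.of_forall fun p => Tendsto.const_mul _ ?_
      have := (hker (p.2 - p.1)).tendsto.mono_left (nhdsWithin_le_nhds (s := Ioi 0))
      rwa [hs0] at this
  refine tendsto_nhds_unique (hl1.congr' ?_) hl2
  filter_upwards [self_mem_nhdsWithin] with δ hδ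
  rw [max_eq_left (mem_Ioi.1 hδ).le, inner_heat (by rw [hre]; exact hδ) hg hh]

lemma heatKer_I_norm {τ : ℝ} (hτ : 0 < τ) (y : E3) :
    ‖heatKer (-Complex.I * τ) y‖ ≤ ((4 * Real.pi * τ) ^ (3 / 2 : ℝ))⁻¹ := by
  refine (heatKer_norm_le (by simp) y).trans ?_
  rw [heatAmp_norm]
  simp [abs_of_pos hτ]

/-- The dispersive estimate. -/
lemma inner_Ev_le {τ : ℝ} (hτ : τ ≠ 0) {g h : L2} (hg : Integrable g) (hh : Integrable h) :
    ‖inner ℂ g (Ev τ h)‖ ≤ ((4 * Real.pi * |τ|) ^ (3 / 2 : ℝ))⁻¹ * ((∫ x, ‖g x‖) * ∫ x, ‖h x‖) := by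
  have key : ∀ {τ : ℝ}, 0 < τ → ∀ {g h : L2}, Integrable g → Integrable h →
      ‖inner ℂ g (Ev τ h)‖ ≤ ((4 * Real.pi * τ) ^ (3 / 2 : ℝ))⁻¹ * ((∫ x, ‖g x‖) * ∫ x, ‖h x‖) := by
    intro τ hτ g h hg hh
    rw [inner_Ev_kernel hτ hg hh]
    refine (norm_integral_le_of_norm_le ((integrable_conj_mul hg hh).norm.const_mul
      ((4 * Real.pi * τ) ^ (3 / 2 : ℝ))⁻¹) (Eventually.of_forall fun p => ?_)).trans (le_of_eq ?_)
    · rw [norm_mul, mul_comm]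
      gcongr
      exact heatKer_I_norm hτ _
    · rw [integral_const_mul]
      simp_rw [norm_mul, RCLike.norm_conj]
      rw [Measure.volume_eq_prod, integral_prod_mul (fun x => ‖g x‖) (fun x => ‖h x‖)]
  rcases lt_or_gt_of_ne hτ with h' | h'
  · rw [abs_of_neg h', Ev_inner, ← inner_conj_symm, RCLike.norm_conj, mul_comm (∫ x, ‖g x‖)]
    exact key (by linarith) hh hg
  · rw [abs_of_pos h']
    exact key h' hg hh

end

noncomputable section

/-! ### The derivative of `u e^{iτH₀} v` -/

/-- `u`, `x_l u` and `x_l² u` are bounded. -/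
def WBdd (b : OrthonormalBasis (Fin 3) ℝ E3) (u : E3 → ℂ) : Prop :=
  ∀ l a : Fin 3, BddM (qf b u l a)

lemma qf_zero (b : OrthonormalBasis (Fin 3) ℝ E3) (u : E3 → ℂ) (l : Fin 3) : qf b u l 0 = u := by
  ext x; simp [qf]

section
variable {b : OrthonormalBasis (Fin 3) ℝ E3} {u v : E3 → ℂ}

lemma WBdd.bdd (h : WBdd b u) : BddM u := by simpa [qf_zero] using h 0 0

lemma WBdd.bound (h : WBdd b u) : ∃ C : ℝ, 0 ≤ C ∧ ∀ l a x, ‖qf b u l a x‖ ≤ C := by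
  choose h1 C hC using h
  have h0 : ∀ l a, 0 ≤ C l a := fun l a => (norm_nonneg _).trans (hC l a 0)
  refine ⟨∑ l, ∑ a, C l a, Finset.sum_nonneg fun l _ => Finset.sum_nonneg fun a _ => h0 l a,
    fun l a x => (hC l a x).trans ?_⟩
  refine (Finset.single_le_sum (f := fun a => C l a) (fun a _ => h0 l a) (Finset.mem_univ a)).trans ?_
  exact Finset.single_le_sum (f := fun l => ∑ a, C l a)
    (fun l _ => Finset.sum_nonneg fun a _ => h0 l a) (Finset.mem_univ l)

lemma norm_sub_sq_coord (b : OrthonormalBasis (Fin 3) ℝ E3) (x y : E3) : ‖y - x‖ ^ 2 =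
    ∑ l, (inner ℝ x (b l) ^ 2 - 2 * (inner ℝ x (b l) * inner ℝ y (b l)) + inner ℝ y (b l) ^ 2) := by
  rw [← b.sum_sq_norm_inner_right (y - x)]
  refine Finset.sum_congr rfl fun l _ => ?_
  rw [Real.norm_eq_abs, sq_abs, inner_sub_right, real_inner_comm, real_inner_comm x]
  ring

lemma inner_mulL_Ev_mulL (hu : BddM u) (hv : BddM v) {g h : L2}
    (hg : Integrable g) (hh : Integrable h) {τ : ℝ} (hτ : 0 < τ) :
    inner ℂ g (mulL u (Ev τ (mulL v h))) = ∫ p : E3 × E3,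
      ((starRingEnd ℂ) (g p.1) * h p.2) * (u p.1 * v p.2 * heatKer (-Complex.I * τ) (p.2 - p.1)) := by
  have i1 : Integrable (mulL (fun x => (starRingEnd ℂ) (u x)) g) := by
    refine (integrable_congr (mulL_coeFn hu.conj g)).2 ?_
    obtain ⟨h1, C, hC⟩ := hu.conj
    exact hg.bdd_mul h1 (Eventually.of_forall hC)
  have i2 : Integrable (mulL v h) := by
    refine (integrable_congr (mulL_coeFn hv h)).2 ?_
    obtain ⟨h1, C, hC⟩ := hv
    exact hh.bdd_mul h1 (Eventually.of_forall hC)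
  rw [← mulL_inner_left hu, inner_Ev_kernel hτ i1 i2]
  refine integral_congr_ae ?_
  filter_upwards [Measure.quasiMeasurePreserving_fst.ae (mulL_coeFn hu.conj g),
    Measure.quasiMeasurePreserving_snd.ae (mulL_coeFn hv h)] with p h1 h2
  rw [h1, h2, map_mul, Complex.conj_conj]
  ring

lemma heatKer_I_hasDerivAt {τ : ℝ} (hτ : 0 < τ) (y : E3) :
    HasDerivAt (fun τ : ℝ => heatKer (-Complex.I * τ) y)
      ((-(3 / (2 * τ) : ℝ) + Complex.I * ((1 / (4 * τ ^ 2) * ‖y‖ ^ 2 : ℝ) : ℂ)) *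
        heatKer (-Complex.I * τ) y) τ := by
  have hpi : (Real.pi : ℂ) ≠ 0 := by exact_mod_cast Real.pi_ne_zero
  have hτ' : (τ : ℂ) ≠ 0 := by exact_mod_cast hτ.ne'
  set z : ℂ := 4 * Real.pi * (-Complex.I * τ) with hz
  have hz0 : z ≠ 0 := mul_ne_zero (mul_ne_zero (by norm_num) hpi)
    (mul_ne_zero (neg_ne_zero.2 Complex.I_ne_zero) hτ')
  have hslit : z ∈ Complex.slitPlane := by
    rw [Complex.mem_slitPlane_iff]
    right
    have : z = ((-(4 * Real.pi * τ) : ℝ) : ℂ) * Complex.I := by rw [hz]; push_cast; ring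
    rw [this, Complex.im_ofReal_mul, Complex.I_im, mul_one]
    have := Real.pi_pos
    have : 0 < 4 * Real.pi * τ := by positivity
    linarith
  have d0 : HasDerivAt (fun w : ℂ => 4 * Real.pi * (-Complex.I * w)) (4 * Real.pi * (-Complex.I)) (τ : ℂ) := by
    simpa using ((hasDerivAt_id (τ : ℂ)).const_mul (-Complex.I)).const_mul (4 * Real.pi : ℂ)
  have hp0 : z ^ (((3 / 2 : ℝ)) : ℂ) ≠ 0 := by
    rw [Complex.cpow_ne_zero_iff_of_exponent_ne_zero (by norm_num)]; exact hz0
  have d1 : HasDerivAt (fun w : ℂ => heatAmp (-Complex.I * w)) _ (τ : ℂ) :=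
    (d0.cpow_const (c := (((3 / 2 : ℝ)) : ℂ)) hslit).inv hp0
  have d2 : HasDerivAt (fun w : ℂ => -(1 / (4 * (-Complex.I * w))) * (‖y‖ : ℂ) ^ 2)
      (Complex.I * (1 / (4 * (τ : ℂ) ^ 2)) * (‖y‖ : ℂ) ^ 2) (τ : ℂ) := by
    have e : (fun w : ℂ => -(1 / (4 * (-Complex.I * w))) * (‖y‖ : ℂ) ^ 2) =
        fun w => (-(Complex.I / 4) * (‖y‖ : ℂ) ^ 2) * w⁻¹ := by
      ext w
      rw [one_div, mul_inv, mul_inv, inv_neg, Complex.inv_I]; ring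
    rw [e]
    refine ((hasDerivAt_inv hτ').const_mul (-(Complex.I / 4) * (‖y‖ : ℂ) ^ 2)).congr_deriv ?_
    ring
  have d3 := (d1.mul d2.cexp).comp_ofReal
  refine d3.congr_deriv ?_
  change _ = _ * (heatAmp (-Complex.I * τ) * Complex.exp (-(1 / (4 * (-Complex.I * τ))) * (‖y‖ : ℂ) ^ 2))
  have e3 : (4 * Real.pi * (-Complex.I) : ℂ) / z = 1 / τ := by
    rw [hz]
    have := Complex.I_ne_zero
    field_simp
  simp only [← hz]
  have e1 : z ^ ((((3 / 2 : ℝ)) : ℂ) - 1) = z ^ (((3 / 2 : ℝ)) : ℂ) / z := by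
    rw [Complex.cpow_sub _ _ hz0, Complex.cpow_one]
  have e2 : heatAmp (-Complex.I * τ) = (z ^ (((3 / 2 : ℝ)) : ℂ))⁻¹ := rfl
  rw [e1, e2]
  set P := z ^ (((3 / 2 : ℝ)) : ℂ)
  set X := Complex.exp (-(1 / (4 * (-Complex.I * τ))) * (‖y‖ : ℂ) ^ 2)
  have e4 : -((((3 / 2 : ℝ)) : ℂ) * (P / z) * (4 * Real.pi * (-Complex.I))) / P ^ 2 =
      -(3 / (2 * τ) : ℂ) * P⁻¹ := by
    have : (((3 / 2 : ℝ)) : ℂ) * (P / z) * (4 * Real.pi * (-Complex.I)) =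
      (((3 / 2 : ℝ)) : ℂ) * P * ((4 * Real.pi * (-Complex.I) : ℂ) / z) := by ring
    rw [this, e3]
    push_cast
    field_simp
  rw [e4]
  push_cast
  ring

/-- `u e^{iτH₀} v`. -/
def sand (u v : E3 → ℂ) (τ : ℝ) : Op := mulL u * Ev τ * mulL v

lemma sand_apply (u v : E3 → ℂ) (τ : ℝ) (f : L2) : sand u v τ f = mulL u (Ev τ (mulL v f)) := rfl

lemma sand_continuous (u v : E3 → ℂ) (f : L2) : Continuous fun τ => sand u v τ f :=
  (mulL u).continuous.comp (Ev_continuous _)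

lemma sand_norm_le (u v : E3 → ℂ) (τ : ℝ) : ‖sand u v τ‖ ≤ ‖mulL u‖ * ‖mulL v‖ := by
  refine (norm_mul_le _ _).trans ?_
  gcongr
  refine (norm_mul_le _ _).trans ?_
  exact mul_le_of_le_one_right (norm_nonneg _) (Ev_opNorm_le τ)

/-- The sum of second order commutator terms in the derivative of `u e^{iτH₀} v`. -/
def sandQ (b : OrthonormalBasis (Fin 3) ℝ E3) (u v : E3 → ℂ) (τ : ℝ) : Op :=
  ∑ l, (sand (qf b u l 2) v τ - (2 : ℂ) • sand (qf b u l 1) (qf b v l 1) τ + sand u (qf b v l 2) τ)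

lemma sandQ_continuous (b : OrthonormalBasis (Fin 3) ℝ E3) (u v : E3 → ℂ) (f : L2) :
    Continuous fun τ => sandQ b u v τ f := by
  have e : (fun τ => sandQ b u v τ f) = fun τ => ∑ l, (sand (qf b u l 2) v τ f -
      (2 : ℂ) • sand (qf b u l 1) (qf b v l 1) τ f + sand u (qf b v l 2) τ f) := by
    ext1 τ
    simp only [sandQ, sum_apply, add_apply, sub_apply, smul_apply]
  rw [e]
  refine continuous_finsetSum _ fun l _ => Continuous.add (Continuous.sub ?_ ?_) ?_
  · exact sand_continuous _ _ f
  · exact Continuous.const_smul (sand_continuous _ _ f) (2 : ℂ)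
  · exact sand_continuous _ _ f

/-- The derivative of `u e^{iτH₀} v`. -/
def sandD (b : OrthonormalBasis (Fin 3) ℝ E3) (u v : E3 → ℂ) (τ : ℝ) : Op :=
  -((3 / (2 * τ) : ℝ) : ℂ) • sand u v τ + (Complex.I * ((1 / (4 * τ ^ 2) : ℝ) : ℂ)) • sandQ b u v τ

lemma sand_integrable (hu : BddM u) (hv : BddM v) {g h : L2}
    (hg : Integrable g) (hh : Integrable h) {τ : ℝ} (hτ : 0 < τ) : Integrable fun p : E3 × E3 =>
      ((starRingEnd ℂ) (g p.1) * h p.2) * (u p.1 * v p.2 * heatKer (-Complex.I * τ) (p.2 - p.1)) := by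
  obtain ⟨h1, C, hC⟩ := hu
  obtain ⟨h2, C', hC'⟩ := hv
  refine (integrable_conj_mul hg hh).mul_bdd (c := C * C' * ((4 * Real.pi * τ) ^ (3 / 2 : ℝ))⁻¹)
    ((h1.comp_fst.mul h2.comp_snd).mul
      ((heatKer_continuous _).comp (by fun_prop)).aestronglyMeasurable)
    (Eventually.of_forall fun p => ?_)
  rw [norm_mul, norm_mul]
  have := hC p.1
  have := hC' p.2
  have := heatKer_I_norm hτ (p.2 - p.1)
  have : 0 ≤ C := (norm_nonneg _).trans (hC 0)
  have : 0 ≤ C' := (norm_nonneg _).trans (hC' 0)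
  gcongr

/-- Differentiation under the integral in the explicit kernel. The derivative brings down
|x-y|²/(4τ²), which is unbounded; expanded in coordinates it turns into the weights x_l^j on u and
v, and these are bounded by assumption. -/
lemma inner_sand_hasDerivAt (hu : WBdd b u) (hv : WBdd b v) {g h : L2} (hg : Integrable g)
    (hh : Integrable h) {τ : ℝ} (hτ : 0 < τ) :
    HasDerivAt (fun τ => inner ℂ g (sand u v τ h)) (inner ℂ g (sandD b u v τ h)) τ := by
  obtain ⟨C, hC0, hC⟩ := hu.bound
  obtain ⟨C', hC'0, hC'⟩ := hv.bound
  let B : E3 × E3 → ℂ := fun p => (starRingEnd ℂ) (g p.1) * h p.2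
  let K : ℝ → E3 × E3 → ℂ := fun s p => heatKer (-Complex.I * s) (p.2 - p.1)
  let F : ℝ → E3 × E3 → ℂ := fun s p => B p * (u p.1 * v p.2 * K s p)
  let d : ℝ → E3 × E3 → ℂ := fun s p =>
    -(3 / (2 * s) : ℝ) + Complex.I * ((1 / (4 * s ^ 2) * ‖p.2 - p.1‖ ^ 2 : ℝ) : ℂ)
  have hB : Integrable B := integrable_conj_mul hg hh
  have hu0 : ∀ x, ‖u x‖ ≤ C := fun x => by simpa [qf_zero] using hC 0 0 x
  have hv0 : ∀ x, ‖v x‖ ≤ C' := fun x => by simpa [qf_zero] using hC' 0 0 x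
  have hquad : ∀ p : E3 × E3, u p.1 * v p.2 * ((‖p.2 - p.1‖ ^ 2 : ℝ) : ℂ) =
      ∑ l, (qf b u l 2 p.1 * v p.2 - 2 * (qf b u l 1 p.1 * qf b v l 1 p.2) +
        u p.1 * qf b v l 2 p.2) := fun p => by
    rw [norm_sub_sq_coord b, Complex.ofReal_sum, Finset.mul_sum]
    refine Finset.sum_congr rfl fun l _ => ?_
    simp only [qf, Fin.val_two, Fin.val_one]
    push_cast; ring
  -- Three coordinates, each contributing 1 + 2 + 1 products bounded by C C'.
  have hquad' : ∀ p : E3 × E3, ‖u p.1 * v p.2‖ * ‖p.2 - p.1‖ ^ 2 ≤ 12 * (C * C') := fun p => by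
    have e := congrArg norm (hquad p)
    rw [norm_mul, Complex.norm_real, Real.norm_of_nonneg (by positivity)] at e
    rw [e]
    refine (norm_sum_le _ _).trans ?_
    have : ∀ l ∈ Finset.univ, ‖qf b u l 2 p.1 * v p.2 - 2 * (qf b u l 1 p.1 * qf b v l 1 p.2) +
        u p.1 * qf b v l 2 p.2‖ ≤ 4 * (C * C') := fun l _ => by
      refine (norm_add_le _ _).trans ?_
      have e1 := norm_sub_le (qf b u l 2 p.1 * v p.2) (2 * (qf b u l 1 p.1 * qf b v l 1 p.2))
      simp only [norm_mul, Complex.norm_ofNat] at e1 ⊢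
      have e2 := mul_le_mul (hC l 2 p.1) (hv0 p.2) (norm_nonneg _) hC0
      have e3 := mul_le_mul (hC l 1 p.1) (hC' l 1 p.2) (norm_nonneg _) hC0
      have e4 := mul_le_mul (hu0 p.1) (hC' l 2 p.2) (norm_nonneg _) hC0
      linarith
    refine (Finset.sum_le_sum this).trans (le_of_eq ?_)
    simp; ring
  have key := hasDerivAt_integral_of_dominated_loc_of_deriv_le (μ := (volume : Measure (E3 × E3)))
    (F := F) (F' := fun s p => d s p * F s p) (x₀ := τ) (s := Ioi (τ / 2))
    (bound := fun p => ‖B p‖ * (((4 * Real.pi * (τ / 2)) ^ (3 / 2 : ℝ))⁻¹ *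
      (3 / τ * (C * C') + 1 / τ ^ 2 * (12 * (C * C')))))
    (Ioi_mem_nhds (by linarith)) ?_ (sand_integrable hu.bdd hv.bdd hg hh hτ) ?_ ?_
    (hB.norm.mul_const _) ?_
  · have e1 : ∫ p, d τ p * F τ p = inner ℂ g (sandD b u v τ h) := by
      have i0 := sand_integrable hu.bdd hv.bdd hg hh hτ
      have hdF : ∀ p, d τ p * F τ p = -(3 / (2 * τ) : ℝ) * F τ p +
          ∑ l, (Complex.I * ((1 / (4 * τ ^ 2) : ℝ) : ℂ)) * ((B p * (qf b u l 2 p.1 * v p.2 * K τ p) -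
          2 * (B p * (qf b u l 1 p.1 * qf b v l 1 p.2 * K τ p))) +
          B p * (u p.1 * qf b v l 2 p.2 * K τ p)) := fun p => by
        have e := hquad p
        have e' : ∑ l, (Complex.I * ((1 / (4 * τ ^ 2) : ℝ) : ℂ)) * ((B p * (qf b u l 2 p.1 * v p.2 * K τ p) -
          2 * (B p * (qf b u l 1 p.1 * qf b v l 1 p.2 * K τ p))) +
          B p * (u p.1 * qf b v l 2 p.2 * K τ p)) =
          (Complex.I * ((1 / (4 * τ ^ 2) : ℝ) : ℂ)) * B p * K τ p *
            ∑ l, (qf b u l 2 p.1 * v p.2 - 2 * (qf b u l 1 p.1 * qf b v l 1 p.2) +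
              u p.1 * qf b v l 2 p.2) := by
          rw [Finset.mul_sum]
          refine Finset.sum_congr rfl fun l _ => ?_
          ring
        rw [e', ← e]
        simp only [d, F]
        push_cast; ring
      have iq : ∀ l, Integrable fun p => (Complex.I * ((1 / (4 * τ ^ 2) : ℝ) : ℂ)) *
          ((B p * (qf b u l 2 p.1 * v p.2 * K τ p) -
          2 * (B p * (qf b u l 1 p.1 * qf b v l 1 p.2 * K τ p))) +
          B p * (u p.1 * qf b v l 2 p.2 * K τ p)) := fun l =>
        (((sand_integrable (hu l 2) hv.bdd hg hh hτ).sub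
          ((sand_integrable (hu l 1) (hv l 1) hg hh hτ).const_mul 2)).add
          (sand_integrable hu.bdd (hv l 2) hg hh hτ)).const_mul _
      simp_rw [hdF]
      rw [integral_add (i0.const_mul _) (integrable_finsetSum _ fun l _ => iq l),
        integral_finsetSum _ fun l _ => iq l, integral_const_mul]
      simp only [sandD, sandQ, add_apply, smul_apply, sum_apply, sub_apply,
        inner_add_right, inner_smul_right, inner_sum, inner_sub_right, sand_apply]
      congr 1
      · rw [inner_mulL_Ev_mulL hu.bdd hv.bdd hg hh hτ]
      · rw [Finset.mul_sum]
        refine Finset.sum_congr rfl fun l _ => ?_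
        rw [integral_const_mul, inner_mulL_Ev_mulL (hu l 2) hv.bdd hg hh hτ,
          inner_mulL_Ev_mulL (hu l 1) (hv l 1) hg hh hτ, inner_mulL_Ev_mulL hu.bdd (hv l 2) hg hh hτ]
        congr 1
        have j1 := sand_integrable (hu l 2) hv.bdd hg hh hτ
        have j2 := (sand_integrable (hu l 1) (hv l 1) hg hh hτ).const_mul 2
        have j3 := sand_integrable hu.bdd (hv l 2) hg hh hτ
        have e2 := integral_add (j1.sub j2) j3
        refine e2.trans ?_
        congr 1
        refine (integral_sub j1 j2).trans ?_
        rw [integral_const_mul]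
    rw [← e1]
    refine key.2.congr_of_eventuallyEq ?_
    filter_upwards [Ioi_mem_nhds hτ] with s hs
    exact inner_mulL_Ev_mulL hu.bdd hv.bdd hg hh hs
  · filter_upwards [Ioi_mem_nhds hτ] with s hs
    exact (sand_integrable hu.bdd hv.bdd hg hh hs).1
  · refine AEStronglyMeasurable.mul ?_ (sand_integrable hu.bdd hv.bdd hg hh hτ).1
    exact (by fun_prop : Continuous (d τ)).aestronglyMeasurable
  · refine Eventually.of_forall fun p s hs => ?_
    have hs' : τ / 2 < s := hs
    have hs0 : 0 < s := by linarith
    have n1 : ‖d s p‖ ≤ 3 / τ + 1 / τ ^ 2 * ‖p.2 - p.1‖ ^ 2 := by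
      refine (norm_add_le _ _).trans ?_
      rw [norm_neg, norm_mul, Complex.norm_I, one_mul, Complex.norm_real, Complex.norm_real,
        Real.norm_of_nonneg (by positivity), Real.norm_of_nonneg (by positivity)]
      gcongr
      · linarith
      · nlinarith
    have n2 : ‖K s p‖ ≤ ((4 * Real.pi * (τ / 2)) ^ (3 / 2 : ℝ))⁻¹ := by
      refine (heatKer_I_norm hs0 _).trans ?_
      have := Real.pi_pos
      gcongr
    have n3 : ‖u p.1 * v p.2‖ ≤ C * C' := by
      rw [norm_mul]; exact mul_le_mul (hu0 _) (hv0 _) (norm_nonneg _) hC0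
    have n4 := hquad' p
    calc ‖d s p * F s p‖ = ‖B p‖ * (‖K s p‖ * (‖d s p‖ * ‖u p.1 * v p.2‖)) := by
          simp only [F, norm_mul]; ring
      _ ≤ _ := by
          gcongr
          calc ‖d s p‖ * ‖u p.1 * v p.2‖ ≤ (3 / τ + 1 / τ ^ 2 * ‖p.2 - p.1‖ ^ 2) * ‖u p.1 * v p.2‖ := by
                gcongr
            _ = 3 / τ * ‖u p.1 * v p.2‖ + 1 / τ ^ 2 * (‖u p.1 * v p.2‖ * ‖p.2 - p.1‖ ^ 2) := by ring
            _ ≤ _ := by gcongr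
  · refine Eventually.of_forall fun p s hs => ?_
    have hs0 : 0 < s := by have : τ / 2 < s := hs; linarith
    have := ((heatKer_I_hasDerivAt hs0 (p.2 - p.1)).const_mul (u p.1 * v p.2)).const_mul (B p)
    refine this.congr_deriv ?_
    simp only [d, F, K]
    ring

end

end

noncomputable section

section
variable {b : OrthonormalBasis (Fin 3) ℝ E3} {u v : E3 → ℂ}

lemma sandQ_norm_le (b : OrthonormalBasis (Fin 3) ℝ E3) (u v : E3 → ℂ) :
    ∃ K : ℝ, ∀ τ, ‖sandQ b u v τ‖ ≤ K := by
  refine ⟨∑ l, (‖mulL (qf b u l 2)‖ * ‖mulL v‖ + 2 * (‖mulL (qf b u l 1)‖ * ‖mulL (qf b v l 1)‖) +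
    ‖mulL u‖ * ‖mulL (qf b v l 2)‖), fun τ => (norm_sum_le _ _).trans
      (Finset.sum_le_sum fun l _ => ?_)⟩
  refine (norm_add_le _ _).trans (add_le_add ((norm_sub_le _ _).trans (add_le_add ?_ ?_)) ?_)
  · exact sand_norm_le _ _ _
  · rw [norm_smul, Complex.norm_ofNat]
    gcongr
    exact sand_norm_le _ _ _
  · exact sand_norm_le _ _ _

lemma sandD_norm_le (b : OrthonormalBasis (Fin 3) ℝ E3) (u v : E3 → ℂ) {a : ℝ} (ha : 0 < a) :
    ∃ K : ℝ, 0 ≤ K ∧ ∀ τ, a ≤ τ → ‖sandD b u v τ‖ ≤ K := by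
  obtain ⟨K, hK⟩ := sandQ_norm_le b u v
  have hK0 : 0 ≤ K := (norm_nonneg _).trans (hK 0)
  refine ⟨3 / (2 * a) * (‖mulL u‖ * ‖mulL v‖) + 1 / (4 * a ^ 2) * K, by positivity, fun τ hτ => ?_⟩
  have hτ0 : 0 < τ := by linarith
  refine (norm_add_le _ _).trans (add_le_add ?_ ?_)
  · rw [norm_smul, norm_neg, Complex.norm_real, Real.norm_of_nonneg (by positivity)]
    have := sand_norm_le u v τ
    gcongr
  · rw [norm_smul, norm_mul, Complex.norm_I, one_mul, Complex.norm_real,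
      Real.norm_of_nonneg (by positivity)]
    have := hK τ
    gcongr

lemma sandD_continuous (b : OrthonormalBasis (Fin 3) ℝ E3) (u v : E3 → ℂ) {a : ℝ} (ha : 0 < a)
    (f : L2) : Continuous fun τ => sandD b u v (max τ a) f := by
  have hne : ∀ τ : ℝ, max τ a ≠ 0 := fun τ => (ha.trans_le (le_max_right _ _)).ne'
  have hm : Continuous fun τ : ℝ => max τ a := by fun_prop
  have c1 : Continuous fun τ : ℝ => -((3 / (2 * max τ a) : ℝ) : ℂ) := by
    refine (Complex.continuous_ofReal.comp ?_).neg
    exact continuous_const.div (continuous_const.mul hm) fun τ => mul_ne_zero two_ne_zero (hne τ)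
  have c2 : Continuous fun τ : ℝ => (Complex.I * ((1 / (4 * max τ a ^ 2) : ℝ) : ℂ)) := by
    refine continuous_const.mul (Complex.continuous_ofReal.comp ?_)
    exact continuous_const.div (continuous_const.mul (hm.pow 2)) fun τ =>
      mul_ne_zero (by norm_num) (pow_ne_zero _ (hne τ))
  have e : (fun τ => sandD b u v (max τ a) f) = fun τ =>
      -((3 / (2 * max τ a) : ℝ) : ℂ) • sand u v (max τ a) f +
      (Complex.I * ((1 / (4 * max τ a ^ 2) : ℝ) : ℂ)) • sandQ b u v (max τ a) f := by
    ext1 τ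
    simp only [sandD, add_apply, smul_apply]
  rw [e]
  refine Continuous.add (Continuous.smul c1 ?_) (Continuous.smul c2 ?_)
  · exact (sand_continuous u v f).comp hm
  · exact (sandQ_continuous b u v f).comp hm

lemma exists_seq_integrable (f : L2) : ∃ s : ℕ → L2, (∀ n, Integrable (s n : E3 → ℂ)) ∧
    Tendsto s atTop (𝓝 f) := by
  have hd : Dense {f : L2 | Integrable (f : E3 → ℂ)} := by
    refine (SchwartzMap.denseRange_toLpCLM (E := E3) (F := ℂ) (μ := volume) (p := 2)
      ENNReal.ofNat_ne_top).mono ?_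
    rintro _ ⟨φ, rfl⟩
    exact (integrable_congr (SchwartzMap.coeFn_toLp φ 2 volume)).2 φ.integrable
  obtain ⟨s, h1, h2⟩ := mem_closure_iff_seq_limit.1 (hd f)
  exact ⟨s, h1, h2⟩

lemma eq_of_inner_integrable {x y : L2}
    (h : ∀ g : L2, Integrable (g : E3 → ℂ) → inner ℂ g x = inner ℂ g y) : x = y := by
  refine ext_inner_left ℂ fun g => ?_
  obtain ⟨s, h1, h2⟩ := exists_seq_integrable g
  exact tendsto_nhds_unique ((h2.inner tendsto_const_nhds).congr fun n => h _ (h1 n))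
    (h2.inner tendsto_const_nhds)

/-- The fundamental theorem of calculus holds for matrix elements between integrable functions and
extends to all of L² by density, since the derivative is a bounded operator for σ ≥ a. Writing max σ
a keeps the integrand continuous on all of ℝ without changing it on [a, t]. -/
lemma sand_eq_integral (hu : WBdd b u) (hv : WBdd b v) {a : ℝ} (ha : 0 < a) {t : ℝ} (ht : a ≤ t)
    (f : L2) : sand u v t f = sand u v a f + ∫ σ in a..t, sandD b u v (max σ a) f := by
  have hc := sandD_continuous b u v ha
  have h1 : ∀ h : L2, Integrable (h : E3 → ℂ) →
      sand u v t h = sand u v a h + ∫ σ in a..t, sandD b u v (max σ a) h := by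
    intro h hh
    refine eq_of_inner_integrable fun g hg => ?_
    rw [inner_add_right, inner_intervalIntegral (hc h)]
    have hcg : Continuous fun σ => inner ℂ g (sandD b u v (max σ a) h) :=
      continuous_const.inner (hc h)
    rw [intervalIntegral.integral_eq_sub_of_hasDerivAt
      (f := fun τ => inner ℂ g (sand u v τ h)) (fun σ hσ => ?_) (hcg.intervalIntegrable _ _)]
    · ring
    · rw [uIcc_of_le ht] at hσ
      rw [max_eq_left hσ.1]
      exact inner_sand_hasDerivAt hu hv hg hh (ha.trans_le hσ.1)
  obtain ⟨K, hK0, hK⟩ := sandD_norm_le b u v ha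
  have hlip : Continuous fun f : L2 => ∫ σ in a..t, sandD b u v (max σ a) f := by
    refine (LipschitzWith.of_dist_le_mul (K := ⟨K * |t - a|, by positivity⟩) fun f g => ?_).continuous
    rw [dist_eq_norm, dist_eq_norm, ← intervalIntegral.integral_sub ((hc f).intervalIntegrable _ _)
      ((hc g).intervalIntegrable _ _)]
    change _ ≤ K * |t - a| * _
    refine (intervalIntegral.norm_integral_le_of_norm_le_const (C := K * ‖f - g‖)
      fun σ _ => ?_).trans (le_of_eq (by ring))
    rw [← map_sub]
    exact ContinuousLinearMap.le_of_opNorm_le _ (hK _ (le_max_right _ _)) _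
  obtain ⟨s, hs1, hs2⟩ := exists_seq_integrable f
  refine tendsto_nhds_unique (((sand u v t).continuous.tendsto f).comp hs2) ?_
  refine Tendsto.congr (fun n => (h1 _ (hs1 n)).symm) ?_
  exact (((sand u v a).continuous.tendsto f).comp hs2).add ((hlip.tendsto f).comp hs2)

lemma sand_hasDerivAt (hu : WBdd b u) (hv : WBdd b v) {τ : ℝ} (hτ : 0 < τ) (f : L2) :
    HasDerivAt (fun τ => sand u v τ f) (sandD b u v τ f) τ := by
  have ha : 0 < τ / 2 := by linarith
  have h1 := ((sandD_continuous b u v ha f).integral_hasStrictDerivAt (τ / 2) τ).hasDerivAt.const_add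
    (sand u v (τ / 2) f)
  rw [max_eq_left (by linarith)] at h1
  refine h1.congr_of_eventuallyEq ?_
  filter_upwards [Ioi_mem_nhds (by linarith : τ / 2 < τ)] with t ht
  exact sand_eq_integral hu hv ha (le_of_lt ht) f

/-- The product rule for a strongly differentiable family of operators. -/
lemma hasDerivAt_strong_apply {N : ℝ → Op} {C : ℝ} (hC : ∀ s, ‖N s‖ ≤ C)
    (hN : ∀ f, Continuous fun s => N s f) {y : ℝ → L2} {y' d : L2} {t : ℝ}
    (hy : HasDerivAt y y' t) (hd : HasDerivAt (fun s => N s (y t)) d t) :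
    HasDerivAt (fun s => N s (y s)) (d + N t y') t := by
  rw [hasDerivAt_iff_tendsto_slope] at *
  have h1 : Tendsto (fun s => N s (slope y t s)) (𝓝[≠] t) (𝓝 (N t y')) := by
    have e : ∀ s, N s (slope y t s) = N s (slope y t s - y') + N s y' := fun s => by
      rw [← map_add, sub_add_cancel]
    simp_rw [e]
    have h2 : Tendsto (fun s => N s (slope y t s - y')) (𝓝[≠] t) (𝓝 0) := by
      refine squeeze_zero_norm (a := fun s => C * ‖slope y t s - y'‖) (fun s =>
        (N s).le_of_opNorm_le (hC s) _) ?_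
      have := (tendsto_iff_norm_sub_tendsto_zero.1 hy).const_mul C
      rwa [mul_zero] at this
    have h3 : Tendsto (fun s => N s y') (𝓝[≠] t) (𝓝 (N t y')) :=
      ((hN y').tendsto t).mono_left nhdsWithin_le_nhds
    simpa using h2.add h3
  refine (hd.add h1).congr fun s => ?_
  have e : N s ((s - t)⁻¹ • (y s - y t)) = (s - t)⁻¹ • N s (y s - y t) :=
    (N s).map_smul_of_tower _ _
  rw [slope_def_module, slope_def_module, slope_def_module, e, ← smul_add, map_sub]
  congr 1
  abel

end

/-! ### Resolvents -/

/-- `R` and `S = H₀ R` as functions of the free Hamiltonian. -/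
structure IsPreResolvent (R S : Op) : Prop where
  comm : ∀ t, R * Ev t = Ev t * R
  comm' : ∀ t, S * Ev t = Ev t * S
  comm_RS : R * S = S * R
  deriv : ∀ (f : L2) (t : ℝ), HasDerivAt (fun t => Ev (-t) (R f)) (-Complex.I • Ev (-t) (S f)) t

/-- Boundedness of |k|² r(k) puts the range of the multiplier in the domain of H₀; by the mean value
inequality the difference quotients of the symbols are bounded by the same C, and dominated
convergence applies. -/
lemma Ev_fmul_hasDerivAt {r : E3 → ℂ} {C : ℝ} (hr : BddM r)
    (hC : ∀ ξ, ‖(((2 * Real.pi * ‖ξ‖) ^ 2 : ℝ) : ℂ) * r ξ‖ ≤ C) (f : L2) (t : ℝ) :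
    HasDerivAt (fun t => Ev (-t) (fmul r f))
      (-Complex.I • Ev (-t) (fmul (fun ξ => (((2 * Real.pi * ‖ξ‖) ^ 2 : ℝ) : ℂ) * r ξ) f)) t := by
  have hs : BddM (fun ξ => (((2 * Real.pi * ‖ξ‖) ^ 2 : ℝ) : ℂ) * r ξ) :=
    ⟨(by fun_prop : Continuous fun ξ : E3 => (((2 * Real.pi * ‖ξ‖) ^ 2 : ℝ) : ℂ)).aestronglyMeasurable.mul
      hr.1, C, hC⟩
  have hd : ∀ (ξ : E3) (t : ℝ), HasDerivAt (fun t => symE (-t) ξ * r ξ)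
      (-Complex.I * (symE (-t) ξ * ((((2 * Real.pi * ‖ξ‖) ^ 2 : ℝ) : ℂ) * r ξ))) t := by
    intro ξ t
    have h1 : HasDerivAt (fun t : ℝ => Complex.I * ((-t * (2 * Real.pi * ‖ξ‖) ^ 2 : ℝ) : ℂ))
        (Complex.I * ((-1 * (2 * Real.pi * ‖ξ‖) ^ 2 : ℝ) : ℂ)) t :=
      (((hasDerivAt_id t).neg.mul_const _).ofReal_comp).const_mul _
    refine (h1.cexp.mul_const (r ξ)).congr_deriv ?_
    simp only [symE]
    push_cast; ring
  have e1 : ∀ s, Ev (-s) (fmul r f) = fmul (fun ξ => symE (-s) ξ * r ξ) f := fun s => by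
    rw [← fmul_mul (symE_bdd _) hr]; rfl
  have hb : ∀ s : ℝ, BddM fun ξ => symE (-s) ξ * r ξ := fun s => (symE_bdd _).mul hr
  rw [hasDerivAt_iff_tendsto_slope]
  have e2 : ∀ s, slope (fun t => Ev (-t) (fmul r f)) t s =
      fmul (fun ξ => ((s - t)⁻¹ : ℝ) * (symE (-s) ξ * r ξ - symE (-t) ξ * r ξ)) f := by
    intro s
    have e3 : (fun ξ => (((s - t)⁻¹ : ℝ) : ℂ) * (symE (-s) ξ * r ξ - symE (-t) ξ * r ξ)) =
        fun ξ => (((s - t)⁻¹ : ℝ) : ℂ) * (symE (-s) ξ * r ξ + (-1) * (symE (-t) ξ * r ξ)) := by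
      ext ξ; ring
    rw [e3, fmul_smul _ ((hb s).add ((hb t).smul (-1))), fmul_add (hb s) ((hb t).smul (-1)),
      fmul_smul (-1) (hb t), slope_def_module, e1, e1]
    simp only [smul_apply, neg_smul, one_smul, ← sub_eq_add_neg]
    rfl
  have e4 : -Complex.I • Ev (-t) (fmul (fun ξ => (((2 * Real.pi * ‖ξ‖) ^ 2 : ℝ) : ℂ) * r ξ) f) =
      fmul (fun ξ => -Complex.I * (symE (-t) ξ * ((((2 * Real.pi * ‖ξ‖) ^ 2 : ℝ) : ℂ) * r ξ))) f := by
    rw [fmul_smul _ ((symE_bdd _).mul hs), ← fmul_mul (symE_bdd _) hs]; rfl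
  have hdb : ∀ ξ t, ‖-Complex.I * (symE (-t) ξ * ((((2 * Real.pi * ‖ξ‖) ^ 2 : ℝ) : ℂ) * r ξ))‖ ≤ C :=
    fun ξ t => by
      rw [norm_mul, norm_mul, norm_neg, Complex.norm_I, symE_norm, one_mul, one_mul]; exact hC ξ
  rw [e4, funext e2]
  refine fmul_tendsto (C := C) (fun s => ?_) (((symE_bdd _).mul hs).smul _).1 (fun s ξ => ?_)
    (fun ξ => hdb ξ t) (fun ξ => ?_) f
  · exact aestronglyMeasurable_const.mul ((hb s).1.sub (hb t).1)
  · have := Convex.norm_image_sub_le_of_norm_hasDerivWithin_le (s := univ)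
      (f := fun t => symE (-t) ξ * r ξ) (fun x _ => (hd ξ x).hasDerivWithinAt) (fun x _ => hdb ξ x)
      convex_univ (mem_univ t) (mem_univ s)
    rw [norm_mul, Complex.norm_real, norm_inv]
    rcases eq_or_ne s t with h | h
    · rw [h]; simpa using (norm_nonneg _).trans (hC ξ)
    · rw [inv_mul_le_iff₀ (norm_pos_iff.2 (sub_ne_zero.2 h)), mul_comm _ C]
      exact this
  · have := hasDerivAt_iff_tendsto_slope.1 (hd ξ t)
    refine this.congr fun s => ?_
    rw [slope_def_module, Complex.real_smul]

lemma isPreResolvent_fmul {r : E3 → ℂ} {C : ℝ} (hr : BddM r)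
    (hC : ∀ ξ, ‖(((2 * Real.pi * ‖ξ‖) ^ 2 : ℝ) : ℂ) * r ξ‖ ≤ C) :
    IsPreResolvent (fmul r) (fmul fun ξ => (((2 * Real.pi * ‖ξ‖) ^ 2 : ℝ) : ℂ) * r ξ) := by
  have hs : BddM (fun ξ => (((2 * Real.pi * ‖ξ‖) ^ 2 : ℝ) : ℂ) * r ξ) :=
    ⟨(by fun_prop : Continuous fun ξ : E3 => (((2 * Real.pi * ‖ξ‖) ^ 2 : ℝ) : ℂ)).aestronglyMeasurable.mul
      hr.1, C, hC⟩
  exact ⟨fun t => fmul_comm hr (symE_bdd t), fun t => fmul_comm hs (symE_bdd t), fmul_comm hr hs,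
    Ev_fmul_hasDerivAt hr hC⟩

end

noncomputable section

/-! ### Integration by parts -/

/-- The weight `χ(τ > a) τ^{-m} e^{-ετ}`. -/
def wpow (ε a : ℝ) (m : ℕ) : ℝ → ℂ :=
  indicator (Ioi a) fun τ => ((((τ ^ m)⁻¹ * Real.exp (-ε * τ) : ℝ)) : ℂ)

lemma wpow_bound {ε a : ℝ} (ha : 0 < a) (m : ℕ) (τ : ℝ) :
    ‖wpow ε a m τ‖ ≤ (a ^ m)⁻¹ * ‖indicator (Ioi a) (fun τ => Real.exp (-ε * τ)) τ‖ := by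
  rw [wpow]
  by_cases h : τ ∈ Ioi a
  · rw [indicator_of_mem h, indicator_of_mem h]
    have : a < τ := h
    have : 0 < τ := by linarith
    rw [Complex.norm_real, norm_mul, Real.norm_of_nonneg (by positivity : 0 ≤ (τ ^ m)⁻¹)]
    gcongr
  · rw [indicator_of_notMem h, indicator_of_notMem h]; simp

lemma wpow_measurable (ε a : ℝ) (m : ℕ) : Measurable (wpow ε a m) := by
  refine Measurable.indicator ?_ measurableSet_Ioi
  fun_prop

lemma wpow_integrable {ε a : ℝ} (hε : 0 < ε) (ha : 0 < a) (m : ℕ) : Integrable (wpow ε a m) := by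
  have h1 : Integrable (indicator (Ioi a) (fun τ => Real.exp (-ε * τ))) :=
    (integrable_indicator_iff measurableSet_Ioi).2 (integrableOn_exp_mul_Ioi (by linarith) a)
  exact (h1.norm.const_mul (a ^ m)⁻¹).mono' (wpow_measurable ε a m).aestronglyMeasurable
    (Eventually.of_forall (wpow_bound ha m))

lemma wpow_smul_integral (ε a : ℝ) (m : ℕ) (y : ℝ → L2) : ∫ τ, wpow ε a m τ • y τ =
    ∫ τ in Ioi a, (((τ ^ m)⁻¹ * Real.exp (-ε * τ) : ℝ) : ℂ) • y τ := by
  rw [← integral_indicator measurableSet_Ioi]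
  congr 1; ext1 τ
  simp only [wpow, indicator]
  split_ifs <;> simp

lemma wpow_smul_integrable {ε a : ℝ} (hε : 0 < ε) (ha : 0 < a) (m : ℕ) {y : ℝ → L2} (hy : BC y) :
    IntegrableOn (fun τ => (((τ ^ m)⁻¹ * Real.exp (-ε * τ) : ℝ) : ℂ) • y τ) (Ioi a) := by
  obtain ⟨h1, C, hC⟩ := hy
  have h2 := (wpow_integrable hε ha m).smul_bdd C h1.aestronglyMeasurable (Eventually.of_forall hC)
  rw [← integrable_indicator_iff measurableSet_Ioi]
  refine h2.congr (Eventually.of_forall fun τ => ?_)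
  change wpow ε a m τ • y τ = _
  simp only [wpow, indicator]
  split_ifs
  · rfl
  · rw [zero_smul]

lemma hasDerivAt_inv_pow (m : ℕ) {t : ℝ} (ht : t ≠ 0) :
    HasDerivAt (fun t : ℝ => (t ^ m)⁻¹) (-m * (t ^ (m + 1))⁻¹) t := by
  refine ((hasDerivAt_pow m t).inv (pow_ne_zero _ ht)).congr_deriv ?_
  rcases m with _ | k
  · simp
  · simp only [Nat.add_sub_cancel]
    field_simp
    try ring

section
variable {b : OrthonormalBasis (Fin 3) ℝ E3} {u v : E3 → ℂ} {R S T X : Op} {ε : ℝ}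

lemma mulL_avg_mulL {w : ℝ → ℂ} (hw : Integrable w) (u v : E3 → ℂ) (Z : Op) (f : L2) :
    (mulL u * avg w (mulL v * Z)) f = ∫ τ, w τ • sand u v τ (Z (Ev (-τ) f)) := by
  change mulL u (avg w (mulL v * Z) f) = _
  rw [avg_apply hw, ← ContinuousLinearMap.integral_comp_comm _ (integrable_smul_conjEv hw _ f)]
  simp_rw [map_smul]
  rfl

lemma BC_strong {N : ℝ → Op} {C : ℝ} (hC : ∀ s, ‖N s‖ ≤ C) (hN : ∀ f, Continuous fun s => N s f)
    (Z : Op) (f : L2) : BC fun τ => N τ (Z (Ev (-τ) f)) := by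
  refine ⟨strong_joint hC hN continuous_id (Z.continuous.comp ((Ev_continuous f).comp continuous_neg)),
    C * (‖Z‖ * ‖f‖), fun τ => ?_⟩
  refine ((N τ).le_of_opNorm_le (hC τ) _).trans ?_
  have : 0 ≤ C := (norm_nonneg _).trans (hC 0)
  gcongr
  refine (Z.le_opNorm _).trans ?_
  rw [Ev_norm]

/-- `T = (1 - iεR)⁻¹`, so that `RT = (H₀ - iε)⁻¹` at high frequency. -/
structure IsNeumann (ε : ℝ) (R T : Op) : Prop where
  comm : ∀ t, T * Ev t = Ev t * T
  eq : T = 1 + (Complex.I * ε) • (R * T)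

/-- An antiderivative of e^{-εt} X e^{-itH₀}. Differentiation gives -iXST - εXRT; here XS = X, and T
= 1 + iεRT cancels the two ε-terms, leaving -iX. -/
lemma resolvent_hasDerivAt (hRS : IsPreResolvent R S) (hT : IsNeumann ε R T) (hX : X * S = X)
    (f : L2) (t : ℝ) :
    HasDerivAt (fun t => (Real.exp (-ε * t) : ℂ) • (X * (R * T)) (Ev (-t) f))
      (-Complex.I • (Real.exp (-ε * t) : ℂ) • X (Ev (-t) f)) t := by
  have e1 : ∀ t, (X * (R * T)) (Ev (-t) f) = X (Ev (-t) (R (T f))) := fun t => by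
    have h1 : T (Ev (-t) f) = Ev (-t) (T f) := congrArg (fun A : Op => A f) (hT.comm (-t))
    have h2 : R (Ev (-t) (T f)) = Ev (-t) (R (T f)) :=
      congrArg (fun A : Op => A (T f)) (hRS.comm (-t))
    change X (R (T (Ev (-t) f))) = _
    rw [h1, h2]
  simp_rw [e1]
  have d1 : HasDerivAt (fun t : ℝ => (Real.exp (-ε * t) : ℂ)) ((-ε * Real.exp (-ε * t) : ℝ) : ℂ) t := by
    have := ((Real.hasDerivAt_exp (-ε * t)).comp t ((hasDerivAt_id t).const_mul (-ε))).ofReal_comp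
    convert this using 2
    simp; ring
  have d2 : HasDerivAt (fun t => X (Ev (-t) (R (T f)))) (X (-Complex.I • Ev (-t) (S (T f)))) t := by
    have := (X.restrictScalars ℝ).hasFDerivAt.comp_hasDerivAt t (hRS.deriv (T f) t)
    exact this
  refine (d1.smul d2).congr_deriv ?_
  have e2 : X (Ev (-t) (S (T f))) = X (Ev (-t) (T f)) := by
    have h1 : Ev (-t) (S (T f)) = S (Ev (-t) (T f)) :=
      (congrArg (fun A : Op => A (T f)) (hRS.comm' (-t))).symm
    have h2 := congrArg (fun A : Op => A (Ev (-t) (T f))) hX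
    rw [h1]; exact h2
  have e3 : T f = f + (Complex.I * ε) • R (T f) := congrArg (fun A : Op => A f) hT.eq
  rw [map_smul, e2]
  have e4 : X (Ev (-t) (T f)) = X (Ev (-t) f) + (Complex.I * ε) • X (Ev (-t) (R (T f))) := by
    conv_lhs => rw [e3]
    rw [map_add, map_add, map_smul, map_smul]
  rw [e4, smul_add, smul_add, smul_smul, smul_smul, smul_smul, smul_smul, add_assoc, ← add_smul]
  have e5 : (Real.exp (-ε * t) : ℂ) * -Complex.I * (Complex.I * ε) +
      ((-ε * Real.exp (-ε * t) : ℝ) : ℂ) = 0 := by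
    push_cast
    linear_combination (-(ε : ℂ) * Complex.exp (-ε * t)) * Complex.I_mul_I
  rw [e5, zero_smul, add_zero, mul_comm]

/-- Integrate the oscillating factor by `resolvent_hasDerivAt` and differentiate τ^{-m} u e^{iτH₀}
v. The coefficient m + 3/2 adds the -m of the power to the -3/2 of the kernel amplitude; the
quadratic phase of the kernel produces the τ^{-m-2} term. -/
lemma ibp_vector (hRS : IsPreResolvent R S) (hT : IsNeumann ε R T) (hX : X * S = X) (hε : 0 < ε)
    (hu : WBdd b u) (hv : WBdd b v) {a : ℝ} (ha : 0 < a) (m : ℕ) (f : L2) :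
    ∫ τ in Ioi a, (((τ ^ m)⁻¹ * Real.exp (-ε * τ) : ℝ) : ℂ) • sand u v τ (X (Ev (-τ) f)) =
      (-Complex.I * (((a ^ m)⁻¹ * Real.exp (-ε * a) : ℝ) : ℂ)) •
          sand u v a ((X * (R * T)) (Ev (-a) f)) +
      (Complex.I * (m + 3 / 2)) • (∫ τ in Ioi a, (((τ ^ (m + 1))⁻¹ * Real.exp (-ε * τ) : ℝ) : ℂ) •
        sand u v τ ((X * (R * T)) (Ev (-τ) f))) +
      (1 / 4 : ℂ) • ∫ τ in Ioi a, (((τ ^ (m + 2))⁻¹ * Real.exp (-ε * τ) : ℝ) : ℂ) •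
        sandQ b u v τ ((X * (R * T)) (Ev (-τ) f)) := by
  set X' := X * (R * T) with hX'
  let y : ℝ → L2 := fun t => (Real.exp (-ε * t) : ℂ) • X' (Ev (-t) f)
  let Ψ : ℝ → L2 := fun t => (((t ^ m)⁻¹ : ℝ) : ℂ) • sand u v t (y t)
  let e : ℕ → ℝ → ℂ := fun m τ => (((τ ^ m)⁻¹ * Real.exp (-ε * τ) : ℝ) : ℂ)
  obtain ⟨KQ, hKQ⟩ := sandQ_norm_le b u v
  have b0 : BC fun τ => sand u v τ (X (Ev (-τ) f)) :=
    BC_strong (sand_norm_le u v) (sand_continuous u v) X f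
  have b1 : BC fun τ => sand u v τ (X' (Ev (-τ) f)) :=
    BC_strong (sand_norm_le u v) (sand_continuous u v) X' f
  have b2 : BC fun τ => sandQ b u v τ (X' (Ev (-τ) f)) :=
    BC_strong hKQ (sandQ_continuous b u v) X' f
  have i0 := (wpow_smul_integrable hε ha m b0).smul (-Complex.I)
  have i1 := (wpow_smul_integrable hε ha (m + 1) b1).smul (-((m : ℂ) + 3 / 2))
  have i2 := (wpow_smul_integrable hε ha (m + 2) b2).smul (Complex.I / 4)
  have hd : ∀ t, 0 < t → HasDerivAt Ψ (-Complex.I • e m t • sand u v t (X (Ev (-t) f)) +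
      (-((m : ℂ) + 3 / 2)) • e (m + 1) t • sand u v t (X' (Ev (-t) f)) +
      (Complex.I / 4) • e (m + 2) t • sandQ b u v t (X' (Ev (-t) f))) t := by
    intro t ht
    have hne := ht.ne'
    have d1 : HasDerivAt (fun t : ℝ => (((t ^ m)⁻¹ : ℝ) : ℂ)) ((-m * (t ^ (m + 1))⁻¹ : ℝ) : ℂ) t :=
      (hasDerivAt_inv_pow m hne).ofReal_comp
    have d2 := hasDerivAt_strong_apply (sand_norm_le u v) (sand_continuous u v)
      (resolvent_hasDerivAt hRS hT hX f t) (sand_hasDerivAt hu hv ht (y t))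
    refine (d1.smul d2).congr_deriv ?_
    simp only [sandD, add_apply, smul_apply, y, map_smul, smul_add, smul_smul, e]
    have hc : (t : ℂ) ≠ 0 := by exact_mod_cast hne
    have k1 : ∀ (A B C : L2) (a1 a2 a3 a4 b1 b2 b3 : ℂ), a3 = b1 → a1 + a4 = b2 → a2 = b3 →
        a1 • B + a2 • C + a3 • A + a4 • B = b1 • A + b2 • B + b3 • C := by
      intro A B C a1 a2 a3 a4 b1 b2 b3 h1 h2 h3
      rw [← h1, ← h2, ← h3, add_smul]; abel
    refine k1 _ _ _ _ _ _ _ _ _ _ ?_ ?_ ?_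
    · push_cast; ring
    · push_cast; field_simp; ring
    · push_cast; field_simp; ring
  have hlim : Tendsto Ψ atTop (𝓝 0) := by
    refine squeeze_zero_norm' (a := fun t => Real.exp (-ε * t) * ((‖mulL u‖ * ‖mulL v‖) *
      (‖X'‖ * ‖f‖))) ?_ ?_
    · filter_upwards [eventually_ge_atTop 1] with t ht
      have h1 : ‖(((t ^ m)⁻¹ : ℝ) : ℂ)‖ ≤ 1 := by
        rw [Complex.norm_real, Real.norm_of_nonneg (by positivity)]
        exact inv_le_one_of_one_le₀ (one_le_pow₀ ht)
      have h2 : ‖y t‖ ≤ Real.exp (-ε * t) * (‖X'‖ * ‖f‖) := by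
        simp only [y]
        rw [norm_smul, Complex.norm_real, Real.norm_of_nonneg (Real.exp_pos _).le]
        gcongr
        refine (X'.le_opNorm _).trans ?_
        rw [Ev_norm]
      have h3 := (sand u v t).le_of_opNorm_le (sand_norm_le u v t) (y t)
      calc ‖Ψ t‖ = ‖(((t ^ m)⁻¹ : ℝ) : ℂ)‖ * ‖sand u v t (y t)‖ := norm_smul _ _
        _ ≤ 1 * ((‖mulL u‖ * ‖mulL v‖) * (Real.exp (-ε * t) * (‖X'‖ * ‖f‖))) := by
          gcongr
          exact h3.trans (by gcongr)
        _ = _ := by ring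
    · have h1 : Tendsto (fun t : ℝ => -ε * t) atTop atBot :=
        tendsto_id.const_mul_atTop_of_neg (by linarith)
      simpa using (Real.tendsto_exp_atBot.comp h1).mul_const ((‖mulL u‖ * ‖mulL v‖) * (‖X'‖ * ‖f‖))
  have key := integral_Ioi_of_hasDerivAt_of_tendsto (a := a)
    (hd a ha).continuousAt.continuousWithinAt (fun t ht => hd t (ha.trans ht))
    ((i0.add i1).add i2) hlim
  have s1 := integral_add (i0.add i1) i2
  have s2 := integral_add i0 i1
  have s3 : -Complex.I • (∫ τ in Ioi a, e m τ • sand u v τ (X (Ev (-τ) f))) +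
      (-((m : ℂ) + 3 / 2)) • (∫ τ in Ioi a, e (m + 1) τ • sand u v τ (X' (Ev (-τ) f))) +
      (Complex.I / 4) • (∫ τ in Ioi a, e (m + 2) τ • sandQ b u v τ (X' (Ev (-τ) f))) = 0 - Ψ a := by
    rw [← key, ← integral_smul, ← integral_smul, ← integral_smul]
    refine Eq.symm (s1.trans ?_)
    congr 1
  have s4 : Ψ a = e m a • sand u v a (X' (Ev (-a) f)) := by
    simp only [Ψ, y, map_smul, smul_smul, e]
    push_cast; rfl
  rw [s4] at s3
  change (∫ τ in Ioi a, e m τ • sand u v τ (X (Ev (-τ) f))) = (-Complex.I * e m a) • _ +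
    (Complex.I * (m + 3 / 2)) • (∫ τ in Ioi a, e (m + 1) τ • sand u v τ (X' (Ev (-τ) f))) +
      (1 / 4 : ℂ) • (∫ τ in Ioi a, e (m + 2) τ • sandQ b u v τ (X' (Ev (-τ) f)))
  generalize (∫ τ in Ioi a, e m τ • sand u v τ (X (Ev (-τ) f))) = J at *
  generalize (∫ τ in Ioi a, e (m + 1) τ • sand u v τ (X' (Ev (-τ) f))) = A1 at *
  generalize (∫ τ in Ioi a, e (m + 2) τ • sandQ b u v τ (X' (Ev (-τ) f))) = B2 at *
  generalize sand u v a (X' (Ev (-a) f)) = D at *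
  have s5 := congrArg (fun z => Complex.I • z) s3
  simp only [smul_add, smul_neg, smul_smul, zero_sub] at s5
  have hII : Complex.I * -Complex.I = 1 := by rw [mul_neg, Complex.I_mul_I, neg_neg]
  rw [hII, one_smul] at s5
  have hI4 : Complex.I * (Complex.I / 4) = -(1 / 4) := by
    rw [← mul_div_assoc, Complex.I_mul_I]; ring
  rw [hI4, mul_neg, neg_smul, neg_smul] at s5
  rw [neg_mul, neg_smul, ← s5]
  abel

lemma ibp_op (hRS : IsPreResolvent R S) (hT : IsNeumann ε R T) (hX : X * S = X) (hε : 0 < ε)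
    (hu : WBdd b u) (hv : WBdd b v) {a : ℝ} (ha : 0 < a) (m : ℕ) :
    mulL u * avg (wpow ε a m) (mulL v * X) =
      (-Complex.I * (((a ^ m)⁻¹ * Real.exp (-ε * a) : ℝ) : ℂ)) •
        (mulL u * conjEv a (mulL v * (X * (R * T)))) +
      (Complex.I * (m + 3 / 2)) • (mulL u * avg (wpow ε a (m + 1)) (mulL v * (X * (R * T)))) +
      (1 / 4 : ℂ) • ∑ l, (mulL (qf b u l 2) * avg (wpow ε a (m + 2)) (mulL v * (X * (R * T))) -
        (2 : ℂ) • (mulL (qf b u l 1) * avg (wpow ε a (m + 2)) (mulL (qf b v l 1) * (X * (R * T)))) +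
        mulL u * avg (wpow ε a (m + 2)) (mulL (qf b v l 2) * (X * (R * T)))) := by
  ext1 f
  have hw : ∀ m, Integrable (wpow ε a m) := wpow_integrable hε ha
  have h := ibp_vector hRS hT hX hε hu hv ha m f
  have hQ : ∫ τ in Ioi a, (((τ ^ (m + 2))⁻¹ * Real.exp (-ε * τ) : ℝ) : ℂ) •
        sandQ b u v τ ((X * (R * T)) (Ev (-τ) f)) =
      ∑ l, ((mulL (qf b u l 2) * avg (wpow ε a (m + 2)) (mulL v * (X * (R * T)))) f -
        (2 : ℂ) • (mulL (qf b u l 1) * avg (wpow ε a (m + 2))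
          (mulL (qf b v l 1) * (X * (R * T)))) f +
        (mulL u * avg (wpow ε a (m + 2)) (mulL (qf b v l 2) * (X * (R * T)))) f) := by
    simp_rw [mulL_avg_mulL (hw _), wpow_smul_integral]
    have i := fun (u v : E3 → ℂ) => wpow_smul_integrable hε ha (m + 2)
      (BC_strong (sand_norm_le u v) (sand_continuous u v) (X * (R * T)) f)
    have i3 := fun l => ((i (qf b u l 2) v).sub ((i (qf b u l 1) (qf b v l 1)).smul (2 : ℂ))).add
      (i u (qf b v l 2))
    have e1 : ∀ τ : ℝ, (((τ ^ (m + 2))⁻¹ * Real.exp (-ε * τ) : ℝ) : ℂ) •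
        sandQ b u v τ ((X * (R * T)) (Ev (-τ) f)) = ∑ l,
        ((((τ ^ (m + 2))⁻¹ * Real.exp (-ε * τ) : ℝ) : ℂ) • sand (qf b u l 2) v τ ((X * (R * T)) (Ev (-τ) f)) -
        (2 : ℂ) • (((τ ^ (m + 2))⁻¹ * Real.exp (-ε * τ) : ℝ) : ℂ) •
          sand (qf b u l 1) (qf b v l 1) τ ((X * (R * T)) (Ev (-τ) f)) +
        (((τ ^ (m + 2))⁻¹ * Real.exp (-ε * τ) : ℝ) : ℂ) • sand u (qf b v l 2) τ ((X * (R * T)) (Ev (-τ) f))) := by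
      intro τ
      simp only [sandQ, sum_apply, add_apply, sub_apply, smul_apply, Finset.smul_sum, smul_add,
        smul_sub]
      refine Finset.sum_congr rfl fun l _ => ?_
      rw [smul_comm (2 : ℂ)]
    simp_rw [e1]
    refine (integral_finsetSum _ fun l _ => i3 l).trans ?_
    refine Finset.sum_congr rfl fun l _ => ?_
    refine (integral_add ((i (qf b u l 2) v).sub ((i (qf b u l 1) (qf b v l 1)).smul (2 : ℂ)))
      (i u (qf b v l 2))).trans ?_
    congr 1
    refine (integral_sub (i (qf b u l 2) v) ((i (qf b u l 1) (qf b v l 1)).smul (2 : ℂ))).trans ?_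
    congr 1
    exact integral_smul (μ := volume.restrict (Ioi a)) (2 : ℂ) fun τ : ℝ =>
      (((τ ^ (m + 2))⁻¹ * Real.exp (-ε * τ) : ℝ) : ℂ) •
        sand (qf b u l 1) (qf b v l 1) τ ((X * (R * T)) (Ev (-τ) f))
  rw [hQ] at h
  simp only [add_apply, smul_apply, sum_apply, sub_apply]
  rw [mulL_avg_mulL (hw m), wpow_smul_integral, h]
  congr 2
  rw [mulL_avg_mulL (hw (m + 1)), wpow_smul_integral]

end

end

noncomputable section

/-! ### Size functionals on families of operators -/

/-- A notion of size of a family of operators which is compatible with the phase space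
domination `DomF`. -/
structure Gauge (ι : Type) where
  P : (ι → Op) → NNReal → Prop
  mono : ∀ {X c c'}, P X c → c ≤ c' → P X c'
  zero : P (fun _ => 0) 0
  add : ∀ {X Y c c'}, P X c → P Y c' → P (fun i => X i + Y i) (c + c')
  smul : ∀ {X c}, P X c → ∀ {a : ι → ℂ} {k : NNReal}, (∀ i, ‖a i‖ ≤ k) →
    P (fun i => a i • X i) (k * c)
  mul_left : ∀ {X Y c c'}, DomF Y c' → P X c → P (fun i => Y i * X i) (c' * c)
  mul_right : ∀ {X Y c c'}, P X c → DomF Y c' → P (fun i => X i * Y i) (c * c')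
  conj : ∀ {X c}, P X c → ∀ τ, P (fun i => conjEv τ (X i)) c
  avg : ∀ {X c}, P X c → ∀ {w : ι → ℝ → ℂ} {w' : ℝ → ℝ≥0∞} {k : NNReal},
    (∀ i, Integrable (w i)) → Measurable w' → (∀ i τ, ‖w i τ‖ₑ ≤ w' τ) → ∫⁻ τ, w' τ ≤ k →
      P (fun i => avg (w i) (X i)) (k * c)

/-- The size measured by domination in phase space. -/
def domGauge (ι : Type) : Gauge ι where
  P := DomF
  mono := DomF.mono
  zero := DomF.zero
  add := DomF.add
  smul h _ _ ha := h.smul ha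
  mul_left h h' := h.mul h'
  mul_right h h' := h.mul h'
  conj h τ := h.conjEv τ
  avg h _ _ _ h1 h2 h3 h4 := h.avg h1 h2 h3 h4

/-- The size measured by the operator norm. -/
def normGauge (ι : Type) : Gauge ι where
  P X c := ∀ i, ‖X i‖ ≤ c
  mono h hc i := (h i).trans (by exact_mod_cast hc)
  zero i := by simp
  add h h' i := by
    rw [NNReal.coe_add]
    exact (norm_add_le _ _).trans (add_le_add (h i) (h' i))
  smul {X c} h a k ha i := by
    rw [NNReal.coe_mul]
    refine (norm_smul_le (a i) (X i)).trans ?_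
    have := h i
    have := ha i
    gcongr
  mul_left h h' i := by
    rw [NNReal.coe_mul]
    refine (norm_mul_le _ _).trans ?_
    have := h.norm_le i
    have := h' i
    gcongr
  mul_right h h' i := by
    rw [NNReal.coe_mul]
    refine (norm_mul_le _ _).trans ?_
    have := h'.norm_le i
    have := h i
    gcongr
  conj h τ i := (conjEv_norm_le τ _).trans (h i)
  avg {X c} h w w' k h1 h2 h3 h4 i := by
    rw [NNReal.coe_mul]
    refine (avg_norm_le (h1 i) _).trans ?_
    have h5 : ∫ τ, ‖w i τ‖ ≤ k := by
      have e : ENNReal.ofReal (∫ τ, ‖w i τ‖) ≤ k := by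
        rw [ofReal_integral_norm_eq_lintegral_enorm (h1 i)]
        exact (lintegral_mono (h3 i)).trans h4
      have := ENNReal.toReal_mono ENNReal.coe_ne_top e
      rwa [ENNReal.toReal_ofReal (integral_nonneg fun _ => norm_nonneg _)] at this
    have := h i
    gcongr

section
variable {ι : Type} (g : Gauge ι)

lemma Gauge.sum_fin {X : Fin 3 → ι → Op} {c : NNReal} (h : ∀ l, g.P (X l) c) :
    g.P (fun i => ∑ l, X l i) (3 * c) := by
  simp_rw [Fin.sum_univ_three]
  exact g.mono (g.add (g.add (h 0) (h 1)) (h 2)) (le_of_eq (by ring))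

lemma Gauge.csmul {X : ι → Op} {c : NNReal} (h : g.P X c) (a : ℂ) {k : NNReal} (ha : ‖a‖ ≤ k) :
    g.P (fun i => a • X i) (k * c) := g.smul h fun _ => ha

/-- The weight `χ(0 < τ ≤ a) e^{-ετ}`. -/
def wlow (ε a : ℝ) : ℝ → ℂ := indicator (Ioc 0 a) fun τ => (Real.exp (-ε * τ) : ℂ)

lemma enorm_wlow_le {ε : ℝ} (hε : 0 ≤ ε) (a τ : ℝ) :
    ‖wlow ε a τ‖ₑ ≤ indicator (Ioc 0 a) (fun _ => (1 : ℝ≥0∞)) τ := by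
  rw [wlow]
  by_cases h : τ ∈ Ioc 0 a
  · rw [indicator_of_mem h, indicator_of_mem h, ← ofReal_norm, Complex.norm_real,
      Real.norm_of_nonneg (Real.exp_pos _).le]
    refine ENNReal.ofReal_le_one.2 (Real.exp_le_one_iff.2 ?_)
    nlinarith [h.1]
  · rw [indicator_of_notMem h, indicator_of_notMem h]; simp

lemma wlow_integrable (ε a : ℝ) : Integrable (wlow ε a) := by
  refine (integrable_indicator_iff measurableSet_Ioc).2 ?_
  exact ((by fun_prop : Continuous fun τ : ℝ => (Real.exp (-ε * τ) : ℂ)).integrableOn_Icc).mono_set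
    Ioc_subset_Icc_self

lemma Gauge.avg_wlow {X : ι → Op} {c : NNReal} (h : g.P X c) {ε : ι → ℝ} (hε : ∀ i, 0 < ε i)
    (a : NNReal) : g.P (fun i => _root_.avg (wlow (ε i) a) (X i)) (a * c) := by
  refine g.avg h (fun i => wlow_integrable _ _) (w' := indicator (Ioc 0 (a : ℝ)) fun _ => 1)
    (measurable_const.indicator measurableSet_Ioc) (fun i => enorm_wlow_le (hε i).le a) ?_
  rw [lintegral_indicator measurableSet_Ioc]
  simp

lemma enorm_wpow_le {ε : ℝ} (hε : 0 ≤ ε) {a : ℝ} (ha : 0 < a) (m : ℕ) (τ : ℝ) :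
    ‖wpow ε a m τ‖ₑ ≤ indicator (Ioi a) (fun τ => ENNReal.ofReal ((τ ^ m)⁻¹)) τ := by
  rw [wpow]
  by_cases h : τ ∈ Ioi a
  · rw [indicator_of_mem h, indicator_of_mem h, ← ofReal_norm, Complex.norm_real]
    have : a < τ := h
    have h0 : 0 < τ := by linarith
    rw [Real.norm_of_nonneg (by positivity)]
    refine ENNReal.ofReal_le_ofReal (mul_le_of_le_one_right (by positivity) ?_)
    refine Real.exp_le_one_iff.2 ?_
    nlinarith
  · rw [indicator_of_notMem h, indicator_of_notMem h]; simp

lemma lintegral_inv_sq {a : NNReal} (ha : 0 < a) :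
    ∫⁻ τ, indicator (Ioi (a : ℝ)) (fun τ => ENNReal.ofReal ((τ ^ 2)⁻¹)) τ = (a⁻¹ : NNReal) := by
  have ha' : (0 : ℝ) < a := ha
  rw [lintegral_indicator measurableSet_Ioi]
  have h1 : ∀ τ ∈ Ioi (a : ℝ), (τ ^ 2)⁻¹ = τ ^ (-2 : ℝ) := fun τ hτ => by
    rw [Real.rpow_neg (ha'.trans hτ).le]; norm_num
  have h2 := integrableOn_Ioi_rpow_of_lt (by norm_num : (-2 : ℝ) < -1) ha'
  have h3 := integral_Ioi_rpow_of_lt (by norm_num : (-2 : ℝ) < -1) ha'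
  have h4 : IntegrableOn (fun τ : ℝ => (τ ^ 2)⁻¹) (Ioi (a : ℝ)) :=
    h2.congr_fun (fun τ hτ => (h1 τ hτ).symm) measurableSet_Ioi
  rw [← ofReal_integral_eq_lintegral_ofReal h4 (Eventually.of_forall fun τ => by positivity),
    setIntegral_congr_fun measurableSet_Ioi h1, h3]
  have : -(a : ℝ) ^ ((-2 : ℝ) + 1) / (-2 + 1) = (a⁻¹ : NNReal) := by
    norm_num [Real.rpow_neg_one]
  rw [this, ENNReal.ofReal_coe_nnreal]

lemma measurable_ofReal_inv_pow (m : ℕ) : Measurable fun τ : ℝ => ENNReal.ofReal ((τ ^ m)⁻¹) := by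
  fun_prop

lemma Gauge.avg_wpow_two {X : ι → Op} {c : NNReal} (h : g.P X c) {ε : ι → ℝ} (hε : ∀ i, 0 < ε i)
    {a : NNReal} (ha : 0 < a) : g.P (fun i => _root_.avg (wpow (ε i) a 2) (X i)) (a⁻¹ * c) :=
  g.avg h (fun i => wpow_integrable (hε i) ha 2)
    ((measurable_ofReal_inv_pow 2).indicator measurableSet_Ioi)
    (fun i => enorm_wpow_le (hε i).le ha 2) (lintegral_inv_sq ha).le

/-- On τ > a one has τ^{-3} ≤ a^{-1} τ^{-2}; this crude bound suffices. -/
lemma Gauge.avg_wpow_three {X : ι → Op} {c : NNReal} (h : g.P X c) {ε : ι → ℝ} (hε : ∀ i, 0 < ε i)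
    {a : NNReal} (ha : 0 < a) : g.P (fun i => _root_.avg (wpow (ε i) a 3) (X i)) (a⁻¹ * a⁻¹ * c) := by
  have ha' : (0 : ℝ) < a := ha
  refine g.avg h (fun i => wpow_integrable (hε i) ha' 3)
    (w' := fun τ => (a⁻¹ : NNReal) * indicator (Ioi (a : ℝ)) (fun τ => ENNReal.ofReal ((τ ^ 2)⁻¹)) τ)
    (((measurable_ofReal_inv_pow 2).indicator measurableSet_Ioi).const_mul _)
    (fun i τ => (enorm_wpow_le (hε i).le ha' 3 τ).trans ?_) ?_
  · by_cases hτ : τ ∈ Ioi (a : ℝ)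
    · rw [indicator_of_mem hτ, indicator_of_mem hτ]
      have h1 : (a : ℝ) < τ := hτ
      have h0 : 0 < τ := by linarith
      rw [← ENNReal.ofReal_coe_nnreal, ← ENNReal.ofReal_mul (by positivity)]
      refine ENNReal.ofReal_le_ofReal ?_
      rw [NNReal.coe_inv, ← mul_inv]
      gcongr
      nlinarith [sq_nonneg τ]
    · rw [indicator_of_notMem hτ, indicator_of_notMem hτ]; simp
  · rw [lintegral_const_mul _ ((measurable_ofReal_inv_pow 2).indicator measurableSet_Ioi),
      lintegral_inv_sq ha, ← ENNReal.coe_mul]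

end

lemma avg_add_weight {w w' : ℝ → ℂ} (hw : Integrable w) (hw' : Integrable w') (Z : Op) :
    avg (fun τ => w τ + w' τ) Z = avg w Z + avg w' Z := by
  ext1 f
  have h : Integrable fun τ => w τ + w' τ := hw.add hw'
  rw [add_apply, avg_apply h, avg_apply hw, avg_apply hw',
    ← integral_add (integrable_smul_conjEv hw Z f) (integrable_smul_conjEv hw' Z f)]
  simp_rw [add_smul]

lemma wexp_split (ε : ℝ) {a : ℝ} (ha : 0 < a) : wexp ε = fun τ => wlow ε a τ + wpow ε a 0 τ := by
  ext τ
  simp only [wexp, wlow, wpow, indicator, mem_Ioi, mem_Ioc, pow_zero, inv_one, one_mul]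
  by_cases h1 : 0 < τ
  · by_cases h2 : τ ≤ a
    · simp [h1, h2, not_lt.2 h2]
    · simp [h1, h2, not_le.1 h2]
  · have h2 : ¬ a < τ := fun h => h1 (ha.trans h)
    simp [h1, h2]

section
variable {b : OrthonormalBasis (Fin 3) ℝ E3} {V₀ : E3 → ℂ}

/-- The coefficients obtained by integrating by parts in `u ∫₀^∞ e^{-ετ} e^{iτH₀} V X e^{-iτH₀} dτ`. -/
def ibpCoeff (b : OrthonormalBasis (Fin 3) ℝ E3) (V₀ : E3 → ℂ) (ε a : ℝ) (Q X : Op) :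
    Fin 3 → Fin 3 → Op := fun l j =>
  if j = 0 then (if l = 0 then
    avg (wlow ε a) (mulL V₀ * X) +
      ((-Complex.I * (((a ^ 0)⁻¹ * Real.exp (-ε * a) : ℝ) : ℂ)) • conjEv a (mulL V₀ * (X * Q)) +
      (1 / 4 : ℂ) • ∑ l, avg (wpow ε a 2) (mulL (qf b V₀ l 2) * (X * Q))) +
      (Complex.I * (3 / 2)) •
        ((-Complex.I * (((a ^ 1)⁻¹ * Real.exp (-ε * a) : ℝ) : ℂ)) • conjEv a (mulL V₀ * (X * Q * Q)) +
        (Complex.I * (5 / 2)) • avg (wpow ε a 2) (mulL V₀ * (X * Q * Q)) +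
        (1 / 4 : ℂ) • ∑ l, avg (wpow ε a 3) (mulL (qf b V₀ l 2) * (X * Q * Q)))
    else 0)
  else if j = 1 then (-(1 / 2) : ℂ) • avg (wpow ε a 2) (mulL (qf b V₀ l 1) * (X * Q)) +
      (-(Complex.I * (3 / 4))) • avg (wpow ε a 3) (mulL (qf b V₀ l 1) * (X * Q * Q))
  else (1 / 4 : ℂ) • avg (wpow ε a 2) (mulL V₀ * (X * Q)) +
      (Complex.I * (3 / 8)) • avg (wpow ε a 3) (mulL V₀ * (X * Q * Q))

/-- Times τ ≤ a are left alone. Beyond a, one integration by parts leaves a τ^{-1} term, not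
integrable uniformly in ε, so that term is integrated by parts once more; what remains has weights
τ^{-2}, τ^{-3} and boundary values at a. The function u occurs only through the left factors x_l^j
u, so the coefficients do not depend on u. -/
lemma ibpCoeff_eq {u : E3 → ℂ} {R S T X : Op} {ε : ℝ}
    (hRS : IsPreResolvent R S) (hT : IsNeumann ε R T) (hTS : T * S = S * T) (hX : X * S = X)
    (hε : 0 < ε) (hu : WBdd b u) (hV : WBdd b V₀) {a : ℝ} (ha : 0 < a) :
    mulL u * avg (wexp ε) (mulL V₀ * X) =
      ∑ l, ∑ j, mulL (qf b u l j) * ibpCoeff b V₀ ε a (R * T) X l j := by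
  -- The operator X R T is again unchanged by S, so the second integration by parts may take it in
  -- place of X.
  have hX1 : X * (R * T) * S = X * (R * T) := by
    rw [mul_assoc, mul_assoc, hTS, ← mul_assoc R, hRS.comm_RS, mul_assoc S, ← mul_assoc, hX]
  have h0 := ibp_op hRS hT hX hε hu hV ha 0
  have h1 := ibp_op hRS hT hX1 hε hu hV ha 1
  have e : avg (wexp ε) (mulL V₀ * X) =
      avg (wlow ε a) (mulL V₀ * X) + avg (wpow ε a 0) (mulL V₀ * X) := by
    rw [wexp_split ε ha, avg_add_weight (wlow_integrable ε a) (wpow_integrable hε ha 0)]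
  rw [e, mul_add, h0]
  simp only [zero_add, Nat.reduceAdd] at h1 ⊢
  rw [h1]
  simp only [Fin.sum_univ_three, ibpCoeff, qf_zero, if_true, Fin.isValue, one_ne_zero, if_false,
    mul_zero, mul_add, mul_smul_comm,
    (by decide : (2 : Fin 3) ≠ 0), (by decide : (2 : Fin 3) ≠ 1)]
  push_cast
  module

/-- Bookkeeping: a for the short times, ρ or a^{-1}ρ² for boundary values, a^{-1} for each weight
τ^{-2}, a^{-2} for τ^{-3}, one factor ρ for each resolvent, and 3 for each sum over coordinates. The
numerical coefficients of the integrations by parts are rounded up, and the same bound serves all l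
and j. -/
lemma Gauge.ibpCoeff {ι : Type} (g : Gauge ι) {ε : ι → ℝ} (hε : ∀ i, 0 < ε i) {X Q : ι → Op}
    {c ρ : NNReal} (hX : ∀ l j, g.P (fun i => mulL (qf b V₀ l j) * X i) c) (hQ : DomF Q ρ)
    {a : NNReal} (ha : 0 < a) (l j : Fin 3) :
    g.P (fun i => _root_.ibpCoeff b V₀ (ε i) a (Q i) (X i) l j)
      ((a + (ρ + 3 * (a⁻¹ * ρ)) + 2 * (a⁻¹ * ρ ^ 2 + 3 * (a⁻¹ * ρ ^ 2) +
        3 * (a⁻¹ * a⁻¹ * ρ ^ 2))) * c) := by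
  have hV : ∀ X : ι → Op, (∀ l j, g.P (fun i => mulL (qf b V₀ l j) * X i) c) →
      g.P (fun i => mulL V₀ * X i) c := fun X h => by simpa [qf_zero] using h 0 0
  have hX1 : ∀ l j, g.P (fun i => mulL (qf b V₀ l j) * (X i * Q i)) (c * ρ) := fun l j => by
    simpa only [mul_assoc] using g.mul_right (hX l j) hQ
  have hX2 : ∀ l j, g.P (fun i => mulL (qf b V₀ l j) * (X i * Q i * Q i)) (c * ρ * ρ) := fun l j => by
    simpa only [mul_assoc] using g.mul_right (hX1 l j) hQ
  have hV0 : g.P (fun i => mulL V₀ * X i) c := by simpa [qf_zero] using hX 0 0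
  have hV1 : g.P (fun i => mulL V₀ * (X i * Q i)) (c * ρ) := by simpa [qf_zero] using hX1 0 0
  have hV2 : g.P (fun i => mulL V₀ * (X i * Q i * Q i)) (c * ρ * ρ) := by
    simpa [qf_zero] using hX2 0 0
  have ha' : (0 : ℝ) < a := ha
  have hexp : ∀ i, Real.exp (-ε i * a) ≤ 1 := fun i => by
    refine Real.exp_le_one_iff.2 ?_
    nlinarith [hε i]
  have bd : ∀ m : ℕ, ∀ i, ‖-Complex.I * ((((a : ℝ) ^ m)⁻¹ * Real.exp (-ε i * a) : ℝ) : ℂ)‖ ≤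
      ((a ^ m)⁻¹ : NNReal) := fun m i => by
    rw [norm_mul, norm_neg, Complex.norm_I, one_mul, Complex.norm_real,
      Real.norm_of_nonneg (by positivity)]
    push_cast
    exact mul_le_of_le_one_right (by positivity) (hexp i)
  have n1 : ‖(1 / 4 : ℂ)‖ ≤ (1 : NNReal) := by norm_num
  unfold _root_.ibpCoeff
  split_ifs with h1 h2 h3
  · refine g.mono (g.add (g.add (g.avg_wlow hV0 hε a) (g.add (g.smul (g.conj hV1 a) (bd 0))
      (g.csmul (g.sum_fin fun l => g.avg_wpow_two (hX1 l 2) hε ha) _ n1)))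
      (g.csmul (k := 2) (g.add (g.add (g.smul (g.conj hV2 a) (bd 1))
      (g.csmul (k := 3) (g.avg_wpow_two hV2 hε ha) _ ?_))
      (g.csmul (g.sum_fin fun l => g.avg_wpow_three (hX2 l 2) hε ha) _ n1)) _ ?_)) (le_of_eq ?_)
    · simp; norm_num
    · simp; norm_num
    · rw [pow_zero, inv_one, pow_one]; ring
  · exact g.mono g.zero (by positivity)
  · refine g.mono (g.add (g.csmul (k := 1) (g.avg_wpow_two (hX1 l 1) hε ha) _ ?_)
      (g.csmul (k := 1) (g.avg_wpow_three (hX2 l 1) hε ha) _ ?_)) ?_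
    · simp; norm_num
    · simp; norm_num
    · have : 1 * (a⁻¹ * (c * ρ)) + 1 * (a⁻¹ * a⁻¹ * (c * ρ * ρ)) =
        (a⁻¹ * ρ + a⁻¹ * a⁻¹ * ρ ^ 2) * c := by ring
      rw [this]
      refine mul_le_mul' ?_ le_rfl
      rw [← NNReal.coe_le_coe]
      push_cast
      have h4 : (0 : ℝ) ≤ (a : ℝ)⁻¹ * ρ := by positivity
      have h5 : (0 : ℝ) ≤ (a : ℝ)⁻¹ * (a : ℝ)⁻¹ * ρ ^ 2 := by positivity
      have h6 : (0 : ℝ) ≤ (a : ℝ)⁻¹ * ρ ^ 2 := by positivity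
      have h7 : (0 : ℝ) ≤ ρ := ρ.2
      linarith
  · refine g.mono (g.add (g.csmul (k := 1) (g.avg_wpow_two hV1 hε ha) _ ?_)
      (g.csmul (k := 1) (g.avg_wpow_three hV2 hε ha) _ ?_)) ?_
    · simp; norm_num
    · simp; norm_num
    · have : 1 * (a⁻¹ * (c * ρ)) + 1 * (a⁻¹ * a⁻¹ * (c * ρ * ρ)) =
        (a⁻¹ * ρ + a⁻¹ * a⁻¹ * ρ ^ 2) * c := by ring
      rw [this]
      refine mul_le_mul' ?_ le_rfl
      rw [← NNReal.coe_le_coe]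
      push_cast
      have h4 : (0 : ℝ) ≤ (a : ℝ)⁻¹ * ρ := by positivity
      have h5 : (0 : ℝ) ≤ (a : ℝ)⁻¹ * (a : ℝ)⁻¹ * ρ ^ 2 := by positivity
      have h6 : (0 : ℝ) ≤ (a : ℝ)⁻¹ * ρ ^ 2 := by positivity
      have h7 : (0 : ℝ) ≤ ρ := ρ.2
      linarith

end

end

noncomputable section

/-! ### The Neumann series -/

lemma conjEv_add (τ : ℝ) (Z Z' : Op) : conjEv τ (Z + Z') = conjEv τ Z + conjEv τ Z' := by
  rw [conjEv, mul_add, add_mul]; rfl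

lemma conjEv_smul (τ : ℝ) (c : ℂ) (Z : Op) : conjEv τ (c • Z) = c • conjEv τ Z := by
  rw [conjEv, mul_smul_comm, smul_mul_assoc]; rfl

lemma avg_add {w : ℝ → ℂ} (hw : Integrable w) (Z Z' : Op) : avg w (Z + Z') = avg w Z + avg w Z' := by
  ext1 f
  rw [add_apply, avg_apply hw, avg_apply hw, avg_apply hw,
    ← integral_add (integrable_smul_conjEv hw Z f) (integrable_smul_conjEv hw Z' f)]
  simp_rw [conjEv_add, add_apply, smul_add]

lemma avg_smul {w : ℝ → ℂ} (hw : Integrable w) (c : ℂ) (Z : Op) : avg w (c • Z) = c • avg w Z := by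
  ext1 f
  rw [smul_apply, avg_apply hw, avg_apply hw, ← integral_smul]
  simp_rw [conjEv_smul, smul_apply, smul_comm c]

lemma avg_mul_comm {w : ℝ → ℂ} (hw : Integrable w) {Z S : Op} (hS : ∀ t, S * Ev t = Ev t * S) :
    avg w (Z * S) = avg w Z * S := by
  ext1 f
  change _ = avg w Z (S f)
  rw [avg_apply hw, avg_apply hw]
  congr 1; ext1 τ
  have : S (Ev (-τ) f) = Ev (-τ) (S f) := congrArg (fun A : Op => A f) (hS (-τ))
  rw [conjEv_apply, conjEv_apply, ← this]
  rfl

/-- `X ↦ ∫₀^∞ e^{-ετ} e^{iτH₀} A X e^{-iτH₀} dτ`. -/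
def duhamel (A : Op) {ε : ℝ} (hε : 0 < ε) : Op →ₗ[ℂ] Op where
  toFun X := avg (wexp ε) (A * X)
  map_add' X Y := by rw [mul_add, avg_add (wexp_integrable hε)]
  map_smul' c X := by rw [mul_smul_comm, avg_smul (wexp_integrable hε), RingHom.id_apply]

lemma duhamel_apply (A : Op) {ε : ℝ} (hε : 0 < ε) (X : Op) :
    duhamel A hε X = avg (wexp ε) (A * X) := rfl

lemma duhamel_mul (A : Op) {ε : ℝ} (hε : 0 < ε) {S : Op} (hS : ∀ t, S * Ev t = Ev t * S) (X : Op) :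
    duhamel A hε (X * S) = duhamel A hε X * S := by
  rw [duhamel_apply, duhamel_apply, ← mul_assoc, avg_mul_comm (wexp_integrable hε) hS]

lemma duhamel_pow_mul (A : Op) {ε : ℝ} (hε : 0 < ε) {S : Op} (hS : ∀ t, S * Ev t = Ev t * S)
    {X : Op} (hX : X * S = X) (n : ℕ) : ((duhamel A hε) ^ n) X * S = ((duhamel A hε) ^ n) X := by
  induction n with
  | zero => simpa using hX
  | succ n ih =>
    rw [pow_succ', Module.End.mul_apply, ← duhamel_mul A hε hS, ih]

lemma duhamel_expansion (A : Op) {ε : ℝ} (hε : 0 < ε) {X B : Op}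
    (hX : X = B + Complex.I • duhamel A hε X) (N : ℕ) :
    X = ∑ n ∈ Finset.range N, Complex.I ^ n • ((duhamel A hε) ^ n) B +
      Complex.I ^ N • ((duhamel A hε) ^ N) X := by
  induction N with
  | zero => simp
  | succ N ih =>
    have h1 : ((duhamel A hε) ^ N) X = ((duhamel A hε) ^ N) B +
        Complex.I • ((duhamel A hε) ^ (N + 1)) X := by
      conv_lhs => rw [hX]
      rw [map_add, map_smul, pow_succ, Module.End.mul_apply]
    rw [h1, smul_add, smul_smul, ← pow_succ, ← add_assoc, ← Finset.sum_range_succ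
      (fun n => Complex.I ^ n • ((duhamel A hε) ^ n) B)] at ih
    exact ih

section
variable {b : OrthonormalBasis (Fin 3) ℝ E3} {V₀ : E3 → ℂ} {ι : Type} {ε : ι → ℝ} {S : Op}
  {e m₀ : NNReal}

/-- The bound on the Duhamel operator which the integration by parts provides at high frequency. -/
def IBPBound (b : OrthonormalBasis (Fin 3) ℝ E3) (V₀ : E3 → ℂ) (ε : ι → ℝ) (S : Op) (e : NNReal) :
    Prop :=
  ∀ (g : Gauge ι) (X : ι → Op) (c : NNReal), (∀ i, X i * S = X i) →
    (∀ l j, g.P (fun i => mulL (qf b V₀ l j) * X i) c) →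
    ∃ F : Fin 3 → Fin 3 → ι → Op, (∀ u, WBdd b u → ∀ i, mulL u * avg (wexp (ε i)) (mulL V₀ * X i) =
      ∑ l, ∑ j, mulL (qf b u l j) * F l j i) ∧ ∀ l j, g.P (F l j) (e * c)

/-- The multipliers `x_r^j x_m^l V` are dominated in phase space. -/
def PotDom (b : OrthonormalBasis (Fin 3) ℝ E3) (V₀ : E3 → ℂ) (m₀ : NNReal) : Prop :=
  WBdd b V₀ ∧ (∀ l j, WBdd b (qf b V₀ l j)) ∧
    ∀ (ι : Type) (r j m l : Fin 3), DomF (fun _ : ι => mulL (qf b (qf b V₀ m l) r j)) m₀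

lemma PotDom.dom (h : PotDom b V₀ m₀) (ι : Type) (m l : Fin 3) :
    DomF (fun _ : ι => mulL (qf b V₀ m l)) m₀ := by
  simpa [qf_zero] using h.2.2 ι 0 0 m l

lemma IBPBound.of_resolvent (hV : WBdd b V₀) (hε : ∀ i, 0 < ε i) {R : Op} {T : ι → Op}
    (hRS : IsPreResolvent R S) (hT : ∀ i, IsNeumann (ε i) R (T i)) (hTS : ∀ i, T i * S = S * T i)
    {a ρ : NNReal} (ha : 0 < a) (hQ : DomF (fun i => R * T i) ρ) :
    IBPBound b V₀ ε S (a + (ρ + 3 * (a⁻¹ * ρ)) + 2 * (a⁻¹ * ρ ^ 2 + 3 * (a⁻¹ * ρ ^ 2) +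
        3 * (a⁻¹ * a⁻¹ * ρ ^ 2))) := by
  intro g X c hX hXc
  exact ⟨fun l j i => ibpCoeff b V₀ (ε i) a (R * T i) (X i) l j,
    fun u hu i => ibpCoeff_eq hRS (hT i) (hTS i) (hX i) (hε i) hu hV ha,
    fun l j => g.ibpCoeff hε hXc hQ ha l j⟩

/-- When ε is bounded below no oscillation is needed: the weight e^{-ετ} itself has integral at most
1/ε₀. The operator sits in the component l = j = 0, whose weight is 1. -/
lemma IBPBound.of_large {ε₀ : NNReal} (hε₀ : 0 < ε₀) (hε : ∀ i, (ε₀ : ℝ) ≤ ε i) (S : Op) :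
    IBPBound b V₀ ε S ε₀⁻¹ := by
  intro g X c _ hXc
  have h0 : (0 : ℝ) < ε₀ := hε₀
  refine ⟨fun l j i => if l = 0 then (if j = 0 then avg (wexp (ε i)) (mulL V₀ * X i) else 0) else 0,
    fun u _ i => ?_, fun l j => ?_⟩
  · simp [qf_zero]
  · beta_reduce
    split_ifs
    · have hV : g.P (fun i => mulL V₀ * X i) c := by simpa [qf_zero] using hXc 0 0
      refine g.avg hV (fun i => wexp_integrable (h0.trans_le (hε i)))
        (w' := indicator (Ioi 0) fun τ => ENNReal.ofReal (Real.exp (-ε₀ * τ)))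
        (Measurable.indicator (by fun_prop) measurableSet_Ioi) (fun i τ => ?_) ?_
      · rw [wexp]
        by_cases hτ : τ ∈ Ioi (0 : ℝ)
        · rw [indicator_of_mem hτ, indicator_of_mem hτ, ← ofReal_norm, Complex.norm_real,
            Real.norm_of_nonneg (Real.exp_pos _).le]
          have : 0 < τ := hτ
          refine ENNReal.ofReal_le_ofReal (Real.exp_le_exp.2 ?_)
          nlinarith [hε i]
        · rw [indicator_of_notMem hτ, indicator_of_notMem hτ]; simp
      · rw [lintegral_indicator measurableSet_Ioi, ← ofReal_integral_eq_lintegral_ofReal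
          (integrable_exp_neg h0) (Eventually.of_forall fun τ => (Real.exp_pos _).le),
          integral_exp_mul_Ioi (by linarith : -(ε₀ : ℝ) < 0)]
        have : -Real.exp (-(ε₀ : ℝ) * 0) / -(ε₀ : ℝ) = (ε₀⁻¹ : NNReal) := by
          rw [mul_zero, Real.exp_zero, neg_div_neg_eq, one_div, NNReal.coe_inv]
        rw [this, ENNReal.ofReal_coe_nnreal]
    · exact g.mono g.zero (by positivity)
    · exact g.mono g.zero (by positivity)

/-- The bound is applied with u = x_m^k V, so that products x_l^j x_m^k V appear; this is why mixed
derivatives of the transform in two directions are assumed. The 9 counts the pairs (l, j). -/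
lemma IBPBound.step (h : IBPBound b V₀ ε S e) (hV : PotDom b V₀ m₀) (hε : ∀ i, 0 < ε i)
    (g : Gauge ι) {X : ι → Op} {c : NNReal} (hX : ∀ i, X i * S = X i)
    (hXc : ∀ l j, g.P (fun i => mulL (qf b V₀ l j) * X i) c) (m k : Fin 3) :
    g.P (fun i => mulL (qf b V₀ m k) * duhamel (mulL V₀) (hε i) (X i)) (9 * m₀ * e * c) := by
  obtain ⟨F, h1, h2⟩ := h g X c hX hXc
  simp_rw [duhamel_apply, h1 _ (hV.2.1 m k)]
  refine g.mono (g.sum_fin fun l => g.sum_fin fun j =>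
    g.mul_left (hV.2.2 ι l j m k) (h2 l j)) (le_of_eq (by ring))

lemma IBPBound.iterate (h : IBPBound b V₀ ε S e) (hV : PotDom b V₀ m₀) (hε : ∀ i, 0 < ε i)
    (hS : ∀ t, S * Ev t = Ev t * S)
    (g : Gauge ι) {X : ι → Op} {c : NNReal} (hX : ∀ i, X i * S = X i)
    (hXc : ∀ l j, g.P (fun i => mulL (qf b V₀ l j) * X i) c) (n : ℕ) : ∀ m k : Fin 3,
    g.P (fun i => mulL (qf b V₀ m k) * ((duhamel (mulL V₀) (hε i)) ^ n) (X i))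
      ((9 * m₀ * e) ^ n * c) := by
  induction n with
  | zero => simpa using hXc
  | succ n ih =>
    intro m k
    simp_rw [pow_succ', Module.End.mul_apply]
    refine g.mono (h.step hV hε g (fun i => duhamel_pow_mul _ (hε i) hS (hX i) n) ih m k)
      (le_of_eq (by ring))

/-- At high frequency the Neumann series converges in phase space. -/
lemma IBPBound.neumann (h : IBPBound b V₀ ε S e) (hV : PotDom b V₀ m₀) (hε : ∀ i, 0 < ε i)
    (hS : ∀ t, S * Ev t = Ev t * S) (hκ : 9 * m₀ * e < 1) {B : Op} (hB : B * S = B) {cB : NNReal}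
    (hBc : DomF (fun _ : ι => B) cB) {X : ι → Op} (hX : ∀ i, X i * S = X i)
    (hXB : ∀ i, X i = B + Complex.I • duhamel (mulL V₀) (hε i) (X i)) {K : NNReal}
    (hK : ∀ i, ‖X i‖ ≤ K) :
    ∃ (c : NNReal) (F : Fin 3 → Fin 3 → ι → Op), (∀ l j, DomF (F l j) c) ∧
      ∀ i, mulL V₀ * X i = ∑ l, ∑ j, mulL (qf b V₀ l j) * F l j i := by
  set κ := 9 * m₀ * e with hκd
  have hd0 : ∀ l j, DomF (fun _ : ι => mulL (qf b V₀ l j) * B) (m₀ * cB) := fun l j =>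
    (hV.dom ι l j).mul hBc
  -- The same iteration is run with two sizes. Phase-space mass is known for B only, and controls
  -- the terms of the series.
  have hdn := h.iterate hV hε hS (domGauge ι) (X := fun _ => B) (fun _ => hB) hd0
  -- The operator norm is also known for X itself, and shows that the remainder after N terms tends
  -- to 0.
  have hnX : ∀ l j, (normGauge ι).P (fun i => mulL (qf b V₀ l j) * X i) (m₀ * K) := fun l j =>
    (normGauge ι).mul_left (hV.dom ι l j) hK
  have hnn := h.iterate hV hε hS (normGauge ι) hX hnX
  have hsum : ∀ l j i, HasSum (fun n => Complex.I ^ n •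
      (mulL (qf b V₀ l j) * ((duhamel (mulL V₀) (hε i)) ^ n) B)) (mulL (qf b V₀ l j) * X i) := by
    intro l j i
    have hκ' : (κ : ℝ) < 1 := hκ
    have hs : Summable (fun n => Complex.I ^ n •
        (mulL (qf b V₀ l j) * ((duhamel (mulL V₀) (hε i)) ^ n) B)) := by
      refine Summable.of_norm_bounded (g := fun n => (κ : ℝ) ^ n * (m₀ * cB)) ?_ fun n => ?_
      · exact (summable_geometric_of_lt_one κ.2 hκ').mul_right _
      · rw [norm_smul, norm_pow, Complex.norm_I, one_pow, one_mul]
        have := DomF.norm_le (hdn n l j) i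
        exact_mod_cast this
    have hlim : Tendsto (fun N => ∑ n ∈ Finset.range N, Complex.I ^ n •
        (mulL (qf b V₀ l j) * ((duhamel (mulL V₀) (hε i)) ^ n) B)) atTop
        (𝓝 (mulL (qf b V₀ l j) * X i)) := by
      rw [tendsto_iff_norm_sub_tendsto_zero]
      refine squeeze_zero (fun _ => norm_nonneg _) (g := fun n => (κ : ℝ) ^ n * (m₀ * K)) (fun n => ?_) ?_
      · have e1 : mulL (qf b V₀ l j) * X i = ∑ n ∈ Finset.range n, Complex.I ^ n •
            (mulL (qf b V₀ l j) * ((duhamel (mulL V₀) (hε i)) ^ n) B) + Complex.I ^ n •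
            (mulL (qf b V₀ l j) * ((duhamel (mulL V₀) (hε i)) ^ n) (X i)) := by
          conv_lhs => rw [duhamel_expansion (mulL V₀) (hε i) (hXB i) n]
          rw [mul_add, Finset.mul_sum]
          simp_rw [mul_smul_comm]
        rw [norm_sub_rev, e1, add_sub_cancel_left, norm_smul, norm_pow, Complex.norm_I, one_pow,
          one_mul]
        have := hnn n l j i
        exact_mod_cast this
      · simpa using (tendsto_pow_atTop_nhds_zero_of_lt_one κ.2 hκ').mul_const ((m₀ : ℝ) * K)
    have := tendsto_nhds_unique hs.hasSum.tendsto_sum_nat hlim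
    rw [← this]; exact hs.hasSum
  have hdX : ∀ l j, DomF (fun i => mulL (qf b V₀ l j) * X i) (∑' n, κ ^ n * (m₀ * cB)) := by
    intro l j
    refine DomF.hasSum (X := fun n i => Complex.I ^ n •
      (mulL (qf b V₀ l j) * ((duhamel (mulL V₀) (hε i)) ^ n) B)) (fun n => ?_) ?_ (hsum l j)
    · refine ((hdn n l j).smul (a := fun _ => Complex.I ^ n) (k := 1) fun i => ?_).mono
        (le_of_eq (one_mul _))
      simp
    · exact (NNReal.summable_geometric hκ).mul_right _
  -- Once all x_l^j V X are known to be dominated, one more application of the bound gives the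
  -- factorisation of V D X; the term V B goes into the component l = j = 0.
  obtain ⟨F, hF1, hF2⟩ := h (domGauge ι) X _ hX hdX
  refine ⟨cB + 1 * (e * ∑' n, κ ^ n * (m₀ * cB)),
    fun l j i => (if l = 0 then (if j = 0 then B else 0) else 0) + Complex.I • F l j i,
    fun l j => ?_, fun i => ?_⟩
  · refine DomF.add ?_ ((hF2 l j).smul (a := fun _ => Complex.I) (k := 1) fun i => by simp)
    split_ifs
    · exact hBc
    · exact DomF.zero.mono (by positivity)
    · exact DomF.zero.mono (by positivity)
  · have := hF1 V₀ hV.1 i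
    conv_lhs => rw [hXB i]
    rw [mul_add, mul_smul_comm, duhamel_apply, this]
    simp only [mul_add, Finset.sum_add_distrib, mul_smul_comm, Finset.smul_sum]
    congr 1
    simp [qf_zero]

end

end

noncomputable section

/-! ### Smooth functions of the kinetic energy -/

lemma energy_contDiff (a : ℝ) : ContDiff ℝ (⊤ : ℕ∞) fun ξ : E3 => a * (2 * Real.pi * ‖ξ‖) ^ 2 := by
  simp only [mul_pow]
  exact contDiff_const.mul (contDiff_const.mul (contDiff_norm_sq ℝ))

lemma energy_compactSupport {ψ : ℝ → ℝ} {a L : ℝ} (ha : 0 < a) (h0 : ∀ lam ≥ L, ψ lam = 0) :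
    HasCompactSupport fun ξ : E3 => ((ψ (a * (2 * Real.pi * ‖ξ‖) ^ 2) : ℝ) : ℂ) := by
  refine HasCompactSupport.intro (isCompact_closedBall (0 : E3) (1 + |L| / a)) fun ξ hξ => ?_
  rw [mem_closedBall_zero_iff, not_le] at hξ
  have h1 : a + |L| < a * ‖ξ‖ := by
    have := (mul_lt_mul_iff_right₀ ha).2 hξ
    rwa [mul_add, mul_one, mul_div_cancel₀ _ ha.ne'] at this
  have h2 : 1 ≤ ‖ξ‖ := by
    have : 0 ≤ |L| / a := by positivity
    linarith
  have h4 : ‖ξ‖ ≤ (2 * Real.pi * ‖ξ‖) ^ 2 := by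
    have := Real.pi_gt_three
    calc ‖ξ‖ ≤ ‖ξ‖ ^ 2 := by nlinarith
      _ ≤ _ := pow_le_pow_left₀ (norm_nonneg _) (by nlinarith) 2
  rw [h0, Complex.ofReal_zero]
  exact ((le_abs_self L).trans (by linarith)).trans (mul_le_mul_of_nonneg_left h4 ha.le)

/-- The multiplier is a superposition of translations with density the Fourier transform of Ψ.
Replacing ξ by aξ only dilates the translations and keeps the density, so the mass does not depend
on a. -/
lemma exists_fmul_mass {Ψ : E3 → ℂ} (h1 : ContDiff ℝ (⊤ : ℕ∞) Ψ) (h2 : HasCompactSupport Ψ) :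
    ∃ c : NNReal, ∀ (a : ℝ) (ι : Type), DomF (fun _ : ι => fmul fun ξ => Ψ (a • ξ)) c := by
  let Φ : SchwartzMap E3 ℂ := h2.toSchwartzMap h1
  obtain ⟨C, hC⟩ := h1.continuous.bounded_above_of_compact_support h2
  have hk : Integrable (𝓕 Φ : SchwartzMap E3 ℂ) := SchwartzMap.integrable _
  have hΦ : ∀ ξ, Ψ ξ = ∫ y, (𝓕 Φ : SchwartzMap E3 ℂ) y *
      Complex.exp (Complex.I * (2 * Real.pi * inner ℝ y ξ : ℝ)) := fun ξ => by
    have h3 : Ψ ξ = 𝓕⁻ ((𝓕 Φ : SchwartzMap E3 ℂ) : E3 → ℂ) ξ := by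
      rw [← SchwartzMap.fourierInv_coe, FourierTransform.fourierInv_fourier_eq]; rfl
    rw [h3, Real.fourierInv_eq']
    congr 1; ext y
    rw [smul_eq_mul, mul_comm, mul_comm Complex.I]
  refine ⟨_, fun a ι => DomF.of_Weyl_integral hk (θ := fun y => (0, a • y)) (by fun_prop)
    (fun f g => ?_) ι⟩
  have hb : BddM (fun ξ => Ψ (a • ξ)) :=
    BddM.of_continuous (h1.continuous.comp (continuous_const_smul a)) fun x => hC _
  simp_rw [← shiftL_eq_Weyl]
  rw [inner_fmul, inner_mulL_integral hk
    (e := fun y ξ => Complex.exp (Complex.I * (2 * Real.pi * inner ℝ (a • y) ξ : ℝ))) (by fun_prop)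
    (fun y x => (norm_exp_I_mul _).le) hb fun ξ => ?_]
  · congr 1; ext y
    rw [shiftL, inner_fmul]
  · rw [hΦ]
    simp_rw [inner_smul_left, inner_smul_right]
    simp

/-- A smooth function which equals `1/λ` for `λ ≥ 1/2` and vanishes for `λ ≤ 1/4`. -/
def cutInv (lam : ℝ) : ℝ := Real.smoothTransition (4 * lam - 1) / lam

lemma cutInv_of_large {lam : ℝ} (h : 1 / 2 ≤ lam) : cutInv lam = 1 / lam := by
  rw [cutInv, Real.smoothTransition.one_of_one_le (by linarith)]

lemma cutInv_of_small {lam : ℝ} (h : lam ≤ 1 / 4) : cutInv lam = 0 := by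
  rw [cutInv, Real.smoothTransition.zero_of_nonpos (by linarith), zero_div]

lemma cutInv_contDiff : ContDiff ℝ (⊤ : ℕ∞) cutInv := by
  rw [contDiff_iff_contDiffAt]
  intro x
  rcases lt_or_ge x (1 / 4) with hx | hx
  · refine (contDiffAt_const (c := (0 : ℝ))).congr_of_eventuallyEq ?_
    filter_upwards [Iio_mem_nhds hx] with y hy using cutInv_of_small (le_of_lt hy)
  · refine ContDiffAt.div ?_ contDiffAt_id (show x ≠ 0 from (by linarith : 0 < x).ne')
    exact (Real.smoothTransition.contDiff.comp (by fun_prop : ContDiff ℝ _ fun x : ℝ => 4 * x - 1)).contDiffAt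

lemma mul_cutInv (lam : ℝ) : |lam * cutInv lam| ≤ 1 := by
  rw [cutInv]
  rcases eq_or_ne lam 0 with rfl | h
  · simp
  · rw [mul_div_cancel₀ _ h, abs_of_nonneg (Real.smoothTransition.nonneg _)]
    exact Real.smoothTransition.le_one _

lemma abs_cutInv_le (lam : ℝ) : |cutInv lam| ≤ 4 := by
  rcases le_total lam (1 / 4) with h | h
  · rw [cutInv_of_small h]; norm_num
  · have := mul_cutInv lam
    rw [abs_mul, abs_of_nonneg (by linarith : (0 : ℝ) ≤ lam)] at this
    nlinarith [abs_nonneg (cutInv lam)]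

/-- The symbol of `a (aH₀)⁻¹`, cut off at low energy. -/
def cutSym (a : ℝ) (ξ : E3) : ℂ := ((a * cutInv (a * (2 * Real.pi * ‖ξ‖) ^ 2) : ℝ) : ℂ)

lemma cutSym_norm_le {a : ℝ} (ha : 0 ≤ a) (ξ : E3) : ‖cutSym a ξ‖ ≤ 4 * a := by
  rw [cutSym, Complex.norm_real, norm_mul, Real.norm_of_nonneg ha, mul_comm]
  exact mul_le_mul_of_nonneg_right (abs_cutInv_le _) ha

lemma cutSym_bdd {a : ℝ} (ha : 0 ≤ a) : BddM (cutSym a) :=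
  BddM.of_continuous (by
    have := cutInv_contDiff.continuous
    unfold cutSym; fun_prop) (cutSym_norm_le ha)

/-- The symbol behaves like 1/λ and has no compact support, so it is decomposed dyadically: ψ(λ) =
`cutInv` λ - ¼ `cutInv` (λ/4) vanishes for λ ≥ 2, where both terms are 1/λ. The cut resolvent is the
sum of the pieces 4^{-n} a ψ(4^{-n} a λ), of masses 4^{-n} a c. Linearity in a is what later turns a
= M^{-2} into smallness. -/
lemma exists_cutSym_mass : ∃ c : NNReal, 0 < c ∧ ∀ (a : NNReal) (ι : Type),
    DomF (fun _ : ι => fmul (cutSym a)) (c * a) := by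
  let ψ : ℝ → ℝ := fun lam => cutInv lam - 4⁻¹ * cutInv (4⁻¹ * lam)
  have hψ : ContDiff ℝ (⊤ : ℕ∞) ψ := cutInv_contDiff.sub (contDiff_const.mul
    (cutInv_contDiff.comp (contDiff_const.mul contDiff_id)))
  have hψ0 : ∀ lam ≥ 2, ψ lam = 0 := fun lam h => by
    have h' : (2 : ℝ) ≤ lam := h
    simp only [ψ]
    rw [cutInv_of_large (by linarith), cutInv_of_large (by linarith)]
    field_simp; ring
  obtain ⟨c, hc⟩ := exists_fmul_mass (Ψ := fun ξ : E3 => ((ψ (1 * (2 * Real.pi * ‖ξ‖) ^ 2) : ℝ) : ℂ))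
    (Complex.ofRealCLM.contDiff.comp (hψ.comp (energy_contDiff 1)))
    (energy_compactSupport one_pos hψ0)
  have hdiff : ∀ (a : ℝ) (ξ : E3), cutSym a ξ = (a : ℂ) *
      ((ψ (a * (2 * Real.pi * ‖ξ‖) ^ 2) : ℝ) : ℂ) + cutSym (4⁻¹ * a) ξ := fun a ξ => by
    simp only [cutSym, ψ, ← Complex.ofReal_mul, ← Complex.ofReal_add]
    congr 1
    rw [mul_assoc 4⁻¹ a]; ring_nf
  have hmass : ∀ (a : NNReal) (ι : Type), DomF (fun _ : ι => (a : ℂ) •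
      fmul fun ξ => ((ψ (a * (2 * Real.pi * ‖ξ‖) ^ 2) : ℝ) : ℂ)) (a * c) := fun a ι => by
    refine DomF.smul (a := fun _ => (a : ℂ)) ?_ fun i => ?_
    -- The energy is quadratic in ξ, so the scale a in energy is √a in frequency.
    · convert hc (Real.sqrt a) ι using 6 with _ ξ
      rw [norm_smul, Real.norm_of_nonneg (Real.sqrt_nonneg _), one_mul, mul_left_comm, mul_pow (Real.sqrt _),
        Real.sq_sqrt (NNReal.coe_nonneg a)]
    · simp
  have hstep : ∀ a : NNReal, fmul (cutSym a) = (a : ℂ) •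
      fmul (fun ξ => ((ψ (a * (2 * Real.pi * ‖ξ‖) ^ 2) : ℝ) : ℂ)) + fmul (cutSym (4⁻¹ * a)) := by
    intro a
    have hb : BddM (fun ξ : E3 => ((ψ (a * (2 * Real.pi * ‖ξ‖) ^ 2) : ℝ) : ℂ)) := by
      refine BddM.of_continuous (by have := hψ.continuous; fun_prop) (C := 5) fun ξ => ?_
      rw [Complex.norm_real]
      refine (norm_sub_le _ _).trans ?_
      rw [norm_mul, Real.norm_eq_abs, Real.norm_eq_abs, Real.norm_eq_abs]
      have h1 := abs_cutInv_le (a * (2 * Real.pi * ‖ξ‖) ^ 2)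
      have h2 := abs_cutInv_le (4⁻¹ * (a * (2 * Real.pi * ‖ξ‖) ^ 2))
      rw [abs_of_pos (by norm_num : (0 : ℝ) < 4⁻¹)]
      linarith
    rw [← fmul_smul _ hb, ← fmul_add (hb.smul _) (cutSym_bdd (by positivity))]
    congr 1; ext ξ; exact hdiff _ ξ
  have hN : ∀ (a : NNReal) (N : ℕ), fmul (cutSym a) - ∑ n ∈ Finset.range N,
      (((4⁻¹ : NNReal) ^ n * a : NNReal) : ℂ) • fmul (fun ξ =>
        ((ψ (((4⁻¹ : NNReal) ^ n * a : NNReal) * (2 * Real.pi * ‖ξ‖) ^ 2) : ℝ) : ℂ)) =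
      fmul (cutSym ((4⁻¹ : NNReal) ^ N * a : NNReal)) := by
    intro a N
    induction N with
    | zero => simp
    | succ N ih =>
      rw [Finset.sum_range_succ, ← sub_sub, ih, hstep, add_sub_cancel_left]
      congr 2; push_cast; ring
  have hgeo : Summable fun n : ℕ => (4⁻¹ : NNReal) ^ n :=
    NNReal.summable_geometric (inv_lt_one_of_one_lt₀ (by norm_num))
  -- The added 1 makes the constant positive, so that it can be divided by later.
  refine ⟨(∑' n : ℕ, (4⁻¹ : NNReal) ^ n) * c + 1, by positivity, fun a ι => ?_⟩
  have key : DomF (fun _ : ι => fmul (cutSym a)) (∑' n : ℕ, ((4⁻¹ : NNReal) ^ n * a * c)) := by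
    refine DomF.hasSum (fun n => hmass ((4⁻¹ : NNReal) ^ n * a) ι) ((hgeo.mul_right a).mul_right c)
      fun _ => ?_
    have hs : Summable fun n : ℕ => (((4⁻¹ : NNReal) ^ n * a : NNReal) : ℂ) • fmul (fun ξ =>
        ((ψ (((4⁻¹ : NNReal) ^ n * a : NNReal) * (2 * Real.pi * ‖ξ‖) ^ 2) : ℝ) : ℂ)) := by
      refine Summable.of_norm_bounded (g := fun n : ℕ => (((4⁻¹ : NNReal) ^ n * a * c : NNReal) : ℝ))
        (NNReal.summable_coe.2 ((hgeo.mul_right a).mul_right c)) fun n => ?_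
      exact DomF.norm_le (hmass ((4⁻¹ : NNReal) ^ n * a) Unit) ()
    suffices h : Tendsto _ _ (𝓝 (fmul (cutSym a))) by
      have := hs.hasSum
      rwa [tendsto_nhds_unique hs.hasSum.tendsto_sum_nat h] at this
    rw [tendsto_iff_norm_sub_tendsto_zero]
    refine squeeze_zero (fun _ => norm_nonneg _)
      (g := fun N => 4 * (((4⁻¹ : NNReal) ^ N * a : NNReal) : ℝ)) (fun N => ?_) ?_
    · rw [norm_sub_rev, hN]
      exact fmul_norm_le (cutSym_norm_le (NNReal.coe_nonneg _))
    · have := ((tendsto_pow_atTop_nhds_zero_of_lt_one (r := (4⁻¹ : ℝ)) (by norm_num)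
        (by norm_num)).mul_const (a : ℝ)).const_mul 4
      simpa using this
  refine key.mono ?_
  rw [NNReal.tsum_mul_right, NNReal.tsum_mul_right]
  calc _ ≤ (∑' n : ℕ, (4⁻¹ : NNReal) ^ n) * a * c + a := le_self_add
    _ = _ := by ring

/-! ### High frequencies -/

/-- `β(H₀ > M²)`. -/
def highOp (β : ℝ → ℝ) (M : ℝ) : Op := fmul fun ξ => (β ((2 * Real.pi * ‖ξ‖) ^ 2 / M ^ 2) : ℂ)

section
variable {β : ℝ → ℝ} (hβ : IsCutoff β)
include hβ

lemma highOp_bdd (M : ℝ) : BddM fun ξ : E3 => (β ((2 * Real.pi * ‖ξ‖) ^ 2 / M ^ 2) : ℂ) := by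
  obtain ⟨C, hC⟩ := isCompact_Icc.exists_bound_of_continuousOn (s := Icc 0 1) hβ.1.continuous.continuousOn
  refine BddM.of_continuous (by have := hβ.1.continuous; fun_prop) (C := max C 1) fun ξ => ?_
  rw [Complex.norm_real]
  rcases le_total ((2 * Real.pi * ‖ξ‖) ^ 2 / M ^ 2) 1 with h | h
  · exact (hC _ ⟨by positivity, h⟩).trans (le_max_left _ _)
  · rw [hβ.2.2 _ h]; simp

lemma highFreq_eq (M : ℝ) (f : L2) : highFreq β M f = highOp β M f :=
  (fmul_apply_eq (highOp_bdd hβ M) f).symm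

lemma highOp_adjoint (M : ℝ) : ContinuousLinearMap.adjoint (highOp β M) = highOp β M := by
  rw [highOp, fmul_adjoint (highOp_bdd hβ M)]
  congr 1; ext ξ; exact Complex.conj_ofReal _

/-- β - 1 vanishes at high energy, so B is the identity plus a multiplier with smooth compactly
supported symbol. The mass may depend on β and M: it only multiplies the Neumann series and does not
affect its convergence. -/
lemma exists_highOp_mass {M : ℝ} (hM : 0 < M) :
    ∃ c : NNReal, ∀ ι : Type, DomF (fun _ : ι => highOp β M) c := by
  have h0 : ∀ lam ≥ 1, β lam - 1 = 0 := fun lam h => by rw [hβ.2.2 lam h, sub_self]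
  have h1 : ContDiff ℝ (⊤ : ℕ∞) fun ξ : E3 =>
      ((β ((M ^ 2)⁻¹ * (2 * Real.pi * ‖ξ‖) ^ 2) - 1 : ℝ) : ℂ) :=
    Complex.ofRealCLM.contDiff.comp ((hβ.1.comp (energy_contDiff _)).sub contDiff_const)
  have h2 := energy_compactSupport (a := (M ^ 2)⁻¹) (ψ := fun lam => β lam - 1) (by positivity) h0
  obtain ⟨c, hc⟩ := exists_fmul_mass h1 h2
  obtain ⟨C, hC⟩ := h1.continuous.bounded_above_of_compact_support h2
  refine ⟨c + 1, fun ι => ?_⟩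
  have h3 := (hc 1 ι).add DomF.one
  convert h3 using 2
  rw [← one_smul ℂ (1 : Op), ← fmul_const, ← fmul_add ?_ (BddM.const _), highOp]
  swap
  · exact BddM.of_continuous (h1.continuous.comp (continuous_const_smul (1 : ℝ))) fun _ => hC _
  congr 1; ext ξ
  rw [one_smul, Complex.ofReal_sub, Complex.ofReal_one, sub_add_cancel, inv_mul_eq_div]

/-- On the support of β(λ/M²) one has λ/M² ≥ 1/2, where the cut resolvent is exactly 1/λ. -/
lemma highOp_mul_cut (M : ℝ) : highOp β M *
    fmul (fun ξ => (((2 * Real.pi * ‖ξ‖) ^ 2 : ℝ) : ℂ) * cutSym ((M ^ 2)⁻¹) ξ) = highOp β M := by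
  have e : ∀ ξ, (((2 * Real.pi * ‖ξ‖) ^ 2 : ℝ) : ℂ) * cutSym ((M ^ 2)⁻¹) ξ =
      (((M ^ 2)⁻¹ * (2 * Real.pi * ‖ξ‖) ^ 2 * cutInv ((M ^ 2)⁻¹ * (2 * Real.pi * ‖ξ‖) ^ 2) : ℝ) : ℂ) :=
    fun ξ => by rw [cutSym, ← Complex.ofReal_mul]; congr 1; ring
  simp_rw [e]
  rw [highOp, fmul_mul (highOp_bdd hβ M) (BddM.of_continuous (by
    have := cutInv_contDiff.continuous; fun_prop) (C := 1) fun ξ => by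
      rw [Complex.norm_real]; exact mul_cutInv _)]
  congr 1; ext ξ
  rcases lt_or_ge ((2 * Real.pi * ‖ξ‖) ^ 2 / M ^ 2) (1 / 2) with h | h
  · rw [hβ.2.1 _ h]; simp
  · rw [inv_mul_eq_div, cutInv_of_large h, mul_one_div_cancel (by linarith)]; simp

end

end

noncomputable section

/-! ### High-frequency factorisation of the Abel means -/

/-- The geometric series for (1 - iεR)⁻¹ has ratio at most ε₀d = 1/2 in mass as well as in norm,
uniformly in ε ≤ ε₀; multiplied by R its mass sums to 2d. -/
lemma exists_isNeumann {R S : Op} {d ε₀ : NNReal} (hR : ∀ ι : Type, DomF (fun _ : ι => R) d)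
    (hRS : IsPreResolvent R S) (hd : ε₀ * d = 2⁻¹) :
    ∃ T : {ε : ℝ // 0 < ε ∧ ε ≤ ε₀} → Op, (∀ i, IsNeumann i.1 R (T i)) ∧ (∀ i, T i * S = S * T i) ∧
      DomF (fun i => R * T i) (2 * d) := by
  have hRn : ‖R‖ ≤ d := DomF.norm_le (hR Unit) ()
  have hn : ∀ i : {ε : ℝ // 0 < ε ∧ ε ≤ ε₀}, ‖(Complex.I * (i : ℝ)) • R‖ < 1 := fun i => by
    rw [norm_smul, norm_mul, Complex.norm_I, one_mul, Complex.norm_real, Real.norm_of_nonneg i.2.1.le]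
    have h1 : (ε₀ : ℝ) * d = 2⁻¹ := by rw [← NNReal.coe_mul, hd]; simp
    have := mul_le_mul i.2.2 hRn (norm_nonneg _) ε₀.2
    exact lt_of_le_of_lt (this.trans h1.le) (by norm_num)
  have hs := fun i => summable_geometric_of_norm_lt_one (hn i)
  have hcomm : ∀ (Z : Op), R * Z = Z * R → ∀ i : {ε : ℝ // 0 < ε ∧ ε ≤ ε₀}, (∑' n : ℕ, ((Complex.I * (i : ℝ)) • R) ^ n) * Z =
      Z * ∑' n : ℕ, ((Complex.I * (i : ℝ)) • R) ^ n := fun Z hZ i =>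
    Commute.tsum_left Z fun n => (Commute.smul_left hZ _).pow_left n
  refine ⟨fun i => ∑' n : ℕ, ((Complex.I * (i : ℝ)) • R) ^ n, fun i => ⟨fun t => ?_, ?_⟩,
    fun i => ?_, ?_⟩
  · exact hcomm _ (hRS.comm t) i
  · have := (hs i).one_sub_mul_tsum_pow
    rw [sub_mul, one_mul, smul_mul_assoc, sub_eq_iff_eq_add] at this
    exact this
  · exact hcomm _ hRS.comm_RS i
  · have hpow : ∀ n : ℕ, DomF (fun _ : {ε : ℝ // 0 < ε ∧ ε ≤ ε₀} => R ^ (n + 1)) (d ^ (n + 1)) := by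
      intro n
      induction n with
      | zero => simpa using hR _
      | succ n ih => simp_rw [pow_succ _ (n + 1)]; exact ih.mul (hR _)
    have hterm : ∀ n : ℕ, DomF (fun i : {ε : ℝ // 0 < ε ∧ ε ≤ ε₀} =>
        R * ((Complex.I * (i : ℝ)) • R) ^ n) (2⁻¹ ^ n * d) := by
      intro n
      have h1 := (hpow n).smul (a := fun i => (Complex.I * (i : ℝ)) ^ n) (k := ε₀ ^ n) fun i => by
        rw [norm_pow, norm_mul, Complex.norm_I, one_mul, Complex.norm_real,
          Real.norm_of_nonneg i.2.1.le, NNReal.coe_pow]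
        exact pow_le_pow_left₀ i.2.1.le i.2.2 n
      convert h1 using 1
      · ext1 i; rw [smul_pow, mul_smul_comm, pow_succ']
      · rw [← hd]; ring
    have hgeo : Summable fun n : ℕ => (2⁻¹ : NNReal) ^ n :=
      NNReal.summable_geometric (inv_lt_one_of_one_lt₀ (by norm_num))
    refine (DomF.hasSum hterm (hgeo.mul_right d) fun i => (hs i).hasSum.mul_left R).mono (le_of_eq ?_)
    rw [NNReal.tsum_mul_right, NNReal.tsum_geometric (inv_lt_one_of_one_lt₀ (by norm_num))]
    congr 1
    rw [← NNReal.coe_inj]; push_cast [NNReal.coe_sub (show (2⁻¹ : NNReal) ≤ 1 from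
      (inv_lt_one_of_one_lt₀ (by norm_num)).le)]; norm_num

lemma DomF.dite {ι : Type} {p : ι → Prop} [DecidablePred p] {X : {i // p i} → Op}
    {Y : {i // ¬ p i} → Op} {c c' : NNReal} (h : DomF X c) (h' : DomF Y c') :
    DomF (fun i => if hi : p i then X ⟨i, hi⟩ else Y ⟨i, hi⟩) (c + c') := by
  obtain ⟨μ, h1, h2⟩ := h
  obtain ⟨ν, h3, h4⟩ := h'
  refine ⟨μ + ν, ?_, fun i => ?_⟩
  · rw [Measure.add_apply, ENNReal.coe_add]
    exact add_le_add h1 h3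
  · beta_reduce
    split_ifs with hi
    · exact (h2 _).mono (Measure.le_add_right le_rfl)
    · exact (h4 _).mono (Measure.le_add_left le_rfl)

variable {b : OrthonormalBasis (Fin 3) ℝ E3} {V₀ : E3 → ℂ} {m₀ : NNReal}

/-- At high frequency, `V Ω_ε β(H₀ > M²)` is a sum of products of `x_l^j V` with operators which are
dominated in phase space uniformly in `ε`. -/
theorem exists_factorisation (hV : PotDom b V₀ m₀) (hA : SymOp (mulL V₀)) :
    ∃ M₀ : ℝ, 0 < M₀ ∧ ∀ β : ℝ → ℝ, IsCutoff β → ∀ M ≥ M₀,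
      ∃ (c : NNReal) (F : Fin 3 → Fin 3 → {ε : ℝ // 0 < ε} → Op), (∀ l j, DomF (F l j) c) ∧
        ∀ i : {ε : ℝ // 0 < ε}, mulL V₀ * (abelOp (mulL V₀) i * highOp β M) =
          ∑ l, ∑ j, mulL (qf b V₀ l j) * F l j i := by
  classical
  obtain ⟨c, hc, hmass⟩ := exists_cutSym_mass
  -- The bound of `Gauge.ibpCoeff` at a = 1/M, ρ = 2c/M² and M ≥ 1 is at most C/M. The threshold 1 +
  -- 9 m₀ C then makes the ratio 9 m₀ C/M of the Neumann series less than 1, independently of β.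
  set C : NNReal := 1 + 8 * c + 56 * c ^ 2 with hC
  refine ⟨((1 + 9 * m₀ * C : NNReal) : ℝ), by positivity, fun β hβ M' hM' => ?_⟩
  have hM0' : (0 : ℝ) < M' := lt_of_lt_of_le (by positivity) hM'
  obtain ⟨M, rfl⟩ : ∃ M : NNReal, (M : ℝ) = M' := ⟨⟨M', hM0'.le⟩, rfl⟩
  have hM : 1 + 9 * m₀ * C ≤ M := by exact_mod_cast hM'
  have hM0 : 0 < M := by exact_mod_cast hM0'
  have hM1 : 1 ≤ M := le_self_add.trans hM
  have hMinv : M⁻¹ ≤ 1 := inv_le_one_of_one_le₀ hM1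
  have hκ : 9 * m₀ * (C * M⁻¹) < 1 := by
    rw [← mul_assoc, ← div_eq_mul_inv, div_lt_one hM0]
    exact lt_of_lt_of_le (lt_add_of_pos_left _ one_pos) hM
  set R : Op := fmul (cutSym ((M : ℝ) ^ 2)⁻¹) with hRd
  set S : Op := fmul (fun ξ => (((2 * Real.pi * ‖ξ‖) ^ 2 : ℝ) : ℂ) * cutSym ((M : ℝ) ^ 2)⁻¹ ξ) with hSd
  have hRS : IsPreResolvent R S := by
    refine isPreResolvent_fmul (C := 1) (cutSym_bdd (by positivity)) fun ξ => ?_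
    rw [cutSym, ← Complex.ofReal_mul, Complex.norm_real, ← mul_assoc, mul_comm ((2 * Real.pi * ‖ξ‖) ^ 2)]
    exact mul_cutInv _
  have hR : ∀ ι : Type, DomF (fun _ : ι => R) (c * (M ^ 2)⁻¹) := fun ι => by
    have := hmass (M ^ 2)⁻¹ ι
    rwa [NNReal.coe_inv, NNReal.coe_pow] at this
  -- The cut resolvent has mass c/M²; this is the value of ε₀ for which ε₀ times that mass equals
  -- 1/2. Below it the resolvent argument works, above it the crude bound 1/ε₀ = 2c/M² is already
  -- small enough.
  set ε₀ : NNReal := 2⁻¹ * M ^ 2 * c⁻¹ with hε₀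
  have hε₀0 : 0 < ε₀ := by positivity
  have hd : ε₀ * (c * (M ^ 2)⁻¹) = 2⁻¹ := by
    rw [hε₀]; field_simp
  obtain ⟨T, hT, hTS, hRT⟩ := exists_isNeumann hR hRS hd
  have hB : highOp β M * S = highOp β M := highOp_mul_cut hβ M
  obtain ⟨cB, hcB⟩ := exists_highOp_mass hβ hM0'
  have hX : ∀ ε : ℝ, abelOp (mulL V₀) ε * highOp β M * S = abelOp (mulL V₀) ε * highOp β M := fun ε => by
    rw [mul_assoc, hB]
  have hcomm : ∀ t, highOp β M * Ev t = Ev t * highOp β M := fun t =>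
    fmul_comm (highOp_bdd hβ M) (symE_bdd t)
  have hXB : ∀ (ε : ℝ) (hε : 0 < ε), abelOp (mulL V₀) ε * highOp β M = highOp β M + Complex.I •
      duhamel (mulL V₀) hε (abelOp (mulL V₀) ε * highOp β M) := fun ε hε => by
    rw [duhamel_apply, ← mul_assoc, avg_mul_comm (wexp_integrable hε) hcomm, ← smul_mul_assoc]
    conv_lhs => rw [abelOp_fix hA hε, add_mul, one_mul]
  have hK : ∀ ε : ℝ, ‖abelOp (mulL V₀) ε * highOp β M‖ ≤ cB := fun ε => by
    refine (norm_mul_le _ _).trans ?_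
    have h1 := abelOp_norm_le (A := mulL V₀) ε
    have h2 := DomF.norm_le (hcB Unit) ()
    exact (mul_le_mul h1 h2 (norm_nonneg _) zero_le_one).trans_eq (one_mul _)
  have hsmall : IBPBound b V₀ (fun i : {ε : ℝ // 0 < ε ∧ ε ≤ ε₀} => (i : ℝ)) S (C * M⁻¹) := by
    -- Cutting at a = 1/M balances the short-time contribution a against ρ/a, where ρ is of order
    -- M^{-2}.
    have h := IBPBound.of_resolvent (a := M⁻¹) hV.1 (fun i => i.2.1) hRS hT hTS (by positivity) hRT
    intro g X c' h1 h2
    obtain ⟨F, h3, h4⟩ := h g X c' h1 h2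
    refine ⟨F, h3, fun l j => g.mono (h4 l j) (mul_le_mul' ?_ le_rfl)⟩
    calc _ = M⁻¹ * (1 + 2 * c * M⁻¹ + 6 * c + 32 * c ^ 2 * (M⁻¹ * M⁻¹) + 24 * c ^ 2 * M⁻¹) := by
          field_simp; ring
      _ ≤ M⁻¹ * (1 + 2 * c * 1 + 6 * c + 32 * c ^ 2 * (1 * 1) + 24 * c ^ 2 * 1) := by gcongr
      _ = C * M⁻¹ := by rw [hC]; ring
  have hlarge : IBPBound b V₀ (fun i : {ε : {ε : ℝ // 0 < ε} // ¬ (ε : ℝ) ≤ ε₀} => (i.1 : ℝ)) S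
      (C * M⁻¹) := by
    have h := IBPBound.of_large (b := b) (V₀ := V₀) hε₀0
      (ε := fun i : {ε : {ε : ℝ // 0 < ε} // ¬ (ε : ℝ) ≤ ε₀} => (i.1 : ℝ)) (fun i => (not_le.1 i.2).le) S
    intro g X c' h1 h2
    obtain ⟨F, h3, h4⟩ := h g X c' h1 h2
    refine ⟨F, h3, fun l j => g.mono (h4 l j) (mul_le_mul' ?_ le_rfl)⟩
    calc ε₀⁻¹ = M⁻¹ * (2 * c * M⁻¹) := by rw [hε₀]; field_simp
      _ ≤ M⁻¹ * (2 * c * 1) := by gcongr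
      _ ≤ M⁻¹ * (2 * c * 1 + (1 + 6 * c + 56 * c ^ 2)) := mul_le_mul' le_rfl le_self_add
      _ = C * M⁻¹ := by rw [hC]; ring
  obtain ⟨c1, F1, hF1, hF1'⟩ := hsmall.neumann hV (fun i => i.2.1) hRS.comm' hκ hB (hcB _)
    (X := fun i => abelOp (mulL V₀) i.1 * highOp β M)
    (fun i => hX i) (fun i => hXB _ i.2.1) fun i => hK i
  obtain ⟨c2, F2, hF2, hF2'⟩ := hlarge.neumann hV (fun i => i.1.2) hRS.comm' hκ hB (hcB _)
    (fun i => hX i.1) (fun i => hXB _ i.1.2) fun i => hK i.1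
  refine ⟨c1 + c2, fun l j i => if hi : (i : ℝ) ≤ ε₀ then F1 l j ⟨i, i.2, hi⟩ else F2 l j ⟨i, hi⟩,
    fun l j => ?_, fun i => ?_⟩
  · exact ((hF1 l j).comp fun i : {i : {ε : ℝ // 0 < ε} // (i : ℝ) ≤ ε₀} => ⟨i.1, i.1.2, i.2⟩).dite (hF2 l j)
  · by_cases hi : (i : ℝ) ≤ ε₀
    · simp only [hi, dif_pos]
      exact hF1' ⟨i, i.2, hi⟩
    · simp only [hi, dif_neg, not_false_eq_true]
      exact hF2' ⟨i, hi⟩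

end

noncomputable section

/-! ### The operators of the statement -/

section
variable {V : E3 → ℝ} {V₀ : E3 → ℂ}

lemma potOp_eq (hV : (fun x => (V x : ℂ)) =ᵐ[volume] V₀) (hb : BddM V₀) (f : L2) :
    potOp V f = mulL V₀ f := by
  rw [potOp, mulOp_congr hV, mulL_apply hb]

lemma symOp_mulL (hb : BddM V₀) (hr : ∀ x, (starRingEnd ℂ) (V₀ x) = V₀ x) : SymOp (mulL V₀) :=
  fun f g => by rw [← mulL_inner_left hb]; simp_rw [hr]

/-- A Duhamel solution exists and is unique, so the choice in the definition of the propagator is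
forced and the default value 0 never occurs. -/
lemma propagator_eq (hV : (fun x => (V x : ℂ)) =ᵐ[volume] V₀) (hb : BddM V₀)
    (hA : SymOp (mulL V₀)) (t s : ℝ) (f : L2) : propagator V t s f = Gp (mulL V₀) (t - s) f := by
  have hsol : ∀ ψ, IsSchrodingerSolution V s f ψ ↔ IsSol (mulL V₀) s f ψ := fun ψ => by
    simp only [IsSchrodingerSolution, IsSol, freeEvolution_eq, potOp_eq hV hb]
  have h : ∃ ψ, IsSchrodingerSolution V s f ψ := ⟨_, (hsol _).2 (Gp_isSol hA s f)⟩
  rw [propagator, dif_pos h]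
  exact ((hsol _).1 h.choose_spec).eq hA t

lemma waveAt_eq (hV : (fun x => (V x : ℂ)) =ᵐ[volume] V₀) (hb : BddM V₀)
    (hA : SymOp (mulL V₀)) (t : ℝ) (f : L2) : waveAt V t f = Om (mulL V₀) t f := by
  rw [waveAt, propagator_eq hV hb hA, freeEvolution_eq, Om_apply, zero_sub]

lemma abelWave_eq (hV : (fun x => (V x : ℂ)) =ᵐ[volume] V₀) (hb : BddM V₀)
    (hA : SymOp (mulL V₀)) {ε : ℝ} (hε : 0 < ε) (f : L2) :
    abelWave V ε f = abelOp (mulL V₀) ε f := by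
  rw [abelWave, abelOp_eq hA hε]
  simp_rw [waveAt_eq hV hb hA, freeEvolution_eq, potOp_eq hV hb, neg_neg, conjEv_apply]

end

/-! ### Existence of the wave operator -/

lemma integral_norm_mul_le {u v : E3 → ℂ} (hu : MemLp u 2) (hv : MemLp v 2) :
    Integrable (fun x => u x * v x) ∧
      ∫ x, ‖u x * v x‖ ≤ (eLpNorm u 2 volume).toReal * (eLpNorm v 2 volume).toReal := by
  have h1 : Integrable (fun x => u x * v x) := hu.integrable_mul hv
  refine ⟨h1, ?_⟩
  have h2 := eLpNorm_smul_le_mul_eLpNorm (p := 2) (q := 2) (r := 1) hv.1 hu.1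
  rw [integral_norm_eq_lintegral_enorm h1.1, ← ENNReal.toReal_mul]
  refine ENNReal.toReal_mono (ENNReal.mul_ne_top hu.2.ne hv.2.ne) ?_
  rwa [eLpNorm_one_eq_lintegral_enorm] at h2

lemma memLp_two_of_integrable {u : E3 → ℂ} (h : Integrable u) (hb : BddM u) : MemLp u 2 := by
  obtain ⟨hm, C, hC⟩ := hb
  rw [memLp_two_iff_integrable_sq_norm hm]
  refine (h.norm.mul_const C).mono' (hm.norm.pow 2) (Eventually.of_forall fun x => ?_)
  rw [Real.norm_of_nonneg (by positivity), pow_two]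
  exact mul_le_mul_of_nonneg_left (hC x) (norm_nonneg _)

/-- The constant of the dispersive estimate. -/
def dispC (τ : ℝ) : ℝ := ((4 * Real.pi * |τ|) ^ (3 / 2 : ℝ))⁻¹

lemma dispC_nonneg (τ : ℝ) : 0 ≤ dispC τ := by unfold dispC; positivity

lemma dispC_integrableOn {δ : ℝ} (hδ : 0 < δ) : IntegrableOn dispC (Ioi δ) := by
  have h : IntegrableOn (fun t : ℝ => (4 * Real.pi) ^ (-(3 / 2) : ℝ) * t ^ (-(3 / 2) : ℝ)) (Ioi δ) :=
    (integrableOn_Ioi_rpow_of_lt (by norm_num) hδ).const_mul _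
  refine h.congr_fun (fun t ht => ?_) measurableSet_Ioi
  have : 0 < t := hδ.trans ht
  simp only [dispC]
  rw [abs_of_pos this, ← Real.rpow_neg (by positivity), ← Real.mul_rpow (by positivity) this.le]

/-- With y = V e^{iτH₀} f one has ‖y‖² = ⟨conj V · y, e^{iτH₀} f⟩, and conj V · y is in L¹ with norm
at most ‖V‖₂‖y‖; the dispersive estimate applies and one factor ‖y‖ cancels. The resulting decay
τ^{-3/2} is what Cook's method integrates. -/
lemma mulL_Ev_norm_le {V₀ : E3 → ℂ} (hb : BddM V₀) (hi : Integrable V₀) {f : L2}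
    (hf : Integrable (f : E3 → ℂ)) {τ : ℝ} (hτ : τ ≠ 0) :
    ‖mulL V₀ (Ev τ f)‖ ≤ dispC τ * ((eLpNorm V₀ 2 volume).toReal * ∫ x, ‖f x‖) := by
  set y := mulL V₀ (Ev τ f) with hy
  have hb' : BddM (fun x => (starRingEnd ℂ) (V₀ x)) := hb.conj
  have h2 : MemLp (fun x => (starRingEnd ℂ) (V₀ x)) 2 := by
    refine memLp_two_of_integrable ?_ hb'
    exact hi.norm.mono' hb'.1 (Eventually.of_forall fun x => by simp)
  have hN : eLpNorm (fun x => (starRingEnd ℂ) (V₀ x)) 2 volume = eLpNorm V₀ 2 volume :=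
    eLpNorm_congr_norm_ae (Eventually.of_forall fun x => by simp)
  obtain ⟨h3, h4⟩ := integral_norm_mul_le h2 (Lp.memLp y)
  have hg := mulL_coeFn hb' y
  have h5 : Integrable (mulL (fun x => (starRingEnd ℂ) (V₀ x)) y : E3 → ℂ) := h3.congr hg.symm
  have h6 := inner_Ev_le hτ h5 hf
  have h7 : inner ℂ (mulL (fun x => (starRingEnd ℂ) (V₀ x)) y) (Ev τ f) = inner ℂ y y := by
    rw [mulL_inner_left hb, hy]
  rw [h7, inner_self_eq_norm_sq_to_K, norm_pow, RCLike.norm_ofReal, abs_of_nonneg (norm_nonneg _),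
    integral_congr_ae (hg.mono fun x hx => congrArg norm hx)] at h6
  rw [hN] at h4
  have h8 : (eLpNorm (y : E3 → ℂ) 2 volume).toReal = ‖y‖ := rfl
  rw [h8] at h4
  rcases eq_or_lt_of_le (norm_nonneg y) with h0 | h0
  · rw [← h0]; exact mul_nonneg (dispC_nonneg _) (by positivity)
  · refine le_of_mul_le_mul_right ?_ h0
    rw [← pow_two]
    refine h6.trans ?_
    have := mul_le_mul_of_nonneg_left (mul_le_mul_of_nonneg_right h4
      (by positivity : 0 ≤ ∫ x, ‖f x‖)) (dispC_nonneg τ)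
    refine this.trans_eq (by ring)

lemma exists_waveOp {V₀ : E3 → ℂ} (hb : BddM V₀) (hi : Integrable V₀) (hA : SymOp (mulL V₀)) :
    ∃ Ω : Op, ∀ f, Tendsto (fun t => Om (mulL V₀) t f) atTop (𝓝 (Ω f)) := by
  have hd : Dense {f : L2 | Integrable (f : E3 → ℂ)} := fun f => by
    obtain ⟨s, h1, h2⟩ := exists_seq_integrable f
    exact mem_closure_of_tendsto h2 (Eventually.of_forall h1)
  refine exists_wave hA hd fun f hf => ?_
  have hc : Continuous fun t => mulL V₀ (Ev (-t) f) :=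
    (mulL V₀).continuous.comp ((Ev_continuous f).comp continuous_neg)
  rw [← Ioc_union_Ioi_eq_Ioi (zero_le_one' ℝ)]
  refine IntegrableOn.union (hc.integrableOn_Icc.mono_set Ioc_subset_Icc_self) ?_
  refine ((dispC_integrableOn one_pos).mul_const ((eLpNorm V₀ 2 volume).toReal * ∫ x, ‖f x‖)).mono'
    hc.aestronglyMeasurable ?_
  refine (ae_restrict_iff' measurableSet_Ioi).2 (Eventually.of_forall fun t ht => ?_)
  have h0 : (0 : ℝ) < t := one_pos.trans ht
  have := mulL_Ev_norm_le hb hi hf (neg_ne_zero.2 h0.ne')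
  rwa [dispC, abs_neg] at this

/-! ### Phase space bounds for the potential -/

lemma exists_potDom {b : OrthonormalBasis (Fin 3) ℝ E3} {V₀ : E3 → ℂ}
    (h : ∀ r j m l : Fin 3, FT1 fun x => ((inner ℝ x (b r) ^ (j : ℕ) : ℝ) : ℂ) * qf b V₀ m l x) :
    ∃ m₀ : NNReal, PotDom b V₀ m₀ := by
  have h' : ∀ r j m l : Fin 3, FT1 (qf b (qf b V₀ m l) r j) := h
  choose D hD1 hD2 using h'
  refine ⟨∑ r, ∑ j, ∑ m, ∑ l, (∫⁻ ξ, ‖D r j m l ξ‖ₑ).toNNReal, fun l a => ?_, fun l j r a => ?_,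
    fun ι r j m l => ?_⟩
  · have := (h 0 0 l a).bdd
    simpa using this
  · exact (h r a l j).bdd
  · refine (DomF.mulL (hD1 r j m l) (h r j m l).bdd (hD2 r j m l) ι).mono ?_
    refine le_trans ?_ (Finset.single_le_sum (fun _ _ => zero_le) (Finset.mem_univ r))
    refine le_trans ?_ (Finset.single_le_sum (fun _ _ => zero_le) (Finset.mem_univ j))
    refine le_trans ?_ (Finset.single_le_sum (fun _ _ => zero_le) (Finset.mem_univ m))
    exact Finset.single_le_sum (f := fun l => (∫⁻ ξ, ‖D r j m l ξ‖ₑ).toNNReal) (fun _ _ => zero_le) (Finset.mem_univ l)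

end

noncomputable section

/-! ### Polar coordinates -/

/-- The unit sphere. -/
abbrev S2 : Type := Metric.sphere (0 : E3) 1

/-- The surface measure of the unit sphere. -/
abbrev sigmaS : Measure S2 := (volume : Measure E3).toSphere

/-- The measure `r² dr` on `(0, ∞)`. -/
def radMeas : Measure ℝ := (volume.restrict (Ioi (0 : ℝ))).withDensity fun r => ENNReal.ofReal (r ^ 2)

instance : SFinite radMeas := by unfold radMeas; infer_instance

lemma measurePreserving_polar : MeasurePreserving (fun p : S2 × ℝ => p.2 • (p.1 : E3))
    (sigmaS.prod radMeas) volume := by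
  have hm : Measurable fun p : S2 × ℝ => p.2 • (p.1 : E3) := by fun_prop
  refine ⟨hm, Measure.ext_of_lintegral _ fun f hf => ?_⟩
  have h0 : MeasurableSet ({(0 : E3)}ᶜ : Set E3) := (measurableSet_singleton _).compl
  rw [lintegral_map hf hm]
  refine (lintegral_prod _ (hf.comp hm).aemeasurable).trans ?_
  have hMP := (volume : Measure E3).measurePreserving_homeomorphUnitSphereProd
  have h1 : ∫⁻ x, f x = ∫⁻ x : ({(0 : E3)}ᶜ : Set E3), f x ∂((volume : Measure E3).comap Subtype.val) := by
    rw [lintegral_subtype_comap h0, restrict_compl_singleton]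
  have h2 : ∀ x : ({(0 : E3)}ᶜ : Set E3), f x =
      (fun p : S2 × Ioi (0 : ℝ) => f ((p.2 : ℝ) • (p.1 : E3))) (homeomorphUnitSphereProd E3 x) := fun x => by
    have : ((homeomorphUnitSphereProd E3).symm (homeomorphUnitSphereProd E3 x) : E3) = x := by simp
    simp only
    rw [← homeomorphUnitSphereProd_symm_apply_coe, this]
  have hf' : Measurable fun p : S2 × Ioi (0 : ℝ) => f ((p.2 : ℝ) • (p.1 : E3)) := hf.comp (by fun_prop)
  rw [h1]
  simp_rw [h2]
  rw [hMP.lintegral_comp hf', lintegral_prod _ hf'.aemeasurable]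
  congr 1; ext ω
  have hfω : Measurable fun r : ℝ => f (r • (ω : E3)) := hf.comp (by fun_prop)
  change ∫⁻ r, f (r • (ω : E3)) ∂radMeas = ∫⁻ r : Ioi (0 : ℝ), f ((r : ℝ) • (ω : E3)) ∂_
  rw [radMeas, lintegral_withDensity_eq_lintegral_mul _ (by fun_prop) hfω, Measure.volumeIoiPow]
  have hd : Module.finrank ℝ E3 - 1 = 2 := by simp
  have h3 : Measurable fun r : Ioi (0 : ℝ) => f ((r : ℝ) • (ω : E3)) := hfω.comp measurable_subtype_coe
  rw [hd, lintegral_withDensity_eq_lintegral_mul _ (by fun_prop) h3]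
  exact (lintegral_subtype_comap measurableSet_Ioi
    (fun r : ℝ => ENNReal.ofReal (r ^ 2) * f (r • (ω : E3)))).symm

lemma ae_radMeas {P : ℝ → Prop} : (∀ᵐ r ∂radMeas, P r) ↔ ∀ᵐ r ∂(volume.restrict (Ioi (0 : ℝ))), P r := by
  rw [radMeas, ae_withDensity_iff (by fun_prop)]
  rw [ae_restrict_iff' measurableSet_Ioi, ae_restrict_iff' measurableSet_Ioi]
  refine eventually_congr (Eventually.of_forall fun r => ?_)
  refine forall_congr' fun hr => ?_
  have : ENNReal.ofReal (r ^ 2) ≠ 0 := by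
    rw [Ne, ENNReal.ofReal_eq_zero, not_le]
    exact pow_pos hr 2
  simp [this]

lemma integrable_polar {Φ : E3 → ℂ} (h : Integrable Φ) :
    ∀ᵐ ω : S2 ∂sigmaS, IntegrableOn (fun r : ℝ => ((r ^ 2 : ℝ) : ℂ) * Φ (r • (ω : E3))) (Ioi 0) := by
  have h1 : Integrable (fun p : S2 × ℝ => Φ (p.2 • (p.1 : E3))) (sigmaS.prod radMeas) :=
    measurePreserving_polar.integrable_comp_of_integrable h
  filter_upwards [h1.prod_right_ae] with ω hω
  have := (integrable_withDensity_iff_integrable_smul₀ (f := fun r : ℝ => Real.toNNReal (r ^ 2))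
    (by fun_prop) (μ := volume.restrict (Ioi 0))).1 hω
  refine this.congr (Eventually.of_forall fun r => ?_)
  simp only [NNReal.smul_def, Real.coe_toNNReal _ (sq_nonneg r), Complex.real_smul]

lemma integral_polar {Φ : E3 → ℂ} (h : Integrable Φ) :
    ∫ x, Φ x = ∫ ω, ∫ r in Ioi (0 : ℝ), ((r ^ 2 : ℝ) : ℂ) * Φ (r • (ω : E3)) ∂volume ∂sigmaS := by
  have h1 : Integrable (fun p : S2 × ℝ => Φ (p.2 • (p.1 : E3))) (sigmaS.prod radMeas) :=
    measurePreserving_polar.integrable_comp_of_integrable h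
  have h2 := integral_map measurePreserving_polar.measurable.aemeasurable (f := Φ)
    (μ := sigmaS.prod radMeas) (by rw [measurePreserving_polar.map_eq]; exact h.1)
  rw [measurePreserving_polar.map_eq] at h2
  rw [h2, integral_prod _ h1]
  congr 1; ext ω
  refine (integral_withDensity_eq_integral_smul₀ (f := fun r : ℝ => Real.toNNReal (r ^ 2))
    (by fun_prop) _).trans ?_
  congr 1; ext r
  simp only [NNReal.smul_def, Real.coe_toNNReal _ (sq_nonneg r), Complex.real_smul]

/-! ### The radial Fourier transform -/

/-- The integral in the definition of `L_η`, for a general function `D` in place of the derivatives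
of `V̂`. -/
def radF (D : E3 → ℂ) (η : E3) (k : ℝ) (ω : E3) (ε : ℝ) : ℂ :=
  ((2 * Real.pi) ^ (-(1 / 2) : ℝ) : ℝ) *
    ∫ r in Ioi (0 : ℝ), Complex.exp (-Complex.I * (k * r : ℝ)) *
      ((r * Real.exp (-ε / r) : ℝ) * D (r • ω - η))

lemma ae_polar {D D' : E3 → ℂ} (h : D =ᵐ[volume] D') (η : E3) :
    ∀ᵐ ω : S2 ∂sigmaS, ∀ᵐ r ∂(volume.restrict (Ioi (0 : ℝ))), D (r • (ω : E3) - η) = D' (r • (ω : E3) - η) := by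
  have h1 := (measurePreserving_sub_right volume η).quasiMeasurePreserving.ae h
  have h2 := measurePreserving_polar.quasiMeasurePreserving.ae h1
  filter_upwards [Measure.ae_ae_of_ae_prod h2] with ω hω
  exact ae_radMeas.1 hω

lemma radF_congr {D D' : E3 → ℂ} (h : D =ᵐ[volume] D') (η : E3) :
    ∀ᵐ ω : S2 ∂sigmaS, ∀ k ε, radF D η k ω ε = radF D' η k ω ε := by
  filter_upwards [ae_polar h η] with ω hω k ε
  rw [radF, radF]
  congr 1
  refine integral_congr_ae ?_
  filter_upwards [hω] with r hr
  rw [hr]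

/-- The regularisation e^{-ε/r} supplies the second power of r: integrability of D gives
integrability of r²D(rω - η) in r for almost every ω, whereas the radial transform carries only one
factor r. -/
lemma mul_exp_div_le {r ε : ℝ} (hr : 0 < r) (hε : 0 < ε) : r * Real.exp (-ε / r) ≤ ε⁻¹ * r ^ 2 := by
  have h1 : ε / r ≤ Real.exp (ε / r) := (lt_of_lt_of_le (lt_add_one _) (Real.add_one_le_exp _)).le
  rw [neg_div, Real.exp_neg]
  have h2 : (Real.exp (ε / r))⁻¹ ≤ (ε / r)⁻¹ := inv_anti₀ (by positivity) h1
  calc _ ≤ r * (ε / r)⁻¹ := mul_le_mul_of_nonneg_left h2 hr.le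
    _ = _ := by field_simp

lemma radF_continuousAt {D : E3 → ℂ} {η : E3} {ω : E3} (hD : StronglyMeasurable D)
    (h : IntegrableOn (fun r : ℝ => ((r ^ 2 : ℝ) : ℂ) * D (r • ω - η)) (Ioi 0)) (k : ℝ) {ε : ℝ}
    (hε : 0 < ε) : ContinuousAt (fun ε => radF D η k ω ε) ε := by
  refine ContinuousAt.mul continuousAt_const ?_
  have hDm : Measurable fun r : ℝ => D (r • ω - η) := hD.measurable.comp (by fun_prop)
  refine continuousAt_of_dominated (bound := fun r => (ε / 2)⁻¹ * ‖((r ^ 2 : ℝ) : ℂ) * D (r • ω - η)‖)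
    (Eventually.of_forall fun ε' => Measurable.aestronglyMeasurable (by fun_prop)) ?_ (h.norm.const_mul _) ?_
  · filter_upwards [Ioi_mem_nhds (half_lt_self hε)] with ε' hε'
    refine (ae_restrict_iff' measurableSet_Ioi).2 (Eventually.of_forall fun r hr => ?_)
    have hr' : 0 < r := hr
    have e1 : ‖Complex.exp (-Complex.I * (k * r : ℝ))‖ = 1 := by
      rw [neg_mul, ← mul_neg, ← Complex.ofReal_neg]; exact norm_exp_I_mul _
    rw [norm_mul, e1, one_mul, norm_mul, norm_mul, Complex.norm_real, Complex.norm_real,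
      Real.norm_of_nonneg (by positivity), Real.norm_of_nonneg (by positivity), ← mul_assoc]
    refine mul_le_mul_of_nonneg_right ?_ (norm_nonneg _)
    have h1 := mul_exp_div_le hr' (half_pos hε)
    refine le_trans (mul_le_mul_of_nonneg_left (Real.exp_le_exp.2 ?_) hr'.le) h1
    exact div_le_div_of_nonneg_right (neg_le_neg (le_of_lt hε')) hr'.le
  · refine (ae_restrict_iff' measurableSet_Ioi).2 (Eventually.of_forall fun r hr => ?_)
    have : r ≠ 0 := (show (0 : ℝ) < r from hr).ne'
    fun_prop

/-- A measurable version of `sup_{ε > 0} |L_η|`. -/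
def radSup (D : E3 → ℂ) (η : E3) (p : S2 × ℝ) : ℝ≥0∞ :=
  ⨆ q : {q : ℚ // 0 < q}, ‖radF D η p.2 p.1 (q : ℚ)‖ₑ

lemma radSup_measurable {D : E3 → ℂ} (hD : StronglyMeasurable D) (η : E3) :
    Measurable (radSup D η) := by
  refine Measurable.iSup fun q => Measurable.enorm ?_
  refine Measurable.const_mul ?_ _
  refine StronglyMeasurable.measurable ?_
  refine StronglyMeasurable.integral_prod_right' (f := fun z : (S2 × ℝ) × ℝ =>
    Complex.exp (-Complex.I * (z.1.2 * z.2 : ℝ)) *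
      ((z.2 * Real.exp (-((q : ℚ) : ℝ) / z.2) : ℝ) * D (z.2 • (z.1.1 : E3) - η))) ?_
  refine Measurable.stronglyMeasurable ?_
  have := hD.measurable
  fun_prop

/-- By continuity in ε the supremum over positive rationals already dominates every ε > 0; the
countable supremum is measurable. -/
lemma radF_le_radSup {D : E3 → ℂ} {η : E3} {ω : S2} (hD : StronglyMeasurable D)
    (h : IntegrableOn (fun r : ℝ => ((r ^ 2 : ℝ) : ℂ) * D (r • (ω : E3) - η)) (Ioi 0)) (k : ℝ) {ε : ℝ}
    (hε : 0 < ε) : ‖radF D η k ω ε‖ₑ ≤ radSup D η (ω, k) := by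
  by_contra hlt
  rw [not_le] at hlt
  have h1 := (radF_continuousAt hD h k hε).enorm.eventually (lt_mem_nhds hlt)
  obtain ⟨l, u, hlu, hs⟩ := mem_nhds_iff_exists_Ioo_subset.1 (h1.and (Ioi_mem_nhds hε))
  obtain ⟨q, hq1, hq2⟩ := exists_rat_btwn hlu.2
  obtain ⟨h2, h3⟩ := hs ⟨hlu.1.trans hq1, hq2⟩
  refine absurd h2 (not_lt.2 ?_)
  exact le_iSup (fun q : {q : ℚ // 0 < q} => ‖radF D η k ω (q : ℚ)‖ₑ) ⟨q, by exact_mod_cast h3⟩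

/-- Changing D on a null set changes its values on almost every ray only in a null set of radii, so
a strongly measurable representative leaves the radial transforms unaffected for almost every ω. -/
lemma lintegral_radSup_le (b : OrthonormalBasis (Fin 3) ℝ E3) (V : E3 → ℝ) (η : E3) (l j : Fin 3)
    {D : E3 → ℂ} (h : weakDeriv (List.replicate j (b l)) (fourierHat V) =ᵐ[volume] D) :
    ∫⁻ ω, ∫⁻ k, radSup D η (ω, k) ∂volume ∂sigmaS ≤ Km b V := by
  refine le_trans ?_ (le_iSup _ η)
  refine le_trans ?_ (le_iSup₂ (f := fun l j : Fin 3 => ∫⁻ ω : S2, ∫⁻ k : ℝ, ⨆ (ε : ℝ) (_ : 0 ≤ ε),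
      ‖radialFourier b V η l j k ω ε‖ₑ ∂volume ∂sigmaS) l j)
  refine lintegral_mono_ae ?_
  filter_upwards [radF_congr h η] with ω hω
  refine lintegral_mono fun k => iSup_le fun q => ?_
  rw [← hω]
  exact le_iSup₂ (f := fun (ε : ℝ) (_ : 0 ≤ ε) => ‖radialFourier b V η l j k ω ε‖ₑ) ((q : ℚ) : ℝ)
    (by exact_mod_cast q.2.le)

end

noncomputable section

/-! ### The kernel estimate for one Weyl operator -/

/-- The form with kernel `χ(s > 0) F(ω, -(s + ω·x))` on the lines `s ↦ x + 2sω`. -/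
def lineForm (F : S2 × ℝ → ℝ≥0∞) (h k : E3 → ℝ≥0∞) : ℝ≥0∞ :=
  ∫⁻ ω, ∫⁻ p : ℝ × E3, h p.2 * k (p.2 + (2 * p.1) • (ω : E3)) *
    F (ω, -(p.1 + inner ℝ (ω : E3) p.2)) ∂((volume.restrict (Ioi (0 : ℝ))).prod volume) ∂sigmaS

lemma lintegral_enorm_mul_shift_le (f g : L2) (y : E3) :
    ∫⁻ x, ‖g x‖ₑ * ‖f (x + y)‖ₑ ≤ eLpNorm g 2 volume * eLpNorm f 2 volume := by
  have hmp := measurePreserving_add_right (volume : Measure E3) y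
  have h1 := eLpNorm_smul_le_mul_eLpNorm (p := 2) (q := 2) (r := 1)
    ((Lp.memLp f).1.comp_measurePreserving hmp) (Lp.memLp g).1
  rw [eLpNorm_one_eq_lintegral_enorm, eLpNorm_comp_measurePreserving (Lp.memLp f).1 hmp] at h1
  refine le_trans (le_of_eq ?_) h1
  congr 1; ext x
  exact (enorm_mul _ _).symm

lemma lintegral_exp_neg {a : ℝ} (ha : 0 < a) :
    ∫⁻ s in Ioi (0 : ℝ), ENNReal.ofReal (Real.exp (-a * s)) = ENNReal.ofReal a⁻¹ := by
  rw [← ofReal_integral_eq_lintegral_ofReal (integrable_exp_neg ha)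
    (Eventually.of_forall fun τ => (Real.exp_pos _).le), integral_exp_mul_Ioi (by linarith : -a < 0)]
  congr 1
  rw [mul_zero, Real.exp_zero, neg_div_neg_eq, one_div]

section
variable {D : E3 → ℂ} {η ω : E3} {ε : ℝ} (f g : L2)

/-- The integrand of the matrix element in polar coordinates. -/
def polarKer (D : E3 → ℂ) (η ω : E3) (ε : ℝ) (f g : L2) (r : ℝ) (p : ℝ × E3) : ℂ :=
  (Complex.exp (-Complex.I * (-(p.1 + inner ℝ ω p.2) * r : ℝ)) *
    ((r * Real.exp (-(ε * p.1) / r) : ℝ) * D (r • ω - η))) *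
  ((starRingEnd ℂ) (g p.2) * f (p.2 + (2 * p.1) • ω))

lemma polarKer_enorm (hr : 0 < r) (p : ℝ × E3) : ‖polarKer D η ω ε f g r p‖ₑ =
    (ENNReal.ofReal r * ‖D (r • ω - η)‖ₑ) * (ENNReal.ofReal (Real.exp (-(ε / r) * p.1)) *
      (‖g p.2‖ₑ * ‖f (p.2 + (2 * p.1) • ω)‖ₑ)) := by
  have e1 : ‖Complex.exp (-Complex.I * (-(p.1 + inner ℝ ω p.2) * r : ℝ))‖ₑ = 1 := by
    rw [neg_mul, ← mul_neg, ← Complex.ofReal_neg]; exact enorm_exp_I_mul _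
  have e2 : ‖((r * Real.exp (-(ε * p.1) / r) : ℝ) : ℂ)‖ₑ =
      ENNReal.ofReal r * ENNReal.ofReal (Real.exp (-(ε / r) * p.1)) := by
    rw [← ofReal_norm, Complex.norm_real, Real.norm_of_nonneg (by positivity),
      ENNReal.ofReal_mul hr.le]
    congr 3; ring
  have e3 : ‖(starRingEnd ℂ) (g p.2)‖ₑ = ‖g p.2‖ₑ := by
    rw [← ofReal_norm, RCLike.norm_conj, ofReal_norm]
  rw [polarKer, enorm_mul, enorm_mul, enorm_mul, enorm_mul, e1, e2, e3]
  ring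

/-- Absolute integrability for fixed ε > 0: the s-integral of e^{-εs/r} gives r/ε, which together
with the factor r makes r²|D|, and the x-integral is handled by Cauchy–Schwarz. It justifies doing
the r-integral first. -/
lemma polarKer_integrable (hD : StronglyMeasurable D) (hε : 0 < ε)
    (h : IntegrableOn (fun r : ℝ => ((r ^ 2 : ℝ) : ℂ) * D (r • ω - η)) (Ioi 0)) :
    Integrable (fun z : ℝ × (ℝ × E3) => polarKer D η ω ε f g z.1 z.2)
      ((volume.restrict (Ioi (0 : ℝ))).prod ((volume.restrict (Ioi (0 : ℝ))).prod volume)) := by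
  have hD' := hD.measurable
  have hf := (Lp.stronglyMeasurable f).measurable
  have hg := (Lp.stronglyMeasurable g).measurable
  have hm : Measurable fun z : ℝ × (ℝ × E3) => polarKer D η ω ε f g z.1 z.2 := by
    unfold polarKer
    fun_prop
  refine ⟨hm.aestronglyMeasurable, ?_⟩
  rw [hasFiniteIntegral_iff_enorm, lintegral_prod _ hm.enorm.aemeasurable]
  have h1 : ∀ r > 0, ∫⁻ p, ‖polarKer D η ω ε f g r p‖ₑ ∂((volume.restrict (Ioi (0 : ℝ))).prod volume) ≤
      ‖((r ^ 2 : ℝ) : ℂ) * D (r • ω - η)‖ₑ *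
        (ENNReal.ofReal ε⁻¹ * (eLpNorm g 2 volume * eLpNorm f 2 volume)) := by
    intro r hr
    simp_rw [polarKer_enorm f g hr]
    have hmm : Measurable fun p : ℝ × E3 => ENNReal.ofReal (Real.exp (-(ε / r) * p.1)) *
      (‖g p.2‖ₑ * ‖f (p.2 + (2 * p.1) • ω)‖ₑ) := by fun_prop
    rw [lintegral_const_mul _ hmm, lintegral_prod _ hmm.aemeasurable]
    have h2 : ∀ s : ℝ, ∫⁻ x, ENNReal.ofReal (Real.exp (-(ε / r) * s)) *
        (‖g x‖ₑ * ‖f (x + (2 * s) • ω)‖ₑ) ≤ ENNReal.ofReal (Real.exp (-(ε / r) * s)) *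
          (eLpNorm g 2 volume * eLpNorm f 2 volume) := fun s => by
      rw [lintegral_const_mul _ (by fun_prop)]
      exact mul_le_mul' le_rfl (lintegral_enorm_mul_shift_le f g _)
    refine (mul_le_mul' le_rfl (lintegral_mono h2)).trans ?_
    rw [lintegral_mul_const _ (by fun_prop), lintegral_exp_neg (by positivity), enorm_mul]
    have e2 : ‖((r ^ 2 : ℝ) : ℂ)‖ₑ = ENNReal.ofReal r * ENNReal.ofReal r := by
      rw [← ofReal_norm, Complex.norm_real, Real.norm_of_nonneg (by positivity), pow_two,
        ENNReal.ofReal_mul hr.le]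
    have e3 : ENNReal.ofReal (ε / r)⁻¹ = ENNReal.ofReal r * ENNReal.ofReal ε⁻¹ := by
      rw [inv_div, div_eq_mul_inv, ENNReal.ofReal_mul hr.le]
    rw [e2, e3]
    exact le_of_eq (by ring)
  refine (setLIntegral_mono_ae' measurableSet_Ioi (Eventually.of_forall h1)).trans_lt ?_
  rw [lintegral_mul_const'' _ h.1.enorm]
  refine ENNReal.mul_lt_top h.2 (ENNReal.mul_lt_top ENNReal.ofReal_lt_top
    (ENNReal.mul_lt_top (Lp.memLp g).2 (Lp.memLp f).2))

/-- After Fubini the r-integral at fixed (s, x) is the radial transform at frequency -(s + ω·x) with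
regularisation εs. The modulus is taken only then, so the oscillation in r is kept. -/
lemma integral_polarKer_enorm_le {ω : S2} (hD : StronglyMeasurable D) (hε : 0 < ε)
    (h : IntegrableOn (fun r : ℝ => ((r ^ 2 : ℝ) : ℂ) * D (r • (ω : E3) - η)) (Ioi 0)) {c₀ : ℂ}
    (hc : ‖c₀‖ ≤ (2 * Real.pi) ^ (-(1 / 2) : ℝ)) :
    ‖∫ r in Ioi (0 : ℝ), c₀ * ∫ s in Ioi (0 : ℝ), ∫ x, polarKer D η ω ε f g r (s, x)‖ₑ ≤
      ∫⁻ p : ℝ × E3, ‖g p.2‖ₑ * ‖f (p.2 + (2 * p.1) • (ω : E3))‖ₑ *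
        radSup D η (ω, -(p.1 + inner ℝ (ω : E3) p.2)) ∂((volume.restrict (Ioi (0 : ℝ))).prod volume) := by
  have hi := polarKer_integrable f g hD hε h
  have h1 : ∫ r in Ioi (0 : ℝ), c₀ * ∫ s in Ioi (0 : ℝ), ∫ x, polarKer D η ω ε f g r (s, x) =
      ∫ p, (c₀ * ∫ r in Ioi (0 : ℝ), polarKer D η ω ε f g r p) ∂((volume.restrict (Ioi (0 : ℝ))).prod volume) := by
    rw [integral_const_mul, integral_const_mul]
    congr 1
    refine Eq.trans ?_ (integral_integral_swap hi)
    refine integral_congr_ae ?_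
    filter_upwards [hi.prod_right_ae] with r hr
    exact (integral_prod _ hr).symm
  rw [h1]
  refine (enorm_integral_le_lintegral_enorm _).trans (lintegral_mono_ae ?_)
  have hpos : ∀ᵐ p : ℝ × E3 ∂((volume.restrict (Ioi (0 : ℝ))).prod volume), 0 < p.1 :=
    Measure.quasiMeasurePreserving_fst.ae ((ae_restrict_iff' measurableSet_Ioi).2
      (Eventually.of_forall fun _ h => h))
  filter_upwards [hpos] with p hp
  have e3 : ‖(starRingEnd ℂ) (g p.2)‖ₑ = ‖g p.2‖ₑ := by
    rw [← ofReal_norm, RCLike.norm_conj, ofReal_norm]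
  simp only [polarKer]
  rw [integral_mul_const, ← mul_assoc, enorm_mul, enorm_mul _ (f _), e3, mul_comm]
  refine mul_le_mul' le_rfl (le_trans ?_ (radF_le_radSup hD h _ (mul_pos hε hp)))
  rw [radF, enorm_mul, enorm_mul]
  refine mul_le_mul' ?_ le_rfl
  rw [← ofReal_norm, ← ofReal_norm, Complex.norm_real, Real.norm_of_nonneg (by positivity)]
  exact ENNReal.ofReal_le_ofReal hc

/-- The change of variable s = rτ: the translation 2τrω becomes 2sω, the phases τr² and rω·x combine
to r(s + ω·x), and e^{-ετ} becomes e^{-εs/r}. -/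
lemma polarKer_eq {τ r : ℝ} (hr : 0 < r) {ω : E3} (hω : ‖ω‖ = 1) :
    ∫ x, polarKer D η ω ε f g r (r * τ, x) = (r : ℂ) * ((Real.exp (-ε * τ) : ℂ) * (D (r • ω - η) *
      inner ℂ g (conjEv τ (modul (r • ω)) f))) := by
  rw [modul_eq_Weyl, conjEv_Weyl, smul_apply, inner_smul_right, L2_inner_eq, ← integral_const_mul,
    ← integral_const_mul, ← integral_const_mul, ← integral_const_mul]
  refine integral_congr_ae ?_
  filter_upwards [Weyl_coeFn (flow τ (r • ω, 0)) f] with x hx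
  have e1 : -(ε * (r * τ)) / r = -ε * τ := by field_simp
  have e2 : x + (flow τ (r • ω, 0)).2 = x + (2 * (r * τ)) • ω := by
    simp only [flow]
    rw [zero_add, smul_smul, mul_assoc, mul_comm τ]
  have e3 : Complex.exp (-Complex.I * (-(r * τ + inner ℝ ω x) * r : ℝ)) =
      Complex.exp (Complex.I * ((τ * ‖r • ω‖ ^ 2 : ℝ) : ℂ)) *
        Complex.exp (Complex.I * (inner ℝ (r • ω) x : ℝ)) := by
    rw [← Complex.exp_add, norm_smul, hω, inner_smul_left, mul_one, Real.norm_eq_abs, sq_abs]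
    congr 1
    simp only [conj_trivial]
    push_cast; ring
  rw [hx, polarKer, e1, e2, e3, Complex.ofReal_mul r]
  simp only [flow]
  ring

end

/-- The matrix elements of the time average of `x_l^j V e^{iη·x}`. -/
lemma inner_avg_le_lineForm {q : E3 → ℂ} {D : E3 → ℂ} (hD : StronglyMeasurable D)
    (hDi : Integrable D) {c₀ : ℂ} (hc : ‖c₀‖ ≤ (2 * Real.pi) ^ (-(1 / 2) : ℝ))
    (hq : ∀ x, q x = c₀ * invF D x) (η : E3) {ε : ℝ} (hε : 0 < ε) (f g : L2) :
    ‖inner ℂ g (avg (wexp ε) (mulL q * modul η) f)‖ₑ ≤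
      lineForm (radSup D η) (fun x => ‖g x‖ₑ) (fun x => ‖f x‖ₑ) := by
  have hqb : BddM q := by
    rw [funext hq]; exact (invF_bdd hDi).smul c₀
  have hDη : Integrable fun ξ => D (ξ - η) := hDi.comp_sub_right η
  let a : ℝ → E3 → ℂ := fun τ ξ => inner ℂ g (conjEv τ (modul ξ) f)
  have ha : Continuous fun p : ℝ × E3 => a p.1 p.2 := by
    refine continuous_const.inner (Ev_joint continuous_fst ?_)
    exact strong_joint modul_norm_le modul_continuous continuous_snd
      ((Ev_continuous f).comp continuous_fst.neg)
  have hab : ∀ τ ξ, ‖a τ ξ‖ ≤ ‖g‖ * ‖f‖ := fun τ ξ => by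
    refine (norm_inner_le_norm _ _).trans (mul_le_mul_of_nonneg_left ?_ (norm_nonneg _))
    refine ((conjEv τ (modul ξ)).le_of_opNorm_le ((conjEv_norm_le _ _).trans (modul_norm_le ξ)) f).trans_eq
      (one_mul _)
  -- Multiplying by e^{iη·x} translates the frequency variable, which turns D(ξ) into D(ξ - η); this
  -- is the origin of the shift η in L_η.
  have h1 : ∀ τ, inner ℂ g (conjEv τ (mulL q * modul η) f) = ∫ ξ, c₀ * (D (ξ - η) * a τ ξ) := fun τ => by
    rw [modul, mulL_mul hqb (modul_bdd η), conjEv_inner]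
    have := inner_mulL_integral (c := fun ξ => c₀ * D (ξ - η)) (hDη.const_mul c₀)
      (e := fun ξ x => Complex.exp (Complex.I * (inner ℝ ξ x : ℝ))) (by fun_prop)
      (fun a x => (norm_exp_I_mul _).le) (hqb.mul (modul_bdd η)) (fun x => ?_) (Ev (-τ) f) (Ev (-τ) g)
    · rw [this]
      congr 1; ext ξ
      simp only [a]
      rw [conjEv_inner, mul_assoc]; rfl
    · rw [hq, invF, ← integral_const_mul, ← integral_mul_const, ← integral_sub_right_eq_self _ η]
      congr 1; ext ξ
      rw [inner_sub_left, Complex.ofReal_sub, mul_sub, Complex.exp_sub]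
      field_simp
  have hprod : Integrable (fun p : E3 × ℝ => c₀ * ((wexp ε p.2 * D (p.1 - η)) * a p.2 p.1))
      (volume.prod volume) := by
    have := (hDη.mul_prod (wexp_integrable hε)).mul_bdd (c := ‖g‖ * ‖f‖)
      (g := fun p : E3 × ℝ => a p.2 p.1) (ha.comp continuous_swap).aestronglyMeasurable
      (Eventually.of_forall fun p => hab _ _)
    refine (this.const_mul c₀).congr (Eventually.of_forall fun p => ?_)
    simp only; ring
  have h2 : inner ℂ g (avg (wexp ε) (mulL q * modul η) f) =
      ∫ ξ, ∫ τ, c₀ * ((wexp ε τ * D (ξ - η)) * a τ ξ) := by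
    rw [inner_avg (wexp_integrable hε), integral_integral_swap hprod]
    congr 1; ext τ
    rw [h1, ← integral_const_mul]
    congr 1; ext ξ; ring
  have hΦ := hprod.integral_prod_left
  rw [h2, integral_polar hΦ]
  refine (enorm_integral_le_lintegral_enorm _).trans (lintegral_mono_ae ?_)
  filter_upwards [integrable_polar hDη] with ω hω
  refine le_trans (le_of_eq ?_) (integral_polarKer_enorm_le f g hD hε hω hc)
  congr 1
  refine setIntegral_congr_fun measurableSet_Ioi fun r hr => ?_
  have hr' : 0 < r := hr
  rw [integral_const_mul, mul_left_comm]
  congr 1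
  -- Of the Jacobian r² dr one factor r is spent on ds = r dτ; the other is the factor r in L_η.
  have h3 := integral_comp_mul_left_Ioi (fun s => ∫ x, polarKer D η ω ε f g r (s, x)) 0 hr'
  rw [mul_zero] at h3
  have hω1 : ‖(ω : E3)‖ = 1 := by simp
  simp_rw [polarKer_eq f g hr' hω1] at h3
  rw [integral_const_mul] at h3
  have h4 : ∫ τ, wexp ε τ * D (r • (ω : E3) - η) * a τ (r • (ω : E3)) =
      ∫ τ in Ioi (0 : ℝ), (Real.exp (-ε * τ) : ℂ) * (D (r • (ω : E3) - η) * a τ (r • (ω : E3))) := by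
    rw [← integral_indicator measurableSet_Ioi]
    congr 1; ext τ
    rw [mul_assoc, wexp]
    by_cases hτ : τ ∈ Ioi (0 : ℝ)
    · rw [indicator_of_mem hτ, indicator_of_mem hτ]
    · rw [indicator_of_notMem hτ, indicator_of_notMem hτ, zero_mul]
  rw [h4, Complex.ofReal_pow, pow_two, mul_assoc, h3, Complex.real_smul, ← mul_assoc, Complex.ofReal_inv,
    mul_inv_cancel₀ (by exact_mod_cast hr'.ne'), one_mul]

end

noncomputable section

/-! ### Bounds for line forms -/

section
variable {F : S2 × ℝ → ℝ≥0∞} {h k h' k' : E3 → ℝ≥0∞}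

lemma ae_shift {P : E3 → Prop} (hP : ∀ᵐ x, P x) (ω : E3) (μ : Measure ℝ) [SFinite μ] :
    ∀ᵐ p : ℝ × E3 ∂(μ.prod volume), P (p.2 + (2 * p.1) • ω) := by
  have hmp : MeasurePreserving (fun p : ℝ × E3 => (p.1, p.2 + (2 * p.1) • ω)) (μ.prod volume)
      (μ.prod volume) := by
    refine (MeasurePreserving.id μ).skew_product (g := fun s x => x + (2 * s) • ω) (by fun_prop) ?_
    exact Eventually.of_forall fun s => map_add_right_eq_self volume _
  exact hmp.quasiMeasurePreserving.ae (Measure.quasiMeasurePreserving_snd.ae hP)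

lemma lineForm_mono_ae {F' : S2 × ℝ → ℝ≥0∞} (hh : h ≤ᵐ[volume] h') (hk : k ≤ᵐ[volume] k')
    (hF : ∀ (ω : S2) (s : ℝ) (x : E3), 0 < s → h' x ≠ 0 → k' (x + (2 * s) • (ω : E3)) ≠ 0 →
      F (ω, -(s + inner ℝ (ω : E3) x)) ≤ F' (ω, -(s + inner ℝ (ω : E3) x))) :
    lineForm F h k ≤ lineForm F' h' k' := by
  refine lintegral_mono fun ω => lintegral_mono_ae ?_
  have hpos : ∀ᵐ p : ℝ × E3 ∂((volume.restrict (Ioi (0 : ℝ))).prod volume), 0 < p.1 :=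
    Measure.quasiMeasurePreserving_fst.ae ((ae_restrict_iff' measurableSet_Ioi).2
      (Eventually.of_forall fun _ h => h))
  filter_upwards [hpos, Measure.quasiMeasurePreserving_snd.ae hh, ae_shift hk (ω : E3) _] with p h0 h1 h2
  refine (mul_le_mul' (mul_le_mul' h1 h2) le_rfl).trans ?_
  rcases eq_or_ne (h' p.2) 0 with e | e
  · simp [e]
  rcases eq_or_ne (k' (p.2 + (2 * p.1) • (ω : E3))) 0 with e' | e'
  · simp [e']
  exact mul_le_mul' le_rfl (hF ω p.1 p.2 h0 e e')

/-- With k bounded, integrate over s first at fixed x: s ↦ -(s + ω·x) is a reflection and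
translation of the line, so F contributes its full line integral. -/
lemma lineForm_le_right (hF : Measurable F) (hh : Measurable h) {B : ℝ≥0∞} (hk : ∀ᵐ x, k x ≤ B) :
    lineForm F h k ≤ (∫⁻ x, h x) * B * ∫⁻ ω, ∫⁻ r, F (ω, r) ∂volume ∂sigmaS := by
  rw [← lintegral_const_mul _ hF.lintegral_prod_right']
  refine lintegral_mono fun ω => ?_
  have hFω : Measurable fun r => F (ω, r) := hF.comp measurable_prodMk_left
  have h1 : Measurable fun p : ℝ × E3 => h p.2 * B * F (ω, -(p.1 + inner ℝ (ω : E3) p.2)) :=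
    ((hh.comp measurable_snd).mul_const B).mul (hFω.comp (by fun_prop))
  calc _ ≤ ∫⁻ p : ℝ × E3, h p.2 * B * F (ω, -(p.1 + inner ℝ (ω : E3) p.2))
        ∂((volume.restrict (Ioi (0 : ℝ))).prod volume) := by
        refine lintegral_mono_ae ?_
        filter_upwards [ae_shift hk (ω : E3) _] with p hp
        exact mul_le_mul' (mul_le_mul' le_rfl hp) le_rfl
    _ = ∫⁻ x : E3, h x * B * ∫⁻ s in Ioi (0 : ℝ), F (ω, -(s + inner ℝ (ω : E3) x)) := by
        rw [lintegral_prod_symm' _ h1]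
        congr 1; ext x
        have hm : Measurable fun s : ℝ => F (ω, -(s + inner ℝ (ω : E3) x)) := hFω.comp (by fun_prop)
        exact lintegral_const_mul (h x * B) hm
    _ ≤ ∫⁻ x : E3, h x * B * ∫⁻ r, F (ω, r) := by
        refine lintegral_mono fun x => mul_le_mul' le_rfl ((setLIntegral_le_lintegral _ _).trans_eq ?_)
        rw [lintegral_add_right_eq_self (fun s => F (ω, -s)) (inner ℝ (ω : E3) x),
          lintegral_neg_eq_self (fun s => F (ω, s))]
    _ = _ := by
        rw [lintegral_mul_const _ (hh.mul_const B), lintegral_mul_const _ hh]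

/-- With h bounded, replace x by x - 2sω: the argument -(s + ω·x) becomes s - ω·x because |ω| = 1,
again a translation in s, and the roles of h and k are exchanged. -/
lemma lineForm_le_left (hF : Measurable F) (hk : Measurable k) {B : ℝ≥0∞} (hh : ∀ᵐ x, h x ≤ B) :
    lineForm F h k ≤ (∫⁻ x, k x) * B * ∫⁻ ω, ∫⁻ r, F (ω, r) ∂volume ∂sigmaS := by
  rw [← lintegral_const_mul _ hF.lintegral_prod_right']
  refine lintegral_mono fun ω => ?_
  have hFω : Measurable fun r => F (ω, r) := hF.comp measurable_prodMk_left
  have hω : ‖(ω : E3)‖ = 1 := by simp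
  calc _ ≤ ∫⁻ p : ℝ × E3, B * k (p.2 + (2 * p.1) • (ω : E3)) * F (ω, -(p.1 + inner ℝ (ω : E3) p.2))
        ∂((volume.restrict (Ioi (0 : ℝ))).prod volume) := by
        refine lintegral_mono_ae ?_
        filter_upwards [Measure.quasiMeasurePreserving_snd.ae hh] with p hp
        exact mul_le_mul' (mul_le_mul' hp le_rfl) le_rfl
    _ = ∫⁻ s in Ioi (0 : ℝ), ∫⁻ x, B * k x * F (ω, s - inner ℝ (ω : E3) x) := by
        have hm : Measurable fun p : ℝ × E3 => B * k (p.2 + (2 * p.1) • (ω : E3)) *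
            F (ω, -(p.1 + inner ℝ (ω : E3) p.2)) :=
          ((hk.comp (by fun_prop)).const_mul B).mul (hFω.comp (by fun_prop))
        rw [lintegral_prod _ hm.aemeasurable]
        congr 1; ext s
        rw [← lintegral_add_right_eq_self (fun x => B * k x * F (ω, s - inner ℝ (ω : E3) x))
          ((2 * s) • (ω : E3))]
        congr 1; ext x
        congr 3
        rw [inner_add_right, inner_smul_right, real_inner_self_eq_norm_sq, hω]; ring
    _ = ∫⁻ x : E3, B * k x * ∫⁻ s in Ioi (0 : ℝ), F (ω, s - inner ℝ (ω : E3) x) := by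
        rw [lintegral_lintegral_swap]
        · congr 1; ext x
          exact lintegral_const_mul _ (hFω.comp (by fun_prop))
        · exact (((hk.comp measurable_snd).const_mul B).mul (hFω.comp (by fun_prop))).aemeasurable
    _ ≤ ∫⁻ x : E3, B * k x * ∫⁻ r, F (ω, r) := by
        refine lintegral_mono fun x => mul_le_mul' le_rfl ((setLIntegral_le_lintegral _ _).trans_eq ?_)
        exact lintegral_sub_right_eq_self (fun s => F (ω, s)) (inner ℝ (ω : E3) x)
    _ = _ := by
        rw [lintegral_mul_const _ (hk.const_mul B), lintegral_const_mul _ hk]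
        ring

/-- The restriction of `F` to `|r| ≥ t`. -/
def tailF (F : S2 × ℝ → ℝ≥0∞) (t : ℝ) : S2 × ℝ → ℝ≥0∞ := indicator {p | t ≤ |p.2|} F

lemma tailF_measurable (hF : Measurable F) (t : ℝ) : Measurable (tailF F t) :=
  hF.indicator (measurableSet_le measurable_const (by fun_prop))

lemma tailF_tendsto (hF : Measurable F) (hfin : ∫⁻ ω, ∫⁻ r, F (ω, r) ∂volume ∂sigmaS ≠ ∞) :
    Tendsto (fun t => ∫⁻ ω, ∫⁻ r, tailF F t (ω, r) ∂volume ∂sigmaS) atTop (𝓝 0) := by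
  have e : ∀ t, ∫⁻ ω, ∫⁻ r, tailF F t (ω, r) ∂volume ∂sigmaS = ∫⁻ p, tailF F t p ∂(sigmaS.prod volume) :=
    fun t => (lintegral_prod _ (tailF_measurable hF t).aemeasurable).symm
  simp_rw [e]
  rw [← lintegral_prod _ hF.aemeasurable] at hfin
  rw [← lintegral_zero (μ := sigmaS.prod (volume : Measure ℝ))]
  refine tendsto_lintegral_filter_of_dominated_convergence F
    (Eventually.of_forall fun t => tailF_measurable hF t)
    (Eventually.of_forall fun t => Eventually.of_forall fun p => indicator_le_self _ _ _) hfin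
    (Eventually.of_forall fun p => ?_)
  refine tendsto_const_nhds.congr' ?_
  filter_upwards [Ioi_mem_atTop |p.2|] with t ht
  rw [tailF, indicator_of_notMem]
  exact not_le.2 (show |p.2| < t from ht)

end

/-! ### Test pairs -/

/-- One of the functions is bounded by `B`, the other has `L¹` norm at most `A`. -/
def TestPair (A B : ℝ≥0∞) (f g : L2) : Prop :=
  (∫⁻ x, ‖f x‖ₑ ≤ A ∧ ∀ᵐ x, ‖g x‖ₑ ≤ B) ∨ (∫⁻ x, ‖g x‖ₑ ≤ A ∧ ∀ᵐ x, ‖f x‖ₑ ≤ B)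

/-- One of the functions is supported in `|x| ≤ a`, the other one in `|x| > b`. -/
def Separated (a b : ℝ) (f g : L2) : Prop :=
  ((∀ᵐ x, f x ≠ 0 → ‖x‖ ≤ a) ∧ ∀ᵐ x, g x ≠ 0 → b < ‖x‖) ∨
    ((∀ᵐ x, g x ≠ 0 → ‖x‖ ≤ a) ∧ ∀ᵐ x, f x ≠ 0 → b < ‖x‖)

section
variable {F : S2 × ℝ → ℝ≥0∞} {A B : ℝ≥0∞} {f g : L2}

lemma L2_enorm_measurable (f : L2) : Measurable fun x => ‖f x‖ₑ :=
  (Lp.stronglyMeasurable f).measurable.enorm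

lemma TestPair.lineForm_le (h : TestPair A B f g) (hF : Measurable F) :
    lineForm F (fun x => ‖g x‖ₑ) (fun x => ‖f x‖ₑ) ≤
      A * B * ∫⁻ ω, ∫⁻ r, F (ω, r) ∂volume ∂sigmaS := by
  rcases h with ⟨h1, h2⟩ | ⟨h1, h2⟩
  · exact (lineForm_le_left hF (L2_enorm_measurable f) h2).trans
      (mul_le_mul' (mul_le_mul' h1 le_rfl) le_rfl)
  · exact (lineForm_le_right hF (L2_enorm_measurable g) h2).trans
      (mul_le_mul' (mul_le_mul' h1 le_rfl) le_rfl)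

lemma TestPair.shift (h : TestPair A B f g) (y : E3) : TestPair A B (shiftL y f) g := by
  have h0 := shiftL_coeFn y f
  have hq := (measurePreserving_add_right (volume : Measure E3) y).quasiMeasurePreserving
  refine h.imp (fun h => ⟨?_, h.2⟩) fun h => ⟨h.1, ?_⟩
  · rw [lintegral_congr_ae (h0.mono fun x hx => congrArg enorm hx)]
    exact (lintegral_add_right_eq_self (fun x => ‖f x‖ₑ) y).trans_le h.1
  · filter_upwards [h0, hq.ae h.2] with x h1 h2
    rwa [h1]

lemma Separated.shift {a b : ℝ} (h : Separated a b f g) (y : E3) :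
    Separated (a + ‖y‖) (b - ‖y‖) (shiftL y f) g := by
  have h0 := shiftL_coeFn y f
  have hq := (measurePreserving_add_right (volume : Measure E3) y).quasiMeasurePreserving
  refine h.imp (fun h => ⟨?_, ?_⟩) fun h => ⟨?_, ?_⟩
  · filter_upwards [h0, hq.ae h.1] with x h1 h2 h3
    have := norm_sub_le (x + y) y
    rw [add_sub_cancel_right] at this
    linarith [h2 (h1 ▸ h3)]
  · filter_upwards [h.2] with x h1 h2
    linarith [h1 h2, norm_nonneg y]
  · filter_upwards [h.1] with x h1 h2
    linarith [h1 h2, norm_nonneg y]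
  · filter_upwards [h0, hq.ae h.2] with x h1 h2 h3
    have := norm_add_le x y
    linarith [h2 (h1 ▸ h3)]

/-- If one end of the segment from x to x + 2sω lies in the ball of radius a and the other outside
the ball of radius b, then 2s > b - a, while the component along ω of the inner end is at most a in
modulus. Hence |s + ω·x| ≥ (b - a)/2 - a, and only the tail of F contributes. -/
lemma Separated.lineForm_le {a b : ℝ} (h : Separated a b f g) :
    lineForm F (fun x => ‖g x‖ₑ) (fun x => ‖f x‖ₑ) ≤
      lineForm (tailF F ((b - 3 * a) / 2)) (fun x => ‖g x‖ₑ) (fun x => ‖f x‖ₑ) := by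
  have key : ∀ (h' k' : E3 → ℝ≥0∞) (_ : (fun x => ‖g x‖ₑ) =ᵐ[volume] h') (_ : (fun x => ‖f x‖ₑ) =ᵐ[volume] k')
      (_ : ∀ (ω : S2) (s : ℝ) (x : E3), 0 < s → h' x ≠ 0 → k' (x + (2 * s) • (ω : E3)) ≠ 0 →
        (b - 3 * a) / 2 ≤ |(-(s + inner ℝ (ω : E3) x))|),
      lineForm F (fun x => ‖g x‖ₑ) (fun x => ‖f x‖ₑ) ≤
        lineForm (tailF F ((b - 3 * a) / 2)) (fun x => ‖g x‖ₑ) (fun x => ‖f x‖ₑ) := by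
    intro h' k' h1 h2 h3
    refine (lineForm_mono_ae (F' := tailF F ((b - 3 * a) / 2)) h1.le h2.le ?_).trans
      (lineForm_mono_ae h1.symm.le h2.symm.le fun _ _ _ _ _ _ => le_rfl)
    intro ω s x h0 h4 h5
    rw [tailF, indicator_of_mem]
    exact h3 ω s x h0 h4 h5
  have hin : ∀ (ω : S2) (x : E3), |inner ℝ (ω : E3) x| ≤ ‖x‖ := fun ω x => by
    have := abs_real_inner_le_norm (ω : E3) x
    simpa using this
  have hns : ∀ (ω : S2) (s : ℝ), 0 < s → ‖(2 * s) • (ω : E3)‖ = 2 * s := fun ω s hs => by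
    rw [norm_smul, Real.norm_of_nonneg (by positivity)]; simp
  have hmod : ∀ (u : L2) (P : E3 → Prop), (∀ᵐ x, u x ≠ 0 → P x) →
      (fun x => ‖u x‖ₑ) =ᵐ[volume] indicator {x | P x} fun x => ‖u x‖ₑ := fun u P hP => by
    filter_upwards [hP] with x hx
    by_cases hx' : P x
    · rw [indicator_of_mem (show x ∈ {x | P x} from hx')]
    · rw [indicator_of_notMem (show x ∉ {x | P x} from hx')]
      by_contra h0
      exact hx' (hx fun h1 => h0 (by simp [h1]))
  rcases h with ⟨h1, h2⟩ | ⟨h1, h2⟩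
  · refine key _ _ (hmod g _ h2) (hmod f _ h1) fun ω s x hs h3 h4 => ?_
    have h3' : x ∈ {x | b < ‖x‖} := mem_of_indicator_ne_zero h3
    have h4' : x + (2 * s) • (ω : E3) ∈ {x : E3 | ‖x‖ ≤ a} := mem_of_indicator_ne_zero h4
    rw [mem_ofPred_eq] at h3' h4'
    have h5 := norm_sub_le (x + (2 * s) • (ω : E3)) ((2 * s) • (ω : E3))
    rw [add_sub_cancel_right, hns ω s hs] at h5
    have h6 := (hin ω (x + (2 * s) • (ω : E3))).trans h4'
    have hω : ‖(ω : E3)‖ = 1 := by simp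
    rw [inner_add_right, inner_smul_right, real_inner_self_eq_norm_sq, hω] at h6
    have h7 := abs_le.1 h6
    refine le_trans ?_ (le_abs_self _)
    linarith [h7.2]
  · refine key _ _ (hmod g _ h1) (hmod f _ h2) fun ω s x hs h3 h4 => ?_
    have h3' : x ∈ {x : E3 | ‖x‖ ≤ a} := mem_of_indicator_ne_zero h3
    have h4' : x + (2 * s) • (ω : E3) ∈ {x : E3 | b < ‖x‖} := mem_of_indicator_ne_zero h4
    rw [mem_ofPred_eq] at h3' h4'
    have h5 := norm_add_le x ((2 * s) • (ω : E3))
    rw [hns ω s hs] at h5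
    have h7 := abs_le.1 ((hin ω x).trans h3')
    rw [abs_neg]
    refine le_trans ?_ (le_abs_self _)
    linarith [h7.1]

end

end

noncomputable section

/-! ### Estimates for the Abel means on test pairs -/

/-- The time averages of `q e^{iη·x}` are dominated by line forms, uniformly in `η`. -/
def KerBdd (q : E3 → ℂ) (K : ℝ≥0∞) : Prop :=
  BddM q ∧ ∀ η, ∃ F : S2 × ℝ → ℝ≥0∞, Measurable F ∧ ∫⁻ ω, ∫⁻ r, F (ω, r) ∂volume ∂sigmaS ≤ K ∧
    ∀ ε > 0, ∀ f g : L2, ‖inner ℂ g (avg (wexp ε) (mulL q * modul η) f)‖ₑ ≤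
      lineForm F (fun x => ‖g x‖ₑ) fun x => ‖f x‖ₑ

lemma inner_avg_wexp {ε : ℝ} (hε : 0 < ε) (Z : Op) (f g : L2) : inner ℂ g (avg (wexp ε) Z f) =
    pairing ε (fun t => Ev (-t) f) (fun t => Ev (-t) g) Z := by
  rw [inner_avg (wexp_integrable hε), pairing, ← integral_indicator measurableSet_Ioi]
  congr 1; ext τ
  rw [conjEv_inner, wexp]
  by_cases hτ : τ ∈ Ioi (0 : ℝ)
  · rw [indicator_of_mem hτ, indicator_of_mem hτ]
  · rw [indicator_of_notMem hτ, indicator_of_notMem hτ, zero_mul]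

section
variable {q : E3 → ℂ} {K A B : ℝ≥0∞} {ε : ℝ} {f g : L2}

lemma inner_avg_Weyl (hε : 0 < ε) (f g : L2) (η y : E3) :
    inner ℂ g (avg (wexp ε) (mulL q * Weyl (η, y)) f) =
      inner ℂ g (avg (wexp ε) (mulL q * modul η) (shiftL y f)) := by
  rw [Weyl, ← mul_assoc, avg_mul_comm (wexp_integrable hε) (shiftL_Ev y)]; rfl

lemma avg_Weyl_measurable (hε : 0 < ε) (f g : L2) :
    Measurable fun θ => ‖inner ℂ g (avg (wexp ε) (mulL q * Weyl θ) f)‖ₑ := by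
  simp_rw [inner_avg_wexp hε, pairing_mul_left]
  exact pairing_Weyl_measurable hε (BC.Ev f) ((BC.Ev g).clm _)

/-- The time average is a pairing along the free curves e^{-itH₀}f and e^{-itH₀}g. Domination thus
replaces Z by Weyl operators inside the modulus of the whole time integral, where the oscillatory
bound applies. -/
lemma Dom.inner_avg_le {Z : Op} {μ : Measure (E3 × E3)} (h : Dom Z μ) (hε : 0 < ε) (f g : L2) :
    ‖inner ℂ g (_root_.avg (wexp ε) (mulL q * Z) f)‖ₑ ≤
      ∫⁻ θ, ‖inner ℂ g (_root_.avg (wexp ε) (mulL q * _root_.Weyl θ) f)‖ₑ ∂μ := by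
  simp_rw [inner_avg_wexp hε, pairing_mul_left]
  exact h ε hε _ _ (BC.Ev f) ((BC.Ev g).clm _)

lemma KerBdd.inner_Weyl_le (h : KerBdd q K) (hε : 0 < ε) (ht : TestPair A B f g) (θ : E3 × E3) :
    ‖inner ℂ g (avg (wexp ε) (mulL q * Weyl θ) f)‖ₑ ≤ A * B * K := by
  obtain ⟨F, hF, hK, hb⟩ := h.2 θ.1
  rw [← Prod.mk.eta (p := θ), inner_avg_Weyl hε]
  exact ((hb ε hε _ _).trans ((ht.shift θ.2).lineForm_le hF)).trans (mul_le_mul' le_rfl hK)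

lemma KerBdd.inner_avg_le (h : KerBdd q K) {ι : Type} {Z : ι → Op} {c : NNReal} (hZ : DomF Z c)
    (i : ι) (hε : 0 < ε) (ht : TestPair A B f g) :
    ‖inner ℂ g (avg (wexp ε) (mulL q * Z i) f)‖ₑ ≤ A * B * K * c := by
  obtain ⟨μ, hμ, hD⟩ := hZ
  refine ((hD i).inner_avg_le hε f g).trans ?_
  refine (lintegral_mono fun θ => h.inner_Weyl_le hε ht θ).trans ?_
  rw [lintegral_const]
  exact mul_le_mul' le_rfl hμ

/-- The function F depends on η, with no uniform control of its tails. For fixed θ the tail integral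
tends to 0 as the separation grows, and all integrands are bounded by A B K; dominated convergence
against the finite measure μ gives uniformity, which is why the proof runs along a sequence of
counterexamples. -/
lemma KerBdd.tight (h : KerBdd q K) (hK : K ≠ ∞) {ι : Type} {Z : ι → Op} {c : NNReal} (hZ : DomF Z c)
    (hA : A ≠ ∞) (hB : B ≠ ∞) (a : ℝ) {δ : ℝ≥0∞} (hδ : 0 < δ) :
    ∃ b : ℝ, ∀ i, ∀ ε > 0, ∀ f g : L2, TestPair A B f g → Separated a b f g →
      ‖inner ℂ g (avg (wexp ε) (mulL q * Z i) f)‖ₑ ≤ δ := by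
  by_contra hcon
  push Not at hcon
  choose i ε hε f g ht hs hlt using fun n : ℕ => hcon n
  obtain ⟨μ, hμ, hD⟩ := hZ
  have hfin : IsFiniteMeasure μ := isFiniteMeasure_of_le hμ
  have hlim : Tendsto (fun n => ∫⁻ θ, ‖inner ℂ (g n) (avg (wexp (ε n)) (mulL q * Weyl θ) (f n))‖ₑ ∂μ)
      atTop (𝓝 0) := by
    rw [← lintegral_zero (μ := μ)]
    refine tendsto_lintegral_of_dominated_convergence (fun _ => A * B * K)
      (fun n => avg_Weyl_measurable (hε n) _ _)
      (fun n => Eventually.of_forall fun θ => h.inner_Weyl_le (hε n) (ht n) θ) ?_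
      (Eventually.of_forall fun θ => ?_)
    · rw [lintegral_const]
      exact ENNReal.mul_ne_top (ENNReal.mul_ne_top (ENNReal.mul_ne_top hA hB) hK) (measure_ne_top _ _)
    · obtain ⟨F, hF, hFK, hb⟩ := h.2 θ.1
      have h1 := tailF_tendsto hF (ne_top_of_le_ne_top hK hFK)
      have h2 : Tendsto (fun n : ℕ => (((n : ℝ) - ‖θ.2‖) - 3 * (a + ‖θ.2‖)) / 2) atTop atTop := by
        refine Tendsto.atTop_div_const two_pos ?_
        simp_rw [sub_eq_add_neg]
        exact tendsto_atTop_add_const_right _ _ (tendsto_atTop_add_const_right _ _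
          tendsto_natCast_atTop_atTop)
      have h3 := ENNReal.Tendsto.const_mul (h1.comp h2) (a := A * B) (Or.inr (ENNReal.mul_ne_top hA hB))
      rw [mul_zero] at h3
      refine tendsto_of_tendsto_of_tendsto_of_le_of_le tendsto_const_nhds h3 (fun _ => zero_le) fun n => ?_
      simp only
      rw [← Prod.mk.eta (p := θ), inner_avg_Weyl (hε n)]
      exact ((hb _ (hε n) _ _).trans ((hs n).shift θ.2).lineForm_le).trans
        (((ht n).shift θ.2).lineForm_le (tailF_measurable hF _))
  obtain ⟨n, hn⟩ := (hlim.eventually (gt_mem_nhds hδ)).exists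
  exact absurd (((hD (i n)).inner_avg_le (hε n) (f n) (g n)).trans_lt hn) (not_lt.2 (hlt n).le)

lemma Dom.inner_testPair_le {Z : Op} {μ : Measure (E3 × E3)} (h : Dom Z μ) (ht : TestPair A B f g) :
    ‖inner ℂ g (Z f)‖ₑ ≤ A * B * μ univ := by
  refine (h.inner_le f g).trans ?_
  rw [← lintegral_const]
  refine lintegral_mono fun θ => ?_
  have h1 : ‖inner ℂ g (_root_.Weyl θ f)‖ₑ ≤ ∫⁻ x, ‖g x‖ₑ * ‖shiftL θ.2 f x‖ₑ := by
    rw [L2_inner_eq]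
    refine (enorm_integral_le_lintegral_enorm _).trans (lintegral_mono_ae ?_)
    filter_upwards [Weyl_coeFn θ f, shiftL_coeFn θ.2 f] with x h1 h2
    rw [h1, h2, enorm_mul, enorm_mul, enorm_exp_I_mul, one_mul, ← ofReal_norm (starRingEnd ℂ (g x)),
      RCLike.norm_conj, ofReal_norm]
  refine h1.trans ?_
  rcases ht.shift θ.2 with ⟨h2, h3⟩ | ⟨h2, h3⟩
  · calc _ ≤ ∫⁻ x, B * ‖shiftL θ.2 f x‖ₑ := lintegral_mono_ae (h3.mono fun x hx => mul_le_mul' hx le_rfl)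
      _ = (∫⁻ x, ‖shiftL θ.2 f x‖ₑ) * B := by
        rw [lintegral_const_mul _ (L2_enorm_measurable _), mul_comm]
      _ ≤ A * B := mul_le_mul' h2 le_rfl
  · calc _ ≤ ∫⁻ x, ‖g x‖ₑ * B := lintegral_mono_ae (h3.mono fun x hx => mul_le_mul' le_rfl hx)
      _ = (∫⁻ x, ‖g x‖ₑ) * B := lintegral_mul_const _ (L2_enorm_measurable _)
      _ ≤ A * B := mul_le_mul' h2 le_rfl

end

end

noncomputable section

/-! ### Summary of the estimates on test pairs -/

/-- `T` is bounded on all test pairs. -/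
def TestBdd (T : Op) (C : ℝ≥0∞) : Prop :=
  ∀ (A B : ℝ≥0∞) (f g : L2), TestPair A B f g → ‖inner ℂ g (T f)‖ₑ ≤ C * (A * B)

/-- `Y ε → Y₀` as `ε ↓ 0`, with bounds on test pairs, tightness, and uniform convergence. -/
structure TestConv (Y : ℝ → Op) (Y₀ : Op) (C : ℝ≥0∞) : Prop where
  ne_top : C ≠ ∞
  bdd : ∀ ε > 0, TestBdd (Y ε) C
  bdd₀ : TestBdd Y₀ C
  tendsto : ∀ f, Tendsto (fun ε => Y ε f) (𝓝[>] 0) (𝓝 (Y₀ f))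
  tight : ∀ A B : ℝ≥0∞, A ≠ ∞ → B ≠ ∞ → ∀ a : ℝ, ∀ δ > 0, ∃ b : ℝ, ∀ ε > 0, ∀ f g : L2,
    TestPair A B f g → Separated a b f g → ‖inner ℂ g (Y ε f - Y₀ f)‖ₑ ≤ δ
  unif : ∀ f : L2, ∀ B : ℝ≥0∞, B ≠ ∞ → (∀ᵐ x, ‖f x‖ₑ ≤ B) → ∀ δ > 0, ∀ᶠ ε in 𝓝[>] (0 : ℝ),
    ∀ g : L2, ∫⁻ x, ‖g x‖ₑ ≤ 1 → ‖inner ℂ g (Y ε f - Y₀ f)‖ₑ ≤ δ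

lemma inner_le_of_tendsto {Y : ℝ → L2} {y : L2} (h : Tendsto Y (𝓝[>] 0) (𝓝 y)) {g : L2} {z : ℂ}
    {δ : ℝ≥0∞} (hY : ∀ ε > 0, ‖inner ℂ g (Y ε) - z‖ₑ ≤ δ) : ‖inner ℂ g y - z‖ₑ ≤ δ := by
  refine le_of_tendsto ((tendsto_const_nhds.inner h).sub_const z).enorm ?_
  filter_upwards [self_mem_nhdsWithin] with ε hε using hY ε hε

section
variable {V₀ : E3 → ℂ} {Bh : Op} {Y : ℝ → Op} {Y₀ : Op}

lemma inner_conjEv_mulL_le (hb : BddM V₀) (hi : Integrable V₀) (Z : Op) (f g : L2)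
    (hg : Integrable (g : E3 → ℂ)) {τ : ℝ} (hτ : 0 < τ) : ‖inner ℂ g (conjEv τ (mulL V₀ * Z) f)‖ ≤
      dispC τ * ((eLpNorm V₀ 2 volume).toReal * ∫ x, ‖g x‖) * ‖Z (Ev (-τ) f)‖ := by
  have h1 : inner ℂ g (conjEv τ (mulL V₀ * Z) f) =
      inner ℂ (mulL (fun x => (starRingEnd ℂ) (V₀ x)) (Ev (-τ) g)) (Z (Ev (-τ) f)) := by
    rw [conjEv_inner, mulL_inner_left hb]; rfl
  have h2 := mulL_Ev_norm_le hb.conj (Complex.conjCLE.toContinuousLinearMap.integrable_comp hi) hg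
    (neg_ne_zero.2 hτ.ne')
  have h3 : eLpNorm (fun x => (starRingEnd ℂ) (V₀ x)) 2 volume = eLpNorm V₀ 2 volume :=
    eLpNorm_congr_norm_ae (Eventually.of_forall fun x => by simp)
  rw [h3, dispC, abs_neg] at h2
  rw [h1]
  exact (norm_inner_le_norm _ _).trans (mul_le_mul_of_nonneg_right h2 (norm_nonneg _))

/-- Uniform convergence from the dispersive estimate and phase space bounds. -/
lemma uniform_of_dispersive (hb : BddM V₀) (hi : Integrable V₀)
    (hY : ∀ ε > 0, Y ε = Bh + Complex.I • avg (wexp ε) (mulL V₀ * Y ε)) {K : ℝ}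
    (hK : ∀ ε > 0, ‖Y ε‖ ≤ K) (hlim : ∀ f, Tendsto (fun ε => Y ε f) (𝓝[>] 0) (𝓝 (Y₀ f)))
    {c : NNReal} (hD : DomF (fun i : {ε : ℝ // 0 < ε} => mulL V₀ * Y i) c) (f : L2) {B : ℝ≥0∞}
    (hB : B ≠ ∞) (hf : ∀ᵐ x, ‖f x‖ₑ ≤ B) {δ : ℝ≥0∞} (hδ : 0 < δ) : ∀ᶠ ε in 𝓝[>] (0 : ℝ),
      ∀ g : L2, ∫⁻ x, ‖g x‖ₑ ≤ 1 → ‖inner ℂ g (Y ε f - Y₀ f)‖ₑ ≤ δ := by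
  obtain ⟨d, hd0, hd⟩ : ∃ d : ℝ, 0 < d ∧ ENNReal.ofReal d ≤ δ := by
    refine ⟨(min δ 1).toReal, ENNReal.toReal_pos (lt_min hδ one_pos).ne' (by simp), ?_⟩
    rw [ENNReal.ofReal_toReal (by simp)]
    exact min_le_left _ _
  set N := (eLpNorm V₀ 2 volume).toReal with hN
  set m : ℝ := c * B.toReal with hm
  have hm0 : 0 ≤ m := by positivity
  -- The integrand at short times is at most m = cB, since domination bounds V Y_ε between L¹ and
  -- L^∞; the time s is chosen to make the contribution of (0, s] at most d/4.
  obtain ⟨s, hs0, hs⟩ : ∃ s : ℝ, 0 < s ∧ s * m ≤ d / 4 := by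
    refine ⟨d / (4 * (m + 1)), by positivity, ?_⟩
    rw [div_mul_eq_mul_div, div_le_div_iff₀ (by positivity) (by norm_num)]
    nlinarith
  have hK0 : ∀ h, ‖Y₀ h‖ ≤ K * ‖h‖ := fun h => by
    refine le_of_tendsto (hlim h).norm ?_
    filter_upwards [self_mem_nhdsWithin] with ε hε using (Y ε).le_of_opNorm_le (hK ε hε) h
  -- Error from times beyond s: dispersive decay times the strong error of e^{-ετ} Y_ε along the
  -- free trajectory of f. It does not involve g, which is where uniformity over the unit ball of L¹
  -- comes from.
  let ρ : ℝ → ℝ := fun ε => ∫ τ in Ioi s, dispC τ * (N * 1) *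
    ‖((Real.exp (-ε * τ) : ℂ) • Y ε - Y₀) (Ev (-τ) f)‖
  have hcont : ∀ ε, Continuous fun τ => ((Real.exp (-ε * τ) : ℂ) • Y ε - Y₀) (Ev (-τ) f) := fun ε => by
    have h1 := (Y ε).continuous.comp ((Ev_continuous f).comp continuous_neg)
    have h2 := Y₀.continuous.comp ((Ev_continuous f).comp continuous_neg)
    exact (Continuous.smul (by fun_prop : Continuous fun τ : ℝ => (Real.exp (-ε * τ) : ℂ)) h1).sub h2
  have hdm : AEStronglyMeasurable dispC (volume.restrict (Ioi s)) := (dispC_integrableOn hs0).1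
  have hbd : ∀ ε > 0, ∀ τ > 0, ‖((Real.exp (-ε * τ) : ℂ) • Y ε - Y₀) (Ev (-τ) f)‖ ≤ 2 * (K * ‖f‖) := by
    intro ε hε τ hτ
    have h1 : ‖Y ε (Ev (-τ) f)‖ ≤ K * ‖f‖ := by
      have := (Y ε).le_of_opNorm_le (hK ε hε) (Ev (-τ) f)
      rwa [Ev_norm] at this
    have h2 : ‖Y₀ (Ev (-τ) f)‖ ≤ K * ‖f‖ := by
      have := hK0 (Ev (-τ) f)
      rwa [Ev_norm] at this
    refine (norm_sub_le _ _).trans ?_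
    rw [two_mul]
    refine add_le_add ?_ h2
    change ‖(Real.exp (-ε * τ) : ℂ) • Y ε (Ev (-τ) f)‖ ≤ _
    rw [norm_smul, Complex.norm_real, Real.norm_of_nonneg (Real.exp_pos _).le]
    refine (mul_le_of_le_one_left (norm_nonneg _) ?_).trans h1
    exact Real.exp_le_one_iff.2 (by nlinarith)
  have hρ : Tendsto ρ (𝓝[>] 0) (𝓝 0) := by
    suffices Tendsto ρ (𝓝[>] 0) (𝓝 (∫ τ in Ioi s, (0 : ℝ))) by simpa using this
    refine tendsto_integral_filter_of_dominated_convergence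
      (fun τ => dispC τ * (N * 1) * (2 * (K * ‖f‖)))
      (Eventually.of_forall fun ε => (hdm.mul_const _).mul (hcont ε).norm.aestronglyMeasurable) ?_
      (((dispC_integrableOn hs0).mul_const _).mul_const _) ?_
    · filter_upwards [self_mem_nhdsWithin] with ε hε
      refine (ae_restrict_iff' measurableSet_Ioi).2 (Eventually.of_forall fun τ hτ => ?_)
      have h3 : 0 ≤ dispC τ * (N * 1) := mul_nonneg (dispC_nonneg τ) (by positivity)
      rw [norm_mul, Real.norm_of_nonneg h3, norm_norm]
      exact mul_le_mul_of_nonneg_left (hbd ε hε τ (hs0.trans hτ)) h3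
    · refine Eventually.of_forall fun τ => ?_
      have h1 : Tendsto (fun ε : ℝ => (Real.exp (-ε * τ) : ℂ)) (𝓝[>] 0) (𝓝 1) := by
        have : Continuous fun ε : ℝ => (Real.exp (-ε * τ) : ℂ) := by fun_prop
        simpa using (this.tendsto 0).mono_left nhdsWithin_le_nhds
      have h2 := (h1.smul (hlim (Ev (-τ) f))).sub_const (Y₀ (Ev (-τ) f))
      rw [one_smul, sub_self] at h2
      simpa using h2.norm.const_mul (dispC τ * (N * 1))
  have hcg : ∀ (Z : Op) (g : L2), Continuous fun τ => inner ℂ g (conjEv τ Z f) := fun Z g =>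
    continuous_const.inner (conjEv_continuous Z f)
  -- The comparison value z is the formula for ⟨g, Y₀ f⟩ without the short times. Comparing both Y_ε
  -- f and, in the limit, Y₀ f with z avoids needing the integral equation for Y₀.
  have key : ∀ g : L2, ∫⁻ x, ‖g x‖ₑ ≤ 1 → ∃ z : ℂ, ∀ ε > 0, ‖inner ℂ g (Y ε f) - z‖ ≤ s * m + ρ ε := by
    intro g hg
    have hgi : Integrable (g : E3 → ℂ) := ⟨(Lp.memLp g).1, hg.trans_lt ENNReal.one_lt_top⟩
    have hg1 : ∫ x, ‖g x‖ ≤ 1 := by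
      rw [integral_norm_eq_lintegral_enorm hgi.1]
      exact ENNReal.toReal_le_of_le_ofReal zero_le_one (by simpa using hg)
    have hdisp : ∀ (Z : Op) (τ : ℝ), 0 < τ → ‖inner ℂ g (conjEv τ (mulL V₀ * Z) f)‖ ≤
        dispC τ * (N * 1) * ‖Z (Ev (-τ) f)‖ := fun Z τ hτ => by
      refine (inner_conjEv_mulL_le hb hi Z f g hgi hτ).trans
        (mul_le_mul_of_nonneg_right ?_ (norm_nonneg _))
      exact mul_le_mul_of_nonneg_left (mul_le_mul_of_nonneg_left hg1 (by positivity)) (dispC_nonneg _)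
    have hint0 : IntegrableOn (fun τ => inner ℂ g (conjEv τ (mulL V₀ * Y₀) f)) (Ioi s) := by
      refine (((dispC_integrableOn hs0).mul_const (N * 1)).mul_const (K * ‖f‖)).mono'
        (hcg _ g).aestronglyMeasurable ?_
      refine (ae_restrict_iff' measurableSet_Ioi).2 (Eventually.of_forall fun τ hτ => ?_)
      refine (hdisp Y₀ τ (hs0.trans hτ)).trans (mul_le_mul_of_nonneg_left ?_
        (mul_nonneg (dispC_nonneg τ) (by positivity)))
      have := hK0 (Ev (-τ) f)
      rwa [Ev_norm] at this
    refine ⟨inner ℂ g (Bh f) + Complex.I * ∫ τ in Ioi s, inner ℂ g (conjEv τ (mulL V₀ * Y₀) f),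
      fun ε hε => ?_⟩
    have hint : IntegrableOn (fun τ => (Real.exp (-ε * τ) : ℂ) *
        inner ℂ g (conjEv τ (mulL V₀ * Y ε) f)) (Ioi 0) :=
      (integrable_exp_neg hε).ofReal.mul_bdd (c := ‖g‖ * (‖mulL V₀ * Y ε‖ * ‖f‖))
        (hcg _ g).aestronglyMeasurable (Eventually.of_forall fun τ =>
          (norm_inner_le_norm _ _).trans (mul_le_mul_of_nonneg_left
            ((conjEv τ _).le_of_opNorm_le (conjEv_norm_le _ _) f) (norm_nonneg _)))
    have e1 : inner ℂ g (Y ε f) = inner ℂ g (Bh f) + Complex.I * ((∫ τ in Ioc 0 s,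
        (Real.exp (-ε * τ) : ℂ) * inner ℂ g (conjEv τ (mulL V₀ * Y ε) f)) + ∫ τ in Ioi s,
        (Real.exp (-ε * τ) : ℂ) * inner ℂ g (conjEv τ (mulL V₀ * Y ε) f)) := by
      conv_lhs => rw [hY ε hε]
      rw [add_apply, smul_apply, inner_add_right, inner_smul_right, inner_avg_wexp hε, pairing]
      simp_rw [← conjEv_inner]
      rw [← setIntegral_union (Ioc_disjoint_Ioi le_rfl) measurableSet_Ioi
        (hint.mono_set Ioc_subset_Ioi_self) (hint.mono_set (Ioi_subset_Ioi hs0.le)),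
        Ioc_union_Ioi_eq_Ioi hs0.le]
    have hsub : (∫ τ in Ioi s, (Real.exp (-ε * τ) : ℂ) * inner ℂ g (conjEv τ (mulL V₀ * Y ε) f)) -
        ∫ τ in Ioi s, inner ℂ g (conjEv τ (mulL V₀ * Y₀) f) =
        ∫ τ in Ioi s, inner ℂ g (conjEv τ (mulL V₀ * ((Real.exp (-ε * τ) : ℂ) • Y ε - Y₀)) f) := by
      rw [← integral_sub (hint.mono_set (Ioi_subset_Ioi hs0.le)) hint0]
      congr 1; ext τ
      simp only [conjEv_apply, mul_sub, mul_smul_comm, sub_apply, smul_apply, map_sub, map_smul,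
        inner_sub_right, inner_smul_right]
    have h1 : ‖∫ τ in Ioc 0 s, (Real.exp (-ε * τ) : ℂ) * inner ℂ g (conjEv τ (mulL V₀ * Y ε) f)‖ ≤
        s * m := by
      have := norm_setIntegral_le_of_norm_le_const (s := Ioc 0 s) (C := m) (by simp)
        (f := fun τ => (Real.exp (-ε * τ) : ℂ) * inner ℂ g (conjEv τ (mulL V₀ * Y ε) f))
        (μ := volume) fun τ hτ => ?_
      · rwa [Real.volume_real_Ioc_of_le hs0.le, sub_zero, mul_comm] at this
      · obtain ⟨μ, hμ, hμD⟩ := hD.conjEv τ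
        have h2 := (hμD ⟨ε, hε⟩).inner_testPair_le (Or.inr ⟨hg, hf⟩)
        rw [norm_mul, Complex.norm_real, Real.norm_of_nonneg (Real.exp_pos _).le]
        refine (mul_le_of_le_one_left (norm_nonneg _) (Real.exp_le_one_iff.2 ?_)).trans ?_
        · nlinarith [hτ.1]
        · have h3 := ENNReal.toReal_mono (ENNReal.mul_ne_top (by simpa using hB) ENNReal.coe_ne_top)
            (h2.trans (mul_le_mul' le_rfl hμ))
          rw [toReal_enorm] at h3
          refine h3.trans_eq ?_
          simp [hm, mul_comm]
    have h2 : ‖∫ τ in Ioi s, inner ℂ g (conjEv τ (mulL V₀ * ((Real.exp (-ε * τ) : ℂ) • Y ε - Y₀)) f)‖ ≤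
        ρ ε := by
      refine norm_integral_le_of_norm_le ?_ ((ae_restrict_iff' measurableSet_Ioi).2
        (Eventually.of_forall fun τ hτ => hdisp _ τ (hs0.trans hτ)))
      refine (((dispC_integrableOn hs0).mul_const (N * 1)).mul_const (2 * (K * ‖f‖))).mono'
        ((hdm.mul_const _).mul (hcont ε).norm.aestronglyMeasurable) ?_
      refine (ae_restrict_iff' measurableSet_Ioi).2 (Eventually.of_forall fun τ hτ => ?_)
      have h3 : 0 ≤ dispC τ * (N * 1) := mul_nonneg (dispC_nonneg τ) (by positivity)
      rw [norm_mul, Real.norm_of_nonneg h3, norm_norm]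
      exact mul_le_mul_of_nonneg_left (hbd ε hε τ (hs0.trans hτ)) h3
    rw [e1, add_sub_add_left_eq_sub, ← mul_sub, add_sub_assoc, hsub, norm_mul, Complex.norm_I, one_mul]
    exact (norm_add_le _ _).trans (add_le_add h1 h2)
  filter_upwards [self_mem_nhdsWithin, hρ.eventually (ge_mem_nhds (half_pos hd0))] with ε hε hρε g hg
  obtain ⟨z, hz⟩ := key g hg
  have h1 : ‖inner ℂ g (Y₀ f) - z‖ ≤ s * m := by
    have h2 := (hρ.const_add (s * m))
    rw [add_zero] at h2
    refine le_of_tendsto_of_tendsto ((tendsto_const_nhds.inner (hlim f)).sub_const z).norm h2 ?_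
    filter_upwards [self_mem_nhdsWithin] with ε hε using hz ε hε
  refine le_trans ?_ hd
  rw [← ofReal_norm]
  refine ENNReal.ofReal_le_ofReal ?_
  rw [inner_sub_right, ← sub_sub_sub_cancel_right _ _ z]
  refine (norm_sub_le _ _).trans ?_
  linarith [hz ε hε]

end

end

/-! ### Bounds, tightness and uniform convergence for the Abel means -/

noncomputable section

lemma TestBdd.of_tendsto {Y : ℝ → Op} {Y₀ : Op} {C : ℝ≥0∞} (h : ∀ ε > 0, TestBdd (Y ε) C)
    (hlim : ∀ f, Tendsto (fun ε => Y ε f) (𝓝[>] 0) (𝓝 (Y₀ f))) : TestBdd Y₀ C := fun A B f g ht => by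
  have := inner_le_of_tendsto (hlim f) (g := g) (z := 0) (δ := C * (A * B)) fun ε hε => by
    rw [sub_zero]; exact h ε hε A B f g ht
  rwa [sub_zero] at this

section
variable {b : OrthonormalBasis (Fin 3) ℝ E3} {V : E3 → ℝ} {V₀ : E3 → ℂ}

lemma kerBdd_qf (hD : ∀ l j : Fin 3, Integrable (weakDeriv (List.replicate j (b l)) (fourierHat V)) ∧
    ∀ x, qf b V₀ l j x = (((2 * Real.pi) ^ (-(3 / 2) : ℝ) : ℝ) * Complex.I ^ (j : ℕ)) *
      invF (weakDeriv (List.replicate j (b l)) (fourierHat V)) x) (l j : Fin 3) :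
    KerBdd (qf b V₀ l j) (Km b V) := by
  obtain ⟨hi, hq⟩ := hD l j
  -- Only an upper bound by the prefactor in L_η is needed, so the smaller constant (2π)^{-3/2} of
  -- Fourier inversion is harmless.
  have hc : ‖(((2 * Real.pi) ^ (-(3 / 2) : ℝ) : ℝ) : ℂ) * Complex.I ^ (j : ℕ)‖ ≤
      (2 * Real.pi) ^ (-(1 / 2) : ℝ) := by
    rw [norm_mul, norm_pow, Complex.norm_I, one_pow, mul_one, Complex.norm_real,
      Real.norm_of_nonneg (by positivity)]
    refine Real.rpow_le_rpow_of_exponent_le ?_ (by norm_num)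
    linarith [Real.pi_gt_three]
  have hm := hi.1.stronglyMeasurable_mk
  have hq' : ∀ x, qf b V₀ l j x = (((2 * Real.pi) ^ (-(3 / 2) : ℝ) : ℝ) * Complex.I ^ (j : ℕ)) *
      invF (hi.1.mk _) x := fun x => by
    rw [hq, invF, invF]
    congr 1
    exact integral_congr_ae (hi.1.ae_eq_mk.mono fun ξ hξ => by simp only; rw [hξ])
  refine ⟨?_, fun η => ⟨_, radSup_measurable hm η, lintegral_radSup_le b V η l j hi.1.ae_eq_mk,
    fun ε hε f g => inner_avg_le_lineForm hm (hi.congr hi.1.ae_eq_mk) hc hq' η hε f g⟩⟩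
  rw [funext hq]
  exact (invF_bdd hi).smul _

variable {F : Fin 3 → Fin 3 → {ε : ℝ // 0 < ε} → Op} {Bh : Op} {Y : ℝ → Op} {Y₀ : Op} {K : ℝ≥0∞}

/-- By the integral equation Y_ε - B is i times the sum of nine time averages of x_l^j V F_{lj},
with F_{lj} dominated independently of ε. Bounds and tightness come from the kernel estimates for
these averages; uniform convergence from the dispersive estimate, with V Y_ε dominated. -/
lemma testConv_of_factorisation (hb : BddM V₀) (hi : Integrable V₀)
    (hq : ∀ l j, KerBdd (qf b V₀ l j) K) (hK : K ≠ ∞) {m₀ : NNReal} (hV : PotDom b V₀ m₀)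
    (hY : ∀ ε > 0, Y ε = Bh + Complex.I • avg (wexp ε) (mulL V₀ * Y ε)) {k : ℝ}
    (hYk : ∀ ε > 0, ‖Y ε‖ ≤ k) (hlim : ∀ f, Tendsto (fun ε => Y ε f) (𝓝[>] 0) (𝓝 (Y₀ f)))
    {cB : NNReal} (hB : DomF (fun _ : Unit => Bh) cB) {c : NNReal} (hF : ∀ l j, DomF (F l j) c)
    (hYF : ∀ i : {ε : ℝ // 0 < ε}, mulL V₀ * Y i = ∑ l, ∑ j, mulL (qf b V₀ l j) * F l j i) :
    ∃ C, TestConv Y Y₀ C := by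
  have hin : ∀ ε (hε : 0 < ε) (f g : L2), inner ℂ g (Y ε f) - inner ℂ g (Bh f) =
      Complex.I * ∑ l, ∑ j, inner ℂ g (avg (wexp ε) (mulL (qf b V₀ l j) * F l j ⟨ε, hε⟩) f) := by
    intro ε hε f g
    have hsum : ∀ (s : Finset (Fin 3)) (Z : Fin 3 → Op), avg (wexp ε) (∑ l ∈ s, Z l) =
        ∑ l ∈ s, avg (wexp ε) (Z l) := fun s Z => by
      have := map_sum (duhamel 1 hε) Z s
      simpa only [duhamel_apply, one_mul] using this
    conv_lhs => rw [hY ε hε, hYF ⟨ε, hε⟩, hsum]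
    simp_rw [hsum]
    rw [add_apply, inner_add_right, add_sub_cancel_left, smul_apply, inner_smul_right]
    simp only [sum_apply, inner_sum]
  have h9 : ∀ (z : Fin 3 → Fin 3 → ℂ) (δ : ℝ≥0∞), (∀ l j, ‖z l j‖ₑ ≤ δ) →
      ‖Complex.I * ∑ l, ∑ j, z l j‖ₑ ≤ 9 * δ := fun z δ hz => by
    have hI : ‖Complex.I‖ₑ = 1 := by rw [← ofReal_norm, Complex.norm_I, ENNReal.ofReal_one]
    rw [enorm_mul, hI, one_mul]
    refine (enorm_sum_le _ _).trans ?_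
    calc ∑ l, ‖∑ j, z l j‖ₑ ≤ ∑ l : Fin 3, ∑ j : Fin 3, δ :=
          Finset.sum_le_sum fun l _ => (enorm_sum_le _ _).trans (Finset.sum_le_sum fun j _ => hz l j)
      _ = 9 * δ := by simp [← mul_assoc]; norm_num
  obtain ⟨μ, hμ, hμB⟩ := id hB
  have hbdd : ∀ ε > 0, TestBdd (Y ε) (9 * (K * c) + cB) := fun ε hε A B f g ht => by
    have h1 := h9 _ (A * B * K * c) fun l j => (hq l j).inner_avg_le (hF l j) ⟨ε, hε⟩ hε ht
    rw [← hin ε hε] at h1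
    have h2 := ((hμB ()).inner_testPair_le ht).trans (mul_le_mul' le_rfl hμ)
    rw [← sub_add_cancel (inner ℂ g (Y ε f)) (inner ℂ g (Bh f))]
    refine (enorm_add_le _ _).trans ((add_le_add h1 h2).trans (le_of_eq (by ring)))
  refine ⟨_, ?_, hbdd, TestBdd.of_tendsto hbdd hlim, hlim, ?_, ?_⟩
  · exact ENNReal.add_ne_top.2 ⟨ENNReal.mul_ne_top (by simp) (ENNReal.mul_ne_top hK (by simp)), by simp⟩
  · intro A B hA hB a δ hδ
    -- Nine terms give δ/2 for Y_ε - B; the limit Y₀ - B inherits δ/2, and the difference of the two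
    -- is at most δ.
    have hδ' : 0 < δ / 18 := ENNReal.div_pos hδ.ne' (by simp)
    choose b' hb' using fun l j => (hq l j).tight hK (hF l j) hA hB a hδ'
    refine ⟨∑ l, ∑ j, |b' l j|, fun ε hε f g ht hs => ?_⟩
    have hs' : ∀ l j, Separated a (b' l j) f g := fun l j => by
      have hle : b' l j ≤ ∑ l, ∑ j, |b' l j| := (le_abs_self _).trans
        ((Finset.single_le_sum (f := fun j => |b' l j|) (fun _ _ => abs_nonneg _) (Finset.mem_univ j)).trans
          (Finset.single_le_sum (f := fun l => ∑ j, |b' l j|)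
            (fun _ _ => Finset.sum_nonneg fun _ _ => abs_nonneg _) (Finset.mem_univ l)))
      exact hs.imp (fun h => ⟨h.1, h.2.mono fun x hx h0 => hle.trans_lt (hx h0)⟩)
        fun h => ⟨h.1, h.2.mono fun x hx h0 => hle.trans_lt (hx h0)⟩
    have h1 : ∀ ε > 0, ‖inner ℂ g (Y ε f) - inner ℂ g (Bh f)‖ₑ ≤ δ / 2 := fun ε hε => by
      rw [hin ε hε]
      refine (h9 _ (δ / 18) fun l j => hb' l j ⟨ε, hε⟩ ε hε f g ht (hs' l j)).trans (le_of_eq ?_)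
      rw [← ENNReal.mul_div_mul_left δ 2 (c := 9) (by simp) (by simp), mul_div_assoc]
      norm_num
    have h2 := inner_le_of_tendsto (hlim f) h1
    rw [inner_sub_right, ← sub_sub_sub_cancel_right _ _ (inner ℂ g (Bh f))]
    exact enorm_sub_le.trans ((add_le_add (h1 ε hε) h2).trans_eq (ENNReal.add_halves δ))
  · intro f B hB hf δ hδ
    have hVY : DomF (fun i : {ε : ℝ // 0 < ε} => mulL V₀ * Y i)
        (∑ _l : Fin 3, ∑ _j : Fin 3, m₀ * c) := by
      simp_rw [hYF]
      exact DomF.sum fun l _ => DomF.sum fun j _ => (hV.dom _ l j).mul (hF l j)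
    exact uniform_of_dispersive hb hi hY hYk hlim hVY f hB hf hδ

end

theorem exists_testConv (b : OrthonormalBasis (Fin 3) ℝ E3) (V : E3 → ℝ)
    (hV : Integrable V) (hVa : HatVaInL1 b V) (hKm : Km b V < ∞) :
    ∃ Ω : Op, IsWaveOperator V Ω ∧ ∃ M₀ : ℝ, 0 < M₀ ∧ ∀ β : ℝ → ℝ, IsCutoff β → ∀ M ≥ M₀,
      ∃ (Y : ℝ → Op) (C : ℝ≥0∞), (∀ ε > 0, ∀ f, abelWave V ε (highFreq β M f) = Y ε f) ∧
        TestConv Y (Ω * highOp β M) C := by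
  obtain ⟨V₀, hae, hi, hreal, hD, hFT⟩ := exists_regular_potential hV hVa
  obtain ⟨m₀, hdom⟩ := exists_potDom hFT
  have hb : BddM V₀ := by simpa [qf_zero] using hdom.1 0 0
  have hA := symOp_mulL hb hreal
  obtain ⟨Ω, hΩ⟩ := exists_waveOp hb hi hA
  refine ⟨Ω, fun f => ?_, ?_⟩
  · simp_rw [waveAt_eq hae hb hA]; exact hΩ f
  obtain ⟨M₀, hM₀, hfac⟩ := exists_factorisation hdom hA
  refine ⟨M₀, hM₀, fun β hβ M hM => ?_⟩
  have hMpos : 0 < M := hM₀.trans_le hM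
  obtain ⟨c, F, hF, hYF⟩ := hfac β hβ M hM
  obtain ⟨cB, hcB⟩ := exists_highOp_mass hβ hMpos
  have hcomm : ∀ t, highOp β M * Ev t = Ev t * highOp β M := fun t =>
    fmul_comm (highOp_bdd hβ M) (symE_bdd t)
  have hY : ∀ ε > 0, abelOp (mulL V₀) ε * highOp β M = highOp β M + Complex.I •
      avg (wexp ε) (mulL V₀ * (abelOp (mulL V₀) ε * highOp β M)) := fun ε hε => by
    rw [← mul_assoc, avg_mul_comm (wexp_integrable hε) hcomm, ← smul_mul_assoc]
    conv_lhs => rw [abelOp_fix hA hε, add_mul, one_mul]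
  have hK : ∀ ε > 0, ‖abelOp (mulL V₀) ε * highOp β M‖ ≤ cB := fun ε hε => by
    refine (norm_mul_le _ _).trans ?_
    exact (mul_le_mul (abelOp_norm_le ε) (DomF.norm_le (hcB Unit) ()) (norm_nonneg _)
      zero_le_one).trans_eq (one_mul _)
  obtain ⟨C, hC⟩ := testConv_of_factorisation hb hi (kerBdd_qf hD) hKm.ne hdom hY hK
    (Y₀ := Ω * highOp β M) (fun f => abelOp_tendsto hA hΩ (highOp β M f)) (hcB Unit) hF hYF
  exact ⟨_, C, fun ε hε f => by rw [highFreq_eq hβ, abelWave_eq hae hb hA hε]; rfl, hC⟩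

end

noncomputable section

/-! ### Duality and interpolation -/

/-- The phase of `u` on `S`. -/
lemma exists_phase {u : E3 → ℂ} (hu : AEStronglyMeasurable u volume) {S : Set E3} (hS : MeasurableSet S)
    (hfin : volume S < ∞) (hui : IntegrableOn u S) : ∃ s : E3 → ℂ, (∀ q : ℝ≥0∞, MemLp s q volume) ∧
      (∀ x, ‖s x‖ₑ ≤ S.indicator 1 x) ∧
      ‖∫ x, (starRingEnd ℂ) (s x) * u x‖ₑ = ∫⁻ x in S, ‖u x‖ₑ := by
  set t : E3 → ℂ := fun x => u x * ((‖u x‖⁻¹ : ℝ) : ℂ) with ht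
  have htn : ∀ x, ‖t x‖ ≤ 1 := fun x => by
    rw [ht]; simp only
    rw [norm_mul, Complex.norm_real, norm_inv, norm_norm]
    exact mul_inv_le_one
  have htm : AEStronglyMeasurable t volume :=
    hu.mul (Complex.measurable_ofReal.comp_aemeasurable hu.norm.aemeasurable.inv).aestronglyMeasurable
  refine ⟨S.indicator t, fun q => ?_, fun x => ?_, ?_⟩
  · rw [memLp_indicator_iff_restrict hS]
    have : IsFiniteMeasure (volume.restrict S) := ⟨by simpa using hfin⟩
    exact MemLp.of_bound htm.restrict 1 (Eventually.of_forall htn)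
  · by_cases hx : x ∈ S
    · rw [indicator_of_mem hx, indicator_of_mem hx, ← ofReal_norm]
      simpa using ENNReal.ofReal_le_ofReal (htn x)
    · rw [indicator_of_notMem hx, enorm_zero]; exact zero_le
  · have h1 : ∀ x, (starRingEnd ℂ) (S.indicator t x) * u x = S.indicator (fun x => ((‖u x‖ : ℝ) : ℂ)) x := by
      intro x
      by_cases hx : x ∈ S
      · rw [indicator_of_mem hx, indicator_of_mem hx, ht]
        simp only [map_mul, Complex.conj_ofReal]
        rcases eq_or_ne (u x) 0 with h0 | h0
        · simp [h0]
        · have hn : ((‖u x‖ : ℝ) : ℂ) ≠ 0 := by simpa using h0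
          have := Complex.conj_mul' (u x)
          rw [mul_right_comm, this, Complex.ofReal_inv]
          field_simp
      · rw [indicator_of_notMem hx, indicator_of_notMem hx]; simp
    simp_rw [h1]
    rw [integral_indicator hS, integral_complex_ofReal, ← ofReal_norm, Complex.norm_real,
      Real.norm_of_nonneg (integral_nonneg fun _ => norm_nonneg _),
      ofReal_integral_norm_eq_lintegral_enorm hui]

lemma exists_phase_L2 (u : L2) {S : Set E3} (hS : MeasurableSet S) (hfin : volume S < ∞) :
    ∃ g : L2, (∀ᵐ x, ‖g x‖ₑ ≤ S.indicator 1 x) ∧ ‖inner ℂ g u‖ₑ = ∫⁻ x in S, ‖u x‖ₑ := by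
  have hu := Lp.memLp u
  have : IsFiniteMeasure (volume.restrict S) := ⟨by simpa using hfin⟩
  obtain ⟨s, h1, h2, h3⟩ := exists_phase hu.1 hS hfin ((hu.restrict S).integrable (by norm_num))
  refine ⟨(h1 2).toLp, (h1 2).coeFn_toLp.mono fun x hx => by rw [hx]; exact h2 x, ?_⟩
  rw [← h3, L2_inner_eq]
  congr 1
  exact integral_congr_ae ((h1 2).coeFn_toLp.mono fun x hx => by simp only; rw [hx])

lemma lintegral_indicator_one_le {g : L2} {S : Set E3} (hS : MeasurableSet S)
    (hg : ∀ᵐ x, ‖g x‖ₑ ≤ S.indicator 1 x) : ∫⁻ x, ‖g x‖ₑ ≤ volume S :=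
  (lintegral_mono_ae hg).trans_eq (lintegral_indicator_one hS)

lemma indicator_one_le' {g : L2} {S : Set E3} (hg : ∀ᵐ x, ‖g x‖ₑ ≤ S.indicator 1 x) :
    ∀ᵐ x, ‖g x‖ₑ ≤ 1 :=
  hg.mono fun _ hx => hx.trans (indicator_le_self' (fun _ _ => zero_le) _)

lemma TestPair.symm {A B : ℝ≥0∞} {f g : L2} (h : TestPair A B f g) : TestPair A B g f := Or.symm h

lemma TestBdd.adjoint {T : Op} {C : ℝ≥0∞} (h : TestBdd T C) :
    TestBdd (ContinuousLinearMap.adjoint T) C := fun A B f g ht => by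
  rw [ContinuousLinearMap.adjoint_inner_right, ← inner_conj_symm, ← ofReal_norm, RCLike.norm_conj,
    ofReal_norm]
  exact h A B g f ht.symm

section
variable {T : Op} {C : ℝ≥0∞}

/-- Duality with the phase of T f on sets of finite measure, which is a bounded L² test function. -/
lemma TestBdd.lintegral_le (h : TestBdd T C) (f : L2) : ∫⁻ x, ‖T f x‖ₑ ≤ C * ∫⁻ x, ‖f x‖ₑ := by
  refine lintegral_le_of_forall_fin_meas_le _ fun S hS hfin => ?_
  obtain ⟨g, h1, h2⟩ := exists_phase_L2 (T f) hS (lt_top_iff_ne_top.2 hfin)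
  rw [← h2]
  simpa using h _ 1 f g (Or.inl ⟨le_rfl, indicator_one_le' h1⟩)

lemma ae_le_of_forall_inner_le (u : L2) {δ : ℝ≥0∞}
    (h : ∀ g : L2, ∀ S : Set E3, MeasurableSet S → volume S < ∞ → (∀ᵐ x, ‖g x‖ₑ ≤ S.indicator 1 x) →
      ‖inner ℂ g u‖ₑ ≤ δ * volume S) : ∀ᵐ x, ‖u x‖ₑ ≤ δ := by
  refine ae_le_of_forall_setLIntegral_le_of_sigmaFinite (L2_enorm_measurable u) fun S hS hfin => ?_
  obtain ⟨g, h1, h2⟩ := exists_phase_L2 u hS hfin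
  rw [← h2, setLIntegral_const]
  exact h g S hS hfin h1

lemma TestBdd.ae_le (h : TestBdd T C) {f : L2} {B : ℝ≥0∞} (hf : ∀ᵐ x, ‖f x‖ₑ ≤ B) :
    ∀ᵐ x, ‖T f x‖ₑ ≤ C * B := by
  refine ae_le_of_forall_inner_le _ fun g S hS _ hg => ?_
  refine (h _ B f g (Or.inr ⟨lintegral_indicator_one_le hS hg, hf⟩)).trans (le_of_eq ?_)
  ring

lemma lintegral_rpow_mul_sub {p : ℝ} (hp : 1 < p) {a : ℝ} (ha : 0 ≤ a) :
    ∫⁻ t in Ioi (0 : ℝ), ENNReal.ofReal (t ^ (p - 2)) * ENNReal.ofReal (a - t) =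
      ENNReal.ofReal ((p - 1)⁻¹ - p⁻¹) * ENNReal.ofReal (a ^ p) := by
  have hi1 : IntervalIntegrable (fun t : ℝ => t ^ (p - 2)) volume 0 a :=
    intervalIntegral.intervalIntegrable_rpow' (by linarith)
  have hi2 : IntervalIntegrable (fun t : ℝ => t ^ (p - 1)) volume 0 a :=
    intervalIntegral.intervalIntegrable_rpow' (by linarith)
  have hi : IntervalIntegrable (fun t : ℝ => a * t ^ (p - 2) - t ^ (p - 1)) volume 0 a :=
    (hi1.const_mul a).sub hi2
  have e : ∀ t : ℝ, 0 < t → a * t ^ (p - 2) - t ^ (p - 1) = t ^ (p - 2) * (a - t) := fun t ht => by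
    have h1 : t ^ (p - 1) = t ^ (p - 2) * t := by
      rw [← Real.rpow_add_one ht.ne']; congr 1; ring
    rw [h1]; ring
  rw [← Ioc_union_Ioi_eq_Ioi ha, lintegral_union measurableSet_Ioi (Ioc_disjoint_Ioi le_rfl)]
  have h2 : ∫⁻ t in Ioi a, ENNReal.ofReal (t ^ (p - 2)) * ENNReal.ofReal (a - t) = 0 := by
    rw [setLIntegral_congr_fun measurableSet_Ioi (g := fun _ => 0) fun t ht => ?_, lintegral_zero]
    rw [ENNReal.ofReal_of_nonpos (sub_nonpos.2 (le_of_lt ht)), mul_zero]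
  have h3 : ∫⁻ t in Ioc 0 a, ENNReal.ofReal (t ^ (p - 2)) * ENNReal.ofReal (a - t) =
      ∫⁻ t in Ioc 0 a, ENNReal.ofReal (a * t ^ (p - 2) - t ^ (p - 1)) := by
    refine setLIntegral_congr_fun measurableSet_Ioc fun t ht => ?_
    rw [e t ht.1, ENNReal.ofReal_mul (Real.rpow_nonneg ht.1.le _)]
  have h4 : 0 ≤ᵐ[volume.restrict (Ioc 0 a)] fun t => a * t ^ (p - 2) - t ^ (p - 1) := by
    refine (ae_restrict_iff' measurableSet_Ioc).2 (Eventually.of_forall fun t ht => ?_)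
    simp only [Pi.zero_apply]
    rw [e t ht.1]
    exact mul_nonneg (Real.rpow_nonneg ht.1.le _) (sub_nonneg.2 ht.2)
  rw [h2, add_zero, h3, ← ofReal_integral_eq_lintegral_ofReal
    ((intervalIntegrable_iff_integrableOn_Ioc_of_le ha).1 hi) h4, ← intervalIntegral.integral_of_le ha,
    intervalIntegral.integral_sub (hi1.const_mul a) hi2, intervalIntegral.integral_const_mul,
    integral_rpow (Or.inl (by linarith)), integral_rpow (Or.inl (by linarith)),
    ← ENNReal.ofReal_mul]
  · congr 1
    rw [show p - 2 + 1 = p - 1 by ring, show p - 1 + 1 = p by ring, Real.zero_rpow (by linarith),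
      Real.zero_rpow (by linarith), sub_zero, sub_zero]
    rcases eq_or_lt_of_le ha with rfl | h0
    · simp [Real.zero_rpow (show p ≠ 0 by linarith)]
    · rw [Real.rpow_sub_one h0.ne']
      field_simp
  · rw [sub_nonneg]; exact inv_anti₀ (by linarith) (by linarith)

/-- Layer-cake form of a^p: integrating (a - t)₊ against t^{p-2} dt gives a^p with the positive
constant 1/(p-1) - 1/p, so comparison of all truncated integrals implies comparison of p-th powers.
-/
lemma lintegral_rpow_le_of_trunc {U W : E3 → ℝ} (hU : Measurable U) (hW : Measurable W)
    (hU0 : ∀ x, 0 ≤ U x) (hW0 : ∀ x, 0 ≤ W x) {p : ℝ} (hp : 1 < p)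
    (h : ∀ t > 0, ∫⁻ x, ENNReal.ofReal (U x - t) ≤ ∫⁻ x, ENNReal.ofReal (W x - t)) :
    ∫⁻ x, ENNReal.ofReal (U x ^ p) ≤ ∫⁻ x, ENNReal.ofReal (W x ^ p) := by
  have hc : ENNReal.ofReal ((p - 1)⁻¹ - p⁻¹) ≠ 0 := by
    rw [Ne, ENNReal.ofReal_eq_zero, not_le, sub_pos]
    exact inv_strictAnti₀ (by linarith) (by linarith)
  rw [← ENNReal.mul_le_mul_iff_right hc ENNReal.ofReal_ne_top, ← lintegral_const_mul _ (by fun_prop),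
    ← lintegral_const_mul _ (by fun_prop)]
  simp_rw [← lintegral_rpow_mul_sub hp (hU0 _), ← lintegral_rpow_mul_sub hp (hW0 _)]
  have hm : ∀ {U : E3 → ℝ}, Measurable U → AEMeasurable (Function.uncurry fun (x : E3) (t : ℝ) =>
      ENNReal.ofReal (t ^ (p - 2)) * ENNReal.ofReal (U x - t))
      ((volume : Measure E3).prod (volume.restrict (Ioi (0 : ℝ)))) := fun hU => by
    refine Measurable.aemeasurable ?_
    unfold Function.uncurry
    fun_prop
  rw [lintegral_lintegral_swap (hm hU), lintegral_lintegral_swap (hm hW)]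
  refine setLIntegral_mono_ae' measurableSet_Ioi (Eventually.of_forall fun t ht => ?_)
  rw [lintegral_const_mul _ (by fun_prop), lintegral_const_mul _ (by fun_prop)]
  exact mul_le_mul' le_rfl (h t ht)

/-- Truncate f radially at height t. The truncated part stays below t by the L^∞ contraction, so (|T
f| - t)₊ is at most |T(f - f_t)|, whose integral is controlled by the L¹ contraction. This yields
interpolation without loss of constant. -/
lemma TestBdd.trunc_le (h : TestBdd T 1) (f : L2) {t : ℝ} (ht : 0 < t) :
    ∫⁻ x, ENNReal.ofReal (‖T f x‖ - t) ≤ ∫⁻ x, ENNReal.ofReal (‖f x‖ - t) := by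
  have hfm := (Lp.stronglyMeasurable f).measurable
  set m : E3 → ℂ := fun x => ((t / max t ‖f x‖ : ℝ) : ℂ) with hm
  have hmax : ∀ x, 0 < max t ‖f x‖ := fun x => lt_max_of_lt_left ht
  have hmb : BddM m := by
    refine ⟨(by fun_prop : Measurable m).aestronglyMeasurable, 1, fun x => ?_⟩
    rw [hm]; simp only
    rw [Complex.norm_real, Real.norm_of_nonneg (div_nonneg ht.le (hmax x).le)]
    exact div_le_one_of_le₀ (le_max_left _ _) (hmax x).le
  have h2 : ∀ᵐ x, ‖mulL m f x‖ₑ ≤ ENNReal.ofReal t := by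
    filter_upwards [mulL_coeFn hmb f] with x hx
    rw [hx, ← ofReal_norm, norm_mul, hm]
    simp only
    rw [Complex.norm_real, Real.norm_of_nonneg (div_nonneg ht.le (hmax x).le)]
    refine ENNReal.ofReal_le_ofReal ?_
    rw [div_mul_eq_mul_div, div_le_iff₀ (hmax x)]
    exact mul_le_mul_of_nonneg_left (le_max_right _ _) ht.le
  have h1 : ∫⁻ x, ‖(f - mulL m f : L2) x‖ₑ = ∫⁻ x, ENNReal.ofReal (‖f x‖ - t) := by
    refine lintegral_congr_ae ?_
    filter_upwards [Lp.coeFn_sub f (mulL m f), mulL_coeFn hmb f] with x h3 h4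
    have e1 : f x - m x * f x = (((max t ‖f x‖ - t) / max t ‖f x‖ : ℝ) : ℂ) * f x := by
      rw [sub_div, div_self (hmax x).ne', hm]; push_cast; ring
    rw [h3, Pi.sub_apply, h4, e1, ← ofReal_norm, norm_mul, Complex.norm_real,
      Real.norm_of_nonneg (div_nonneg (sub_nonneg.2 (le_max_left _ _)) (hmax x).le)]
    rcases le_total t ‖f x‖ with h5 | h5
    · rw [max_eq_right h5, div_mul_cancel₀ _ (ht.trans_le h5).ne']
    · rw [max_eq_left h5, sub_self, zero_div, zero_mul, ENNReal.ofReal_zero,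
        ENNReal.ofReal_of_nonpos (sub_nonpos.2 h5)]
  have h3 := h.lintegral_le (f - mulL m f)
  rw [one_mul, h1] at h3
  refine (lintegral_mono_ae ?_).trans h3
  filter_upwards [h.ae_le h2, Lp.coeFn_sub (T f) (T (mulL m f))] with x h4 h5
  rw [map_sub, h5, Pi.sub_apply, ← ofReal_norm]
  rw [one_mul, ← ofReal_norm, ENNReal.ofReal_le_ofReal_iff ht.le] at h4
  refine ENNReal.ofReal_le_ofReal ?_
  linarith [norm_sub_norm_le (T f x) (T (mulL m f) x)]

lemma TestBdd.eLpNorm_le_one (h : TestBdd T 1) (p : ℝ≥0∞) (hp : 1 ≤ p) (f : L2) :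
    eLpNorm (T f) p volume ≤ eLpNorm f p volume := by
  rcases eq_or_ne p ∞ with rfl | hpt
  · have h1 : ∀ᵐ x, ‖f x‖ₑ ≤ eLpNorm f ∞ volume := by
      rw [eLpNorm_exponent_top]; exact ae_le_eLpNormEssSup
    have h2 := h.ae_le h1
    rw [one_mul] at h2
    rw [eLpNorm_exponent_top]
    exact essSup_le_of_ae_le _ h2
  rcases eq_or_lt_of_le hp with rfl | hp1
  · rw [eLpNorm_one_eq_lintegral_enorm, eLpNorm_one_eq_lintegral_enorm]
    simpa using h.lintegral_le f
  have hp0 : p ≠ 0 := (zero_lt_one.trans hp1).ne'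
  have hp1' : 1 < p.toReal := by
    have := (ENNReal.toReal_lt_toReal ENNReal.one_ne_top hpt).2 hp1
    simpa using this
  have key := lintegral_rpow_le_of_trunc (Lp.stronglyMeasurable (T f)).measurable.norm
    (Lp.stronglyMeasurable f).measurable.norm (fun _ => norm_nonneg _) (fun _ => norm_nonneg _) hp1'
    fun t ht => h.trunc_le f ht
  rw [eLpNorm_eq_lintegral_rpow_enorm_toReal hp0 hpt, eLpNorm_eq_lintegral_rpow_enorm_toReal hp0 hpt]
  refine ENNReal.rpow_le_rpow ?_ (by positivity)
  have e : ∀ u : L2, ∀ x, ENNReal.ofReal (‖u x‖ ^ p.toReal) = ‖u x‖ₑ ^ p.toReal := fun u x => by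
    rw [← ofReal_norm, ENNReal.ofReal_rpow_of_nonneg (norm_nonneg _) (by positivity)]
  simp_rw [e] at key
  exact key

/-- Rescaling to a contraction; C + 1 replaces C so that the divisor is never 0. -/
lemma TestBdd.eLpNorm_le (h : TestBdd T C) (hC : C ≠ ∞) (p : ℝ≥0∞) (hp : 1 ≤ p) (f : L2) :
    eLpNorm (T f) p volume ≤ (C + 1) * eLpNorm f p volume := by
  set c : NNReal := C.toNNReal + 1 with hc
  have hcC : (c : ℝ≥0∞) = C + 1 := by rw [hc, ENNReal.coe_add, ENNReal.coe_toNNReal hC]; rfl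
  have hc0 : c ≠ 0 := by positivity
  have hn : ‖((c : ℂ)⁻¹)‖ₑ = (c : ℝ≥0∞)⁻¹ := by
    rw [← ENNReal.coe_inv hc0]
    simp [enorm, nnnorm_inv]
  have h1 : TestBdd ((c : ℂ)⁻¹ • T) 1 := fun A B f g ht => by
    rw [smul_apply, inner_smul_right, enorm_mul, hn, one_mul]
    refine (mul_le_mul' le_rfl (h A B f g ht)).trans ?_
    rw [← mul_assoc]
    refine (mul_le_mul' (mul_le_mul' le_rfl (le_self_add.trans_eq hcC.symm)) le_rfl).trans_eq ?_
    rw [ENNReal.inv_mul_cancel (by simpa using hc0) ENNReal.coe_ne_top, one_mul]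
  have h2 := h1.eLpNorm_le_one p hp f
  rw [smul_apply, eLpNorm_congr_ae (Lp.coeFn_smul _ _), eLpNorm_const_smul, hn] at h2
  rw [← hcC]
  refine le_trans (le_of_eq ?_) (mul_le_mul' le_rfl h2)
  rw [← mul_assoc, ENNReal.mul_inv_cancel (by simpa using hc0) ENNReal.coe_ne_top, one_mul]

end

end

noncomputable section

/-! ### Extension to `L^p` -/

/-- The space `L^p(ℝ³; ℂ)`. -/
abbrev LpE (p : ℝ≥0∞) : Type := Lp ℂ p (volume : Measure E3)

/-- `f` is bounded and supported in a ball. -/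
def BddSupp (f : E3 → ℂ) : Prop :=
  AEStronglyMeasurable f volume ∧ (∃ B : NNReal, ∀ᵐ x, ‖f x‖ₑ ≤ B) ∧ ∃ a : ℝ, ∀ᵐ x, f x ≠ 0 → ‖x‖ ≤ a

lemma BddSupp.congr {f g : E3 → ℂ} (h : BddSupp f) (e : f =ᵐ[volume] g) : BddSupp g := by
  obtain ⟨h1, ⟨B, h2⟩, a, h3⟩ := h
  refine ⟨h1.congr e, ⟨B, ?_⟩, a, ?_⟩
  · filter_upwards [h2, e] with x h4 h5 using h5 ▸ h4
  · filter_upwards [h3, e] with x h4 h5 using h5 ▸ h4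

lemma BddSupp.memLp {f : E3 → ℂ} (h : BddSupp f) (p : ℝ≥0∞) : MemLp f p volume := by
  obtain ⟨h1, ⟨B, h2⟩, a, h3⟩ := h
  have hS : MeasurableSet (Metric.closedBall (0 : E3) a) := measurableSet_closedBall
  have h4 : (Metric.closedBall (0 : E3) a).indicator f =ᵐ[volume] f := by
    filter_upwards [h3] with x hx
    by_cases hx' : x ∈ Metric.closedBall (0 : E3) a
    · rw [indicator_of_mem hx']
    · rw [indicator_of_notMem hx']
      by_contra h5
      exact hx' (by simpa using hx (Ne.symm h5))
  have : IsFiniteMeasure (volume.restrict (Metric.closedBall (0 : E3) a)) :=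
    ⟨by simpa using measure_closedBall_lt_top (μ := (volume : Measure E3)) (x := 0) (r := a)⟩
  refine (memLp_congr_ae h4).1 ((memLp_indicator_iff_restrict hS).2 ?_)
  refine MemLp.of_bound h1.restrict B (ae_restrict_of_ae (h2.mono fun x hx => ?_))
  simpa [enorm, ← NNReal.coe_le_coe] using hx

lemma BddSupp.of_continuous {f : E3 → ℂ} (hf : Continuous f) (hc : HasCompactSupport f) :
    BddSupp f := by
  obtain ⟨B, hB⟩ := hc.exists_bound_of_continuous hf
  obtain ⟨a, ha⟩ := hc.isCompact.isBounded.subset_closedBall (0 : E3)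
  refine ⟨hf.aestronglyMeasurable, ⟨B.toNNReal, Eventually.of_forall fun x => ?_⟩, a,
    Eventually.of_forall fun x hx => by simpa using ha (subset_tsupport _ hx)⟩
  rw [← ofReal_norm]
  exact ENNReal.ofReal_le_ofReal (hB x)

lemma exists_continuous_near {p : ℝ≥0∞} [Fact (1 ≤ p)] (hp : p ≠ ∞) (g : LpE p) {δ : ℝ} (hδ : 0 < δ) :
    ∃ (f : E3 → ℂ) (h : MemLp f p volume), Continuous f ∧ HasCompactSupport f ∧ ‖g - h.toLp‖ ≤ δ := by
  obtain ⟨f, h1, h2, h3, h4⟩ := (Lp.memLp g).exists_hasCompactSupport_eLpNorm_sub_le hp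
    (ENNReal.ofReal_pos.2 hδ).ne'
  refine ⟨f, h4, h3, h1, ?_⟩
  rw [Lp.norm_def]
  refine ENNReal.toReal_le_of_le_ofReal hδ.le ((eLpNorm_congr_ae ?_).trans_le h2)
  filter_upwards [Lp.coeFn_sub g h4.toLp, h4.coeFn_toLp] with x h5 h6
  rw [h5, Pi.sub_apply, Pi.sub_apply, h6]

lemma dense_continuous {p : ℝ≥0∞} [Fact (1 ≤ p)] (hp : p ≠ ∞) :
    Dense {g : LpE p | ∃ f : E3 → ℂ, Continuous f ∧ HasCompactSupport f ∧ g =ᵐ[volume] f} := by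
  refine Metric.dense_iff.2 fun g r hr => ?_
  obtain ⟨f, h, h1, h2, h3⟩ := exists_continuous_near hp g (half_pos hr)
  refine ⟨h.toLp, ?_, f, h1, h2, h.coeFn_toLp⟩
  rw [Metric.mem_ball, dist_comm, dist_eq_norm]
  exact h3.trans_lt (half_lt_self hr)

/-- The elements of `L²` that lie in `L^p`. -/
def interLp (p : ℝ≥0∞) : Submodule ℂ L2 where
  carrier := {f | MemLp f p volume}
  zero_mem' := (memLp_congr_ae (Lp.coeFn_zero ℂ 2 _)).2 MemLp.zero
  add_mem' {f g} hf hg := (memLp_congr_ae (Lp.coeFn_add f g)).2 (hf.add hg)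
  smul_mem' c f hf := (memLp_congr_ae (Lp.coeFn_smul c f)).2 (hf.const_smul c)

/-- A linear map from `L² ∩ L^p` to `L^p`. -/
def interMap (p : ℝ≥0∞) [Fact (1 ≤ p)] (T : Op) (hT : ∀ f ∈ interLp p, T f ∈ interLp p) :
    interLp p →ₗ[ℂ] LpE p where
  toFun f := MemLp.toLp (T f) (hT f f.2)
  map_add' f g := by
    refine (MemLp.toLp_congr _ ((hT f f.2).add (hT g g.2)) ?_).trans (MemLp.toLp_add _ _)
    rw [Submodule.coe_add, map_add]
    exact Lp.coeFn_add _ _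
  map_smul' c f := by
    refine (MemLp.toLp_congr _ ((hT f f.2).const_smul c) ?_).trans (MemLp.toLp_const_smul c _)
    rw [Submodule.coe_smul, map_smul]
    exact Lp.coeFn_smul _ _

lemma interMap_coeFn {p : ℝ≥0∞} [Fact (1 ≤ p)] {T : Op} (hT : ∀ f ∈ interLp p, T f ∈ interLp p)
    (f : interLp p) : interMap p T hT f =ᵐ[volume] T f := MemLp.coeFn_toLp (hT f f.2)

lemma interMap_norm {p : ℝ≥0∞} [Fact (1 ≤ p)] {T : Op} (hT : ∀ f ∈ interLp p, T f ∈ interLp p)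
    (f : interLp p) : ‖interMap p T hT f‖ = (eLpNorm (T f) p volume).toReal := by
  rw [Lp.norm_def, eLpNorm_congr_ae (interMap_coeFn hT f)]

section
variable {T : Op} {C : ℝ≥0∞}

lemma TestBdd.exists_extension_lt_top (h : TestBdd T C) (hC : C ≠ ∞) {p : ℝ≥0∞} [hp1 : Fact (1 ≤ p)]
    (hp : p ≠ ∞) : ∃ S : LpE p →L[ℂ] LpE p, ‖S‖ ≤ (C + 1).toReal ∧
      ∀ (f : L2) (g : LpE p), (f : E3 → ℂ) =ᵐ[volume] g → (T f : E3 → ℂ) =ᵐ[volume] S g := by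
  have hC1 : C + 1 ≠ ∞ := by simpa using hC
  have hm : ∀ f ∈ interLp p, T f ∈ interLp p := fun f hf =>
    ⟨(Lp.memLp (T f)).1, (h.eLpNorm_le hC p hp1.out f).trans_lt
      (ENNReal.mul_lt_top hC1.lt_top hf.2)⟩
  have hi : ∀ f ∈ interLp p, (ContinuousLinearMap.id ℂ L2) f ∈ interLp p := fun f hf => by
    rwa [ContinuousLinearMap.id_apply]
  set e := interMap p (ContinuousLinearMap.id ℂ L2) hi with he
  set F := interMap p T hm with hF
  have hn : ∀ f, ‖F f‖ ≤ (C + 1).toReal * ‖e f‖ := fun f => by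
    rw [he, hF, interMap_norm, interMap_norm, ← ENNReal.toReal_mul]
    exact ENNReal.toReal_mono (ENNReal.mul_ne_top hC1 f.2.2.ne) (h.eLpNorm_le hC p hp1.out f)
  have hd : DenseRange e := by
    refine (dense_continuous hp).mono ?_
    rintro g ⟨f, h1, h2, h3⟩
    have h4 := BddSupp.of_continuous h1 h2
    refine ⟨⟨(h4.memLp 2).toLp, (memLp_congr_ae (h4.memLp 2).coeFn_toLp).2 (h4.memLp p)⟩, ?_⟩
    exact Lp.ext ((interMap_coeFn _ _).trans ((h4.memLp 2).coeFn_toLp.trans h3.symm))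
  refine ⟨F.extendOfNorm e, LinearMap.opNorm_extendOfNorm_le hd ENNReal.toReal_nonneg hn,
    fun f g hfg => ?_⟩
  have hf : f ∈ interLp p := (memLp_congr_ae hfg).2 (Lp.memLp g)
  have h1 : e ⟨f, hf⟩ = g := Lp.ext ((interMap_coeFn _ _).trans hfg)
  rw [← h1, LinearMap.extendOfNorm_eq hd ⟨_, hn⟩]
  exact (interMap_coeFn hm ⟨f, hf⟩).symm

end

/-! ### The dual of `L¹` -/

/-- The pairing `∫ h s` of `h ∈ L¹` and `s ∈ L^∞`. -/
def pairL1 : LpE 1 →L[ℂ] LpE ∞ →L[ℂ] ℂ := (ContinuousLinearMap.mul ℂ ℂ).lpPairing volume 1 ∞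

lemma pairL1_apply (h : LpE 1) (s : LpE ∞) : pairL1 h s = ∫ x, h x * s x :=
  ContinuousLinearMap.lpPairing_eq_integral _ _ _

lemma pairL1_norm_le (h : LpE 1) (s : LpE ∞) : ‖pairL1 h s‖ ≤ ‖h‖ * ‖s‖ := by
  have h1 : ∀ᵐ x, ‖s x‖ ≤ ‖s‖ := by
    have := ae_le_eLpNormEssSup (f := (s : E3 → ℂ)) (μ := volume)
    filter_upwards [this] with x hx
    rw [← eLpNorm_exponent_top] at hx
    rw [Lp.norm_def, ← toReal_enorm]
    exact ENNReal.toReal_mono (Lp.eLpNorm_ne_top s) hx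
  rw [pairL1_apply, L1.norm_eq_integral_norm, ← integral_mul_const]
  refine norm_integral_le_of_norm_le ((L1.integrable_coeFn h).norm.mul_const _) (h1.mono fun x hx => ?_)
  rw [norm_mul]
  exact mul_le_mul_of_nonneg_left hx (norm_nonneg _)

lemma linftyNorm_le {s : LpE ∞} {c : ℝ} (hc : 0 ≤ c) (h : ∀ᵐ x, ‖s x‖ ≤ c) : ‖s‖ ≤ c := by
  rw [Lp.norm_def, eLpNorm_exponent_top]
  refine ENNReal.toReal_le_of_le_ofReal hc (essSup_le_of_ae_le _ (h.mono fun x hx => ?_))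
  change ‖s x‖ₑ ≤ _
  rw [← ofReal_norm]
  exact ENNReal.ofReal_le_ofReal hx

lemma pairL1_injective {s s' : LpE ∞} (h : ∀ k, pairL1 k s = pairL1 k s') : s = s' := by
  rw [← sub_eq_zero]
  set u := s - s' with hu
  have h0 : ∀ k, pairL1 k u = 0 := fun k => by rw [hu, map_sub, h, sub_self]
  have h1 : ∀ᵐ x, ‖u x‖ₑ ≤ 0 := by
    refine ae_le_of_forall_setLIntegral_le_of_sigmaFinite (Lp.stronglyMeasurable u).measurable.enorm
      fun S hS hfin => ?_
    have : IsFiniteMeasure (volume.restrict S) := ⟨by simpa using hfin⟩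
    obtain ⟨t, h1, -, h3⟩ := exists_phase (Lp.memLp u).1 hS hfin
      (((Lp.memLp u).restrict S).integrable (by simp))
    have h4 : MemLp (fun x => (starRingEnd ℂ) (t x)) 1 volume := (h1 1).star
    rw [← h3, setLIntegral_const, zero_mul]
    have := h0 h4.toLp
    rw [pairL1_apply] at this
    rw [integral_congr_ae (h4.coeFn_toLp.mono fun x hx => congrArg (· * u x) hx)] at this
    rw [this, enorm_zero]
  refine Lp.ext ?_
  filter_upwards [h1, Lp.coeFn_zero ℂ ∞ (volume : Measure E3)] with x h2 h3
  rw [h3]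
  simpa using h2

lemma L1_ext {ℓ ℓ' : LpE 1 →L[ℂ] ℂ} (h : ∀ (k : LpE 1) (f : E3 → ℂ), Continuous f → HasCompactSupport f →
    k =ᵐ[volume] f → ℓ k = ℓ' k) : ℓ = ℓ' := by
  ext k
  refine (dense_continuous ENNReal.one_ne_top).induction (P := fun k => ℓ k = ℓ' k) ?_
    (isClosed_eq ℓ.continuous ℓ'.continuous) k
  rintro k ⟨f, h1, h2, h3⟩
  exact h k f h1 h2 h3

/-- A weight. -/
def wt (x : E3) : ℝ := (1 + ‖x‖) ^ (-4 : ℝ)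

lemma wt_pos (x : E3) : 0 < wt x := Real.rpow_pos_of_pos (by positivity) _

lemma wt_le_one (x : E3) : wt x ≤ 1 :=
  Real.rpow_le_one_of_one_le_of_nonpos (by linarith [norm_nonneg x]) (by norm_num)

lemma wt_continuous : Continuous wt :=
  (continuous_const.add continuous_norm).rpow_const fun x => Or.inl (show 1 + ‖x‖ ≠ 0 by positivity)

lemma wt_memLp : MemLp (fun x => (wt x : ℂ)) 2 (volume : Measure E3) := by
  have h1 : Integrable (fun x : E3 => (1 + ‖x‖) ^ (-4 : ℝ)) := by
    have := integrable_one_add_norm (E := E3) (μ := volume) (r := 4) (by simp; norm_num)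
    exact this
  have hb : BddM fun x => (wt x : ℂ) := ⟨(Complex.continuous_ofReal.comp wt_continuous).aestronglyMeasurable,
    1, fun x => by rw [Complex.norm_real, Real.norm_of_nonneg (wt_pos x).le]; exact wt_le_one x⟩
  exact memLp_two_of_integrable h1.ofReal hb

/-- Complex conjugation on `L^p`. -/
def conjLp (p : ℝ≥0∞) [Fact (1 ≤ p)] : LpE p →L[ℝ] LpE p :=
  (Complex.conjCLE : ℂ →L[ℝ] ℂ).compLpL p volume

lemma conjLp_coeFn {p : ℝ≥0∞} [Fact (1 ≤ p)] (k : LpE p) :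
    conjLp p k =ᵐ[volume] fun x => (starRingEnd ℂ) (k x) :=
  ContinuousLinearMap.coeFn_compLpL _ _

lemma conjLp_norm {p : ℝ≥0∞} [Fact (1 ≤ p)] (k : LpE p) : ‖conjLp p k‖ = ‖k‖ := by
  rw [Lp.norm_def, Lp.norm_def]
  congr 1
  exact eLpNorm_congr_norm_ae ((conjLp_coeFn k).mono fun x hx => by rw [hx, RCLike.norm_conj])

lemma conjLp_smul {p : ℝ≥0∞} [Fact (1 ≤ p)] (c : ℂ) (k : LpE p) :
    conjLp p (c • k) = (starRingEnd ℂ) c • conjLp p k := by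
  refine Lp.ext ?_
  filter_upwards [conjLp_coeFn (c • k), conjLp_coeFn k, Lp.coeFn_smul c k,
    Lp.coeFn_smul ((starRingEnd ℂ) c) (conjLp p k)] with x h1 h2 h3 h4
  rw [h1, h3, h4, Pi.smul_apply, Pi.smul_apply, h2, smul_eq_mul, smul_eq_mul, map_mul]

/-- Every continuous functional on `L¹` is given by a bounded function. -/
lemma exists_linfty (ℓ : LpE 1 →L[ℂ] ℂ) : ∃ s : LpE ∞, ‖s‖ ≤ ‖ℓ‖ ∧ ∀ k, pairL1 k s = ℓ k := by
  -- The weight embeds L² into L¹ by φ ↦ w φ. Riesz represents the pulled-back functional by v ∈ L²,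
  -- testing with phases gives |v| ≤ ‖ℓ‖ w, and conj v / w is the required bounded function.
  set w : L2 := wt_memLp.toLp with hw
  set J : L2 →L[ℂ] LpE 1 := (ContinuousLinearMap.mul ℂ ℂ).holderL volume 2 2 1 w with hJ
  have hJc : ∀ φ : L2, J φ =ᵐ[volume] fun x => wt x * φ x := fun φ => by
    refine (ContinuousLinearMap.coeFn_holder _ _ _).trans ?_
    filter_upwards [wt_memLp.coeFn_toLp] with x hx
    rw [hw, hx]; rfl
  set v : L2 := (InnerProductSpace.toDual ℂ L2).symm (ℓ ∘L J) with hv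
  have hvi : ∀ φ, inner ℂ v φ = ℓ (J φ) := fun φ => by
    rw [hv, InnerProductSpace.toDual_symm_apply]; rfl
  have hvb : ∀ᵐ x, ‖v x‖ₑ ≤ ‖ℓ‖ₑ * ENNReal.ofReal (wt x) := by
    refine ae_le_of_forall_setLIntegral_le_of_sigmaFinite (L2_enorm_measurable v) fun S hS hfin => ?_
    obtain ⟨g, h1, h2⟩ := exists_phase_L2 v hS hfin
    rw [← h2, ← inner_conj_symm, ← ofReal_norm, RCLike.norm_conj, ofReal_norm, hvi]
    refine (ℓ.le_opENorm _).trans ?_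
    rw [lintegral_const_mul _ (by have := wt_continuous; fun_prop)]
    refine mul_le_mul' le_rfl ?_
    rw [Lp.enorm_def, eLpNorm_one_eq_lintegral_enorm, ← lintegral_indicator hS]
    refine lintegral_mono_ae ?_
    filter_upwards [hJc g, h1] with x h3 h4
    rw [h3, enorm_mul]
    by_cases hx : x ∈ S
    · rw [indicator_of_mem hx] at h4 ⊢
      refine (mul_le_mul' le_rfl h4).trans_eq ?_
      rw [Pi.one_apply, mul_one, ← ofReal_norm, Complex.norm_real, Real.norm_of_nonneg (wt_pos x).le]
    · rw [indicator_of_notMem hx] at h4 ⊢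
      rw [le_antisymm h4 zero_le, mul_zero]
  have hsb : ∀ᵐ x, ‖(starRingEnd ℂ) (v x) / wt x‖ ≤ ‖ℓ‖ := by
    filter_upwards [hvb] with x hx
    rw [norm_div, RCLike.norm_conj, Complex.norm_real, Real.norm_of_nonneg (wt_pos x).le,
      div_le_iff₀ (wt_pos x)]
    rw [← ofReal_norm, ← ofReal_norm, ← ENNReal.ofReal_mul (norm_nonneg _)] at hx
    exact (ENNReal.ofReal_le_ofReal_iff (mul_nonneg (norm_nonneg _) (wt_pos x).le)).1 hx
  have hsm : MemLp (fun x => (starRingEnd ℂ) (v x) / wt x) ∞ volume := by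
    refine memLp_top_of_bound ?_ _ hsb
    have h1 := (Lp.stronglyMeasurable v).measurable
    have h2 := wt_continuous.measurable
    exact ((Complex.continuous_conj.measurable.comp h1).div
      (Complex.measurable_ofReal.comp h2)).aestronglyMeasurable
  refine ⟨hsm.toLp, linftyNorm_le (norm_nonneg _) ?_, fun k => ?_⟩
  · filter_upwards [hsm.coeFn_toLp, hsb] with x h1 h2 using h1 ▸ h2
  · refine DFunLike.congr_fun (L1_ext (ℓ := pairL1.flip hsm.toLp) fun k f hf hc hk => ?_) k
    have h1 : Continuous fun x => f x / wt x :=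
      hf.div (Complex.continuous_ofReal.comp wt_continuous) fun x => by
        simpa using (wt_pos x).ne'
    have h2 : HasCompactSupport fun x => f x / wt x :=
      hc.mono fun x hx hx' => hx (by simp [hx'])
    have h3 := (BddSupp.of_continuous h1 h2).memLp 2
    have h4 : J h3.toLp = k := by
      refine Lp.ext ((hJc _).trans ?_)
      filter_upwards [h3.coeFn_toLp, hk] with x h5 h6
      rw [h5, h6, mul_div_cancel₀]
      simpa using (wt_pos x).ne'
    rw [← h4, ← hvi, L2_inner_eq]
    change pairL1 _ _ = _
    rw [pairL1_apply]
    refine integral_congr_ae ?_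
    filter_upwards [hJc h3.toLp, hsm.coeFn_toLp] with x h5 h6
    have : (wt x : ℂ) ≠ 0 := by simpa using (wt_pos x).ne'
    rw [h5, h6]
    field_simp

section
variable {T : Op} {C : ℝ≥0∞}

/-- The extension to `L^∞`, as the transpose of an operator on `L¹`. -/
lemma TestBdd.exists_extension_top (h : TestBdd T C) (hC : C ≠ ∞) :
    ∃ S : LpE ∞ →L[ℂ] LpE ∞,
      (∀ (f : L2) (g : LpE ∞), (f : E3 → ℂ) =ᵐ[volume] g → (T f : E3 → ℂ) =ᵐ[volume] S g) ∧
      ∀ k : LpE 1, ∃ k' : LpE 1, ∀ g : LpE ∞, pairL1 k (S g) = pairL1 k' g := by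
  obtain ⟨R, -, hR⟩ := h.adjoint.exists_extension_lt_top hC ENNReal.one_ne_top
  have hR' : ∀ k : LpE 1, ‖conjLp 1 (R (conjLp 1 k))‖ ≤ ‖R‖ * ‖k‖ := fun k => by
    rw [conjLp_norm]
    refine (R.le_opNorm _).trans_eq ?_
    rw [conjLp_norm]
  -- The L¹ extension of the adjoint is conjugated on both sides, because the adjoint refers to the
  -- sesquilinear inner product and the transpose to the bilinear pairing. The operator on L^∞ is
  -- the transpose of K.
  set K : LpE 1 →L[ℂ] LpE 1 := LinearMap.mkContinuous
    { toFun := fun k => conjLp 1 (R (conjLp 1 k))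
      map_add' := fun k k' => by rw [map_add, map_add, map_add]
      map_smul' := fun c k => by
        rw [conjLp_smul, map_smul, conjLp_smul, Complex.conj_conj, RingHom.id_apply] }
    ‖R‖ hR' with hK
  choose S hS1 hS2 using fun g : LpE ∞ => exists_linfty ((pairL1.flip g) ∘L K)
  have hS : ∀ g k, pairL1 k (S g) = pairL1 (K k) g := fun g k => hS2 g k
  refine ⟨LinearMap.mkContinuous
    { toFun := S
      map_add' := fun g g' => pairL1_injective fun k => by rw [hS, map_add, map_add, hS, hS]
      map_smul' := fun c g => pairL1_injective fun k => by
        rw [hS, map_smul, RingHom.id_apply, map_smul, hS] }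
    ‖K‖ fun g => ?_, fun f g hfg => ?_, fun k => ⟨K k, fun g => hS g k⟩⟩
  · refine (hS1 g).trans (ContinuousLinearMap.opNorm_le_bound _ (by positivity) fun k => ?_)
    refine (pairL1_norm_le _ _).trans ?_
    rw [mul_right_comm]
    exact mul_le_mul_of_nonneg_right (K.le_opNorm k) (norm_nonneg _)
  · have hf : MemLp f ∞ volume := (memLp_congr_ae hfg).2 (Lp.memLp g)
    have hTf : MemLp (T f) ∞ volume :=
      ⟨(Lp.memLp (T f)).1, (h.eLpNorm_le hC ∞ le_top f).trans_lt
        (ENNReal.mul_lt_top (by simpa using hC.lt_top) hf.2)⟩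
    suffices h1 : hTf.toLp = S g by
      refine hTf.coeFn_toLp.symm.trans ?_
      rw [h1]; rfl
    refine pairL1_injective fun k => ?_
    rw [hS]
    refine DFunLike.congr_fun (L1_ext (ℓ := pairL1.flip hTf.toLp) (ℓ' := pairL1.flip g ∘L K)
      fun k φ hφ hc hk => ?_) k
    change pairL1 _ _ = pairL1 _ _
    have h2 := (BddSupp.of_continuous hφ hc).memLp 2
    have h3 : (conjLp 2 h2.toLp) =ᵐ[volume] conjLp 1 k := by
      filter_upwards [conjLp_coeFn h2.toLp, conjLp_coeFn k, h2.coeFn_toLp, hk] with x h4 h5 h6 h7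
      rw [h4, h5, h6, h7]
    have h4 := ContinuousLinearMap.adjoint_inner_left T f (conjLp 2 h2.toLp)
    rw [L2_inner_eq, L2_inner_eq] at h4
    rw [pairL1_apply, pairL1_apply]
    refine Eq.trans ?_ (h4.symm.trans ?_)
    · refine integral_congr_ae ?_
      filter_upwards [hTf.coeFn_toLp, hk, h2.coeFn_toLp, conjLp_coeFn h2.toLp] with x h5 h6 h7 h8
      rw [h5, h6, h8, h7]
      simp
    · refine integral_congr_ae ?_
      filter_upwards [hR _ _ h3, hfg, conjLp_coeFn (R (conjLp 1 k))] with x h5 h6 h7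
      rw [h5, h6]
      change _ = conjLp 1 (R (conjLp 1 k)) x * g x
      rw [h7]

theorem TestBdd.exists_extension (h : TestBdd T C) (hC : C ≠ ∞) (p : ℝ≥0∞) [Fact (1 ≤ p)] :
    ∃ S : LpE p →L[ℂ] LpE p, IsLpExtension p T S ∧ (p ≠ ∞ → ‖S‖ ≤ (C + 1).toReal) := by
  rcases eq_or_ne p ∞ with rfl | hp
  · obtain ⟨S, h1, h2⟩ := h.exists_extension_top hC
    refine ⟨S, ⟨h1, fun _ k => ?_⟩, fun h => absurd rfl h⟩
    obtain ⟨k', h3⟩ := h2 k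
    refine ⟨k', fun g => ?_⟩
    rw [← pairL1_apply, ← pairL1_apply, h3]
  · obtain ⟨S, h1, h2⟩ := h.exists_extension_lt_top hC hp
    exact ⟨S, ⟨h2, fun h => absurd h hp⟩, fun _ => h1⟩

end

end

noncomputable section

/-! ### Convergence in `L^p` -/

/-- |u|^p ≤ δ^{p-1}|u| wherever |u| ≤ δ. -/
lemma eLpNorm_le_of_ae_le_of_lintegral_le {u : E3 → ℂ} {δ : ℝ≥0∞} (h1 : ∀ᵐ x, ‖u x‖ₑ ≤ δ)
    (h2 : ∫⁻ x, ‖u x‖ₑ ≤ δ) {p : ℝ≥0∞} (hp : 1 ≤ p) : eLpNorm u p volume ≤ δ := by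
  rcases eq_or_ne p ∞ with rfl | hpt
  · rw [eLpNorm_exponent_top]; exact essSup_le_of_ae_le _ h1
  have hp1 : 1 ≤ p.toReal := by
    simpa using (ENNReal.toReal_le_toReal ENNReal.one_ne_top hpt).2 hp
  have hp0 : p ≠ 0 := (zero_lt_one.trans_le hp).ne'
  have e : ∀ z : ℝ≥0∞, z ^ p.toReal = z ^ (p.toReal - 1) * z := fun z => by
    conv_rhs => rw [← ENNReal.rpow_one z, ← ENNReal.rpow_mul, one_mul,
      ← ENNReal.rpow_add_of_nonneg _ _ (by linarith) zero_le_one]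
    congr 1; ring
  rw [eLpNorm_eq_lintegral_rpow_enorm_toReal hp0 hpt, one_div,
    ENNReal.rpow_inv_le_iff (by linarith)]
  calc ∫⁻ x, ‖u x‖ₑ ^ p.toReal ≤ ∫⁻ x, δ ^ (p.toReal - 1) * ‖u x‖ₑ :=
        lintegral_mono_ae (h1.mono fun x hx => by
          rw [e]; exact mul_le_mul' (ENNReal.rpow_le_rpow hx (by linarith)) le_rfl)
    _ ≤ δ ^ p.toReal := by
      rw [e δ]
      rcases eq_or_ne δ ∞ with rfl | hδ
      · rcases eq_or_lt_of_le hp1 with h | h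
        · rw [← h]; simp
        · rw [ENNReal.top_rpow_of_pos (by linarith), ENNReal.top_mul_top]; exact le_top
      · rw [lintegral_const_mul' _ _ (ENNReal.rpow_ne_top_of_nonneg (by linarith) hδ)]
        exact mul_le_mul' le_rfl h2

/-- Homogeneity: a bound on the L¹ unit ball extends to all integrable g. The predicate P carries a
side condition stable under scaling, such as a restriction on the support. -/
lemma inner_le_mul_lintegral {u : L2} {δ : ℝ≥0∞} {P : L2 → Prop} (hP : ∀ (c : ℂ) g, P g → P (c • g))
    (h : ∀ g : L2, P g → ∫⁻ x, ‖g x‖ₑ ≤ 1 → ‖inner ℂ g u‖ₑ ≤ δ) {g : L2} (hPg : P g)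
    (hg : ∫⁻ x, ‖g x‖ₑ ≠ ∞) : ‖inner ℂ g u‖ₑ ≤ δ * ∫⁻ x, ‖g x‖ₑ := by
  set a := ∫⁻ x, ‖g x‖ₑ with ha
  rcases eq_or_ne a 0 with h0 | h0
  · have : g = 0 := by
      refine Lp.ext ?_
      rw [ha, lintegral_eq_zero_iff (L2_enorm_measurable g)] at h0
      filter_upwards [h0, Lp.coeFn_zero ℂ 2 (volume : Measure E3)] with x h1 h2
      rw [h2]; simpa using h1
    rw [this, inner_zero_left, enorm_zero]; exact zero_le
  have hn : ‖((a.toReal⁻¹ : ℝ) : ℂ)‖ₑ = a⁻¹ := by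
    rw [← ofReal_norm, Complex.norm_real, Real.norm_of_nonneg (by positivity),
      ENNReal.ofReal_inv_of_pos (ENNReal.toReal_pos h0 hg), ENNReal.ofReal_toReal hg]
  have h1 : ∫⁻ x, ‖(((a.toReal⁻¹ : ℝ) : ℂ) • g : L2) x‖ₑ ≤ 1 := by
    rw [lintegral_congr_ae ((Lp.coeFn_smul _ g).mono fun x hx => congrArg enorm hx)]
    simp_rw [Pi.smul_apply, enorm_smul, hn]
    rw [lintegral_const_mul _ (L2_enorm_measurable g), ENNReal.inv_mul_cancel h0 hg]
  have h2 := h _ (hP _ _ hPg) h1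
  rw [inner_smul_left, enorm_mul, Complex.conj_ofReal, hn] at h2
  calc ‖inner ℂ g u‖ₑ = a⁻¹ * ‖inner ℂ g u‖ₑ * a := by
        rw [mul_right_comm, ENNReal.inv_mul_cancel h0 hg, one_mul]
    _ ≤ δ * a := mul_le_mul' h2 le_rfl

section
variable {Y : ℝ → Op} {Y₀ : Op} {C : ℝ≥0∞}

lemma TestConv.ae_le (h : TestConv Y Y₀ C) {f : L2} {B : ℝ≥0∞} (hB : B ≠ ∞) (hf : ∀ᵐ x, ‖f x‖ₑ ≤ B)
    {δ : ℝ≥0∞} (hδ : 0 < δ) : ∀ᶠ ε in 𝓝[>] (0 : ℝ), ∀ᵐ x, ‖(Y ε f - Y₀ f : L2) x‖ₑ ≤ δ := by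
  filter_upwards [h.unif f B hB hf δ hδ] with ε hε
  refine ae_le_of_forall_inner_le _ fun g S hS hfin hg => ?_
  have h1 := lintegral_indicator_one_le hS hg
  exact (inner_le_mul_lintegral (P := fun _ => True) (fun _ _ _ => trivial) (fun g _ => hε g) trivial
    (h1.trans_lt hfin).ne).trans (mul_le_mul' le_rfl h1)

lemma TestConv.lintegral_compl_le (h : TestConv Y Y₀ C) {f : L2} (hf : BddSupp f) {δ : ℝ≥0∞}
    (hδ : 0 < δ) : ∃ b : ℝ, ∀ ε > 0, ∫⁻ x in {x | b < ‖x‖}, ‖(Y ε f - Y₀ f : L2) x‖ₑ ≤ δ := by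
  have hf1 : ∫⁻ x, ‖f x‖ₑ ≠ ∞ := by
    rw [← eLpNorm_one_eq_lintegral_enorm]; exact (hf.memLp 1).2.ne
  obtain ⟨a, ha⟩ := hf.2.2
  obtain ⟨b, hb⟩ := h.tight _ 1 hf1 ENNReal.one_ne_top a δ hδ
  have hbm : MeasurableSet {x : E3 | b < ‖x‖} := measurableSet_lt measurable_const measurable_norm
  refine ⟨b, fun ε hε => lintegral_le_of_forall_fin_meas_le _ fun S hS hfin => ?_⟩
  rw [Measure.restrict_apply hS] at hfin
  rw [Measure.restrict_restrict hS]
  obtain ⟨g, h1, h2⟩ := exists_phase_L2 (Y ε f - Y₀ f) (hS.inter hbm) (lt_top_iff_ne_top.2 hfin)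
  rw [← h2]
  refine hb ε hε f g (Or.inl ⟨le_rfl, indicator_one_le' h1⟩) (Or.inl ⟨ha, ?_⟩)
  filter_upwards [h1] with x hx hgx
  by_contra h3
  rw [indicator_of_notMem fun h4 => h3 h4.2] at hx
  exact hgx (by simpa using hx)

/-- Tightness makes the L¹ norm outside a large ball small uniformly in ε, and uniform convergence
makes it small inside, where the volume is finite. Small L¹ and L^∞ norms together bound every L^p
norm. -/
lemma TestConv.eLpNorm_le (h : TestConv Y Y₀ C) {f : L2} (hf : BddSupp f) {p : ℝ≥0∞} (hp : 1 ≤ p)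
    {δ : ℝ≥0∞} (hδ : 0 < δ) :
    ∀ᶠ ε in 𝓝[>] (0 : ℝ), eLpNorm (Y ε f - Y₀ f : L2) p volume ≤ δ := by
  obtain ⟨B, hB⟩ := hf.2.1
  obtain ⟨b, hb⟩ := h.lintegral_compl_le hf (ENNReal.half_pos hδ.ne')
  have hbm : MeasurableSet {x : E3 | b < ‖x‖} := measurableSet_lt measurable_const measurable_norm
  set v := volume {x : E3 | b < ‖x‖}ᶜ with hv
  have hvt : v ≠ ∞ := by
    have : {x : E3 | b < ‖x‖}ᶜ = Metric.closedBall 0 b := by ext x; simp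
    rw [hv, this]; exact measure_closedBall_lt_top.ne
  have hv1 : v + 1 ≠ ∞ := by simpa using hvt
  have hδ' : 0 < min δ (δ / 2 / (v + 1)) :=
    lt_min hδ (ENNReal.div_pos (ENNReal.half_pos hδ.ne').ne' hv1)
  filter_upwards [h.ae_le ENNReal.coe_ne_top hB hδ', self_mem_nhdsWithin] with ε h1 hε
  refine eLpNorm_le_of_ae_le_of_lintegral_le (h1.mono fun x hx => hx.trans (min_le_left _ _)) ?_ hp
  rw [← lintegral_add_compl _ hbm, ← ENNReal.add_halves δ]
  refine add_le_add (hb ε hε) ?_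
  refine (lintegral_mono_ae (ae_restrict_of_ae h1)).trans ?_
  rw [setLIntegral_const]
  calc _ ≤ δ / 2 / (v + 1) * (v + 1) := mul_le_mul' (min_le_right _ _) le_self_add
    _ = δ / 2 := ENNReal.div_mul_cancel (by simp) hv1

variable {p : ℝ≥0∞} [hp1 : Fact (1 ≤ p)] {A : ℝ → LpE p →L[ℂ] LpE p} {A₀ : LpE p →L[ℂ] LpE p}

lemma extension_sub_ae {T T' : Op} {S S' : LpE p →L[ℂ] LpE p} (h : IsLpExtension p T S)
    (h' : IsLpExtension p T' S') {f : L2} {g : LpE p} (hfg : (f : E3 → ℂ) =ᵐ[volume] g) :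
    (S g - S' g : LpE p) =ᵐ[volume] (T f - T' f : L2) := by
  filter_upwards [h.1 f g hfg, h'.1 f g hfg, Lp.coeFn_sub (S g) (S' g), Lp.coeFn_sub (T f) (T' f)]
    with x h1 h2 h3 h4
  rw [h3, h4, Pi.sub_apply, Pi.sub_apply, h1, h2]

/-- Convergence holds on continuous compactly supported functions, which are dense for p < ∞; the
operator norms of the extensions are bounded uniformly in ε. -/
lemma TestConv.tendsto_extension (h : TestConv Y Y₀ C) (hp : p ≠ ∞)
    (hA : ∀ ε > 0, IsLpExtension p (Y ε) (A ε)) (hA₀ : IsLpExtension p Y₀ A₀) {c : ℝ}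
    (hc : ∀ ε > 0, ‖A ε‖ ≤ c) (hc₀ : ‖A₀‖ ≤ c) (g : LpE p) :
    Tendsto (fun ε => A ε g) (𝓝[>] 0) (𝓝 (A₀ g)) := by
  rw [Metric.tendsto_nhds]
  intro r hr
  have hc0 : 0 ≤ c := (norm_nonneg _).trans hc₀
  obtain ⟨f, hf, h1, h2, h3⟩ := exists_continuous_near hp g (δ := r / (4 * (c + 1))) (by positivity)
  have h4 := BddSupp.of_continuous h1 h2
  have h5 := (h4.memLp 2).coeFn_toLp
  filter_upwards [h.eLpNorm_le (h4.congr h5.symm) hp1.out (δ := ENNReal.ofReal (r / 4)) (by positivity),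
    self_mem_nhdsWithin] with ε h6 hε
  have h7 : ‖A ε hf.toLp - A₀ hf.toLp‖ ≤ r / 4 := by
    rw [Lp.norm_def, eLpNorm_congr_ae (extension_sub_ae (hA ε hε) hA₀ (h5.trans hf.coeFn_toLp.symm))]
    exact ENNReal.toReal_le_of_le_ofReal (by positivity) h6
  have h8 : c * (r / (4 * (c + 1))) ≤ r / 4 := by
    rw [mul_div_assoc', div_le_div_iff₀ (by positivity) (by positivity)]
    nlinarith
  have h9 := ((A ε).le_of_opNorm_le (hc ε hε) (g - hf.toLp)).trans (mul_le_mul_of_nonneg_left h3 hc0)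
  have h10 := (A₀.le_of_opNorm_le hc₀ (g - hf.toLp)).trans (mul_le_mul_of_nonneg_left h3 hc0)
  have e : A ε g - A₀ g = A ε (g - hf.toLp) - A₀ (g - hf.toLp) + (A ε hf.toLp - A₀ hf.toLp) := by
    rw [map_sub, map_sub]; abel
  rw [dist_eq_norm, e]
  have := norm_add_le (A ε (g - hf.toLp) - A₀ (g - hf.toLp)) (A ε hf.toLp - A₀ hf.toLp)
  have := norm_sub_le (A ε (g - hf.toLp)) (A₀ (g - hf.toLp))
  linarith

end

section
variable {Y : ℝ → Op} {Y₀ : Op} {C : ℝ≥0∞} {A : ℝ → LpE ∞ →L[ℂ] LpE ∞} {A₀ : LpE ∞ →L[ℂ] LpE ∞}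

lemma linfty_ae_le (g : LpE ∞) : ∀ᵐ x, ‖g x‖ₑ ≤ ‖g‖ₑ := by
  rw [Lp.enorm_def, eLpNorm_exponent_top]
  exact ae_le_eLpNormEssSup

lemma TestConv.ae_le_extension (h : TestConv Y Y₀ C) (hA : ∀ ε > 0, IsLpExtension ∞ (Y ε) (A ε))
    (hA₀ : IsLpExtension ∞ Y₀ A₀) {g : LpE ∞} (hg : MemLp g 2 volume) {δ : ℝ≥0∞} (hδ : 0 < δ) :
    ∀ᶠ ε in 𝓝[>] (0 : ℝ), ∀ᵐ x, ‖(A ε g - A₀ g : LpE ∞) x‖ₑ ≤ δ := by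
  have hb : ∀ᵐ x, ‖(MemLp.toLp _ hg : L2) x‖ₑ ≤ ‖g‖ₑ := by
    filter_upwards [hg.coeFn_toLp, linfty_ae_le g] with x h1 h2 using h1 ▸ h2
  filter_upwards [h.ae_le enorm_ne_top hb hδ, self_mem_nhdsWithin] with ε h1 hε
  filter_upwards [h1, extension_sub_ae (hA ε hε) hA₀ hg.coeFn_toLp] with x h2 h3 using h3 ▸ h2

lemma TestConv.tendsto_extension_top (h : TestConv Y Y₀ C)
    (hA : ∀ ε > 0, IsLpExtension ∞ (Y ε) (A ε)) (hA₀ : IsLpExtension ∞ Y₀ A₀) {g : LpE ∞}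
    (hg : MemLp g 2 volume) : Tendsto (fun ε => A ε g) (𝓝[>] 0) (𝓝 (A₀ g)) := by
  rw [tendsto_iff_norm_sub_tendsto_zero, Metric.tendsto_nhds]
  intro r hr
  filter_upwards [h.ae_le_extension hA hA₀ hg (δ := ENNReal.ofReal (r / 2)) (by positivity)] with ε h1
  rw [dist_zero_right, norm_norm]
  refine (linftyNorm_le (c := r / 2) (by positivity) (h1.mono fun x hx => ?_)).trans_lt (half_lt_self hr)
  rwa [← ofReal_norm, ENNReal.ofReal_le_ofReal_iff (by positivity)] at hx

/-- Truncation of a bounded function. -/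
def truncTop (S : Set E3) (hS : MeasurableSet S) (g : LpE ∞) : LpE ∞ :=
  ((Lp.memLp g).indicator hS).toLp

lemma truncTop_coeFn {S : Set E3} (hS : MeasurableSet S) (g : LpE ∞) :
    truncTop S hS g =ᵐ[volume] S.indicator g := MemLp.coeFn_toLp _

lemma truncTop_memLp_two {S : Set E3} (hS : MeasurableSet S) (hf : volume S ≠ ∞) (g : LpE ∞) :
    MemLp (truncTop S hS g) 2 volume := by
  refine (memLp_congr_ae (truncTop_coeFn hS g)).2 ((memLp_indicator_iff_restrict hS).2 ?_)
  have : IsFiniteMeasure (volume.restrict S) := ⟨by simpa using hf.lt_top⟩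
  exact ((Lp.memLp g).restrict S).mono_exponent le_top

lemma tendsto_pairL1_truncTop (k : LpE 1) (g : LpE ∞) :
    Tendsto (fun n : ℕ => pairL1 k (truncTop (Metric.closedBall 0 n) measurableSet_closedBall g)) atTop
      (𝓝 (pairL1 k g)) := by
  have e : ∀ n : ℕ, pairL1 k (truncTop (Metric.closedBall 0 n) measurableSet_closedBall g) =
      ∫ x, (Metric.closedBall (0 : E3) n).indicator (fun x => k x * g x) x := fun n => by
    rw [pairL1_apply]
    refine integral_congr_ae ((truncTop_coeFn (measurableSet_closedBall (x := (0 : E3)) (ε := n)) g).mono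
      fun x hx => ?_)
    simp only
    rw [hx]
    by_cases h : x ∈ Metric.closedBall (0 : E3) n
    · rw [indicator_of_mem h, indicator_of_mem h]
    · rw [indicator_of_notMem h, indicator_of_notMem h, mul_zero]
  have hi : Integrable fun x => k x * g x :=
    (ContinuousLinearMap.mul ℂ ℂ).integrable_of_bilin_of_bdd_right ‖g‖ (L1.integrable_coeFn k)
      (Lp.memLp g).1 ((linfty_ae_le g).mono fun x hx => by simpa [enorm, ← NNReal.coe_le_coe] using hx)
  simp_rw [e, pairL1_apply]
  refine tendsto_integral_of_dominated_convergence (fun x => ‖k x * g x‖)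
    (fun n => hi.1.indicator measurableSet_closedBall) hi.norm
    (fun n => Eventually.of_forall fun x => norm_indicator_le_norm_self _ _)
    (Eventually.of_forall fun x => tendsto_const_nhds.congr' ?_)
  filter_upwards [eventually_ge_atTop ⌈‖x‖⌉₊] with n hn
  rw [indicator_of_mem]
  simpa using (Nat.le_ceil _).trans (Nat.cast_le.2 hn)

/-- A bounded g need not lie in L², so the tightness bound is applied to its truncations to balls.
Weak-* continuity of both extensions carries the bound over to g itself. -/
lemma TestConv.ae_le_far (h : TestConv Y Y₀ C) (hA : ∀ ε > 0, IsLpExtension ∞ (Y ε) (A ε))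
    (hA₀ : IsLpExtension ∞ Y₀ A₀) {B : ℝ≥0∞} (hB : B ≠ ∞) (R : ℝ) {δ : ℝ≥0∞} (hδ : 0 < δ) :
    ∃ b : ℝ, ∀ ε > 0, ∀ g : LpE ∞, (∀ᵐ x, ‖g x‖ₑ ≤ B) → (∀ᵐ x, g x ≠ 0 → b < ‖x‖) →
      ∀ᵐ x ∂(volume.restrict (Metric.ball (0 : E3) R)), ‖(A ε g - A₀ g : LpE ∞) x‖ₑ ≤ δ := by
  obtain ⟨b, hb⟩ := h.tight 1 B ENNReal.one_ne_top hB R δ hδ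
  refine ⟨b, fun ε hε g hg hgb => ?_⟩
  set u : LpE ∞ := A ε g - A₀ g with hu
  refine ae_le_of_forall_setLIntegral_le_of_sigmaFinite (Lp.stronglyMeasurable u).measurable.enorm
    fun S hS hfin => ?_
  rw [setLIntegral_const, Measure.restrict_restrict hS, Measure.restrict_apply hS]
  rw [Measure.restrict_apply hS] at hfin
  have hS' : MeasurableSet (S ∩ Metric.ball (0 : E3) R) := hS.inter measurableSet_ball
  have : IsFiniteMeasure (volume.restrict (S ∩ Metric.ball (0 : E3) R)) := ⟨by simpa using hfin⟩
  obtain ⟨s, h1, h2, h3⟩ := exists_phase (Lp.memLp u).1 hS' hfin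
    (((Lp.memLp u).restrict _).integrable (by simp))
  have hk : MemLp (fun x => (starRingEnd ℂ) (s x)) 1 volume := (h1 1).star
  obtain ⟨k₁, hk₁⟩ := (hA ε hε).2 rfl hk.toLp
  obtain ⟨k₀, hk₀⟩ := hA₀.2 rfl hk.toLp
  have hpair : ∀ f : LpE ∞, ∫ x, (starRingEnd ℂ) (s x) * (A ε f - A₀ f : LpE ∞) x =
      pairL1 k₁ f - pairL1 k₀ f := fun f => by
    rw [pairL1_apply, pairL1_apply, ← hk₁, ← hk₀, ← pairL1_apply, ← pairL1_apply, ← map_sub,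
      pairL1_apply]
    exact integral_congr_ae (hk.coeFn_toLp.mono fun x hx => congrArg (· * _) hx.symm)
  rw [← h3, hu, hpair]
  refine le_of_tendsto ((tendsto_pairL1_truncTop k₁ g).sub (tendsto_pairL1_truncTop k₀ g)).enorm
    (Eventually.of_forall fun n => ?_)
  set f := truncTop (Metric.closedBall 0 n) measurableSet_closedBall g with hf
  have hf2 : MemLp f 2 volume := truncTop_memLp_two _ measure_closedBall_lt_top.ne g
  have h4 : ∀ᵐ x, ‖(MemLp.toLp _ hf2 : L2) x‖ₑ ≤ B ∧ ((MemLp.toLp _ hf2 : L2) x ≠ 0 → b < ‖x‖) := by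
    filter_upwards [hf2.coeFn_toLp, truncTop_coeFn measurableSet_closedBall g, hg, hgb] with x h5 h6 h7 h8
    rw [h5, hf, h6]
    by_cases hx : x ∈ Metric.closedBall (0 : E3) n
    · rw [indicator_of_mem hx]; exact ⟨h7, h8⟩
    · rw [indicator_of_notMem hx]; simp
  have h5 : ∫ x, (starRingEnd ℂ) (s x) * (A ε f - A₀ f : LpE ∞) x =
      inner ℂ (h1 2).toLp (Y ε hf2.toLp - Y₀ hf2.toLp) := by
    rw [L2_inner_eq]
    refine integral_congr_ae ?_
    filter_upwards [(h1 2).coeFn_toLp, extension_sub_ae (hA ε hε) hA₀ hf2.coeFn_toLp] with x h6 h7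
    rw [h6, h7]
  have h6 : ∀ᵐ x, ‖(MemLp.toLp _ (h1 2) : L2) x‖ₑ ≤ (S ∩ Metric.ball (0 : E3) R).indicator 1 x :=
    (h1 2).coeFn_toLp.mono fun x hx => by rw [hx]; exact h2 x
  have h7 := lintegral_indicator_one_le hS' h6
  rw [← hpair, h5]
  refine (inner_le_mul_lintegral (P := fun g : L2 => ∀ᵐ x, g x ≠ 0 → ‖x‖ ≤ R) (fun c g hg => ?_)
    (fun g' h8 h9 => ?_) ?_ (h7.trans_lt hfin).ne).trans (mul_le_mul' le_rfl h7)
  · filter_upwards [hg, Lp.coeFn_smul c g] with x h8 h9 h10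
    refine h8 fun h11 => h10 ?_
    rw [h9, Pi.smul_apply, h11, smul_zero]
  · exact hb ε hε _ g' (Or.inr ⟨h9, h4.mono fun x hx => hx.1⟩) (Or.inr ⟨h8, h4.mono fun x hx => hx.2⟩)
  · filter_upwards [h6] with x h8 h9
    by_contra h10
    rw [indicator_of_notMem fun h11 => h10 (by simpa using (mem_ball_zero_iff.1 h11.2).le)] at h8
    exact h9 (by simpa using h8)

/-- Split g at radius b. The far part contributes at most δ/2 on the given ball for all ε at once;
the near part is in L² ∩ L^∞, where convergence is uniform. The radius b is chosen before ε. -/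
lemma TestConv.tendsto_local (h : TestConv Y Y₀ C) (hA : ∀ ε > 0, IsLpExtension ∞ (Y ε) (A ε))
    (hA₀ : IsLpExtension ∞ Y₀ A₀) (g : LpE ∞) (R : ℝ) :
    Tendsto (fun ε => eLpNorm (fun x => A ε g x - A₀ g x) ∞
      (volume.restrict (Metric.ball (0 : E3) R))) (𝓝[>] 0) (𝓝 0) := by
  rw [ENNReal.tendsto_nhds_zero]
  intro δ hδ
  obtain ⟨b, hb⟩ := h.ae_le_far hA hA₀ (B := ‖g‖ₑ) enorm_ne_top R (ENNReal.half_pos hδ.ne')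
  have hm : MeasurableSet (Metric.closedBall (0 : E3) b) := measurableSet_closedBall
  set g₁ := truncTop _ hm g with hg₁
  set g₂ := truncTop _ hm.compl g with hg₂
  have hg : g = g₁ + g₂ := by
    refine Lp.ext ?_
    filter_upwards [Lp.coeFn_add g₁ g₂, truncTop_coeFn hm g, truncTop_coeFn hm.compl g] with x h1 h2 h3
    rw [h1, Pi.add_apply, h2, h3]
    exact (congrFun (indicator_self_add_compl _ _) x).symm
  have h1 : ∀ᵐ x, ‖g₂ x‖ₑ ≤ ‖g‖ₑ ∧ (g₂ x ≠ 0 → b < ‖x‖) := by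
    filter_upwards [truncTop_coeFn hm.compl g, linfty_ae_le g] with x h2 h3
    rw [h2]
    by_cases hx : x ∈ (Metric.closedBall (0 : E3) b)ᶜ
    · rw [indicator_of_mem hx]; exact ⟨h3, fun _ => by simpa using hx⟩
    · rw [indicator_of_notMem hx]; simp
  filter_upwards [h.ae_le_extension hA hA₀ (truncTop_memLp_two hm measure_closedBall_lt_top.ne g)
    (ENNReal.half_pos hδ.ne'), self_mem_nhdsWithin] with ε h2 hε
  rw [eLpNorm_exponent_top]
  refine essSup_le_of_ae_le _ ?_
  have e : A ε g - A₀ g = (A ε g₁ - A₀ g₁) + (A ε g₂ - A₀ g₂) := by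
    conv_lhs => rw [hg]
    rw [map_add, map_add]; abel
  have h3 := ae_restrict_of_ae (s := Metric.ball (0 : E3) R) (Lp.coeFn_sub (A ε g) (A₀ g))
  have h4 := ae_restrict_of_ae (s := Metric.ball (0 : E3) R)
    (Lp.coeFn_add (A ε g₁ - A₀ g₁) (A ε g₂ - A₀ g₂))
  filter_upwards [h3, h4, ae_restrict_of_ae h2, hb ε hε g₂ (h1.mono fun x hx => hx.1)
    (h1.mono fun x hx => hx.2)] with x h5 h6 h7 h8
  rw [← Pi.sub_apply, ← h5, e, h6, Pi.add_apply, ← ENNReal.add_halves δ]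
  exact (enorm_add_le _ _).trans (add_le_add h7 h8)

end

end

/-! ### Assembly of the theorem -/

theorem mainTheorem2 (b : OrthonormalBasis (Fin 3) ℝ E3) (V : E3 → ℝ)
    (hV : Integrable V) (hVa : HatVaInL1 b V) (hKm : Km b V < ∞) :
    ∃ Ω : L2 →L[ℂ] L2, IsWaveOperator V Ω ∧
      ∃ M₀ : ℝ, 0 < M₀ ∧ ∀ β : ℝ → ℝ, IsCutoff β → ∀ M ≥ M₀,
        ∀ (p : ℝ≥0∞) [Fact (1 ≤ p)],
          ∃ (A : ℝ → Lp ℂ p (volume : Measure E3) →L[ℂ] Lp ℂ p (volume : Measure E3))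
            (A₀ B : Lp ℂ p (volume : Measure E3) →L[ℂ] Lp ℂ p (volume : Measure E3)),
            (∀ ε > 0, IsLpExtension p (fun f => abelWave V ε (highFreq β M f)) (A ε)) ∧
            IsLpExtension p (fun f => Ω (highFreq β M f)) A₀ ∧
            IsLpExtension p (fun f => highFreq β M (ContinuousLinearMap.adjoint Ω f)) B ∧
            (∀ g : Lp ℂ p (volume : Measure E3), p ≠ ∞ ∨ MemLp g 2 volume →
              Tendsto (fun ε => A ε g) (𝓝[>] 0) (𝓝 (A₀ g))) ∧
            (p = ∞ → ∀ (g : Lp ℂ p (volume : Measure E3)) (R : ℝ),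
              Tendsto (fun ε => eLpNorm (fun x => A ε g x - A₀ g x) ∞
                (volume.restrict (Metric.ball (0 : E3) R))) (𝓝[>] 0) (𝓝 0)) := by
  obtain ⟨Ω, hΩ, M₀, hM₀, h⟩ := exists_testConv b V hV hVa hKm
  refine ⟨Ω, hΩ, M₀, hM₀, fun β hβ M hM p _ => ?_⟩
  obtain ⟨Y, C, hY, hT⟩ := h β hβ M hM
  choose! A hA hAn using fun ε (hε : (0 : ℝ) < ε) => (hT.bdd ε hε).exists_extension hT.ne_top p
  obtain ⟨A₀, hA₀, hA₀n⟩ := hT.bdd₀.exists_extension hT.ne_top p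
  -- Test pairs are symmetric in f and g, so the adjoint of Ω β(H₀ > M²) satisfies the same bounds;
  -- since β is real this adjoint is β(H₀ > M²) Ω*.
  obtain ⟨B, hB, -⟩ := hT.bdd₀.adjoint.exists_extension hT.ne_top p
  have e₀ : ∀ f, (Ω * highOp β M) f = Ω (highFreq β M f) := fun f => by
    rw [highFreq_eq hβ M f]; rfl
  have e₁ : ∀ f, ContinuousLinearMap.adjoint (Ω * highOp β M) f =
      highFreq β M (ContinuousLinearMap.adjoint Ω f) := fun f => by
    rw [highFreq_eq hβ M, ContinuousLinearMap.mul_def, ContinuousLinearMap.adjoint_comp,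
      highOp_adjoint hβ M]
    rfl
  refine ⟨A, A₀, B, fun ε hε => ?_, ?_, ?_, fun g hg => ?_, ?_⟩
  · simp_rw [hY ε hε]; exact hA ε hε
  · simp_rw [← e₀]; exact hA₀
  · simp_rw [← e₁]; exact hB
  · by_cases hp : p = ∞
    · subst hp
      exact hT.tendsto_extension_top hA hA₀ (hg.resolve_left (by simp))
    · exact hT.tendsto_extension hp hA hA₀ (fun ε hε => hAn ε hε hp) (hA₀n hp) g
  · rintro rfl g R
    exact hT.tendsto_local hA hA₀ g R
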